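/- Let $k$ be a field. All $A_\infty$-categories and $A_\infty$-functors are strictly unital (with Seidel's sign conventions) and two-periodic, i.e. linear over $k[u,u^{-1}]$ with $\deg u=2$; equivalently, after setting $u=1$, their morphisms form $\mathbb Z/2$-graded $k$-vector spaces and $\mu_d$ has degree $d$ modulo $2$; this language is used below. Let $n\ge 0$ and let $S=[s_0,s_1,\dots,s_n]$ be a finite cyclically ordered nonempty set, with indices understood modulo $n+1$ and with the element $s_0$ fixed. Let $\mathcal C_S$ be the $A_\infty$-category with set of objects $S$, with morphisms freely spanned by the identities and by degree one morphisms $v_i\in\hom(s_i,s_{i+1})$, $i=0,\dots,n$, and whose only nonzero compositions are the identity compositions and $\mu_{n+1}(v_{i+n},\dots,v_i)=\mathrm{id}_{s_i}$ (that is, $u\,\mathrm{id}_{s_i}$ in the $k[u,u^{-1}]$-linear language). Let $\mathcal C_{S,st}$ be the $A_\infty$-category of (one-sided, finite) twisted complexes over $\mathcal C_S$. Let $\mathcal Q_n$ be the two-periodic differential graded derived category of finite-dimensional representations over $k$ of the quiver $\underset{1}{\bullet}\to\underset{2}{\bullet}\to\cdots\to\underset{n}{\bullet}$, realized as the dg category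 of two-periodic complexes of finite-dimensional projective representations. Let $P_i$ be the representation with $k$ at the vertices $i,i+1,\dots,n$ and identity maps between them ($P_{n+1}=0$). For $i=1,\dots,n$ let $m_i\in\mathcal Q_n$ be the one-dimensional module supported at the vertex $i$, represented by its projective resolution $P_{i+1}\hookrightarrow P_i$ ($P_i$ in even degree), and for $i=1,\dots,n-1$ let $w_i:m_i\to m_{i+1}$ be the degree one generating morphism given by the identity of $P_{i+1}$. Then $\mathcal Q_n$ and $\mathcal C_{S,st}$ are $A_\infty$-categories, and there is an $A_\infty$-functor $$F:\mathcal Q_n\longrightarrow \mathcal C_{S,st}$$ which is a quasi-equivalence (it induces isomorphisms on the cohomology of all morphism complexes and is essentially surjective on $H^0$), such that $F(m_i)=s_i$ for $i=1,\dots,n$ and $F_1(w_i)=v_i$ for $i=1,\dots,n-1$. Moreover $$(s_1\xrightarrow{\,v_1\,}s_2\xrightarrow{\,v_2\,}\cdots\xrightarrow{\,v_{n-1}\,}s_n)$$ is a twisted complex, and $s_0$ is isomorphic in $H^0(\mathcal C_{S,st})$ to its shift by one. -/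

import Mathlib

open CategoryTheory

universe u v w

/-!
Two-periodic (`k[u,u⁻¹]`-linear, `deg u = 2`) graded modules are the same thing as `ℤ/2`-graded
`k`-modules (set `u = 1`), and everything below is written in the `ℤ/2`-graded language.
-/

/-! ### Composable sequences -/

/-- Finite composable sequences of elements of a family `H X Y`.
`cons a₁ (cons a₂ (… nil))` is the sequence `X₀ → X₁ → ⋯ → X_d` whose first morphism is `a₁`;
multilinear operations usually written `μ_d(a_d, …, a₁)` are written `μ (cons a₁ (… (cons a_d nil)))`. -/
inductive Chain {O : Type w} (H : O → O → Type v) : O → O → Type (max w v)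
  | nil (X : O) : Chain H X X
  | cons {X Y Z : O} (a : H X Y) (p : Chain H Y Z) : Chain H X Z

namespace Chain

variable {O : Type w} {H : O → O → Type v}

def length : {X Y : O} → Chain H X Y → ℕ
  | _, _, nil _ => 0
  | _, _, cons _ p => p.length + 1

def append : {X Y Z : O} → Chain H X Y → Chain H Y Z → Chain H X Z
  | _, _, _, nil _, q => q
  | _, _, _, cons a p, q => cons a (p.append q)

/-- The sequence of length one. -/
def single {X Y : O} (a : H X Y) : Chain H X Y := cons a (nil Y)

/-- The sequence of length two: first `a`, then `b`. -/
def pair {X Y Z : O} (a : H X Y) (b : H Y Z) : Chain H X Z := cons a (single b)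

/-- `a` repeated `r` times. -/
def rep {X : O} (a : H X X) : ℕ → Chain H X X
  | 0 => nil X
  | r + 1 => cons a (rep a r)

/-- Apply a map (possibly changing objects) to every entry. -/
def map {O' : Type*} {H' : O' → O' → Type*} (f : O → O') (g : ∀ {X Y}, H X Y → H' (f X) (f Y)) :
    {X Y : O} → Chain H X Y → Chain H' (f X) (f Y)
  | _, _, nil X => nil (f X)
  | _, _, cons a p => cons (g a) (p.map f g)

/-- All ways of cutting a sequence into an initial and a final segment (either may be empty). -/
def splits : {X Y : O} → Chain H X Y → List (Σ Z : O, Chain H X Z × Chain H Z Y)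
  | _, _, nil X => [⟨X, nil X, nil X⟩]
  | X, _, cons a p =>
      ⟨X, nil X, cons a p⟩ :: p.splits.map (fun t => ⟨t.1, cons a t.2.1, t.2.2⟩)

/-- All ways of cutting a sequence into consecutive nonempty blocks (a sequence of sequences). -/
def blocks : {X Y : O} → Chain H X Y → List (Chain (fun X Y => Chain H X Y) X Y)
  | _, _, nil X => [nil X]
  | _, _, cons (Y := Y) a p =>
      p.blocks.flatMap fun B =>
        cons (cons a (nil Y)) B ::
          (match B with
            | nil _ => []
            | cons q B' => [cons (cons a q) B'])

end Chain

/-! ### `A_∞`-categories -/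

/-- The data of a (strictly unital) two-periodic `A_∞`-category over `k`: objects, `ℤ/2`-graded
`k`-modules of morphisms (`proj p` is the projection to the homogeneous part of degree `p`),
identity morphisms, and operations `μ_d`, given together as one function on composable sequences.
The axioms of an `A_∞`-category are collected in `AInfData.IsAInf`. -/
structure AInfData (k : Type u) [Field k] where
  Ob : Type w
  Hom : Ob → Ob → Type v
  [addCommGroup : ∀ X Y, AddCommGroup (Hom X Y)]
  [module : ∀ X Y, Module k (Hom X Y)]
  proj : ∀ {X Y}, ZMod 2 → (Hom X Y →ₗ[k] Hom X Y)
  proj_proj : ∀ {X Y} (p q : ZMod 2) (a : Hom X Y),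
    proj p (proj q a) = if p = q then proj p a else 0
  proj_add : ∀ {X Y} (a : Hom X Y), proj 0 a + proj 1 a = a
  one : ∀ X, Hom X X
  μ : ∀ {X Y}, Chain Hom X Y → Hom X Y

attribute [instance] AInfData.addCommGroup AInfData.module

namespace AInfData

variable {k : Type u} [Field k]

section

variable (A : AInfData.{u, v, w} k) {X Y : A.Ob}

/-- `a` is homogeneous of degree `p`. -/
def IsHomog (p : ZMod 2) (a : A.Hom X Y) : Prop := A.proj p a = a

/-- All entries are homogeneous and their degrees add up to `p`. -/
def ChainHomog : {X Y : A.Ob} → Chain A.Hom X Y → ZMod 2 → Prop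
  | _, _, .nil _, p => p = 0
  | _, _, .cons a c, p => ∃ q r : ZMod 2, A.IsHomog q a ∧ ChainHomog c r ∧ p = q + r

/-- The linear map which is `a ↦ (-1)^{|a|} a` on homogeneous elements. -/
def sgn (a : A.Hom X Y) : A.Hom X Y := A.proj 0 a - A.proj 1 a

/-- The linear map which is `a ↦ (-1)^{|a|-1} a` on homogeneous elements. -/
def redSgn (a : A.Hom X Y) : A.Hom X Y := A.proj 1 a - A.proj 0 a

/-- Multiply `a` by `(-1)^{p (|a|-1)}`. -/
def twist (p : ZMod 2) (a : A.Hom X Y) : A.Hom X Y := if p = 0 then a else A.redSgn a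

/-- The sum over all consecutive subsequences
`∑ (-1)^{|a₁|+⋯+|a_n|-n} Φ(a_d, …, a_{n+m+1}, μ_m(a_{n+m}, …, a_{n+1}), a_n, …, a₁)`,
for a multilinear operation `Φ` on composable sequences.  The sign is distributed over the
entries `a₁, …, a_n`. -/
def insertSum {M : Type*} [AddCommGroup M] (Φ : Chain A.Hom X Y → M) (c : Chain A.Hom X Y) : M :=
  (c.splits.map fun s => (s.2.2.splits.map fun t =>
    Φ ((s.2.1.map id A.redSgn).append (Chain.cons (A.μ t.2.1) t.2.2))).sum).sum

/-- The axioms of a strictly unital two-periodic `A_∞`-category (without curvature). -/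
structure IsAInf : Prop where
  μ_nil : ∀ X : A.Ob, A.μ (Chain.nil X) = 0
  /-- multilinearity -/
  μ_add : ∀ {X Y Z W : A.Ob} (p : Chain A.Hom X Y) (a b : A.Hom Y Z) (q : Chain A.Hom Z W),
    A.μ (p.append (.cons (a + b) q)) = A.μ (p.append (.cons a q)) + A.μ (p.append (.cons b q))
  μ_smul : ∀ {X Y Z W : A.Ob} (p : Chain A.Hom X Y) (r : k) (a : A.Hom Y Z) (q : Chain A.Hom Z W),
    A.μ (p.append (.cons (r • a) q)) = r • A.μ (p.append (.cons a q))
  /-- `μ_d` has degree `2 - d` -/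
  μ_deg : ∀ {X Y : A.Ob} (c : Chain A.Hom X Y) (p : ZMod 2), A.ChainHomog c p →
    A.IsHomog (p + 2 - (c.length : ZMod 2)) (A.μ c)
  /-- the quadratic equations -/
  relation : ∀ {X Y : A.Ob} (c : Chain A.Hom X Y), A.insertSum A.μ c = 0
  /-- strict units -/
  one_deg : ∀ X : A.Ob, A.IsHomog 0 (A.one X)
  μ_one_left : ∀ {X Y : A.Ob} (a : A.Hom X Y), A.μ (.pair a (A.one Y)) = A.sgn a
  μ_one_right : ∀ {X Y : A.Ob} (a : A.Hom X Y), A.μ (.pair (A.one X) a) = a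
  μ_one : ∀ {X Y Z : A.Ob} (p : Chain A.Hom X Y) (q : Chain A.Hom Y Z),
    p.length + 1 + q.length ≠ 2 → A.μ (p.append (.cons (A.one Y) q)) = 0

/-- Being a cocycle for `μ₁`. -/
def Closed (a : A.Hom X Y) : Prop := A.μ (.single a) = 0

/-- Being a coboundary for `μ₁`. -/
def Exact (a : A.Hom X Y) : Prop := ∃ b : A.Hom X Y, A.μ (.single b) = a

/-- Two objects are isomorphic in the cohomology category `H⁰`. -/
def HIso (X Y : A.Ob) : Prop :=
  ∃ (f : A.Hom X Y) (g : A.Hom Y X),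
    A.IsHomog 0 f ∧ A.IsHomog 0 g ∧ A.Closed f ∧ A.Closed g ∧
    A.Exact (A.μ (.pair f g) - A.one X) ∧ A.Exact (A.μ (.pair g f) - A.one Y)

/-- Transport of a morphism along equalities of its source and target. -/
def castHom {X X' Y Y' : A.Ob} (hX : X = X') (hY : Y = Y') (a : A.Hom X Y) : A.Hom X' Y' :=
  cast (congrArg₂ A.Hom hX hY) a

end

end AInfData

/-! ### `A_∞`-functors and quasi-equivalences -/

/-- Strictly unital two-periodic `A_∞`-functors; `map` comprises all the maps `F_d`, `d ≥ 1`. -/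
structure AInfFunctor {k : Type u} [Field k] (A : AInfData k) (B : AInfData k) where
  obj : A.Ob → B.Ob
  map : ∀ {X Y : A.Ob}, Chain A.Hom X Y → B.Hom (obj X) (obj Y)
  map_nil : ∀ X : A.Ob, map (Chain.nil X) = 0
  /-- multilinearity -/
  map_add : ∀ {X Y Z W : A.Ob} (p : Chain A.Hom X Y) (a b : A.Hom Y Z) (q : Chain A.Hom Z W),
    map (p.append (.cons (a + b) q)) = map (p.append (.cons a q)) + map (p.append (.cons b q))
  map_smul : ∀ {X Y Z W : A.Ob} (p : Chain A.Hom X Y) (r : k) (a : A.Hom Y Z)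
    (q : Chain A.Hom Z W), map (p.append (.cons (r • a) q)) = r • map (p.append (.cons a q))
  /-- `F_d` has degree `1 - d` -/
  map_deg : ∀ {X Y : A.Ob} (c : Chain A.Hom X Y) (p : ZMod 2), A.ChainHomog c p →
    B.IsHomog (p + 1 - (c.length : ZMod 2)) (map c)
  /-- the polynomial equations
  `∑ μ_r(F_{k_r}(…), …, F_{k₁}(…)) = ∑ ± F(…, μ_m(…), …)` -/
  relation : ∀ {X Y : A.Ob} (c : Chain A.Hom X Y),
    (c.blocks.map fun b => B.μ (b.map obj map)).sum = A.insertSum map c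
  /-- strict unitality -/
  map_single_one : ∀ X : A.Ob, map (.single (A.one X)) = B.one (obj X)
  map_one : ∀ {X Y Z : A.Ob} (p : Chain A.Hom X Y) (q : Chain A.Hom Y Z),
    2 ≤ p.length + 1 + q.length → map (p.append (.cons (A.one Y) q)) = 0

/-- `F` is a quasi-equivalence: `F₁` induces isomorphisms on the cohomology of all morphism
complexes, and every object of the target is isomorphic in `H⁰` to an object in the image. -/
structure AInfFunctor.IsQuasiEquiv {k : Type u} [Field k] {A : AInfData k} {B : AInfData k}
    (F : AInfFunctor A B) : Prop where
  injective : ∀ {X Y : A.Ob} (a : A.Hom X Y), A.Closed a →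
    B.Exact (F.map (.single a)) → A.Exact a
  surjective : ∀ {X Y : A.Ob} (b : B.Hom (F.obj X) (F.obj Y)), B.Closed b →
    ∃ a : A.Hom X Y, A.Closed a ∧ B.Exact (b - F.map (.single a))
  essSurj : ∀ Y : B.Ob, ∃ X : A.Ob, B.HIso (F.obj X) Y

/-! ### Twisted complexes -/

namespace AInfData

variable {k : Type u} [Field k] (A : AInfData.{u, v, w} k)

/-- A finite formal direct sum of shifted objects `⊕ k[σ_i] ⊗ X_i`, with `k[σ_i]` a line in
degree `shift i`. -/
structure Fam where
  N : ℕ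
  obj : Fin N → A.Ob
  shift : Fin N → ZMod 2

namespace Fam

variable {A}

/-- Morphisms in the additive enlargement: matrices of morphisms. -/
abbrev Hom (X Y : A.Fam) : Type v := ∀ (x : Fin X.N) (y : Fin Y.N), A.Hom (X.obj x) (Y.obj y)

/-- The homogeneous part of degree `p` of a matrix: the entry `a x y` contributes to degree
`|a x y| + shift y - shift x`. -/
def proj {X Y : A.Fam} (p : ZMod 2) : Hom X Y →ₗ[k] Hom X Y where
  toFun a x y := A.proj (p + X.shift x - Y.shift y) (a x y)
  map_add' a b := by funext x y; simp
  map_smul' r a := by funext x y; simp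

theorem proj_proj {X Y : A.Fam} (p q : ZMod 2) (a : Hom X Y) :
    proj p (proj q a) = if p = q then proj p a else 0 := by
  funext x y
  by_cases h : p = q <;> simp [proj, A.proj_proj, h]

theorem proj_add {X Y : A.Fam} (a : Hom X Y) : proj 0 a + proj 1 a = a := by
  funext x y
  have key : ∀ s : ZMod 2, A.proj (0 + s) (a x y) + A.proj (1 + s) (a x y) = a x y := by
    intro s
    obtain rfl | rfl : s = 0 ∨ s = 1 := by revert s; decide
    · exact A.proj_add _
    · have h : (1 : ZMod 2) + 1 = 0 := by decide
      rw [h, zero_add, add_comm]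
      exact A.proj_add _
  simpa [proj, add_sub_assoc] using key (X.shift x - Y.shift y)

/-- The identity matrix. -/
def one (X : A.Fam) : Hom X X := fun x y => if h : x = y then h ▸ A.one (X.obj x) else 0

/-- All the sequences of components of a sequence of matrices which begin at index `x` and end at
index `y`.  The component between the indices `z` and `z'` is multiplied by
`(-1)^{p (|component|-1)}`, where `p` is the difference of the shifts at `z` and at the starting
index (whose shift is `σ`).  This implements the Koszul sign `∑_{i<j} |φ_i| (|x_j| - 1)` for
`a_i = φ_i ⊗ x_i`. -/
def expand (σ : ZMod 2) : {X Y : A.Fam} → Chain Hom X Y →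
    ∀ (x : Fin X.N) (y : Fin Y.N), List (Chain A.Hom (X.obj x) (Y.obj y))
  | _, _, .nil X, x, y => if h : x = y then [h ▸ Chain.nil (X.obj x)] else []
  | X, _, .cons (Y := Z) a p, x, y =>
      (List.finRange Z.N).flatMap fun z =>
        (expand σ p z y).map (Chain.cons (A.twist (X.shift x - σ) (a x z)))

/-- The operations of the additive enlargement,
`μ(φ_d ⊗ x_d, …, φ₁ ⊗ x₁) = (-1)^{∑_{i<j} |φ_i| (|x_j|-1)} φ_d ⋯ φ₁ ⊗ μ(x_d, …, x₁)`. -/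
def μ {X Y : A.Fam} (c : Chain Hom X Y) : Hom X Y :=
  fun x y => ((expand (X.shift x) c x y).map A.μ).sum

end Fam

/-- A finite formal sum of shifted objects with an endomorphism `δ`. -/
structure PreTw extends A.Fam where
  δ : Fam.Hom toFam toFam

variable {A} in
/-- The condition that `(X, δ)` is a twisted complex: `δ` has degree one, is strictly triangular,
and satisfies the generalized Maurer-Cartan equation `∑_r μ_r(δ, …, δ) = 0`
(the terms with `r ≥ N` vanish by triangularity). -/
structure PreTw.IsTwisted (X : A.PreTw) : Prop where
  deg : Fam.proj 1 X.δ = X.δ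
  triangular : ∀ x y : Fin X.N, ¬ x < y → X.δ x y = 0
  maurerCartan : ((List.range (X.N + 1)).map fun r => Fam.μ (Chain.rep X.δ r)).sum = 0

/-- Twisted complexes. -/
abbrev TwOb := {X : A.PreTw // X.IsTwisted}

variable {A} in
/-- All the sequences obtained from a sequence of morphisms of twisted complexes by inserting
copies of the differentials `δ` at all places; more than `N` consecutive copies of `δ` never
contribute, by triangularity. -/
def TwOb.insertions : {X Y : A.TwOb} → Chain (fun X Y : A.TwOb => Fam.Hom X.1.toFam Y.1.toFam) X Y →
    List (Chain Fam.Hom X.1.toFam Y.1.toFam)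
  | _, _, .nil X => (List.range (X.1.N + 1)).map (Chain.rep X.1.δ)
  | X, _, .cons a p =>
      (List.range (X.1.N + 1)).flatMap fun r =>
        (TwOb.insertions p).map fun q => (Chain.rep X.1.δ r).append (Chain.cons a q)

/-- The `A_∞`-category of twisted complexes, with
`μ_d(a_d, …, a₁) = ∑ μ(δ, …, δ, a_d, δ, …, δ, a₁, δ, …, δ)`. -/
def tw : AInfData k where
  Ob := A.TwOb
  Hom X Y := Fam.Hom X.1.toFam Y.1.toFam
  proj p := Fam.proj p
  proj_proj := Fam.proj_proj
  proj_add := Fam.proj_add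
  one X := Fam.one X.1.toFam
  μ c := ((TwOb.insertions c).map Fam.μ).sum

variable {A} in
/-- An object regarded as a twisted complex (with one summand and `δ = 0`).  The hypotheses are
instances of the axioms of an `A_∞`-category. -/
def ofOb (X : A.Ob) (h₀ : A.μ (.nil X) = 0) (h₁ : A.μ (.single (0 : A.Hom X X)) = 0) : A.tw.Ob :=
  ⟨{ N := 1, obj := fun _ => X, shift := fun _ => 0, δ := fun _ _ => 0 }, by
    refine ⟨map_zero (Fam.proj 1), fun _ _ _ => rfl, ?_⟩
    funext x y
    obtain rfl : x = y := Subsingleton.elim x y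
    simp only [List.range_succ, List.range_zero, List.nil_append, List.map_append, List.map_cons,
      List.map_nil, List.sum_append, List.sum_cons, List.sum_nil]
    obtain rfl : x = 0 := Subsingleton.elim (α := Fin 1) x 0
    have h₁' : A.μ (Chain.cons (0 : A.Hom X X) (.nil X)) = 0 := h₁
    simp [Fam.μ, Chain.rep, Fam.expand, twist, List.finRange_succ, h₀, h₁']⟩

end AInfData

/-! ### The category attached to a finite cyclically ordered set -/

/-- The generators of the morphisms between the `i`-th and the `j`-th object:
the identity if `i = j`, and `v_i` if `j = i + 1`. -/
abbrev CycGen {m : ℕ} (i j : ZMod m) : Type := PLift (i = j) ⊕ PLift (i + 1 = j)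

namespace CycGen

variable {k : Type u} [Field k] {m : ℕ}

/-- `x • id + y • v`, where generators which do not exist are omitted. -/
def mk (i j : ZMod m) (x y : k) : CycGen i j → k := Sum.elim (fun _ => x) (fun _ => y)

/-- The coefficient of the identity (zero if there is none). -/
def idCoeff {i j : ZMod m} (a : CycGen i j → k) : k :=
  if h : i = j then a (Sum.inl ⟨h⟩) else 0

/-- The coefficient of `v_i` (zero if there is none). -/
def vCoeff {i j : ZMod m} (a : CycGen i j → k) : k :=
  if h : i + 1 = j then a (Sum.inr ⟨h⟩) else 0

def vProd {S : Type w} {e : S → ZMod m} :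
    {X Y : S} → Chain (fun X Y => CycGen (e X) (e Y) → k) X Y → k
  | _, _, .nil _ => 1
  | _, _, .cons a p => vCoeff a * vProd p

/-- The multilinear extension of the identity compositions
`μ₂(a, id) = a`, `μ₂(id, a) = (-1)^{|a|} a`. -/
def idComp {S : Type w} {e : S → ZMod m} :
    {X Y : S} → Chain (fun X Y => CycGen (e X) (e Y) → k) X Y → (CycGen (e X) (e Y) → k)
  | X, Y, .cons a (.cons b (.nil _)) =>
      mk (e X) (e Y) (idCoeff a * idCoeff b) (idCoeff a * vCoeff b - vCoeff a * idCoeff b)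
  | _, _, _ => 0

/-- All compositions: the identity compositions and `μ_m(v_{i+m-1}, …, v_i) = id`. -/
def μ {S : Type w} {e : S → ZMod m} {X Y : S}
    (c : Chain (fun X Y => CycGen (e X) (e Y) → k) X Y) : CycGen (e X) (e Y) → k :=
  idComp c + if c.length = m then mk (e X) (e Y) (vProd c) 0 else 0

theorem μ_nil [NeZero m] {S : Type w} (e : S → ZMod m) (X : S) :
    μ (k := k) (e := e) (.nil X) = 0 := by
  simp [μ, idComp, Chain.length, (NeZero.ne m).symm]

theorem μ_single_zero {S : Type w} (e : S → ZMod m) (X : S) :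
    μ (k := k) (e := e) (.single (0 : CycGen (e X) (e X) → k)) = 0 := by
  funext g
  rcases g with g | g <;> simp [μ, idComp, Chain.single, vProd, vCoeff, mk] <;>
    split_ifs <;> simp

end CycGen

/-- The `A_∞`-category with set of objects a finite cyclically ordered set `S = [s₀, …, s_n]`,
morphisms spanned by the identities and by degree one morphisms `v_i : s_i → s_{i+1}`, and with the
identity compositions and `μ_{n+1}(v_{i+n}, …, v_i) = id` as only nonzero compositions.
The cyclic order is given by the enumeration `s` with indices modulo `n + 1`. -/
def cyc (k : Type u) [Field k] {n : ℕ} {S : Type w} (s : ZMod (n + 1) ≃ S) : AInfData k where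
  Ob := S
  Hom X Y := CycGen (s.symm X) (s.symm Y) → k
  proj p :=
    { toFun := fun a => fun
        | .inl g => if p = 0 then a (.inl g) else 0
        | .inr g => if p = 1 then a (.inr g) else 0
      map_add' := fun a b => by funext g; rcases g with g | g <;> simp <;> split_ifs <;> simp
      map_smul' := fun r a => by funext g; rcases g with g | g <;> simp }
  proj_proj p q a := by
    funext g
    rcases g with g | g <;> by_cases h : p = q <;> simp [h] <;> grind
  proj_add a := by
    funext g
    rcases g with g | g <;> simp
  one X := CycGen.mk (s.symm X) (s.symm X) 1 0
  μ c := CycGen.μ c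

namespace cyc

variable (k : Type u) [Field k] {n : ℕ} {S : Type w} (s : ZMod (n + 1) ≃ S)

/-- The generator `v_i : X → Y` if `X = s_i` and `Y = s_{i+1}`, and zero otherwise. -/
def gen (X Y : (cyc k s).Ob) : (cyc k s).Hom X Y := CycGen.mk (s.symm X) (s.symm Y) 0 1

/-- The object `s_i`; indices are natural numbers, understood modulo `n + 1`. -/
def ob (i : ℕ) : (cyc k s).Ob := s (i : ZMod (n + 1))

/-- The object `s_i` of the category of twisted complexes. -/
def twOb (i : ℕ) : (cyc k s).tw.Ob :=
  AInfData.ofOb (ob k s i) (CycGen.μ_nil _ _) (CycGen.μ_single_zero _ _)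

/-- The morphism `v_i : s_i → s_{i+1}` in the category of twisted complexes. -/
def twV (i : ℕ) : (cyc k s).tw.Hom (twOb k s i) (twOb k s (i + 1)) :=
  fun _ _ => gen k s (ob k s i) (ob k s (i + 1))

/-- The shift by one of `(s₁ → s₂ → ⋯ → s_n)`, with differential given by `v₁, …, v_{n-1}`. -/
def shiftedChain : (cyc k s).PreTw where
  N := n
  obj a := ob k s (a + 1)
  shift _ := 1
  δ a b := if (a : ℕ) + 1 = b then gen k s (ob k s (a + 1)) (ob k s (b + 1)) else 0

end cyc

/-! ### Representations of the `A_n`-quiver -/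

/-- Representations of the quiver `• → • → ⋯ → •` with `n` vertices: the poset `Fin n`, regarded as
a category, is the category of paths in this quiver. -/
abbrev QuiverRep (k : Type u) [Field k] (n : ℕ) := Fin n ⥤ ModuleCat.{u} k

/-- Two-periodic complexes in `𝒜`: a pair of objects `X 0`, `X 1` and a differential
`d` of degree one, written as a matrix whose components of degree zero vanish. -/
structure PerComplex (𝒜 : Type v) [Category.{w} 𝒜] [Preadditive 𝒜] where
  X : ZMod 2 → 𝒜
  d : ∀ i j, X i ⟶ X j
  d_deg : ∀ i j, j ≠ i + 1 → d i j = 0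
  d_sq : ∀ i j, ∑ l, d i l ≫ d l j = 0

namespace PerComplex

variable {𝒜 : Type v} [Category.{w} 𝒜] [Preadditive 𝒜]

/-- Families of morphisms of all degrees, without compatibility with the differentials;
the component `X i ⟶ Y j` has degree `j - i`. -/
abbrev Hom (X Y : PerComplex 𝒜) : Type w := ∀ i j, X.X i ⟶ Y.X j

def comp {X Y Z : PerComplex 𝒜} (a : Hom X Y) (b : Hom Y Z) : Hom X Z :=
  fun i j => ∑ l, a i l ≫ b l j

/-- `a ↦ (-1)^{|a|} a`. -/
def sgn {X Y : PerComplex 𝒜} (a : Hom X Y) : Hom X Y := fun i j => if i = j then a i j else - a i j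

/-- The differential graded category of two-periodic complexes, with differential
`∂ a = d a - (-1)^{|a|} a d`, regarded as an `A_∞`-category in the usual way:
`μ₁(a) = (-1)^{|a|} ∂ a` and `μ₂(b, a) = (-1)^{|a|} b a`. -/
def μ {X Y : PerComplex 𝒜} : Chain Hom X Y → Hom X Y
  | .nil _ => 0
  | .cons a (.nil _) => comp (sgn a) Y.d - comp X.d a
  | .cons a (.cons b (.nil _)) => comp (sgn a) b
  | .cons _ (.cons _ (.cons _ _)) => 0

end PerComplex

/-- The full differential graded category of two-periodic complexes in `𝒜` whose terms satisfy
`P`. -/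
def perDG (k : Type u) [Field k] {𝒜 : Type v} [Category.{w} 𝒜] [Preadditive 𝒜] [Linear k 𝒜]
    (P : 𝒜 → Prop) : AInfData k where
  Ob := {X : PerComplex 𝒜 // ∀ i, P (X.X i)}
  Hom X Y := PerComplex.Hom X.1 Y.1
  proj p :=
    { toFun := fun a i j => if j = i + p then a i j else 0
      map_add' := fun a b => by funext i j; simp only [Pi.add_apply]; split_ifs <;> simp
      map_smul' := fun r a => by funext i j; simp only [Pi.smul_apply]; split_ifs <;> simp }
  proj_proj p q a := by
    funext i j
    by_cases h : p = q
    · subst h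
      by_cases h1 : j = i + p <;> simp [h1]
    · have : ¬ (j = i + p ∧ j = i + q) := fun h' => h (add_left_cancel (h'.1.symm.trans h'.2))
      simp only [LinearMap.coe_mk, AddHom.coe_mk, h, if_false, Pi.zero_apply]
      by_cases h1 : j = i + p <;> by_cases h2 : j = i + q <;> simp_all
  proj_add a := by
    funext i j
    have : j = i ∨ j = i + 1 := by revert i j; decide
    have h1 : ¬ (1 : ZMod 2) = 0 := by decide
    rcases this with rfl | rfl <;> simp
  one X i j := if h : i = j then eqToHom (by rw [h]) else 0
  μ {X Y} c := PerComplex.μ (c.map Subtype.val id)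

/-- The two-periodic differential graded derived category of finite-dimensional representations of
the `A_n`-quiver: two-periodic complexes of finite-dimensional projective representations. -/
abbrev quiverDG (k : Type u) [Field k] (n : ℕ) : AInfData k :=
  perDG k (𝒜 := QuiverRep k n) fun M => Projective M ∧ ∀ v, Module.Finite k (M.obj v)

namespace QuiverRep

variable (k : Type u) [Field k] (n : ℕ)

/-- The space `k` if `p` holds, and `0` otherwise. -/
abbrev Line (p : Prop) : Type u := PLift p → k

/-- The identity of `k` if `p` and `q` hold, and `0` otherwise. -/
def lineMap (p q : Prop) [Decidable p] : Line k p →ₗ[k] Line k q where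
  toFun a _ := if h : p then a ⟨h⟩ else 0
  map_add' a b := by funext; simp; split_ifs <;> simp
  map_smul' r a := by funext; simp

theorem lineMap_self (p : Prop) [Decidable p] : lineMap k p p = LinearMap.id := by
  refine LinearMap.ext fun a => funext fun h => ?_
  simp [lineMap, h.down]

theorem lineMap_comp (p q r : Prop) [Decidable p] [Decidable q] (hpq : p → q) :
    (lineMap k q r).comp (lineMap k p q) = lineMap k p r := by
  refine LinearMap.ext fun a => funext fun h => ?_
  by_cases hp : p
  · simp [lineMap, hp, hpq hp]
  · simp [lineMap, hp]

/-- The representation `P_j` with a copy of `k` at each vertex `≥ j` and identity maps between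
them (it is zero for `j ≥ n`). -/
def P (j : ℕ) : QuiverRep k n where
  obj i := ModuleCat.of k (Line k (j ≤ i.val))
  map {i i'} _ := ModuleCat.ofHom (lineMap k (j ≤ i.val) (j ≤ i'.val))
  map_id i := by rw [lineMap_self]; rfl
  map_comp {i i' i''} f g := by
    rw [← ModuleCat.ofHom_comp, lineMap_comp]
    exact fun h => h.trans (leOfHom f)

/-- The inclusion `P_j → P_i` for `i ≤ j`. -/
def incl {i j : ℕ} (h : i ≤ j) : P k n j ⟶ P k n i where
  app l := ModuleCat.ofHom (lineMap k (j ≤ l.val) (i ≤ l.val))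
  naturality l l' f := by
    simp only [P]
    rw [← ModuleCat.ofHom_comp, ← ModuleCat.ofHom_comp, lineMap_comp, lineMap_comp]
    · exact fun h' => h.trans h'
    · exact fun h' => h'.trans (leOfHom f)

/-- The linear map from `k` or `0` which sends `1` to `x`. -/
def lineTo (p : Prop) [Decidable p] {V : Type u} [AddCommGroup V] [Module k V] (x : p → V) :
    Line k p →ₗ[k] V where
  toFun a := if h : p then a ⟨h⟩ • x h else 0
  map_add' a b := by split_ifs <;> simp [add_smul]
  map_smul' r a := by split_ifs <;> simp [mul_smul]

theorem lineTo_comp_lineMap (p q : Prop) [Decidable p] [Decidable q] (hpq : p → q)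
    {V : Type u} [AddCommGroup V] [Module k V] (x : q → V) :
    (lineTo k q x).comp (lineMap k p q) = lineTo k p fun h => x (hpq h) := by
  refine LinearMap.ext fun a => ?_
  by_cases hp : p
  · simp [lineMap, lineTo, hp, hpq hp]
  · simp [lineMap, lineTo, hp]

theorem comp_lineTo (p : Prop) [Decidable p] {V W : Type u} [AddCommGroup V] [Module k V]
    [AddCommGroup W] [Module k W] (f : V →ₗ[k] W) (x : p → V) :
    f.comp (lineTo k p x) = lineTo k p fun h => f (x h) := by
  refine LinearMap.ext fun a => ?_
  by_cases hp : p <;> simp [lineTo, hp]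

theorem eq_lineTo (p : Prop) [Decidable p] {V : Type u} [AddCommGroup V] [Module k V]
    (f : Line k p →ₗ[k] V) : f = lineTo k p fun _ => f fun _ => 1 := by
  refine LinearMap.ext fun a => ?_
  by_cases hp : p
  · have : a = a ⟨hp⟩ • (fun _ => 1 : Line k p) := by funext h; simp
    simp only [lineTo, hp, LinearMap.coe_mk, AddHom.coe_mk, dif_pos]
    rw [← map_smul, ← this]
  · have : a = 0 := funext fun h => absurd h.down hp
    simp [this]

instance (j : ℕ) : Projective (P k n j) where
  factors {E X} f e _ := by
    have hy : ∀ hj : j < n, ∃ y : E.obj ⟨j, hj⟩,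
        (e.app ⟨j, hj⟩).hom y = (f.app ⟨j, hj⟩).hom (fun _ => (1 : k)) := fun hj =>
      (ModuleCat.epi_iff_surjective _).1 (inferInstance : Epi (e.app ⟨j, hj⟩)) _
    choose y hy using hy
    have le (l : Fin n) (h : j ≤ l.val) : (⟨j, h.trans_lt l.2⟩ : Fin n) ⟶ l := homOfLE h
    refine ⟨{ app := fun l => ModuleCat.ofHom
                (lineTo k (j ≤ l.val) fun h => (E.map (le l h)).hom (y (h.trans_lt l.2)))
              naturality := fun l l' g => ?_ }, ?_⟩
    · refine ModuleCat.hom_ext ?_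
      refine (lineTo_comp_lineMap k _ _ (fun h => h.trans (leOfHom g)) _).trans ?_
      refine Eq.trans ?_ (comp_lineTo k _ _ _).symm
      congr 1
      funext h
      exact ConcreteCategory.congr_hom (E.map_comp (le l h) g) (y _)
    · refine NatTrans.ext (funext fun l => ModuleCat.hom_ext ?_)
      refine (comp_lineTo k _ _ _).trans (Eq.trans ?_ (eq_lineTo k _ _).symm)
      congr 1
      funext h
      have h1 := ConcreteCategory.congr_hom (e.naturality (le l h)) (y (h.trans_lt l.2))
      have h2 := ConcreteCategory.congr_hom (f.naturality (le l h)) (fun _ => (1 : k))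
      have h3 : ((P k n j).map (le l h)).hom (fun _ => (1 : k)) = fun _ => (1 : k) := by
        funext h'
        change lineMap k (j ≤ j) (j ≤ l.val) (fun _ => (1 : k)) h' = 1
        simp [lineMap]
      refine h1.trans ?_
      refine (congrArg (X.map (le l h)).hom (hy _)).trans (h2.symm.trans ?_)
      exact congrArg (f.app l).hom h3

theorem finite_P (j : ℕ) (l : Fin n) : Module.Finite k ((P k n j).obj l) :=
  inferInstanceAs (Module.Finite k (PLift (j ≤ l.val) → k))

/-- The simple module supported at the vertex `i`: a copy of `k` at this vertex, zero elsewhere. -/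
def simple (i : Fin n) : QuiverRep k n where
  obj l := ModuleCat.of k (Line k (l = i))
  map {l l'} _ := ModuleCat.ofHom (lineMap k (l = i) (l' = i))
  map_id l := by rw [lineMap_self]; rfl
  map_comp {l l' l''} f g := by
    rw [← ModuleCat.ofHom_comp]
    congr 1
    refine LinearMap.ext fun a => funext fun h => ?_
    by_cases hl : l = i
    · have : l' = i := le_antisymm (h.down ▸ leOfHom g) (hl ▸ leOfHom f)
      simp [lineMap, hl, this]
    · simp [lineMap, hl]

/-- The projection of `P_i` onto the simple module at `i`. -/
def aug (i : Fin n) : P k n i ⟶ simple k n i where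
  app l := ModuleCat.ofHom (lineMap k (i.val ≤ l.val) (l = i))
  naturality l l' f := by
    change ModuleCat.ofHom _ ≫ ModuleCat.ofHom _ = ModuleCat.ofHom _ ≫ ModuleCat.ofHom _
    rw [← ModuleCat.ofHom_comp, ← ModuleCat.ofHom_comp]
    congr 1
    refine LinearMap.ext fun a => funext fun h => ?_
    have h1 : i.val ≤ l'.val := by rw [h.down]
    by_cases hl : i.val ≤ l.val
    · have h2 : l = i := le_antisymm (h.down ▸ leOfHom f) hl
      simp [lineMap, h1, h2]
    · simp [lineMap, hl]

/-- `0 → P_{i+1} → P_i → simple i → 0` is exact at every vertex. -/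
theorem resolution (i l : Fin n) :
    Function.Injective ((incl k n (Nat.le_succ i)).app l).hom ∧
    Function.Surjective ((aug k n i).app l).hom ∧
    LinearMap.ker ((aug k n i).app l).hom =
      LinearMap.range ((incl k n (Nat.le_succ i)).app l).hom := by
  change Function.Injective (lineMap k (i.val + 1 ≤ l.val) (i.val ≤ l.val)) ∧
    Function.Surjective (lineMap k (i.val ≤ l.val) (l = i)) ∧
    LinearMap.ker (lineMap k (i.val ≤ l.val) (l = i)) =
      LinearMap.range (lineMap k (i.val + 1 ≤ l.val) (i.val ≤ l.val))
  have id1 : ∀ p q : Prop, [Decidable p] → [Decidable q] → (q → p) → ∀ b : Line k q,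
      lineMap k p q (lineMap k q p b) = b := by
    intro p q _ _ hqp b
    funext h
    simp [lineMap, h.down, hqp h.down]
  refine ⟨(Function.LeftInverse.injective (g := lineMap k (i.val ≤ l.val) (i.val + 1 ≤ l.val)) ?_),
    (Function.RightInverse.surjective (g := lineMap k (l = i) (i.val ≤ l.val)) ?_), ?_⟩
  · exact id1 _ _ fun h => by omega
  · exact id1 _ _ fun h => by rw [h]
  · ext a
    constructor
    · intro ha
      refine ⟨lineMap k (i.val ≤ l.val) (i.val + 1 ≤ l.val) a, ?_⟩
      funext h
      by_cases hl : i.val + 1 ≤ l.val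
      · simp [lineMap, hl, h.down]
      · have hli : l = i := Fin.ext (by have := h.down; omega)
        have := congrFun (LinearMap.mem_ker.1 ha) ⟨hli⟩
        simp only [lineMap, LinearMap.coe_mk, AddHom.coe_mk, h.down, dif_pos, Pi.zero_apply] at this
        simp [lineMap, hl, this]
    · rintro ⟨b, rfl⟩
      refine LinearMap.mem_ker.2 (funext fun h => ?_)
      have : ¬ i.val + 1 ≤ l.val := by rw [h.down]; omega
      simp [lineMap, this]

/-- The simple module supported at the vertex `i`, as an object of the derived category: its
projective resolution `P_{i+1} → P_i`, with `P_i` in even and `P_{i+1}` in odd degree. -/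
def simpleOb (i : Fin n) : (quiverDG k n).Ob :=
  ⟨{  X := fun
        | (0 : Fin 2) => P k n i
        | (1 : Fin 2) => P k n (i + 1)
      d := fun
        | (1 : Fin 2), (0 : Fin 2) => incl k n (Nat.le_succ i)
        | (0 : Fin 2), (0 : Fin 2) => 0
        | (0 : Fin 2), (1 : Fin 2) => 0
        | (1 : Fin 2), (1 : Fin 2) => 0
      d_deg := by
        intro (i : Fin 2) (j : Fin 2) h
        fin_cases i <;> fin_cases j <;> first | rfl | exact absurd rfl h
      d_sq := by
        intro (i : Fin 2) (j : Fin 2)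
        refine (Fin.sum_univ_two _).trans ?_
        fin_cases i <;> fin_cases j <;> simp }, by
    intro (i : Fin 2)
    fin_cases i
    · exact ⟨inferInstanceAs (Projective (P k n _)), finite_P k n _⟩
    · exact ⟨inferInstanceAs (Projective (P k n _)), finite_P k n _⟩⟩

/-- The generating morphism `w_i : m_i → m_{i+1}` of degree one, given by the identity of
`P_{i+1}`. -/
def extHom (i : ℕ) (hi : i + 1 < n) :
    (quiverDG k n).Hom (simpleOb k n ⟨i, Nat.lt_of_succ_lt hi⟩) (simpleOb k n ⟨i + 1, hi⟩) := fun
  | (1 : Fin 2), (0 : Fin 2) => 𝟙 (P k n (i + 1))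
  | (0 : Fin 2), (0 : Fin 2) => 0
  | (0 : Fin 2), (1 : Fin 2) => 0
  | (1 : Fin 2), (1 : Fin 2) => 0

end QuiverRep

theorem zmod_two_cases : ∀ p : ZMod 2, p = 0 ∨ p = 1 := by decide

/-! ### Sums over cuttings of composable sequences -/

namespace Chain

variable {O : Type w} {H : O → O → Type v} {M : Type*} [AddCommGroup M]

@[simp] theorem nil_append {X Y : O} (q : Chain H X Y) : (nil X).append q = q := rfl

@[simp] theorem cons_append {X Y Z W : O} (a : H X Y) (p : Chain H Y Z) (q : Chain H Z W) :
    (cons a p).append q = cons a (p.append q) := rfl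

@[simp] theorem append_nil {X Y : O} (p : Chain H X Y) : p.append (nil Y) = p := by
  induction p with
  | nil => rfl
  | cons a p ih => simp [ih]

@[simp] theorem length_nil (X : O) : (nil X : Chain H X X).length = 0 := rfl

@[simp] theorem length_cons {X Y Z : O} (a : H X Y) (p : Chain H Y Z) :
    (cons a p).length = p.length + 1 := rfl

@[simp] theorem length_append {X Y Z : O} (p : Chain H X Y) (q : Chain H Y Z) :
    (p.append q).length = p.length + q.length := by
  induction p with
  | nil => simp
  | cons a p ih => simp [ih]; omega

@[simp] theorem length_map {O' : Type*} {H' : O' → O' → Type*} (f : O → O')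
    (g : ∀ {X Y}, H X Y → H' (f X) (f Y)) {X Y : O} (c : Chain H X Y) :
    (c.map f g).length = c.length := by
  induction c with
  | nil => rfl
  | cons a p ih => simp [map, ih]

theorem map_append {O' : Type*} {H' : O' → O' → Type*} (f : O → O')
    (g : ∀ {X Y}, H X Y → H' (f X) (f Y)) {X Y Z : O} (p : Chain H X Y) (q : Chain H Y Z) :
    (p.append q).map f g = (p.map f g).append (q.map f g) := by
  induction p with
  | nil => rfl
  | cons a p ih => simp [map, ih]

/-- The sum of a function of two sequences over all ways of cutting a sequence in two. -/
def splitSum {X Y : O} (Ψ : ∀ Z, Chain H X Z → Chain H Z Y → M) (c : Chain H X Y) : M :=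
  (c.splits.map fun t => Ψ t.1 t.2.1 t.2.2).sum

@[simp] theorem splitSum_nil {X : O} (Ψ : ∀ Z, Chain H X Z → Chain H Z X → M) :
    splitSum Ψ (nil X) = Ψ X (nil X) (nil X) := by
  simp [splitSum, splits]

@[simp] theorem splitSum_cons {X Y Z : O} (Ψ : ∀ W, Chain H X W → Chain H W Z → M)
    (a : H X Y) (p : Chain H Y Z) :
    splitSum Ψ (cons a p) =
      Ψ X (nil X) (cons a p) + splitSum (fun W q r => Ψ W (cons a q) r) p := by
  simp only [splitSum, splits, List.map_cons, List.sum_cons, List.map_map]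
  rfl

theorem splitSum_add {X Y : O} (Ψ Θ : ∀ Z, Chain H X Z → Chain H Z Y → M) (c : Chain H X Y) :
    splitSum (fun Z p q => Ψ Z p q + Θ Z p q) c = splitSum Ψ c + splitSum Θ c := by
  simp only [splitSum]
  exact List.sum_map_add

theorem map_splitSum {N : Type*} [AddCommGroup N] (g : M →+ N) {X Y : O}
    (Ψ : ∀ Z, Chain H X Z → Chain H Z Y → M) (c : Chain H X Y) :
    g (splitSum Ψ c) = splitSum (fun Z p q => g (Ψ Z p q)) c := by
  simp only [splitSum, map_list_sum, List.map_map]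
  rfl

theorem splitSum_eq_zero {X Y : O} {Ψ : ∀ Z, Chain H X Z → Chain H Z Y → M} {c : Chain H X Y}
    (h : ∀ Z p q, p.append q = c → Ψ Z p q = 0) : splitSum Ψ c = 0 := by
  induction c with
  | nil X => simpa using h X (nil X) (nil X) rfl
  | cons a p ih =>
    rw [splitSum_cons, h _ _ _ rfl, zero_add]
    exact ih fun Z q r e => h Z _ _ (by simp [e])

theorem splitSum_congr {X Y : O} {Ψ Θ : ∀ Z, Chain H X Z → Chain H Z Y → M} {c : Chain H X Y}
    (h : ∀ Z p q, p.append q = c → Ψ Z p q = Θ Z p q) : splitSum Ψ c = splitSum Θ c := by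
  have := splitSum_eq_zero (Ψ := fun Z p q => Ψ Z p q + -Θ Z p q) (c := c)
    fun Z p q e => by rw [h Z p q e, add_neg_cancel]
  rw [splitSum_add] at this
  have h2 := map_splitSum (negAddMonoidHom (α := M)) Θ c
  simp only [negAddMonoidHom_apply] at h2
  rw [← h2] at this
  exact add_neg_eq_zero.1 this

theorem splitSum_sum {ι : Type*} (s : Finset ι) {X Y : O}
    (Ψ : ι → ∀ Z, Chain H X Z → Chain H Z Y → M) (c : Chain H X Y) :
    splitSum (fun Z p q => ∑ i ∈ s, Ψ i Z p q) c = ∑ i ∈ s, splitSum (Ψ i) c := by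
  classical
  induction s using Finset.induction_on with
  | empty => simpa using splitSum_eq_zero fun _ _ _ _ => rfl
  | insert i s hi ih => simp only [Finset.sum_insert hi, splitSum_add, ih]

/-! ### Sums over the ways of cutting into blocks -/

/-- The sum of a function over all ways of cutting into consecutive nonempty blocks. -/
def blockSum {X Y : O} (Θ : Chain (fun X Y => Chain H X Y) X Y → M) (c : Chain H X Y) : M :=
  (c.blocks.map Θ).sum

/-- Lengthening the first block of a sequence of blocks. -/
def growFirst {X Y Z : O} (a : H X Y) (Θ : Chain (fun X Y => Chain H X Y) X Z → M) :
    Chain (fun X Y => Chain H X Y) Y Z → M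
  | nil _ => 0
  | cons q B => Θ (cons (cons a q) B)

theorem blockSum_nil {X : O} (Θ : Chain (fun X Y => Chain H X Y) X X → M) :
    blockSum Θ (nil X) = Θ (nil X) := by simp [blockSum, blocks]

theorem blockSum_cons {X Y Z : O} (Θ : Chain (fun X Y => Chain H X Y) X Z → M)
    (a : H X Y) (p : Chain H Y Z) :
    blockSum Θ (cons a p) =
      blockSum (fun B => Θ (cons (cons a (nil Y)) B)) p + blockSum (growFirst a Θ) p := by
  simp only [blockSum, blocks, List.map_flatMap]
  rw [List.flatMap_def, List.sum_flatten, List.map_map, ← List.sum_map_add]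
  congr 1
  refine List.map_congr_left fun B _ => ?_
  cases B <;> simp [growFirst]

theorem blockSum_eq_zero {X Y Z : O} {Θ : Chain (fun X Y => Chain H X Y) X Z → M}
    (h : ∀ B, 1 ≤ B.length → Θ B = 0) (a : H X Y) (p : Chain H Y Z) :
    blockSum Θ (cons a p) = 0 := by
  have h2 : growFirst a Θ = fun _ => 0 := by
    funext B
    cases B with
    | nil => rfl
    | cons q B => exact h _ (by simp)
  have h3 : ∀ B : Chain (fun X Y => Chain H X Y) Y Z, Θ (cons (cons a (nil Y)) B) = 0 :=
    fun B => h _ (by simp)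
  rw [blockSum_cons]
  simp only [blockSum, h2, h3, List.map_const', List.sum_replicate, smul_zero, add_zero]

theorem blockSum_of_one {X Y Z : O} (Θ : Chain (fun X Y => Chain H X Y) X Z → M)
    (h : ∀ B, 2 ≤ B.length → Θ B = 0) (a : H X Y) (p : Chain H Y Z) :
    blockSum Θ (cons a p) = Θ (single (cons a p)) := by
  induction p generalizing X with
  | nil => simp [blockSum_cons, blockSum_nil, growFirst, single]
  | cons b p ih =>
    rw [blockSum_cons, blockSum_eq_zero, zero_add, ih]
    · rfl
    · intro B hB
      cases B with
      | nil => simp at hB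
      | cons q B => exact h _ hB
    · exact fun B hB => h _ (by simpa using hB)

theorem blockSum_of_two {X Y Z : O} (Θ : Chain (fun X Y => Chain H X Y) X Z → M)
    (h : ∀ B, 3 ≤ B.length → Θ B = 0) (hr : ∀ q, Θ (pair q (nil Z)) = 0)
    (a : H X Y) (p : Chain H Y Z) :
    blockSum Θ (cons a p) =
      Θ (single (cons a p)) + splitSum (fun _ q r => Θ (pair (cons a q) r)) p := by
  induction p generalizing X with
  | nil Y =>
    simp only [blockSum_cons, blockSum_nil, growFirst, single, splitSum_nil, hr]
  | cons b p ih =>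
    rw [blockSum_cons, blockSum_of_one, ih]
    · simp only [growFirst, single, pair, splitSum_cons]
      abel
    · intro B hB
      cases B with
      | nil => rfl
      | cons q B => exact h _ hB
    · exact fun q => hr _
    · exact fun B hB => h _ (by simpa using hB)

end Chain

/-! ### Multilinear functions of composable sequences -/

namespace AInfData

variable {k : Type u} [Field k] {A : AInfData.{u, v, w} k} {M : Type*} [AddCommGroup M]
  [Module k M]

variable (A) in
/-- Multilinearity of a function of composable sequences. -/
structure Multilin {X Y : A.Ob} (Φ : Chain A.Hom X Y → M) : Prop where
  add : ∀ {Z W : A.Ob} (p : Chain A.Hom X Z) (a b : A.Hom Z W) (q : Chain A.Hom W Y),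
    Φ (p.append (.cons (a + b) q)) = Φ (p.append (.cons a q)) + Φ (p.append (.cons b q))
  smul : ∀ {Z W : A.Ob} (p : Chain A.Hom X Z) (r : k) (a : A.Hom Z W) (q : Chain A.Hom W Y),
    Φ (p.append (.cons (r • a) q)) = r • Φ (p.append (.cons a q))

theorem IsAInf.multilin (h : A.IsAInf) {X Y : A.Ob} :
    A.Multilin (A.μ : Chain A.Hom X Y → A.Hom X Y) :=
  ⟨h.μ_add, h.μ_smul⟩

namespace Multilin

variable {X Y Z W : A.Ob} {Φ : Chain A.Hom X Y → M}

theorem cons (h : A.Multilin Φ) (a : A.Hom X Z) : A.Multilin fun c => Φ (.cons a c) :=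
  ⟨fun p => h.add (.cons a p), fun p => h.smul (.cons a p)⟩

/-- The linear function of one entry obtained by fixing all the other entries. -/
def lin (h : A.Multilin Φ) (p : Chain A.Hom X Z) (q : Chain A.Hom W Y) : A.Hom Z W →ₗ[k] M where
  toFun a := Φ (p.append (.cons a q))
  map_add' a b := h.add p a b q
  map_smul' r a := h.smul p r a q

theorem zero (h : A.Multilin Φ) (p : Chain A.Hom X Z) (q : Chain A.Hom W Y) :
    Φ (p.append (.cons 0 q)) = 0 := (h.lin p q).map_zero

theorem zero' (h : A.Multilin Φ) (q : Chain A.Hom W Y) : Φ (.cons 0 q) = 0 := h.zero (.nil X) q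

theorem add' (h : A.Multilin Φ) (a b : A.Hom X W) (q : Chain A.Hom W Y) :
    Φ (.cons (a + b) q) = Φ (.cons a q) + Φ (.cons b q) := h.add (.nil X) a b q

theorem smul' (h : A.Multilin Φ) (r : k) (a : A.Hom X W) (q : Chain A.Hom W Y) :
    Φ (.cons (r • a) q) = r • Φ (.cons a q) := h.smul (.nil X) r a q

end Multilin

/-! ### Signs -/

section Sign

variable {X Y : A.Ob}

variable (A) in
/-- `redSgn` as a linear map. -/
def redSgnₗ (X Y : A.Ob) : A.Hom X Y →ₗ[k] A.Hom X Y := A.proj 1 - A.proj 0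

theorem redSgn_add (a b : A.Hom X Y) : A.redSgn (a + b) = A.redSgn a + A.redSgn b :=
  (A.redSgnₗ X Y).map_add a b

theorem redSgn_smul (r : k) (a : A.Hom X Y) : A.redSgn (r • a) = r • A.redSgn a :=
  (A.redSgnₗ X Y).map_smul r a

@[simp] theorem redSgn_zero : A.redSgn (0 : A.Hom X Y) = 0 := (A.redSgnₗ X Y).map_zero

theorem redSgn_neg (a : A.Hom X Y) : A.redSgn (-a) = -A.redSgn a := (A.redSgnₗ X Y).map_neg a

theorem sgn_eq_neg_redSgn (a : A.Hom X Y) : A.sgn a = -A.redSgn a := by simp [sgn, redSgn]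

theorem proj_redSgn (p : ZMod 2) (a : A.Hom X Y) : A.proj p (A.redSgn a) = A.redSgn (A.proj p a) := by
  simp only [redSgn, map_sub, A.proj_proj]
  obtain rfl | rfl := zmod_two_cases p
  all_goals simp

@[simp] theorem redSgn_redSgn (a : A.Hom X Y) : A.redSgn (A.redSgn a) = a := by
  have := A.proj_add a
  simp only [redSgn, map_sub, A.proj_proj]
  simpa [add_comm] using this

theorem IsHomog.redSgn_eq {p : ZMod 2} {a : A.Hom X Y} (h : A.IsHomog p a) :
    A.redSgn a = if p = 1 then a else -a := by
  rw [← h]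
  simp only [redSgn, A.proj_proj]
  obtain rfl | rfl := zmod_two_cases p
  all_goals simp

theorem isHomog_proj (p : ZMod 2) (a : A.Hom X Y) : A.IsHomog p (A.proj p a) := by
  simp [IsHomog, A.proj_proj]

theorem isHomog_zero (p : ZMod 2) : A.IsHomog p (0 : A.Hom X Y) := map_zero _

theorem IsHomog.add {p : ZMod 2} {a b : A.Hom X Y} (ha : A.IsHomog p a) (hb : A.IsHomog p b) :
    A.IsHomog p (a + b) := (map_add _ a b).trans (congrArg₂ _ ha hb)

theorem IsHomog.neg {p : ZMod 2} {a : A.Hom X Y} (ha : A.IsHomog p a) :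
    A.IsHomog p (-a) := (map_neg _ a).trans (congrArg _ ha)

theorem IsHomog.redSgn {p : ZMod 2} {a : A.Hom X Y} (ha : A.IsHomog p a) :
    A.IsHomog p (A.redSgn a) := by
  rw [IsHomog, proj_redSgn, ha]

/-- `m ↦ (-1)^p m`. -/
def signed (p : ZMod 2) (m : M) : M := if p = 0 then m else -m

@[simp] theorem signed_zero_left (m : M) : signed 0 m = m := rfl

@[simp] theorem signed_zero (p : ZMod 2) : signed p (0 : M) = 0 := by simp [signed]

theorem signed_one (m : M) : signed 1 m = -m := rfl

theorem signed_signed (p q : ZMod 2) (m : M) : signed p (signed q m) = signed (p + q) m := by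
  obtain rfl | rfl := zmod_two_cases p
  · simp
  obtain rfl | rfl := zmod_two_cases q
  · simp
  · rw [show (1 + 1 : ZMod 2) = 0 from rfl]; simp [signed_one]

theorem signed_add (p : ZMod 2) (m n : M) : signed p (m + n) = signed p m + signed p n := by
  unfold signed; split_ifs <;> abel

theorem signed_sum {ι : Type*} (s : Finset ι) (p : ZMod 2) (f : ι → M) :
    signed p (∑ i ∈ s, f i) = ∑ i ∈ s, signed p (f i) := by
  unfold signed; split_ifs <;> simp

theorem map_signed {N : Type*} [AddCommGroup N] (g : M →+ N) (p : ZMod 2) (m : M) :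
    g (signed p m) = signed p (g m) := by
  unfold signed; split_ifs <;> simp

@[simp] theorem twist_zero_left (a : A.Hom X Y) : A.twist 0 a = a := rfl

theorem twist_one (a : A.Hom X Y) : A.twist 1 a = A.redSgn a := rfl

theorem twist_twist (p q : ZMod 2) (a : A.Hom X Y) :
    A.twist p (A.twist q a) = A.twist (p + q) a := by
  obtain rfl | rfl := zmod_two_cases p
  · simp
  obtain rfl | rfl := zmod_two_cases q
  · simp
  · rw [show (1 + 1 : ZMod 2) = 0 from rfl]; simp [twist_one]

variable (A) in
/-- `twist` as a linear map. -/
def twistₗ (p : ZMod 2) (X Y : A.Ob) : A.Hom X Y →ₗ[k] A.Hom X Y :=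
  if p = 0 then LinearMap.id else A.redSgnₗ X Y

theorem twistₗ_apply (p : ZMod 2) (a : A.Hom X Y) : A.twistₗ p X Y a = A.twist p a := by
  unfold twistₗ twist; split_ifs <;> rfl

theorem twist_add (p : ZMod 2) (a b : A.Hom X Y) :
    A.twist p (a + b) = A.twist p a + A.twist p b := by
  simp only [← twistₗ_apply, map_add]

theorem twist_smul (p : ZMod 2) (r : k) (a : A.Hom X Y) :
    A.twist p (r • a) = r • A.twist p a := by
  simp only [← twistₗ_apply, map_smul]

@[simp] theorem twist_zero (p : ZMod 2) : A.twist p (0 : A.Hom X Y) = 0 := by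
  simp only [← twistₗ_apply, map_zero]

theorem twist_neg (p : ZMod 2) (a : A.Hom X Y) : A.twist p (-a) = -A.twist p a := by
  simp only [← twistₗ_apply, map_neg]

theorem IsHomog.twist {p : ZMod 2} {a : A.Hom X Y} (ha : A.IsHomog p a) (q : ZMod 2) :
    A.IsHomog p (A.twist q a) := by
  unfold AInfData.twist; split_ifs
  exacts [ha, ha.redSgn]

theorem IsHomog.twist_eq {p : ZMod 2} {a : A.Hom X Y} (ha : A.IsHomog p a) (q : ZMod 2) :
    A.twist q a = signed (q * (p + 1)) a := by
  obtain rfl | rfl := zmod_two_cases q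
  · simp
  · rw [twist_one, ha.redSgn_eq]
    obtain rfl | rfl := zmod_two_cases p
    · rfl
    · rfl

/-- Two multilinear functions which agree on homogeneous sequences agree. -/
theorem Multilin.ext_homog {Φ Ψ : Chain A.Hom X Y → M} (hΦ : A.Multilin Φ) (hΨ : A.Multilin Ψ)
    (h : ∀ c p, A.ChainHomog c p → Φ c = Ψ c) (c : Chain A.Hom X Y) : Φ c = Ψ c := by
  induction c with
  | nil X => exact h _ 0 rfl
  | cons a c ih =>
    have key : ∀ b q, A.IsHomog q b → Φ (.cons b c) = Ψ (.cons b c) := fun b q hq =>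
      ih (hΦ.cons b) (hΨ.cons b) fun c p hc => h _ (q + p) ⟨q, p, hq, hc, rfl⟩
    rw [← A.proj_add a, hΦ.add', hΨ.add', key _ 0 (isHomog_proj _ _), key _ 1 (isHomog_proj _ _)]

theorem Multilin.signed {Φ : Chain A.Hom X Y → M} (h : A.Multilin Φ) {Z W : A.Ob} (r : ZMod 2)
    (p : Chain A.Hom X Z) (a : A.Hom Z W) (q : Chain A.Hom W Y) :
    Φ (p.append (.cons (signed r a) q)) = AInfData.signed r (Φ (p.append (.cons a q))) :=
  map_signed (h.lin p q).toAddMonoidHom r a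

end Sign

section Insert

variable {k : Type u} [Field k] {A : AInfData.{u, v, w} k} {M : Type*} [AddCommGroup M]
  {X Y : A.Ob}

/-- The terms of `insertSum` in which the inner operation comes first. -/
def headSum (Φ : Chain A.Hom X Y → M) (c : Chain A.Hom X Y) : M :=
  c.splitSum fun _ t q => Φ (.cons (A.μ t) q)

theorem insertSum_eq (Φ : Chain A.Hom X Y → M) (c : Chain A.Hom X Y) :
    A.insertSum Φ c = c.splitSum fun _ p r =>
      headSum (fun q => Φ ((p.map id A.redSgn).append q)) r := rfl

theorem insertSum_nil (Φ : Chain A.Hom X X → M) :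
    A.insertSum Φ (.nil X) = Φ (.cons (A.μ (.nil X)) (.nil X)) := by
  simp [insertSum_eq, headSum, Chain.map]

theorem insertSum_cons {Z : A.Ob} (Φ : Chain A.Hom X Y → M) (a : A.Hom X Z) (c : Chain A.Hom Z Y) :
    A.insertSum Φ (.cons a c) =
      headSum Φ (.cons a c) + A.insertSum (fun q => Φ (.cons (A.redSgn a) q)) c := by
  rw [insertSum_eq, Chain.splitSum_cons]
  rfl

theorem headSum_cons {Z : A.Ob} (Φ : Chain A.Hom X Y → M) (a : A.Hom X Z) (c : Chain A.Hom Z Y) :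
    headSum Φ (.cons a c) = Φ (.cons (A.μ (.nil X)) (.cons a c)) +
      c.splitSum fun _ t q => Φ (.cons (A.μ (.cons a t)) q) := by
  rw [headSum, Chain.splitSum_cons]

theorem map_insertSum {N : Type*} [AddCommGroup N] (g : M →+ N) (Φ : Chain A.Hom X Y → M)
    (c : Chain A.Hom X Y) : g (A.insertSum Φ c) = A.insertSum (fun e => g (Φ e)) c := by
  simp only [insertSum_eq, headSum, Chain.map_splitSum]

theorem insertSum_add (Φ Ψ : Chain A.Hom X Y → M) (c : Chain A.Hom X Y) :
    A.insertSum (fun e => Φ e + Ψ e) c = A.insertSum Φ c + A.insertSum Ψ c := by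
  simp only [insertSum_eq, headSum, Chain.splitSum_add]

theorem insertSum_sum {ι : Type*} (s : Finset ι) (Φ : ι → Chain A.Hom X Y → M)
    (c : Chain A.Hom X Y) :
    A.insertSum (fun e => ∑ i ∈ s, Φ i e) c = ∑ i ∈ s, A.insertSum (Φ i) c := by
  simp only [insertSum_eq, headSum, Chain.splitSum_sum]

theorem headSum_sum {ι : Type*} (s : Finset ι) (Φ : ι → Chain A.Hom X Y → M)
    (c : Chain A.Hom X Y) :
    headSum (fun e => ∑ i ∈ s, Φ i e) c = ∑ i ∈ s, headSum (Φ i) c := by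
  simp only [headSum, Chain.splitSum_sum]

end Insert

/-! ### Elementary consequences of the axioms -/

theorem Multilin.map_redSgn {X Y : A.Ob} {Φ : Chain A.Hom X Y → M} (hΦ : A.Multilin Φ)
    {c : Chain A.Hom X Y} {p : ZMod 2} (hc : A.ChainHomog c p) :
    Φ (c.map id A.redSgn) = AInfData.signed (p + c.length) (Φ c) := by
  induction c generalizing p with
  | nil X =>
    obtain rfl : p = 0 := hc
    simp [Chain.map]
  | cons a c ih =>
    obtain ⟨q, r, hq, hr, rfl⟩ := hc
    refine (ih (hΦ.cons _) hr).trans ?_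
    change AInfData.signed _ (Φ (.cons (A.redSgn a) c)) = _
    rw [← twist_one, hq.twist_eq, one_mul]
    refine (congrArg _ (hΦ.signed _ (.nil _) _ _)).trans ?_
    rw [signed_signed]
    congr 1
    simp only [Chain.length_cons]
    push_cast
    ring

theorem Multilin.comp_map_redSgn {X Y : A.Ob} {Φ : Chain A.Hom X Y → M} (hΦ : A.Multilin Φ) :
    A.Multilin fun c : Chain A.Hom X Y => Φ (c.map id A.redSgn) where
  add p a b q := by
    simp only [Chain.map_append, Chain.map, redSgn_add]
    exact hΦ.add _ _ _ _
  smul p a b q := by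
    simp only [Chain.map_append, Chain.map, redSgn_smul]
    exact hΦ.smul _ _ _ _

theorem Multilin.map {N : Type*} [AddCommGroup N] [Module k N] {X Y : A.Ob}
    {Φ : Chain A.Hom X Y → M} (hΦ : A.Multilin Φ) (g : M →ₗ[k] N) :
    A.Multilin fun c => g (Φ c) where
  add p a b q := by rw [hΦ.add, map_add]
  smul p a b q := by rw [hΦ.smul, map_smul]

theorem Multilin.neg {X Y : A.Ob} {Φ : Chain A.Hom X Y → M} (hΦ : A.Multilin Φ) :
    A.Multilin fun c => -Φ c :=
  hΦ.map (-LinearMap.id)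

namespace IsAInf

variable {X Y Z W : A.Ob}

theorem redSgn_μ (h : A.IsAInf) (c : Chain A.Hom X Y) :
    A.redSgn (A.μ c) = -A.μ (c.map id A.redSgn) := by
  refine Multilin.ext_homog (h.multilin.map (A.redSgnₗ X Y))
    (h.multilin.comp_map_redSgn.neg) (fun c p hc => ?_) c
  change A.redSgn (A.μ c) = -A.μ (c.map id A.redSgn)
  rw [h.multilin.map_redSgn hc, ← twist_one, (h.μ_deg c p hc).twist_eq, ← signed_one,
    signed_signed]
  congr 1
  obtain e | e := zmod_two_cases (c.length : ZMod 2) <;> obtain rfl | rfl := zmod_two_cases p <;>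
    rw [e] <;> rfl

theorem twist_μ (h : A.IsAInf) (q : ZMod 2) (c : Chain A.Hom X Y) :
    A.twist q (A.μ c) = signed q (A.μ (c.map id (A.twist q))) := by
  obtain rfl | rfl := zmod_two_cases q
  · have : ∀ {X Y : A.Ob} (c : Chain A.Hom X Y), c.map id (A.twist 0) = c := by
      intro X Y c
      induction c with
      | nil => rfl
      | cons a c ih => simp only [Chain.map, ih]; rfl
    rw [this]; rfl
  · exact h.redSgn_μ c

/-- The differential. -/
theorem d_d (h : A.IsAInf) (a : A.Hom X Y) : A.μ (.single (A.μ (.single a))) = 0 := by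
  have := h.relation (.single a)
  have z := h.multilin.zero (Y := Y) (.cons (A.redSgn a) (.nil _)) (.nil _)
  simp only [Chain.single, insertSum_cons, insertSum_nil, headSum, h.μ_nil,
    Chain.splitSum_cons, Chain.splitSum_nil, Chain.nil_append, Chain.cons_append,
    h.multilin.zero'] at this z ⊢
  simpa [z] using this

theorem d_pair (h : A.IsAInf) (a : A.Hom X Y) (b : A.Hom Y Z) :
    A.μ (.single (A.μ (.pair a b))) =
      -A.μ (.pair (A.μ (.single a)) b) - A.μ (.pair (A.redSgn a) (A.μ (.single b))) := by
  have := h.relation (.pair a b)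
  have z1 := h.multilin.zero (Y := Z) (.cons (A.redSgn a) (.nil _)) (.single b)
  have z2 := h.multilin.zero (Y := Z) (.cons (A.redSgn a) (.single (A.redSgn b))) (.nil _)
  simp only [Chain.single, Chain.pair, insertSum_cons, insertSum_nil, headSum, h.μ_nil,
    Chain.splitSum_cons, Chain.splitSum_nil, Chain.nil_append, Chain.cons_append,
    h.multilin.zero'] at this z1 z2 ⊢
  rw [z1, z2] at this
  rw [← sub_eq_zero, ← this]
  abel

theorem relation_three (h : A.IsAInf) (a : A.Hom X Y) (b : A.Hom Y Z) (c : A.Hom Z W) :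
    A.μ (.pair (A.μ (.pair a b)) c) + A.μ (.pair (A.redSgn a) (A.μ (.pair b c))) +
      (A.μ (.single (A.μ (.cons a (.pair b c)))) + A.μ (.cons (A.μ (.single a)) (.pair b c)) +
      A.μ (.cons (A.redSgn a) (.pair (A.μ (.single b)) c)) +
      A.μ (.cons (A.redSgn a) (.pair (A.redSgn b) (A.μ (.single c))))) = 0 := by
  have := h.relation (.cons a (.pair b c))
  have z1 := h.multilin.zero (Y := W) (.cons (A.redSgn a) (.nil _)) (.pair b c)
  have z2 := h.multilin.zero (Y := W) (.cons (A.redSgn a) (.single (A.redSgn b))) (.single c)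
  have z3 := h.multilin.zero (Y := W)
    (.cons (A.redSgn a) (.cons (A.redSgn b) (.single (A.redSgn c)))) (.nil _)
  simp only [Chain.single, Chain.pair, insertSum_cons, insertSum_nil, headSum, h.μ_nil,
    Chain.splitSum_cons, Chain.splitSum_nil, Chain.nil_append, Chain.cons_append,
    h.multilin.zero'] at this z1 z2 z3 ⊢
  rw [z1, z2, z3] at this
  rw [← this]
  abel

end IsAInf

end AInfData

/-! ### Sums over the components of a sequence with inserted differentials -/

theorem List.sum_map_range_eq {M : Type*} [AddCommMonoid M] (f : ℕ → M) (r : ℕ) :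
    ((List.range r).map f).sum = ∑ i ∈ Finset.range r, f i := by
  induction r with
  | zero => rfl
  | succ r ih => simp [List.range_succ, Finset.sum_range_succ, ih]

theorem List.sum_map_finset_sum {M ι α : Type*} [AddCommMonoid M] (l : List α) (s : Finset ι)
    (f : ι → α → M) : (l.map fun a => ∑ i ∈ s, f i a).sum = ∑ i ∈ s, (l.map (f i)).sum := by
  induction l with
  | nil => simp
  | cons a l ih => simp [ih, Finset.sum_add_distrib]

theorem List.sum_map_flatMap {M α β : Type*} [AddCommMonoid M] (l : List α) (g : α → List β)
    (f : β → M) : ((l.flatMap g).map f).sum = (l.map fun a => ((g a).map f).sum).sum := by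
  induction l with
  | nil => rfl
  | cons a l ih => simp [ih]

namespace AInfData

variable {k : Type u} [Field k] {A : AInfData.{u, v, w} k} {M : Type*} [AddCommGroup M]

variable (A) in
/-- Sequences of morphisms of twisted complexes. -/
abbrev TwChain (X Y : A.TwOb) := Chain (fun X Y : A.TwOb => Fam.Hom X.1.toFam Y.1.toFam) X Y

/-- Functions which vanish on the sequences with a zero entry. -/
def KillsZero {X Y : A.Ob} (Φ : Chain A.Hom X Y → M) : Prop :=
  ∀ (Z W : A.Ob) (p : Chain A.Hom X Z) (q : Chain A.Hom W Y),
    Φ (p.append (.cons (0 : A.Hom Z W) q)) = 0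

theorem KillsZero.cons {X Y Z : A.Ob} {Φ : Chain A.Hom X Y → M} (h : KillsZero Φ)
    (a : A.Hom X Z) : KillsZero fun c => Φ (.cons a c) :=
  fun _ _ p => h _ _ (.cons a p)

theorem KillsZero.zero' {X Y Z : A.Ob} {Φ : Chain A.Hom X Y → M} (h : KillsZero Φ)
    (q : Chain A.Hom Z Y) : Φ (.cons 0 q) = 0 := h _ _ (.nil _) q

theorem Multilin.killsZero [Module k M] {X Y : A.Ob} {Φ : Chain A.Hom X Y → M}
    (h : A.Multilin Φ) : KillsZero Φ := fun _ _ p q => h.zero p q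

namespace Fam

/-- The sum of a function over the components of a sequence of matrices. -/
def expandSum (σ : ZMod 2) {X Y : A.Fam} (c : Chain Hom X Y) (x : Fin X.N) (y : Fin Y.N)
    (Φ : Chain A.Hom (X.obj x) (Y.obj y) → M) : M :=
  ((expand σ c x y).map Φ).sum

theorem expandSum_cons (σ : ZMod 2) {X Y Z : A.Fam} (a : Hom X Z) (c : Chain Hom Z Y)
    (x : Fin X.N) (y : Fin Y.N) (Φ : Chain A.Hom (X.obj x) (Y.obj y) → M) :
    expandSum σ (.cons a c) x y Φ =
      ∑ z, expandSum σ c z y fun e => Φ (.cons (A.twist (X.shift x - σ) (a x z)) e) := by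
  rw [expandSum, expand, List.sum_map_flatMap, ← Fin.sum_univ_def]
  simp only [List.map_map]
  rfl

theorem expandSum_zero (σ : ZMod 2) {X Y : A.Fam} (c : Chain Hom X Y) (x : Fin X.N)
    (y : Fin Y.N) : expandSum σ c x y (fun _ => (0 : M)) = 0 := by
  simp [expandSum]

theorem expandSum_rep_append (σ : ZMod 2) {X Y : A.Fam} (δ : Hom X X)
    (hδ : ∀ x y : Fin X.N, ¬ x < y → δ x y = 0) (c : Chain Hom X Y) (r : ℕ) (x : Fin X.N)
    (y : Fin Y.N) (hr : X.N ≤ r + x) {Φ : Chain A.Hom (X.obj x) (Y.obj y) → M}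
    (hΦ : KillsZero Φ) : expandSum σ ((Chain.rep δ r).append c) x y Φ = 0 := by
  induction r generalizing x with
  | zero => have := x.2; omega
  | succ r ih =>
    rw [Chain.rep, Chain.cons_append, expandSum_cons]
    refine Finset.sum_eq_zero fun z _ => ?_
    by_cases hz : x < z
    · exact ih z (by have : x.val < z.val := hz; omega) (hΦ.cons _)
    · simp only [hδ x z hz, twist_zero, hΦ.zero', expandSum_zero]

end Fam

/-- The sum of a function over the components of the sequences obtained by inserting differentials. -/
def twSum (σ : ZMod 2) {X Y : A.TwOb} (c : A.TwChain X Y) (x : Fin X.1.N) (y : Fin Y.1.N)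
    (Φ : Chain A.Hom (X.1.obj x) (Y.1.obj y) → M) : M :=
  ((TwOb.insertions c).map fun e => Fam.expandSum σ e x y Φ).sum

theorem tw_μ {X Y : A.TwOb} (c : A.TwChain X Y) (x : Fin X.1.N) (y : Fin Y.1.N) :
    (A.tw.μ c : Fam.Hom X.1.toFam Y.1.toFam) x y = twSum (X.1.shift x) c x y A.μ := by
  have e := map_list_sum ((Pi.evalAddMonoidHom _ y).comp
    (Pi.evalAddMonoidHom (fun x => ∀ y, A.Hom (X.1.obj x) (Y.1.obj y)) x))
    ((TwOb.insertions c).map Fam.μ)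
  rw [List.map_map] at e
  exact e

theorem twSum_nil (σ : ZMod 2) (X : A.TwOb) (x y : Fin X.1.N)
    {Φ : Chain A.Hom (X.1.obj x) (X.1.obj y) → M} (hΦ : KillsZero Φ) :
    twSum σ (.nil X) x y Φ = (if h : x = y then Φ (h ▸ .nil (X.1.obj x)) else 0) +
      ∑ z ∈ Finset.Ioi x, twSum σ (.nil X) z y
        fun e => Φ (.cons (A.twist (X.1.shift x - σ) (X.1.δ x z)) e) := by
  simp only [twSum, TwOb.insertions, List.map_map]
  rw [List.sum_map_range_eq, Finset.sum_range_succ', add_comm]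
  congr 1
  · simp only [Function.comp, Chain.rep, Fam.expandSum, Fam.expand]
    split_ifs <;> simp
  · simp only [Function.comp, Chain.rep, Fam.expandSum_cons, List.sum_map_range_eq]
    rw [Finset.sum_comm, ← Finset.sum_subset (Finset.subset_univ (Finset.Ioi x))]
    · refine Finset.sum_congr rfl fun z hz => ?_
      rw [Finset.sum_range_succ, ← Chain.append_nil (Chain.rep X.1.δ X.1.N),
        Fam.expandSum_rep_append σ _ X.2.triangular _ _ _ _ (by omega) (hΦ.cons _), add_zero]
    · intro z _ hz
      simp only [X.2.triangular x z (by simpa using hz), twist_zero, hΦ.zero',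
        Fam.expandSum_zero, Finset.sum_const_zero]

theorem twSum_cons (σ : ZMod 2) {X Y Z : A.TwOb} (a : Fam.Hom X.1.toFam Z.1.toFam)
    (c : A.TwChain Z Y) (x : Fin X.1.N) (y : Fin Y.1.N)
    {Φ : Chain A.Hom (X.1.obj x) (Y.1.obj y) → M} (hΦ : KillsZero Φ) :
    twSum σ (.cons a c) x y Φ =
      ∑ z, twSum σ c z y (fun e => Φ (.cons (A.twist (X.1.shift x - σ) (a x z)) e)) +
      ∑ z ∈ Finset.Ioi x, twSum σ (.cons a c) z y
        fun e => Φ (.cons (A.twist (X.1.shift x - σ) (X.1.δ x z)) e) := by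
  have e : ∀ (x : Fin X.1.N) (Φ : Chain A.Hom (X.1.obj x) (Y.1.obj y) → M),
      twSum σ (.cons a c) x y Φ = ∑ r ∈ Finset.range (X.1.N + 1),
        ((TwOb.insertions c).map fun q =>
          Fam.expandSum σ ((Chain.rep X.1.δ r).append (.cons a q)) x y Φ).sum := by
    intro x Φ
    rw [twSum, TwOb.insertions, List.sum_map_flatMap, List.sum_map_range_eq]
    simp only [List.map_map]
    rfl
  rw [e, Finset.sum_range_succ', add_comm]
  simp only [e]
  congr 1
  · simp only [Chain.rep, Chain.nil_append, Fam.expandSum_cons, List.sum_map_finset_sum]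
    rfl
  · simp only [Chain.rep, Chain.cons_append, Fam.expandSum_cons, List.sum_map_finset_sum]
    rw [Finset.sum_comm, ← Finset.sum_subset (Finset.subset_univ (Finset.Ioi x))]
    · refine Finset.sum_congr rfl fun z hz => ?_
      rw [Finset.sum_range_succ]
      refine (add_eq_left.2 ?_).symm
      refine List.sum_eq_zero fun m hm => ?_
      obtain ⟨q, -, rfl⟩ := List.mem_map.1 hm
      exact Fam.expandSum_rep_append σ _ X.2.triangular _ _ _ _ (by omega) (hΦ.cons _)
    · intro z _ hz
      simp only [X.2.triangular x z (by simpa using hz), twist_zero, hΦ.zero',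
        Fam.expandSum_zero]
      simp

/-- Induction over sequences of morphisms of twisted complexes, and downwards over the indices of
the source. -/
theorem TwOb.induction {motive : ∀ {X Y : A.TwOb}, A.TwChain X Y → Fin X.1.N → Prop}
    (nil : ∀ (X : A.TwOb) (x), (∀ z, x < z → motive (.nil X) z) → motive (.nil X) x)
    (cons : ∀ {X Y Z : A.TwOb} (a : Fam.Hom X.1.toFam Z.1.toFam) (p : A.TwChain Z Y) (x),
      (∀ z, motive p z) → (∀ z, x < z → motive (.cons a p) z) → motive (.cons a p) x)
    {X Y : A.TwOb} (c : A.TwChain X Y) (x : Fin X.1.N) : motive c x := by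
  have down : ∀ {n : ℕ} {P : Fin n → Prop}, (∀ x, (∀ z, x < z → P z) → P x) → ∀ x, P x :=
    fun h x => WellFounded.induction (r := (· > ·)) wellFounded_gt x h
  induction c with
  | nil X => exact down (nil X) x
  | cons a p ih => exact down (fun x h => cons a p x ih h) x

section Linear

variable {X Y : A.TwOb} (σ : ZMod 2) (c : A.TwChain X Y) (x : Fin X.1.N) (y : Fin Y.1.N)

theorem twSum_add (Φ Ψ : Chain A.Hom (X.1.obj x) (Y.1.obj y) → M) :
    twSum σ c x y (fun e => Φ e + Ψ e) = twSum σ c x y Φ + twSum σ c x y Ψ := by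
  simp only [twSum, Fam.expandSum, List.sum_map_add]

theorem map_twSum {N : Type*} [AddCommGroup N] (g : M →+ N)
    (Φ : Chain A.Hom (X.1.obj x) (Y.1.obj y) → M) :
    twSum σ c x y (fun e => g (Φ e)) = g (twSum σ c x y Φ) := by
  simp only [twSum, Fam.expandSum, map_list_sum, List.map_map, Function.comp_def]

theorem twSum_zero : twSum σ c x y (fun _ => (0 : M)) = 0 := by
  simp [twSum, Fam.expandSum]

end Linear

/-! ### Multilinearity -/

theorem twSum_append_smul_add [Module k M] {X Y Z W : A.TwOb} (σ : ZMod 2) (p : A.TwChain X Z)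
    (r : k) (a b : Fam.Hom Z.1.toFam W.1.toFam) (q : A.TwChain W Y) (x : Fin X.1.N)
    (y : Fin Y.1.N) {Φ : Chain A.Hom (X.1.obj x) (Y.1.obj y) → M} (hΦ : A.Multilin Φ) :
    twSum σ (p.append (.cons (r • a + b) q)) x y Φ =
      r • twSum σ (p.append (.cons a q)) x y Φ + twSum σ (p.append (.cons b q)) x y Φ := by
  revert W
  refine TwOb.induction (motive := fun {X Z} p x => ∀ {Φ : Chain A.Hom (X.1.obj x) (Y.1.obj y) → M},
    A.Multilin Φ → ∀ {W : A.TwOb} (a b : Fam.Hom Z.1.toFam W.1.toFam) (q : A.TwChain W Y),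
    twSum σ (p.append (.cons (r • a + b) q)) x y Φ =
      r • twSum σ (p.append (.cons a q)) x y Φ + twSum σ (p.append (.cons b q)) x y Φ)
    ?_ ?_ p x hΦ
  · intro X x ih Φ hΦ W a b q
    have e : ∀ z, twSum σ q z y (fun e => Φ (.cons (A.twist (X.1.shift x - σ) ((r • a + b) x z)) e))
        = r • twSum σ q z y (fun e => Φ (.cons (A.twist (X.1.shift x - σ) (a x z)) e)) +
          twSum σ q z y (fun e => Φ (.cons (A.twist (X.1.shift x - σ) (b x z)) e)) := by
      intro z
      refine Eq.trans ?_ (congrArg (· + _) (map_twSum σ q z y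
        (DistribSMul.toAddMonoidHom M r) _))
      rw [← twSum_add]
      congr 1
      funext e
      simp only [Pi.add_apply, Pi.smul_apply, twist_add, twist_smul, hΦ.add', hΦ.smul',
        DistribSMul.toAddMonoidHom_apply]
    have e2 := Finset.sum_congr rfl fun z (hz : z ∈ Finset.Ioi x) =>
      ih z (Finset.mem_Ioi.1 hz) (hΦ.cons (A.twist (X.1.shift x - σ) (X.1.δ x z))) a b q
    simp only [Chain.nil_append] at e2 ⊢
    simp only [twSum_cons σ _ _ _ _ hΦ.killsZero, e, e2, Finset.sum_add_distrib, ← Finset.smul_sum,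
      smul_add]
    abel
  · intro X V Z c p x ih ih2 Φ hΦ W a b q
    have e := fun z => ih z (hΦ.cons (A.twist (X.1.shift x - σ) (c x z))) a b q
    have e2 := Finset.sum_congr rfl fun z (hz : z ∈ Finset.Ioi x) =>
      ih2 z (Finset.mem_Ioi.1 hz) (hΦ.cons (A.twist (X.1.shift x - σ) (X.1.δ x z))) a b q
    simp only [Chain.cons_append] at e2 ⊢
    simp only [twSum_cons σ _ _ _ _ hΦ.killsZero, e, e2, Finset.sum_add_distrib, ← Finset.smul_sum,
      smul_add]
    abel

/-! ### Cutting -/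

theorem splitSum_killsZero {X Y : A.Ob} {Ψ : ∀ Z, Chain A.Hom X Z → Chain A.Hom Z Y → M}
    (hl : ∀ Z q, KillsZero fun p => Ψ Z p q) (hr : ∀ Z p, KillsZero (Ψ Z p)) :
    KillsZero fun c => c.splitSum Ψ := by
  intro Z W p q
  induction p with
  | nil X =>
    simp only [Chain.nil_append, Chain.splitSum_cons, (hr _ _).zero', (hl _ _).zero']
    rw [zero_add]
    exact Chain.splitSum_eq_zero fun _ _ _ _ => rfl
  | cons a p ih =>
    simp only [Chain.cons_append, Chain.splitSum_cons]
    refine (congrArg (_ + ·) (ih (fun Z q => (hl Z q).cons a) (fun Z p => hr Z _))).trans ?_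
    rw [add_zero]
    exact hr _ _ _ _ (.cons a p) q

theorem twSum_killsZero {X Y : A.TwOb} {V W : A.Ob} (σ : ZMod 2) (c : A.TwChain X Y)
    (x : Fin X.1.N) (y : Fin Y.1.N)
    {Ψ : Chain A.Hom V W → Chain A.Hom (X.1.obj x) (Y.1.obj y) → M}
    (h : ∀ q, KillsZero fun p => Ψ p q) : KillsZero fun p => twSum σ c x y (Ψ p) := by
  intro Z W p q
  have : Ψ (p.append (.cons 0 q)) = fun _ => 0 := funext fun e => h e _ _ p q
  simp only [this, twSum_zero]

theorem sum_twSum_nil (σ : ZMod 2) (X : A.TwOb) (x : Fin X.1.N)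
    {Θ : ∀ z, Chain A.Hom (X.1.obj x) (X.1.obj z) → M} (hΘ : ∀ z, KillsZero (Θ z)) :
    ∑ z, twSum σ (.nil X) x z (Θ z) = Θ x (.nil _) +
      ∑ w ∈ Finset.Ioi x, ∑ z, twSum σ (.nil X) w z
        fun e => Θ z (.cons (A.twist (X.1.shift x - σ) (X.1.δ x w)) e) := by
  simp only [fun z => twSum_nil σ X x z (hΘ z), Finset.sum_add_distrib]
  rw [Finset.sum_comm, Finset.sum_eq_single x (fun z _ hz => dif_neg hz.symm) (by simp),
    dif_pos rfl]

theorem sum_twSum_cons (σ : ZMod 2) {X Y Z : A.TwOb} (a : Fam.Hom X.1.toFam Z.1.toFam)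
    (t : A.TwChain Z Y) (x : Fin X.1.N)
    {Θ : ∀ z, Chain A.Hom (X.1.obj x) (Y.1.obj z) → M} (hΘ : ∀ z, KillsZero (Θ z)) :
    ∑ z, twSum σ (.cons a t) x z (Θ z) =
      ∑ w, ∑ z, twSum σ t w z (fun e => Θ z (.cons (A.twist (X.1.shift x - σ) (a x w)) e)) +
      ∑ w ∈ Finset.Ioi x, ∑ z, twSum σ (.cons a t) w z
        fun e => Θ z (.cons (A.twist (X.1.shift x - σ) (X.1.δ x w)) e) := by
  simp only [fun z => twSum_cons σ a t x z (hΘ z), Finset.sum_add_distrib]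
  rw [Finset.sum_comm, Finset.sum_comm (s := Finset.univ) (t := Finset.Ioi x)]

theorem twSum_splitSum {X Y : A.TwOb} (σ : ZMod 2) (c : A.TwChain X Y) (x : Fin X.1.N)
    (y : Fin Y.1.N)
    {Ψ : ∀ Z, Chain A.Hom (X.1.obj x) Z → Chain A.Hom Z (Y.1.obj y) → M}
    (hl : ∀ Z q, KillsZero fun p => Ψ Z p q) (hr : ∀ Z p, KillsZero (Ψ Z p)) :
    twSum σ c x y (fun e => e.splitSum Ψ) = c.splitSum fun Z t q =>
      ∑ z, twSum σ t x z fun e => twSum σ q z y (Ψ (Z.1.obj z) e) := by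
  refine TwOb.induction (motive := fun {X Y} c x => ∀ (y : Fin Y.1.N)
    {Ψ : ∀ Z, Chain A.Hom (X.1.obj x) Z → Chain A.Hom Z (Y.1.obj y) → M},
    (∀ Z q, KillsZero fun p => Ψ Z p q) → (∀ Z p, KillsZero (Ψ Z p)) →
    twSum σ c x y (fun e => e.splitSum Ψ) = c.splitSum fun Z t q =>
      ∑ z, twSum σ t x z fun e => twSum σ q z y (Ψ (Z.1.obj z) e)) ?_ ?_ c x y hl hr
  · intro X x ih y Ψ hl hr
    have e2 : ∀ z ∈ Finset.Ioi x, _ := fun z hz =>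
      ih z (Finset.mem_Ioi.1 hz) y (Ψ := fun Z p q => Ψ Z
        (.cons (A.twist (X.1.shift x - σ) (X.1.δ x z)) p) q)
        (fun Z q => (hl Z q).cons _) (fun Z p => hr Z _)
    simp only [Chain.splitSum_nil] at e2 ⊢
    rw [twSum_nil _ _ _ _ (splitSum_killsZero hl hr),
      sum_twSum_nil σ X x fun z => twSum_killsZero σ (.nil X) z y (hl (X.1.obj z)),
      twSum_nil _ _ _ _ (hr _ _)]
    simp only [Chain.splitSum_cons, twSum_add, Finset.sum_add_distrib]
    rw [Finset.sum_congr rfl e2, ← add_assoc]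
    congr 2
    split_ifs with h
    · subst h; simp
    · rfl
  · intro X Z Y a p x ih ih2 y Ψ hl hr
    have e1 := fun z => ih z y (Ψ := fun Z p q => Ψ Z
        (.cons (A.twist (X.1.shift x - σ) (a x z)) p) q)
        (fun Z q => (hl Z q).cons _) (fun Z p => hr Z _)
    have e2 : ∀ z ∈ Finset.Ioi x, _ := fun z hz =>
      ih2 z (Finset.mem_Ioi.1 hz) y (Ψ := fun Z p q => Ψ Z
        (.cons (A.twist (X.1.shift x - σ) (X.1.δ x z)) p) q)
        (fun Z q => (hl Z q).cons _) (fun Z p => hr Z _)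
    rw [twSum_cons _ _ _ _ _ (splitSum_killsZero hl hr), Chain.splitSum_cons,
      sum_twSum_nil σ X x fun z => twSum_killsZero σ (.cons a p) z y (hl (X.1.obj z)),
      twSum_cons _ _ _ _ _ (hr _ _)]
    simp only [fun (W : A.TwOb) (t : A.TwChain _ W) (q : A.TwChain W _) =>
      sum_twSum_cons σ a t x fun z => twSum_killsZero σ q z y (hl (W.1.obj z))]
    simp only [Chain.splitSum_cons, twSum_add, Finset.sum_add_distrib, e1, Chain.splitSum_add,
      Chain.splitSum_sum]
    rw [Finset.sum_congr rfl e2]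
    simp only [Chain.splitSum_cons, Finset.sum_add_distrib]
    abel

end AInfData

namespace AInfData

variable {k : Type u} [Field k] {A : AInfData.{u, v, w} k} {M : Type*} [AddCommGroup M]

/-! ### The quadratic equations for twisted complexes -/

theorem insertSum_zero {X Y : A.Ob} (c : Chain A.Hom X Y) :
    A.insertSum (fun _ => (0 : M)) c = 0 :=
  (map_insertSum (0 : M →+ M) (fun _ => (0 : M)) c).symm

theorem insertSum_nil_eq_headSum {X : A.Ob} (Φ : Chain A.Hom X X → M) :
    A.insertSum Φ (.nil X) = headSum Φ (.nil X) := by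
  rw [insertSum_nil, headSum, Chain.splitSum_nil]

theorem headSum_killsZero [Module k M] (hA : A.IsAInf) {X Y : A.Ob} {Φ : Chain A.Hom X Y → M}
    (hΦ : A.Multilin Φ) : KillsZero (headSum Φ) :=
  splitSum_killsZero
    (fun _ q _ _ p p' => (congrArg (fun a => Φ (.cons a q)) (hA.multilin.zero p p')).trans
      (hΦ.zero' q))
    fun _ p _ _ q q' => hΦ.zero (.cons (A.μ p) q) q'

theorem insertSum_killsZero [Module k M] (hA : A.IsAInf) {X Y : A.Ob}
    {Φ : Chain A.Hom X Y → M} (hΦ : A.Multilin Φ) : KillsZero (A.insertSum Φ) := by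
  intro Z W p q
  induction p with
  | nil X =>
    have e : (fun q => Φ (.cons (A.redSgn (0 : A.Hom X W)) q)) = fun _ => 0 :=
      funext fun q => by rw [redSgn_zero, hΦ.zero']
    rw [Chain.nil_append, insertSum_cons, (headSum_killsZero hA hΦ).zero', e, zero_add]
    exact insertSum_zero q
  | cons a p ih =>
    rw [Chain.cons_append, insertSum_cons, ih (hΦ.cons _), add_zero]
    exact headSum_killsZero hA hΦ _ _ (.cons a p) q

theorem Fam.expandSum_change (σ τ : ZMod 2) {X Y : A.Fam} (c : Chain Fam.Hom X Y)
    (x : Fin X.N) (y : Fin Y.N) (Φ : Chain A.Hom (X.obj x) (Y.obj y) → M) :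
    expandSum σ c x y Φ = expandSum τ c x y fun e => Φ (e.map id (A.twist (τ - σ))) := by
  induction c with
  | nil X =>
    simp only [expandSum, expand]
    split_ifs with h
    · subst h; rfl
    · rfl
  | cons a c ih =>
    simp only [expandSum_cons]
    refine Finset.sum_congr rfl fun z _ => (ih z y _).trans ?_
    congr 1
    funext e
    simp only [Chain.map]
    rw [twist_twist]
    congr 3
    abel

theorem twSum_change (σ τ : ZMod 2) {X Y : A.TwOb} (c : A.TwChain X Y)
    (x : Fin X.1.N) (y : Fin Y.1.N) (Φ : Chain A.Hom (X.1.obj x) (Y.1.obj y) → M) :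
    twSum σ c x y Φ = twSum τ c x y fun e => Φ (e.map id (A.twist (τ - σ))) := by
  simp only [twSum]
  congr 2
  funext e
  exact Fam.expandSum_change σ τ e x y Φ

theorem twSum_comp_μ (hA : A.IsAInf) (σ : ZMod 2) {X Y : A.TwOb} (c : A.TwChain X Y)
    (x : Fin X.1.N) (y : Fin Y.1.N) (g : A.Hom (X.1.obj x) (Y.1.obj y) →+ M) :
    twSum σ c x y (fun e => g (A.μ e)) = signed (X.1.shift x - σ)
      (g (A.twist (X.1.shift x - σ) ((A.tw.μ c : Fam.Hom X.1.toFam Y.1.toFam) x y))) := by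
  rw [tw_μ, twSum_change σ (X.1.shift x)]
  have e : ∀ e : Chain A.Hom (X.1.obj x) (Y.1.obj y),
      g (A.μ (e.map id (A.twist (X.1.shift x - σ)))) = (g.comp
        (AddMonoidHom.mk' (fun a => signed (X.1.shift x - σ) (A.twist (X.1.shift x - σ) a))
          fun a b => by rw [twist_add, signed_add])) (A.μ e) := by
    intro e
    simp only [AddMonoidHom.comp_apply, AddMonoidHom.mk'_apply, hA.twist_μ, signed_signed,
      CharTwo.add_self_eq_zero]
    rfl
  simp only [e]
  rw [map_twSum]
  simp only [AddMonoidHom.comp_apply, AddMonoidHom.mk'_apply, map_signed]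

/-- A multilinear function of sequences as an additive function of the first entry, summed over
the components of the rest. -/
def Multilin.headHom [Module k M] {X : A.Ob} {Z Y : A.TwOb} (σ : ZMod 2) (q : A.TwChain Z Y)
    (z : Fin Z.1.N) (y : Fin Y.1.N) {Φ : Chain A.Hom X (Y.1.obj y) → M} (hΦ : A.Multilin Φ) :
    A.Hom X (Z.1.obj z) →+ M :=
  AddMonoidHom.mk' (fun a => twSum σ q z y fun e => Φ (.cons a e)) fun a b => by
    simp only [hΦ.add', twSum_add]

theorem tw_redSgn_apply {X Y : A.tw.Ob} (a : A.tw.Hom X Y) (x : Fin X.1.N) (y : Fin Y.1.N) :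
    (A.tw.redSgn a : Fam.Hom X.1.toFam Y.1.toFam) x y =
      signed (Y.1.shift y - X.1.shift x) (A.redSgn (a x y)) := by
  change A.proj (1 + X.1.shift x - Y.1.shift y) (a x y) -
    A.proj (0 + X.1.shift x - Y.1.shift y) (a x y) = _
  have e : X.1.shift x - Y.1.shift y = Y.1.shift y - X.1.shift x := by
    rw [CharTwo.sub_eq_add, CharTwo.sub_eq_add, add_comm]
  rw [add_sub_assoc, add_sub_assoc, e]
  obtain h | h := zmod_two_cases (Y.1.shift y - X.1.shift x) <;> rw [h]
  · rfl
  · rw [signed_one, show (1 + 1 : ZMod 2) = 0 from rfl, redSgn, neg_sub, zero_add]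

theorem redSgn_twist (p : ZMod 2) {X Y : A.Ob} (a : A.Hom X Y) :
    A.redSgn (A.twist p a) = A.twist p (A.redSgn a) := by
  rw [← twist_one, ← twist_one, twist_twist, twist_twist, add_comm]

theorem twist_signed (p r : ZMod 2) {X Y : A.Ob} (a : A.Hom X Y) :
    A.twist p (signed r a) = signed r (A.twist p a) := by
  unfold signed; split_ifs
  exacts [rfl, twist_neg p a]

theorem redSgn_δ (X : A.TwOb) (x y : Fin X.1.N) :
    A.redSgn (X.1.δ x y) = signed (X.1.shift y - X.1.shift x) (X.1.δ x y) := by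
  have h : A.IsHomog (1 + X.1.shift x - X.1.shift y) (X.1.δ x y) :=
    congrFun (congrFun X.2.deg x) y
  rw [← twist_one, h.twist_eq]
  congr 1
  obtain e | e := zmod_two_cases (X.1.shift x) <;> obtain e' | e' := zmod_two_cases (X.1.shift y) <;>
    rw [e, e'] <;> rfl

theorem twSum_headSum [Module k M] (hA : A.IsAInf) (σ : ZMod 2) {X Y : A.TwOb}
    (c : A.TwChain X Y) (x : Fin X.1.N) (y : Fin Y.1.N)
    {Φ : Chain A.Hom (X.1.obj x) (Y.1.obj y) → M} (hΦ : A.Multilin Φ) :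
    twSum σ c x y (headSum Φ) = signed (X.1.shift x - σ) (c.splitSum fun _ t q =>
      ∑ z, twSum σ q z y fun e => Φ (.cons (A.twist (X.1.shift x - σ)
        ((A.tw.μ t : Fam.Hom X.1.toFam _) x z)) e)) := by
  refine (twSum_splitSum σ c x y
    (fun _ q _ _ p p' => (congrArg (fun a => Φ (.cons a q)) (hA.multilin.zero p p')).trans
      (hΦ.zero' q))
    fun _ p _ _ q q' => hΦ.zero (.cons (A.μ p) q) q').trans ?_
  refine Eq.trans ?_ (Chain.map_splitSum (AddMonoidHom.mk' (signed (M := M) (X.1.shift x - σ))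
    fun a b => signed_add _ a b) _ c).symm
  congr 1
  funext Z t q
  refine Eq.trans ?_ (signed_sum _ _ _).symm
  exact Finset.sum_congr rfl fun z _ => twSum_comp_μ hA σ t x z (hΦ.headHom σ q z y)

/-- The summand of the quadratic relation for twisted complexes in which the inner operation comes
first. -/
theorem tw_headSum [Module k M] (σ : ZMod 2) {X Y : A.TwOb}
    (c : A.TwChain X Y) (x : Fin X.1.N) (y : Fin Y.1.N)
    {Φ : Chain A.Hom (X.1.obj x) (Y.1.obj y) → M} (hΦ : A.Multilin Φ) :
    headSum (A := A.tw) (X := X) (Y := Y) (fun e => twSum σ e x y Φ) c =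
      (c.splitSum fun _ t q => ∑ z, twSum σ q z y fun e => Φ (.cons (A.twist (X.1.shift x - σ)
        ((A.tw.μ t : Fam.Hom X.1.toFam _) x z)) e)) +
      ∑ z ∈ Finset.Ioi x, headSum (A := A.tw) (X := X) (Y := Y) (fun e => twSum σ e z y
        fun e => Φ (.cons (A.twist (X.1.shift x - σ) (X.1.δ x z)) e)) c := by
  refine Eq.trans ?_ (congrArg (_ + ·) (headSum_sum _ _ _))
  refine Eq.trans ?_ (Chain.splitSum_add _ _ _)
  exact Chain.splitSum_congr fun Z t q _ => twSum_cons σ _ q x y hΦ.killsZero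

theorem tw_insertSum_signed [Module k M] {X : A.Ob} {Z Y : A.TwOb} (σ r : ZMod 2)
    (c : A.TwChain Z Y) (z : Fin Z.1.N) (y : Fin Y.1.N) (b : A.Hom X (Z.1.obj z))
    {Φ : Chain A.Hom X (Y.1.obj y) → M} (hΦ : A.Multilin Φ) :
    A.tw.insertSum (X := Z) (Y := Y)
      (fun e => twSum σ e z y fun e => Φ (.cons (signed r b) e)) c =
    signed r (A.tw.insertSum (X := Z) (Y := Y)
      (fun e => twSum σ e z y fun e => Φ (.cons b e)) c) := by
  refine Eq.trans ?_ (map_insertSum (A := A.tw) (AddMonoidHom.mk' (signed (M := M) r)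
    fun a b => signed_add _ a b) _ _).symm
  refine congrArg (fun F => A.tw.insertSum (X := Z) (Y := Y) F c) (funext fun e => ?_)
  exact map_signed (hΦ.headHom σ e z y) r b

theorem add_sub_sub_eq (p q r : ZMod 2) : p - q + (p - r) = r - q := by
  have : (2 : ZMod 2) = 0 := rfl
  linear_combination (p - r) * this

theorem twSum_insertSum [Module k M] (hA : A.IsAInf) (σ : ZMod 2) {X Y : A.TwOb}
    (c : A.TwChain X Y) (x : Fin X.1.N) (y : Fin Y.1.N)
    {Φ : Chain A.Hom (X.1.obj x) (Y.1.obj y) → M} (hΦ : A.Multilin Φ) :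
    twSum σ c x y (A.insertSum Φ) = signed (X.1.shift x - σ)
      (A.tw.insertSum (X := X) (Y := Y) (fun e => twSum σ e x y Φ) c) := by
  refine TwOb.induction (motive := fun {X Y} c x => ∀ (y : Fin Y.1.N)
    {Φ : Chain A.Hom (X.1.obj x) (Y.1.obj y) → M}, A.Multilin Φ →
    twSum σ c x y (A.insertSum Φ) = signed (X.1.shift x - σ)
      (A.tw.insertSum (X := X) (Y := Y) (fun e => twSum σ e x y Φ) c)) ?_ ?_ c x y hΦ
  · intro X x ih y Φ hΦ
    have hδ : ∀ z ∈ Finset.Ioi x, twSum σ (.nil X) z y (A.insertSum fun e =>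
        Φ (.cons (A.redSgn (A.twist (X.1.shift x - σ) (X.1.δ x z))) e)) =
        signed (X.1.shift x - σ) (A.tw.insertSum (X := X) (Y := X) (fun e => twSum σ e z y fun e =>
          Φ (.cons (A.twist (X.1.shift x - σ) (X.1.δ x z)) e)) (.nil X)) := by
      intro z hz
      rw [ih z (Finset.mem_Ioi.1 hz) y (hΦ.cons _), redSgn_twist, redSgn_δ, twist_signed,
        tw_insertSum_signed σ _ _ _ _ _ hΦ, signed_signed, add_sub_sub_eq]
      rfl
    have h1 := twSum_headSum hA σ (.nil X) x y hΦ
    have h2 := tw_headSum σ (.nil X) x y hΦ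
    rw [twSum_nil _ _ _ _ (headSum_killsZero hA hΦ)] at h1
    rw [twSum_nil _ _ _ _ (insertSum_killsZero hA hΦ)]
    simp only [insertSum_cons, twSum_add, Finset.sum_add_distrib]
    rw [Finset.sum_congr rfl hδ, ← signed_sum, ← add_assoc]
    have h3 : (if h : x = y then A.insertSum Φ (h ▸ .nil (X.1.obj x)) else 0) =
        if h : x = y then headSum Φ (h ▸ .nil (X.1.obj x)) else 0 := by
      split_ifs with h
      · subst h; exact insertSum_nil_eq_headSum Φ
      · rfl
    rw [h3, h1, ← signed_add]
    congr 1
    refine Eq.trans ?_ (h2.symm.trans (insertSum_nil_eq_headSum (A := A.tw) (X := X) _).symm)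
    exact congrArg (_ + ·) (Finset.sum_congr rfl fun z _ =>
      insertSum_nil_eq_headSum (A := A.tw) (X := X) _)
  · intro X Y Z a p x ih ih2 y Φ hΦ
    have hδ : ∀ z ∈ Finset.Ioi x, twSum σ (.cons a p) z y (A.insertSum fun e =>
        Φ (.cons (A.redSgn (A.twist (X.1.shift x - σ) (X.1.δ x z))) e)) =
        signed (X.1.shift x - σ) (A.tw.insertSum (X := X) (Y := Y) (fun e => twSum σ e z y fun e =>
          Φ (.cons (A.twist (X.1.shift x - σ) (X.1.δ x z)) e)) (.cons a p)) := by
      intro z hz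
      rw [ih2 z (Finset.mem_Ioi.1 hz) y (hΦ.cons _), redSgn_twist, redSgn_δ, twist_signed,
        tw_insertSum_signed σ _ _ _ _ _ hΦ, signed_signed, add_sub_sub_eq]
      rfl
    have ha : ∀ z, twSum σ p z y (A.insertSum fun e =>
        Φ (.cons (A.redSgn (A.twist (X.1.shift x - σ) (a x z))) e)) =
        signed (X.1.shift x - σ) (A.tw.insertSum (X := Z) (Y := Y) (fun e => twSum σ e z y fun e =>
          Φ (.cons (A.twist (X.1.shift x - σ)
            (signed (Z.1.shift z - X.1.shift x) (A.redSgn (a x z)))) e)) p) := by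
      intro z
      rw [ih z y (hΦ.cons _), redSgn_twist, twist_signed,
        tw_insertSum_signed σ _ _ _ _ _ hΦ, signed_signed]
      congr 1
      abel
    have hr : (fun q => twSum σ (.cons (A.tw.redSgn (X := X) (Y := Z) a) q) x y Φ) = fun q =>
        ∑ z, twSum σ q z y (fun e => Φ (.cons (A.twist (X.1.shift x - σ)
            (signed (Z.1.shift z - X.1.shift x) (A.redSgn (a x z)))) e)) +
        ∑ z ∈ Finset.Ioi x, twSum σ (.cons (A.tw.redSgn (X := X) (Y := Z) a) q) z y fun e =>
          Φ (.cons (A.twist (X.1.shift x - σ) (X.1.δ x z)) e) := by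
      funext q
      refine (twSum_cons σ _ q x y hΦ.killsZero).trans (congrArg (· + _) ?_)
      refine Finset.sum_congr rfl fun z _ => ?_
      congr 1
      funext e
      rw [← tw_redSgn_apply (X := X) (Y := Z) a x z]
    rw [twSum_cons _ _ _ _ _ (insertSum_killsZero hA hΦ)]
    simp only [insertSum_cons, twSum_add, Finset.sum_add_distrib]
    rw [Finset.sum_congr rfl hδ, Finset.sum_congr rfl fun z _ => ha z, add_add_add_comm,
      ← twSum_cons _ _ _ _ _ (headSum_killsZero hA hΦ), twSum_headSum hA _ _ _ _ hΦ,
      ← signed_sum, ← signed_sum, ← signed_add, ← signed_add]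
    congr 1
    refine Eq.trans ?_ (insertSum_cons (A := A.tw) (X := X) (Y := Y) _ a p).symm
    refine Eq.trans ?_ (congrArg₂ (· + ·) (tw_headSum σ (.cons a p) x y hΦ)
      (congrArg (fun F => A.tw.insertSum (X := Z) (Y := Y) F p) hr)).symm
    refine Eq.trans ?_ (congrArg (_ + ·) ((insertSum_add (A := A.tw) _ _ _).trans
      (congrArg₂ (· + ·) (insertSum_sum (A := A.tw) _ _ _) (insertSum_sum (A := A.tw) _ _ _)))).symm
    refine Eq.trans (congrArg (_ + ·) (congrArg (_ + ·) (Finset.sum_congr rfl fun z _ =>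
      insertSum_cons (A := A.tw) (X := X) (Y := Y) _ a p))) ?_
    rw [Finset.sum_add_distrib]
    have shuffle : ∀ a b c d : M, a + (b + (c + d)) = a + c + (b + d) := fun a b c d => by abel
    exact shuffle _ _ _ _

/-! ### Degrees -/

theorem twSum_mem_of_homog (σ : ZMod 2) {X Y : A.TwOb}
    (c : A.TwChain X Y) (x : Fin X.1.N) (y : Fin Y.1.N) (H : AddSubgroup M) (p : ZMod 2)
    (hc : A.tw.ChainHomog (X := X) (Y := Y) c p)
    {Φ : Chain A.Hom (X.1.obj x) (Y.1.obj y) → M} (hΦ : KillsZero Φ)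
    (h : ∀ e p', A.ChainHomog e p' →
      p' - (e.length : ZMod 2) = p - (c.length : ZMod 2) + X.1.shift x - Y.1.shift y → Φ e ∈ H) :
    twSum σ c x y Φ ∈ H := by
  refine TwOb.induction (motive := fun {X Y} c x => ∀ (y : Fin Y.1.N) (p : ZMod 2)
    {Φ : Chain A.Hom (X.1.obj x) (Y.1.obj y) → M}, A.tw.ChainHomog (X := X) (Y := Y) c p →
    KillsZero Φ → (∀ e p', A.ChainHomog e p' →
      p' - (e.length : ZMod 2) = p - (c.length : ZMod 2) + X.1.shift x - Y.1.shift y → Φ e ∈ H) →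
    twSum σ c x y Φ ∈ H) ?_ ?_ c x y p hc hΦ h
  · intro X x ih y p Φ hp hΦ h
    obtain rfl : p = 0 := hp
    rw [twSum_nil _ _ _ _ hΦ]
    refine H.add_mem ?_ (H.sum_mem fun z hz => ?_)
    · split_ifs with hxy
      · subst hxy
        exact h _ 0 rfl (by simp)
      · exact H.zero_mem
    · refine ih z (Finset.mem_Ioi.1 hz) y 0 rfl (hΦ.cons _) fun e p' he hp' => ?_
      have hδ : A.IsHomog (1 + X.1.shift x - X.1.shift z) (X.1.δ x z) :=
        congrFun (congrFun X.2.deg x) z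
      refine h _ _ ⟨_, p', hδ.twist _, he, rfl⟩ ?_
      simp only [Chain.length_cons, Nat.cast_add, Nat.cast_one]
      linear_combination hp'
  · intro X Y Z a c x ih ih2 y p Φ hp hΦ h
    obtain ⟨q, r, hq, hr, rfl⟩ := hp
    rw [twSum_cons _ _ _ _ _ hΦ]
    refine H.add_mem (H.sum_mem fun z _ => ?_) (H.sum_mem fun z hz => ?_)
    · refine ih z y r hr (hΦ.cons _) fun e p' he hp' => ?_
      have ha : A.IsHomog (q + X.1.shift x - Z.1.shift z) (a x z) :=
        congrFun (congrFun hq x) z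
      refine h _ _ ⟨_, p', ha.twist _, he, rfl⟩ ?_
      simp only [Chain.length_cons, Nat.cast_add, Nat.cast_one]
      linear_combination hp'
    · refine ih2 z (Finset.mem_Ioi.1 hz) y _ ⟨q, r, hq, hr, rfl⟩ (hΦ.cons _) fun e p' he hp' => ?_
      have hδ : A.IsHomog (1 + X.1.shift x - X.1.shift z) (X.1.δ x z) :=
        congrFun (congrFun X.2.deg x) z
      refine h _ _ ⟨_, p', hδ.twist _, he, rfl⟩ ?_
      simp only [Chain.length_cons, Nat.cast_add, Nat.cast_one] at hp' ⊢
      linear_combination hp'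

/-! ### Functions which vanish on long sequences -/

theorem twSum_eq_zero_of_length (σ : ZMod 2) {X Y : A.TwOb} (c : A.TwChain X Y)
    (x : Fin X.1.N) (y : Fin Y.1.N) {Φ : Chain A.Hom (X.1.obj x) (Y.1.obj y) → M}
    (h : ∀ e, c.length ≤ e.length → Φ e = 0) : twSum σ c x y Φ = 0 := by
  have h1 : ∀ {X Y : A.Fam} (c : Chain Fam.Hom X Y) (x : Fin X.N) (y : Fin Y.N)
      {Φ : Chain A.Hom (X.obj x) (Y.obj y) → M}, (∀ e, c.length ≤ e.length → Φ e = 0) →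
      Fam.expandSum σ c x y Φ = 0 := by
    intro X Y c
    induction c with
    | nil X =>
      intro x y Φ h
      rw [Fam.expandSum, Fam.expand]
      split_ifs with hxy
      · simpa using h _ (Nat.zero_le _)
      · rfl
    | cons a c ih =>
      intro x y Φ h
      rw [Fam.expandSum_cons]
      exact Finset.sum_eq_zero fun z _ => ih z y fun e he => h _ (by simpa using he)
  have h2 : ∀ {X Y : A.TwOb} (c : A.TwChain X Y), ∀ e ∈ TwOb.insertions c,
      c.length ≤ e.length := by
    intro X Y c
    induction c with
    | nil X => simp
    | cons a c ih =>
      intro e he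
      simp only [TwOb.insertions, List.mem_flatMap, List.mem_map] at he
      obtain ⟨r, -, q, hq, rfl⟩ := he
      have := ih q hq
      simp only [Chain.length_cons, Chain.length_append]
      omega
  refine List.sum_eq_zero fun m hm => ?_
  obtain ⟨e, he, rfl⟩ := List.mem_map.1 hm
  exact h1 e x y fun e' he' => h e' ((h2 c e he).trans he')

end AInfData

namespace AInfData

variable {k : Type u} [Field k] {A : AInfData.{u, v, w} k} {M : Type*} [AddCommGroup M]

/-! ### Units -/

theorem Fam.one_self (X : A.Fam) (x : Fin X.N) : Fam.one X x x = A.one (X.obj x) := by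
  simp [Fam.one]

theorem Fam.one_ne (X : A.Fam) {x y : Fin X.N} (h : x ≠ y) : Fam.one X x y = 0 := by
  simp [Fam.one, h]

/-- The contribution of an identity morphism at the beginning of a sequence. -/
theorem sum_twSum_one [Module k M] (hA : A.IsAInf) (σ : ZMod 2) {X Y : A.TwOb}
    (q : A.TwChain X Y) (x : Fin X.1.N) (y : Fin Y.1.N)
    {Φ : Chain A.Hom (X.1.obj x) (Y.1.obj y) → M} (hΦ : A.Multilin Φ) :
    ∑ z, twSum σ q z y (fun e => Φ (.cons (A.twist (X.1.shift x - σ)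
        (Fam.one X.1.toFam x z)) e)) =
      signed (X.1.shift x - σ) (twSum σ q x y fun e => Φ (.cons (A.one _) e)) := by
  rw [Finset.sum_eq_single x]
  · rw [Fam.one_self, (hA.one_deg _).twist_eq, zero_add, mul_one]
    exact map_signed (hΦ.headHom σ q x y) _ _
  · intro z _ hz
    rw [Fam.one_ne _ hz.symm, twist_zero]
    simp only [hΦ.zero', twSum_zero]
  · simp

theorem twSum_one_eq_zero [Module k M] (hA : A.IsAInf) (σ : ZMod 2) {X Y Z : A.TwOb}
    (p : A.TwChain X Z) (q : A.TwChain Z Y) (x : Fin X.1.N) (y : Fin Y.1.N)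
    {Φ : Chain A.Hom (X.1.obj x) (Y.1.obj y) → M} (hΦ : A.Multilin Φ)
    (h : ∀ (V : A.Ob) (e : Chain A.Hom (X.1.obj x) V) (e' : Chain A.Hom V (Y.1.obj y)),
      p.length ≤ e.length → q.length ≤ e'.length → Φ (e.append (.cons (A.one V) e')) = 0) :
    twSum σ (p.append (.cons (Fam.one Z.1.toFam) q)) x y Φ = 0 := by
  refine TwOb.induction (motive := fun {X Z} p x => ∀ (q : A.TwChain Z Y)
    {Φ : Chain A.Hom (X.1.obj x) (Y.1.obj y) → M}, A.Multilin Φ →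
    (∀ (V : A.Ob) (e : Chain A.Hom (X.1.obj x) V) (e' : Chain A.Hom V (Y.1.obj y)),
      p.length ≤ e.length → q.length ≤ e'.length → Φ (e.append (.cons (A.one V) e')) = 0) →
    twSum σ (p.append (.cons (Fam.one Z.1.toFam) q)) x y Φ = 0) ?_ ?_ p x q hΦ h
  · intro X x ih q Φ hΦ h
    rw [Chain.nil_append, twSum_cons _ _ _ _ _ hΦ.killsZero, sum_twSum_one hA σ q x y hΦ,
      twSum_eq_zero_of_length (Φ := fun e => Φ (.cons (A.one (X.1.obj x)) e)) σ q x y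
        fun e he => h _ (.nil _) e le_rfl he, signed_zero, zero_add]
    refine Finset.sum_eq_zero fun z hz => ?_
    exact ih z (Finset.mem_Ioi.1 hz) q (hΦ.cons _) fun V e e' _ he' =>
      h V (.cons (A.twist (X.1.shift x - σ) (X.1.δ x z)) e) e' (by simp) he'
  · intro X W Z a p x ih ih2 q Φ hΦ h
    rw [Chain.cons_append, twSum_cons _ _ _ _ _ hΦ.killsZero]
    refine (congrArg₂ (· + ·) (Finset.sum_eq_zero fun z _ => ?_)
      (Finset.sum_eq_zero fun z hz => ?_)).trans (add_zero 0)
    · exact ih z q (hΦ.cons _) fun V e e' he he' =>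
        h V (.cons (A.twist (X.1.shift x - σ) (a x z)) e) e' (by simpa using he) he'
    · exact ih2 z (Finset.mem_Ioi.1 hz) q (hΦ.cons _) fun V e e' he he' =>
        h V (.cons (A.twist (X.1.shift x - σ) (X.1.δ x z)) e) e' (he.trans (by simp)) he'

theorem twSum_nil_of_length_zero (σ : ZMod 2) {X : A.TwOb} (x y : Fin X.1.N)
    {Φ : Chain A.Hom (X.1.obj x) (X.1.obj y) → M} (hΦ : KillsZero Φ)
    (h : ∀ e, 1 ≤ e.length → Φ e = 0) :
    twSum σ (.nil X) x y Φ = if h : x = y then Φ (h ▸ .nil (X.1.obj x)) else 0 := by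
  rw [twSum_nil _ _ _ _ hΦ, Finset.sum_eq_zero, add_zero]
  exact fun z _ => twSum_eq_zero_of_length _ _ _ _ fun e _ => h _ (by simp)

theorem sum_twSum_nil_of_length_zero (σ : ZMod 2) {X : A.TwOb} (y : Fin X.1.N)
    {Φ : ∀ z, Chain A.Hom (X.1.obj z) (X.1.obj y) → M} (hΦ : ∀ z, KillsZero (Φ z))
    (h : ∀ z e, 1 ≤ e.length → Φ z e = 0) :
    ∑ z, twSum σ (.nil X) z y (Φ z) = Φ y (.nil _) := by
  rw [Finset.sum_congr rfl fun z _ => twSum_nil_of_length_zero σ z y (hΦ z) (h z),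
    Finset.sum_eq_single y (fun z _ hz => dif_neg hz) (by simp), dif_pos rfl]

theorem twSum_single (σ : ZMod 2) {X Y : A.TwOb} (a : Fam.Hom X.1.toFam Y.1.toFam)
    (x : Fin X.1.N) (y : Fin Y.1.N)
    {Φ : Chain A.Hom (X.1.obj x) (Y.1.obj y) → M} (hΦ : KillsZero Φ)
    (h : ∀ e, 2 ≤ e.length → Φ e = 0) :
    twSum σ (.single a) x y Φ = Φ (.single (A.twist (X.1.shift x - σ) (a x y))) := by
  rw [Chain.single, twSum_cons _ _ _ _ _ hΦ, sum_twSum_nil_of_length_zero σ y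
    (fun z => hΦ.cons _) fun z e he => h _ (by simpa using he), Finset.sum_eq_zero, add_zero]
  · rfl
  · exact fun z _ => twSum_eq_zero_of_length _ _ _ _ fun e he => h _ (by simpa using he)

theorem twSum_pair (σ : ZMod 2) {X Y Z : A.TwOb} (a : Fam.Hom X.1.toFam Z.1.toFam)
    (b : Fam.Hom Z.1.toFam Y.1.toFam) (x : Fin X.1.N) (y : Fin Y.1.N)
    {Φ : Chain A.Hom (X.1.obj x) (Y.1.obj y) → M} (hΦ : KillsZero Φ)
    (h : ∀ e, 3 ≤ e.length → Φ e = 0) :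
    twSum σ (.pair a b) x y Φ = ∑ z, Φ (.pair (A.twist (X.1.shift x - σ) (a x z))
      (A.twist (Z.1.shift z - σ) (b z y))) := by
  rw [Chain.pair, twSum_cons _ _ _ _ _ hΦ]
  refine (congrArg₂ (· + ·) (Finset.sum_congr rfl fun z _ =>
    twSum_single σ b z y (hΦ.cons _) fun e he => h _ (by simpa using he))
    (Finset.sum_eq_zero fun z _ => twSum_eq_zero_of_length _ _ _ _
      fun e he => h _ (by simpa [Chain.single] using he))).trans (add_zero _)

theorem twSum_nil_of_length_one (σ : ZMod 2) {X : A.TwOb} (x y : Fin X.1.N)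
    {Φ : Chain A.Hom (X.1.obj x) (X.1.obj y) → M} (hΦ : KillsZero Φ)
    (h : ∀ e, e.length ≠ 1 → Φ e = 0) :
    twSum σ (.nil X) x y Φ = Φ (.single (A.twist (X.1.shift x - σ) (X.1.δ x y))) := by
  rw [twSum_nil _ _ _ _ hΦ, Finset.sum_congr rfl fun z _ => twSum_nil_of_length_zero σ z y
    (hΦ.cons _) fun e he => h _ (by simp only [Chain.length_cons]; omega)]
  have h0 : (if h : x = y then Φ (h ▸ .nil (X.1.obj x)) else 0) = 0 := by
    split_ifs with hxy
    · subst hxy; exact h _ (by simp)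
    · rfl
  rw [h0, zero_add]
  by_cases hxy : x < y
  · rw [Finset.sum_eq_single y (fun z _ hz => dif_neg hz) (fun hy => absurd (Finset.mem_Ioi.2 hxy) hy),
      dif_pos rfl]
    rfl
  · rw [X.2.triangular x y hxy, twist_zero, Finset.sum_eq_zero]
    · exact (hΦ.zero' _).symm
    · intro z hz
      exact dif_neg fun e => hxy (by subst e; exact Finset.mem_Ioi.1 hz)

theorem tw_sgn_apply {X Y : A.tw.Ob} (a : A.tw.Hom X Y) (x : Fin X.1.N) (y : Fin Y.1.N) :
    (A.tw.sgn a : Fam.Hom X.1.toFam Y.1.toFam) x y =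
      signed (Y.1.shift y - X.1.shift x) (A.sgn (a x y)) := by
  rw [sgn_eq_neg_redSgn, sgn_eq_neg_redSgn]
  exact (congrArg Neg.neg (tw_redSgn_apply a x y)).trans
    (map_signed (negAddMonoidHom (α := A.Hom (X.1.obj x) (Y.1.obj y))) _ _)

theorem IsAInf.μ_long_one (hA : A.IsAInf) {X Y Z : A.Ob} (p : Chain A.Hom X Y)
    (q : Chain A.Hom Y Z) (h : 2 ≤ p.length + q.length) :
    A.μ (p.append (.cons (A.one Y) q)) = 0 := hA.μ_one p q (by omega)

theorem IsAInf.μ_cons_one (hA : A.IsAInf) {X Y Z W : A.Ob} (a : A.Hom X Y) (p : Chain A.Hom Y Z)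
    (q : Chain A.Hom Z W) (h : 1 ≤ p.length + q.length) :
    A.μ (.cons a (p.append (.cons (A.one Z) q))) = 0 :=
  hA.μ_long_one (.cons a p) q (by simp only [Chain.length_cons]; omega)

theorem IsAInf.μ_cons_cons_one (hA : A.IsAInf) {X X' Y Z W : A.Ob} (a : A.Hom X X')
    (b : A.Hom X' Y) (p : Chain A.Hom Y Z) (q : Chain A.Hom Z W) :
    A.μ (.cons a (.cons b (p.append (.cons (A.one Z) q)))) = 0 :=
  hA.μ_long_one (.cons a (.cons b p)) q (by simp only [Chain.length_cons]; omega)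

theorem tw_μ_one_right (hA : A.IsAInf) {X Y : A.TwOb} (a : Fam.Hom X.1.toFam Y.1.toFam) :
    A.tw.μ (X := X) (Y := Y) (.pair (Z := Y) (Fam.one X.1.toFam) a) = a := by
  funext x y
  refine (tw_μ _ x y).trans ?_
  refine (twSum_cons _ _ _ x y hA.multilin.killsZero).trans ?_
  refine (congrArg₂ (· + ·) (sum_twSum_one hA _ (.single a) x y hA.multilin)
    (Finset.sum_eq_zero fun z _ => ?_)).trans ?_
  · exact twSum_one_eq_zero hA _ (.nil X) (.single a) z y (hA.multilin.cons _) fun V e e' _ he' =>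
      hA.μ_cons_one _ e e' ((Nat.le_add_left 1 _).trans he' |>.trans (Nat.le_add_left _ _))
  · rw [add_zero, sub_self, signed_zero_left]
    refine (twSum_single _ a x y (hA.multilin.cons _).killsZero fun e he =>
      hA.μ_long_one (.nil _) e (he.trans (Nat.le_add_left _ _))).trans ?_
    rw [sub_self]
    exact hA.μ_one_right _

theorem tw_μ_one_left (hA : A.IsAInf) {X Y : A.TwOb} (a : Fam.Hom X.1.toFam Y.1.toFam) :
    A.tw.μ (X := X) (Y := Y) (.pair (Y := Y) a (Fam.one Y.1.toFam)) = A.tw.sgn a := by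
  funext x y
  refine (tw_μ _ x y).trans ?_
  refine (twSum_cons _ _ _ x y hA.multilin.killsZero).trans ?_
  refine (congrArg₂ (· + ·) (Finset.sum_congr rfl fun z _ =>
    (twSum_cons _ _ _ z y (hA.multilin.cons _).killsZero).trans
    (congrArg₂ (· + ·) (sum_twSum_one hA _ (.nil Y) z y (hA.multilin.cons _))
    (Finset.sum_eq_zero fun z' _ => ?_)))
    (Finset.sum_eq_zero fun z _ => ?_)).trans ?_
  · exact twSum_one_eq_zero hA _ (.nil Y) (.nil Y) z' y ((hA.multilin.cons _).cons _)
      fun V e e' _ _ => hA.μ_cons_cons_one _ _ e e'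
  · exact twSum_one_eq_zero hA _ (.single a) (.nil Y) z y (hA.multilin.cons _) fun V e e' he _ =>
      hA.μ_cons_one _ e e' ((Nat.le_add_left 1 _).trans he |>.trans (Nat.le_add_right _ _))
  · simp only [add_zero, sub_self, twist_zero_left]
    refine (Finset.sum_congr rfl fun z _ => congrArg _ (twSum_nil_of_length_zero _ z y
      ((hA.multilin.cons (a x z)).cons (A.one (Y.1.obj z))).killsZero fun e he =>
        hA.μ_long_one (.single (a x z)) e (Nat.add_le_add le_rfl he))).trans ?_
    rw [Finset.sum_eq_single y, dif_pos rfl]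
    · exact (congrArg _ (hA.μ_one_left _)).trans (tw_sgn_apply (A := A) (X := X) (Y := Y) a x y).symm
    · intro z _ hz
      rw [dif_neg hz, signed_zero]
    · simp

theorem twSum_single_one (hA : A.IsAInf) (X : A.TwOb) (x y : Fin X.1.N) :
    twSum (X.1.shift x) (.single (Fam.one X.1.toFam)) x y A.μ = 0 := by
  refine (twSum_cons _ _ _ x y hA.multilin.killsZero).trans ?_
  rw [sum_twSum_one hA _ (.nil X) x y hA.multilin]
  have h1 : twSum (X.1.shift x) (.nil X) x y (fun e => A.μ (.cons (A.one _) e)) = X.1.δ x y := by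
    rw [twSum_nil_of_length_one _ _ _ (hA.multilin.cons _).killsZero, sub_self]
    · exact hA.μ_one_right _
    · exact fun e he => hA.μ_one (.nil _) e (by simp; omega)
  have h2 : ∀ z, twSum (X.1.shift x) (.single (Fam.one X.1.toFam)) z y
      (fun e => A.μ (.cons (X.1.δ x z) e)) = if z = y then -X.1.δ x y else 0 := by
    intro z
    rw [Chain.single, twSum_cons _ _ _ _ _ (hA.multilin.cons _).killsZero,
      sum_twSum_one hA _ (.nil X) z y (hA.multilin.cons _), twSum_nil_of_length_zero _ _ _
      ((hA.multilin.cons _).cons _).killsZero fun e he =>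
        hA.μ_long_one (.single (X.1.δ x z)) e (Nat.add_le_add le_rfl he),
      Finset.sum_eq_zero, add_zero]
    · split_ifs with h
      · subst h
        refine (congrArg _ (hA.μ_one_left _)).trans ?_
        rw [sgn_eq_neg_redSgn, redSgn_δ]
        refine (map_signed (negAddMonoidHom (α := A.Hom (X.1.obj x) (X.1.obj z))) _ _).symm.trans ?_
        rw [signed_signed]
        rw [CharTwo.add_self_eq_zero, signed_zero_left]
        rfl
      · simp
    · intro w _
      exact twSum_one_eq_zero hA _ (.nil X) (.nil X) w y ((hA.multilin.cons _).cons _)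
        fun V e e' _ _ => hA.μ_cons_cons_one _ _ e e'
  simp only [sub_self, twist_zero_left, signed_zero_left]
  refine (congrArg₂ (· + ·) h1 (Finset.sum_congr rfl fun z _ => h2 z)).trans ?_
  rw [Finset.sum_ite_eq']
  split_ifs with h
  · exact add_neg_cancel _
  · rw [X.2.triangular x y fun h' => h (Finset.mem_Ioi.2 h')]
    exact add_zero 0

theorem tw_μ_single_one (hA : A.IsAInf) (X : A.TwOb) :
    A.tw.μ (X := X) (Y := X) (.single (Fam.one X.1.toFam)) = (0 : Fam.Hom X.1.toFam X.1.toFam) := by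
  funext x y
  exact (tw_μ _ x y).trans (twSum_single_one hA X x y)

theorem tw_μ_nil (X : A.TwOb) :
    A.tw.μ (X := X) (Y := X) (.nil X) = (0 : Fam.Hom X.1.toFam X.1.toFam) := by
  refine Eq.trans ?_ X.2.maurerCartan
  change ((List.map (Chain.rep X.1.δ) (List.range (X.1.N + 1))).map Fam.μ).sum = _
  rw [List.map_map]
  rfl

theorem twSum_append_add [Module k M] (σ : ZMod 2) {X Y Z W : A.TwOb} (p : A.TwChain X Z)
    (a b : Fam.Hom Z.1.toFam W.1.toFam) (q : A.TwChain W Y) (x : Fin X.1.N) (y : Fin Y.1.N)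
    {Φ : Chain A.Hom (X.1.obj x) (Y.1.obj y) → M} (hΦ : A.Multilin Φ) :
    twSum σ (p.append (.cons (a + b) q)) x y Φ =
      twSum σ (p.append (.cons a q)) x y Φ + twSum σ (p.append (.cons b q)) x y Φ := by
  have := twSum_append_smul_add σ p (1 : k) a b q x y hΦ
  rwa [one_smul, one_smul] at this

theorem twSum_append_smul [Module k M] (σ : ZMod 2) {X Y Z W : A.TwOb} (p : A.TwChain X Z)
    (r : k) (a : Fam.Hom Z.1.toFam W.1.toFam) (q : A.TwChain W Y) (x : Fin X.1.N) (y : Fin Y.1.N)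
    {Φ : Chain A.Hom (X.1.obj x) (Y.1.obj y) → M} (hΦ : A.Multilin Φ) :
    twSum σ (p.append (.cons (r • a) q)) x y Φ = r • twSum σ (p.append (.cons a q)) x y Φ := by
  have h0 := twSum_append_add σ p (0 : Fam.Hom Z.1.toFam W.1.toFam) 0 q x y hΦ
  rw [add_zero, left_eq_add] at h0
  have := twSum_append_smul_add σ p r a 0 q x y hΦ
  rwa [h0, add_zero, add_zero] at this

theorem tw_μ_deg (hA : A.IsAInf) {X Y : A.TwOb} (c : A.TwChain X Y) (p : ZMod 2)
    (hc : A.tw.ChainHomog (X := X) (Y := Y) c p) :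
    A.tw.IsHomog (p + 2 - (c.length : ZMod 2)) (A.tw.μ (X := X) (Y := Y) c) := by
  funext x y
  change A.proj _ ((A.tw.μ c : Fam.Hom X.1.toFam Y.1.toFam) x y) = _
  rw [tw_μ c x y]
  refine twSum_mem_of_homog _ c x y (LinearMap.eqLocus (A.proj _) LinearMap.id).toAddSubgroup p hc
    hA.multilin.killsZero fun e p' he hp' => ?_
  have := hA.μ_deg e p' he
  rwa [show p' + 2 - (e.length : ZMod 2) = p + 2 - (c.length : ZMod 2) + X.1.shift x - Y.1.shift y
    by linear_combination hp'] at this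

theorem tw_relation (hA : A.IsAInf) {X Y : A.TwOb} (c : A.TwChain X Y) :
    A.tw.insertSum (X := X) (Y := Y) (M := Fam.Hom X.1.toFam Y.1.toFam) A.tw.μ c = 0 := by
  funext x y
  have := twSum_insertSum hA (X.1.shift x) c x y hA.multilin
  rw [sub_self, signed_zero_left, funext fun e => hA.relation e, twSum_zero] at this
  refine Eq.trans ?_ this.symm
  refine (map_insertSum (A := A.tw) ((Pi.evalAddMonoidHom _ y).comp
    (Pi.evalAddMonoidHom (fun x => ∀ y, A.Hom (X.1.obj x) (Y.1.obj y)) x)) _ c).trans ?_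
  exact congrArg (fun F => A.tw.insertSum F c) (funext fun e => tw_μ e x y)

theorem tw_one_deg (hA : A.IsAInf) (X : A.TwOb) :
    A.tw.IsHomog (X := X) (Y := X) 0 (Fam.one X.1.toFam) := by
  funext x y
  change A.proj (0 + X.1.shift x - X.1.shift y) (Fam.one X.1.toFam x y) = Fam.one X.1.toFam x y
  by_cases h : x = y
  · subst h
    rw [Fam.one_self, add_sub_cancel_right]
    exact hA.one_deg _
  · rw [Fam.one_ne _ h, map_zero]

theorem tw_μ_long_one (hA : A.IsAInf) {X Y Z : A.TwOb} (p : A.TwChain X Z) (q : A.TwChain Z Y)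
    (h : 2 ≤ p.length + q.length) :
    A.tw.μ (X := X) (Y := Y) (p.append (.cons (Fam.one Z.1.toFam) q)) =
      (0 : Fam.Hom X.1.toFam Y.1.toFam) := by
  funext x y
  refine (tw_μ _ x y).trans ?_
  exact twSum_one_eq_zero hA _ p q x y hA.multilin fun V e e' he he' =>
    hA.μ_long_one e e' (h.trans (Nat.add_le_add he he'))

/-- Twisted complexes over an `A_∞`-category form an `A_∞`-category. -/
theorem IsAInf.tw (hA : A.IsAInf) : A.tw.IsAInf where
  μ_nil X := tw_μ_nil X
  μ_add {X Y Z W} p a b q := by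
    funext x y
    refine (tw_μ _ x y).trans ((twSum_append_add _ p a b q x y hA.multilin).trans ?_)
    exact (congrArg₂ (· + ·) (tw_μ _ x y) (tw_μ _ x y)).symm
  μ_smul {X Y Z W} p r a q := by
    funext x y
    refine (tw_μ _ x y).trans ((twSum_append_smul _ p r a q x y hA.multilin).trans ?_)
    exact (congrArg (r • ·) (tw_μ _ x y)).symm
  μ_deg := tw_μ_deg hA
  relation := tw_relation hA
  one_deg := tw_one_deg hA
  μ_one_left := tw_μ_one_left hA
  μ_one_right := tw_μ_one_right hA
  μ_one {X Y Z} p q h := by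
    by_cases h1 : 2 ≤ p.length + q.length
    · exact tw_μ_long_one hA p q h1
    · cases p with
      | nil =>
        cases q with
        | nil => exact tw_μ_single_one hA _
        | cons a q => simp only [Chain.length_cons, Chain.length_nil] at h h1; omega
      | cons a p => simp only [Chain.length_cons] at h h1; omega

end AInfData

/-! ### Operations concentrated in one length -/

namespace Chain

variable {O : Type w} {H : O → O → Type v} {M : Type*} [AddCommGroup M]

theorem splitSum_eq_whole {X Y : O} {Ψ : ∀ Z, Chain H X Z → Chain H Z Y → M}
    (h : ∀ Z p q, 1 ≤ q.length → Ψ Z p q = 0) (c : Chain H X Y) :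
    splitSum Ψ c = Ψ Y c (nil Y) := by
  induction c with
  | nil X => simp
  | cons a p ih =>
    rw [splitSum_cons, h _ _ _ (by simp), zero_add, ih fun Z p q hq => h _ _ _ hq]

@[simp] theorem length_single {X Y : O} (a : H X Y) : (single a).length = 1 := rfl

theorem splitSum_append_single {X Y Z : O} {Ψ : ∀ Z, Chain H X Z → Chain H Z Y → M}
    {p : Chain H X Z} {b : H Z Y} (h : ∀ Z p q, q.length ≠ 1 → Ψ Z p q = 0) :
    splitSum Ψ (p.append (single b)) = Ψ Z p (single b) := by
  induction p with
  | nil X => rw [nil_append, single, splitSum_cons, splitSum_nil,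
      h Y (cons b (nil Y)) (nil Y) (by simp), add_zero]
  | cons a p ih =>
    rw [cons_append, splitSum_cons, h _ _ _ (by simp [single]), zero_add,
      ih fun Z p q hq => h _ _ _ hq]

theorem eq_nil_or_append_single {X Y : O} (c : Chain H X Y) :
    (∃ h : X = Y, c = h ▸ nil X) ∨ ∃ (Z : O) (p : Chain H X Z) (b : H Z Y),
      c = p.append (single b) := by
  induction c with
  | nil X => exact .inl ⟨rfl, rfl⟩
  | cons a c ih =>
    obtain ⟨rfl, rfl⟩ | ⟨Z, p, b, rfl⟩ := ih
    · exact .inr ⟨_, nil _, a, rfl⟩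
    · exact .inr ⟨Z, cons a p, b, rfl⟩

end Chain

namespace AInfData

variable {k : Type u} [Field k] {A : AInfData.{u, v, w} k} {M : Type*} [AddCommGroup M]

theorem insertSum_eq_zero {X Y : A.Ob} {Φ : Chain A.Hom X Y → M}
    (h : ∀ e, 1 ≤ e.length → Φ e = 0) (c : Chain A.Hom X Y) : A.insertSum Φ c = 0 := by
  rw [insertSum_eq]
  refine Chain.splitSum_eq_zero fun Z p q _ => Chain.splitSum_eq_zero fun Z' p' q' _ => h _ ?_
  simp only [Chain.length_append, Chain.length_cons]
  omega

theorem insertSum_of_one {X Y : A.Ob} {Φ : Chain A.Hom X Y → M}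
    (h : ∀ e, 2 ≤ e.length → Φ e = 0) (c : Chain A.Hom X Y) :
    A.insertSum Φ c = Φ (.single (A.μ c)) := by
  cases c with
  | nil => rw [insertSum_nil]; rfl
  | cons a c =>
    rw [insertSum_cons, insertSum_eq_zero (fun e he => h _ (by simpa using he)), add_zero, headSum,
      Chain.splitSum_eq_whole fun Z p q hq => h _ (by simpa using hq)]
    rfl

theorem insertSum_of_two {X Y Z : A.Ob} {Φ : Chain A.Hom X Y → M}
    (h : ∀ e, 3 ≤ e.length → Φ e = 0) (a : A.Hom X Z) (c : Chain A.Hom Z Y) :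
    A.insertSum Φ (.cons a c) =
      headSum Φ (.cons a c) + Φ (.pair (A.redSgn a) (A.μ c)) := by
  rw [insertSum_cons, insertSum_of_one fun e he => h _ (by simpa using he)]
  rfl

end AInfData

/-! ### The category of a cyclically ordered set -/

namespace cyc

open AInfData

variable {k : Type u} [Field k] {n : ℕ} {S : Type w} {s : ZMod (n + 1) ≃ S}

/-- The coefficient of the identity. -/
def idc (X Y : (cyc k s).Ob) : (cyc k s).Hom X Y →ₗ[k] k where
  toFun a := CycGen.idCoeff a
  map_add' a b := by
    by_cases h : s.symm X = s.symm Y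
    · simp only [CycGen.idCoeff, h, dif_pos]; rfl
    · simp [CycGen.idCoeff, h]
  map_smul' r a := by
    by_cases h : s.symm X = s.symm Y
    · simp only [CycGen.idCoeff, h, dif_pos]; rfl
    · simp [CycGen.idCoeff, h]

/-- The coefficient of the generator of degree one. -/
def vc (X Y : (cyc k s).Ob) : (cyc k s).Hom X Y →ₗ[k] k where
  toFun a := CycGen.vCoeff a
  map_add' a b := by
    by_cases h : s.symm X + 1 = s.symm Y
    · simp only [CycGen.vCoeff, h, dif_pos]; rfl
    · simp [CycGen.vCoeff, h]
  map_smul' r a := by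
    by_cases h : s.symm X + 1 = s.symm Y
    · simp only [CycGen.vCoeff, h, dif_pos]; rfl
    · simp [CycGen.vCoeff, h]

variable {X Y Z W : (cyc k s).Ob}

/-- The morphism with given coefficients. -/
def mkHom (X Y : (cyc k s).Ob) (x y : k) : (cyc k s).Hom X Y := CycGen.mk (s.symm X) (s.symm Y) x y

theorem ext {a b : (cyc k s).Hom X Y} (h : idc X Y a = idc X Y b) (h' : vc X Y a = vc X Y b) :
    a = b := by
  funext g
  rcases g with ⟨⟨g⟩⟩ | ⟨⟨g⟩⟩
  · have e : ∀ a : (cyc k s).Hom X Y, idc X Y a = a (Sum.inl ⟨g⟩) := fun a => dif_pos g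
    exact (e a).symm.trans (h.trans (e b))
  · have e : ∀ a : (cyc k s).Hom X Y, vc X Y a = a (Sum.inr ⟨g⟩) := fun a => dif_pos g
    exact (e a).symm.trans (h'.trans (e b))

theorem idc_mkHom (x y : k) : idc X Y (mkHom X Y x y) = if s.symm X = s.symm Y then x else 0 := by
  change CycGen.idCoeff (CycGen.mk (s.symm X) (s.symm Y) x y) = _
  unfold CycGen.idCoeff CycGen.mk
  split_ifs <;> rfl

theorem vc_mkHom (x y : k) :
    vc X Y (mkHom X Y x y) = if s.symm X + 1 = s.symm Y then y else 0 := by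
  change CycGen.vCoeff (CycGen.mk (s.symm X) (s.symm Y) x y) = _
  unfold CycGen.vCoeff CycGen.mk
  split_ifs <;> rfl

theorem idc_eq_zero (h : s.symm X ≠ s.symm Y) (a : (cyc k s).Hom X Y) : idc X Y a = 0 := dif_neg h

theorem vc_eq_zero (h : s.symm X + 1 ≠ s.symm Y) (a : (cyc k s).Hom X Y) : vc X Y a = 0 :=
  dif_neg h

theorem idc_proj (p : ZMod 2) (a : (cyc k s).Hom X Y) :
    idc X Y ((cyc k s).proj p a) = if p = 0 then idc X Y a else 0 := by
  by_cases h : s.symm X = s.symm Y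
  · have e : ∀ a : (cyc k s).Hom X Y, idc X Y a = a (Sum.inl ⟨h⟩) := fun a => dif_pos h
    exact (e _).trans (congrArg (fun x => if p = 0 then x else 0) (e a)).symm
  · rw [idc_eq_zero h, idc_eq_zero h, ite_self]

theorem vc_proj (p : ZMod 2) (a : (cyc k s).Hom X Y) :
    vc X Y ((cyc k s).proj p a) = if p = 1 then vc X Y a else 0 := by
  by_cases h : s.symm X + 1 = s.symm Y
  · have e : ∀ a : (cyc k s).Hom X Y, vc X Y a = a (Sum.inr ⟨h⟩) := fun a => dif_pos h
    exact (e _).trans (congrArg (fun x => if p = 1 then x else 0) (e a)).symm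
  · rw [vc_eq_zero h, vc_eq_zero h, ite_self]

theorem idc_redSgn (a : (cyc k s).Hom X Y) : idc X Y ((cyc k s).redSgn a) = -idc X Y a := by
  rw [redSgn, map_sub, idc_proj, idc_proj, if_neg one_ne_zero, if_pos rfl, zero_sub]

theorem vc_redSgn (a : (cyc k s).Hom X Y) : vc X Y ((cyc k s).redSgn a) = vc X Y a := by
  rw [redSgn, map_sub, vc_proj, vc_proj, if_neg zero_ne_one, if_pos rfl, sub_zero]

/-- The product of the coefficients of the generators of degree one. -/
def vProd : {X Y : (cyc k s).Ob} → Chain (cyc k s).Hom X Y → k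
  | _, _, .nil _ => 1
  | _, _, .cons a p => vc _ _ a * vProd p

theorem vProd_eq (c : Chain (cyc k s).Hom X Y) :
    CycGen.vProd (e := s.symm) c = vProd c := by
  induction c with
  | nil => rfl
  | cons a c ih => exact congrArg (CycGen.vCoeff a * ·) ih

theorem target_of_vProd_ne_zero (c : Chain (cyc k s).Hom X Y) (h : vProd c ≠ 0) :
    s.symm Y = s.symm X + c.length := by
  induction c with
  | nil => simp
  | @cons X Z Y a c ih =>
    have h1 : s.symm X + 1 = s.symm Z := by
      by_contra h1
      exact h (by rw [vProd, vc_eq_zero h1, zero_mul])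
    rw [ih (right_ne_zero_of_mul h), ← h1, Chain.length_cons]
    push_cast
    ring

/-- The coefficient of the identity in the composition with identities. -/
def idComp : {X Y : (cyc k s).Ob} → Chain (cyc k s).Hom X Y → k
  | _, _, .cons a (.cons b (.nil _)) => idc _ _ a * idc _ _ b
  | _, _, _ => 0

/-- The coefficient of the generator of degree one in a composition. -/
def vComp : {X Y : (cyc k s).Ob} → Chain (cyc k s).Hom X Y → k
  | _, _, .cons a (.cons b (.nil _)) => idc _ _ a * vc _ _ b - vc _ _ a * idc _ _ b
  | _, _, _ => 0

/-- The product of the coefficients of the generators for sequences of length `j`. -/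
def vProdOf (j : ℕ) (c : Chain (cyc k s).Hom X Y) : k := if c.length = j then vProd c else 0

theorem μ_eq (c : Chain (cyc k s).Hom X Y) :
    (cyc k s).μ c = mkHom X Y (idComp c + vProdOf (n + 1) c) (vComp c) := by
  have e1 : CycGen.idComp (e := s.symm) c = mkHom X Y (idComp c) (vComp c) := by
    cases c with
    | nil => funext g; rcases g with g | g <;> rfl
    | cons a c => cases c with
      | nil => funext g; rcases g with g | g <;> rfl
      | cons b c => cases c with
        | nil => rfl
        | cons d c => funext g; rcases g with g | g <;> rfl
  change CycGen.idComp (e := s.symm) c +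
    (if c.length = n + 1 then CycGen.mk _ _ (CycGen.vProd (e := s.symm) c) 0 else 0) = _
  rw [e1, vProd_eq, vProdOf]
  funext g
  split_ifs <;> rcases g with g | g
  · rfl
  · exact add_zero (vComp c)
  · rfl
  · exact add_zero (vComp c)

theorem idc_μ (c : Chain (cyc k s).Hom X Y) :
    idc X Y ((cyc k s).μ c) = idComp c + vProdOf (n + 1) c := by
  rw [μ_eq, idc_mkHom, ite_eq_left_iff]
  intro h
  have h1 : idComp c = 0 := by
    cases c with
    | nil => rfl
    | @cons X Z Y a c => cases c with
      | nil => rfl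
      | cons b c => cases c with
        | cons d c => rfl
        | nil =>
          change idc _ _ a * idc _ _ b = 0
          by_cases h1 : s.symm X = s.symm Z
          · rw [idc_eq_zero (fun e => h (h1.trans e)) b, mul_zero]
          · rw [idc_eq_zero h1, zero_mul]
  rw [h1, zero_add, vProdOf]
  split_ifs with h2
  · by_contra h3
    have := target_of_vProd_ne_zero c (Ne.symm h3)
    rw [h2, ZMod.natCast_self, add_zero] at this
    exact h this.symm
  · rfl

theorem vc_μ (c : Chain (cyc k s).Hom X Y) : vc X Y ((cyc k s).μ c) = vComp c := by
  rw [μ_eq, vc_mkHom, ite_eq_left_iff]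
  intro h
  cases c with
  | nil => rfl
  | @cons X Z Y a c => cases c with
    | nil => rfl
    | cons b c => cases c with
      | cons d c => rfl
      | nil =>
        change 0 = idc _ _ a * vc _ _ b - vc _ _ a * idc _ _ b
        have h1 : idc _ _ a * vc _ _ b = 0 := by
          by_cases h1 : s.symm X = s.symm Z
          · rw [vc_eq_zero (fun e => h ((congrArg (· + 1) h1).trans e)) b, mul_zero]
          · rw [idc_eq_zero h1, zero_mul]
        have h2 : vc _ _ a * idc _ _ b = 0 := by
          by_cases h2 : s.symm Z = s.symm Y
          · rw [vc_eq_zero (fun e => h (e.trans h2)) a, zero_mul]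
          · rw [idc_eq_zero h2, mul_zero]
        rw [h1, h2, sub_zero]

/-- The product of the coefficients of the generators of degree one of all entries but the last,
and of the coefficient of the identity of the last one. -/
def vProdId : {X Y : (cyc k s).Ob} → Chain (cyc k s).Hom X Y → k
  | _, _, .nil _ => 0
  | _, _, .cons a (.nil _) => idc _ _ a
  | _, _, .cons a (.cons b c) => vc _ _ a * vProdId (.cons b c)

theorem vComp_eq_zero {c : Chain (cyc k s).Hom X Y} (h : c.length ≠ 2) : vComp c = 0 := by
  cases c with
  | nil => rfl
  | cons a c => cases c with
    | nil => rfl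
    | cons b c => cases c with
      | nil => exact absurd rfl h
      | cons d c => rfl

theorem idComp_eq_zero {c : Chain (cyc k s).Hom X Y} (h : c.length ≠ 2) : idComp c = 0 := by
  cases c with
  | nil => rfl
  | cons a c => cases c with
    | nil => rfl
    | cons b c => cases c with
      | nil => exact absurd rfl h
      | cons d c => rfl

theorem vProdOf_cons (j : ℕ) (a : (cyc k s).Hom X Z) (c : Chain (cyc k s).Hom Z Y) :
    vProdOf (j + 1) (.cons a c) = vc _ _ a * vProdOf j c := by
  simp [vProdOf, vProd]

theorem vProdOf_of_eq {j : ℕ} {c : Chain (cyc k s).Hom X Y} (h : c.length = j) :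
    vProdOf j c = vProd c := if_pos h

theorem vProdOf_of_ne {j : ℕ} {c : Chain (cyc k s).Hom X Y} (h : c.length ≠ j) :
    vProdOf j c = 0 := if_neg h

theorem vc_μ_of_ne {c : Chain (cyc k s).Hom X Y} (h : c.length ≠ 2) :
    vc X Y ((cyc k s).μ c) = 0 := (vc_μ c).trans (vComp_eq_zero h)

theorem mul_insertSum (r : k) (Φ : Chain (cyc k s).Hom X Y → k) (c : Chain (cyc k s).Hom X Y) :
    r * (cyc k s).insertSum Φ c = (cyc k s).insertSum (fun e => r * Φ e) c :=
  map_insertSum (AddMonoidHom.mulLeft r) Φ c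

/-- Inserting compositions into the product of the coefficients of the generators. -/
theorem insertSum_vProdOf (j : ℕ) (a : (cyc k s).Hom X Z) (c : Chain (cyc k s).Hom Z Y) :
    (cyc k s).insertSum (vProdOf j) (.cons a c) =
      if c.length = j then idc _ _ a * vProd c - vProdId (.cons a c) else 0 := by
  induction c generalizing X j with
  | nil Z =>
    cases j with
    | zero =>
      rw [insertSum_eq_zero fun e he => vProdOf_of_ne (by omega)]
      simp [vProd, vProdId]
    | succ j =>
      rw [insertSum_cons, insertSum_nil, headSum_cons, Chain.splitSum_nil]
      have h0 (W : (cyc k s).Ob) : vc W W ((cyc k s).μ (.nil W)) = 0 := vc_μ_of_ne (by simp)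
      have h1 : vc X Z ((cyc k s).μ (.cons a (.nil Z))) = 0 := vc_μ_of_ne (by simp)
      simp [vProdOf, vProd, h0, h1]
  | @cons Z V Y b c ih =>
    cases j with
    | zero =>
      rw [insertSum_eq_zero fun e he => vProdOf_of_ne (by omega)]
      simp
    | succ j =>
      have hin : (cyc k s).insertSum (fun q => vProdOf (j + 1) (.cons ((cyc k s).redSgn a) q))
          (.cons b c) = vc _ _ a * (cyc k s).insertSum (vProdOf j) (.cons b c) := by
        simp only [vProdOf_cons, vc_redSgn, mul_insertSum]
      have hhead : headSum (vProdOf (j + 1)) (.cons a (.cons b c)) =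
          (idc _ _ a * vc _ _ b - vc _ _ a * idc _ _ b) * vProdOf j c := by
        simp only [headSum, Chain.splitSum_cons, vProdOf_cons, vc_μ]
        rw [vComp_eq_zero (by simp), vComp_eq_zero (by simp), zero_mul, zero_add, zero_mul,
          zero_add]
        cases c with
        | nil => rw [Chain.splitSum_nil]; rfl
        | cons d c =>
          rw [Chain.splitSum_cons, Chain.splitSum_eq_zero, add_zero]
          · rfl
          · intro W p q _
            rw [vComp_eq_zero (by simp), zero_mul]
      rw [insertSum_cons, hin, hhead, ih, vProdOf]
      simp only [Chain.length_cons, add_left_inj]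
      split_ifs
      · simp only [vProd, vProdId]; ring
      · ring

theorem vProd_append_single (p : Chain (cyc k s).Hom X Z) (b : (cyc k s).Hom Z Y) :
    vProd (p.append (.single b)) = vProd p * vc _ _ b := by
  induction p with
  | nil => simp [vProd, Chain.single]
  | cons a p ih => rw [Chain.cons_append, vProd, ih, vProd, mul_assoc]

theorem vProdId_append_single (p : Chain (cyc k s).Hom X Z) (b : (cyc k s).Hom Z Y) :
    vProdId (p.append (.single b)) = vProd p * idc _ _ b := by
  induction p with
  | nil => simp [vProd, vProdId, Chain.single]
  | cons a p ih =>
    have : vProdId ((Chain.cons a p).append (.single b)) =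
        vc _ _ a * vProdId (p.append (.single b)) := by
      cases p <;> rfl
    rw [this, ih, vProd, mul_assoc]

theorem insertSum_idComp (a : (cyc k s).Hom X Z) (p : Chain (cyc k s).Hom Z W)
    (b : (cyc k s).Hom W Y) :
    (cyc k s).insertSum idComp (.cons a (p.append (.single b))) =
      idc _ _ ((cyc k s).μ (.cons a p)) * idc _ _ b -
        idc _ _ a * idc _ _ ((cyc k s).μ (p.append (.single b))) := by
  rw [insertSum_of_two fun e he => idComp_eq_zero (by omega)]
  have h := Chain.splitSum_append_single (p := Chain.cons a p) (b := b)
    (Ψ := fun Z q r => idComp (.cons ((cyc k s).μ q) r)) fun Z q r hr => idComp_eq_zero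
      (by simpa using hr)
  refine (congrArg₂ (· + ·) h rfl).trans ?_
  change idc _ _ ((cyc k s).μ (.cons a p)) * idc _ _ b + idc _ _ ((cyc k s).redSgn a) * _ = _
  rw [idc_redSgn, neg_mul, sub_eq_add_neg]

theorem insertSum_vComp (a : (cyc k s).Hom X Z) (p : Chain (cyc k s).Hom Z W)
    (b : (cyc k s).Hom W Y) :
    (cyc k s).insertSum vComp (.cons a (p.append (.single b))) =
      idc _ _ ((cyc k s).μ (.cons a p)) * vc _ _ b - vComp (.cons a p) * idc _ _ b -
        (idc _ _ a * vComp (p.append (.single b)) +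
          vc _ _ a * idc _ _ ((cyc k s).μ (p.append (.single b)))) := by
  rw [insertSum_of_two fun e he => vComp_eq_zero (by omega)]
  have h := Chain.splitSum_append_single (p := Chain.cons a p) (b := b)
    (Ψ := fun Z q r => vComp (.cons ((cyc k s).μ q) r)) fun Z q r hr => vComp_eq_zero
      (by simpa using hr)
  refine (congrArg₂ (· + ·) h rfl).trans ?_
  change idc _ _ ((cyc k s).μ (.cons a p)) * vc _ _ b - vc _ _ ((cyc k s).μ (.cons a p)) * idc _ _ b
    + (idc _ _ ((cyc k s).redSgn a) * vc _ _ ((cyc k s).μ (p.append (.single b))) -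
      vc _ _ ((cyc k s).redSgn a) * idc _ _ ((cyc k s).μ (p.append (.single b)))) = _
  rw [idc_redSgn, vc_redSgn, vc_μ, vc_μ]
  ring

theorem insertSum_idComp_single (a : (cyc k s).Hom X Y) :
    (cyc k s).insertSum idComp (.single a) = 0 := by
  rw [Chain.single, insertSum_of_two fun e he => idComp_eq_zero (by omega), headSum_cons,
    Chain.splitSum_nil]
  change idc _ _ ((cyc k s).μ (.nil X)) * idc _ _ a + 0 +
    idc _ _ ((cyc k s).redSgn a) * idc _ _ ((cyc k s).μ (.nil Y)) = 0
  have h (W : (cyc k s).Ob) : (cyc k s).μ (.nil W) = 0 := CycGen.μ_nil _ _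
  rw [h, h]
  simp

theorem insertSum_vComp_single (a : (cyc k s).Hom X Y) :
    (cyc k s).insertSum vComp (.single a) = 0 := by
  rw [Chain.single, insertSum_of_two fun e he => vComp_eq_zero (by omega), headSum_cons,
    Chain.splitSum_nil]
  change idc _ _ ((cyc k s).μ (.nil X)) * vc _ _ a - vc _ _ ((cyc k s).μ (.nil X)) * idc _ _ a + 0 +
    (idc _ _ ((cyc k s).redSgn a) * vc _ _ ((cyc k s).μ (.nil Y)) -
      vc _ _ ((cyc k s).redSgn a) * idc _ _ ((cyc k s).μ (.nil Y))) = 0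
  have h (W : (cyc k s).Ob) : (cyc k s).μ (.nil W) = 0 := CycGen.μ_nil _ _
  rw [h, h]
  simp

theorem idComp_assoc (a : (cyc k s).Hom X Z) (p : Chain (cyc k s).Hom Z W)
    (b : (cyc k s).Hom W Y) :
    idComp (.cons a p) * idc _ _ b = idc _ _ a * idComp (p.append (.single b)) := by
  cases p with
  | nil => simp [idComp, Chain.single]
  | cons c p => cases p with
    | nil => simp [idComp, Chain.single, mul_assoc]
    | cons d p => rw [idComp_eq_zero (by simp), idComp_eq_zero (by simp [Chain.single]), zero_mul,
        mul_zero]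

theorem vComp_assoc (a : (cyc k s).Hom X Z) (p : Chain (cyc k s).Hom Z W)
    (b : (cyc k s).Hom W Y) :
    idComp (.cons a p) * vc _ _ b - vComp (.cons a p) * idc _ _ b =
      idc _ _ a * vComp (p.append (.single b)) + vc _ _ a * idComp (p.append (.single b)) := by
  cases p with
  | nil => simp [idComp, vComp, Chain.single]
  | cons c p => cases p with
    | nil => simp only [idComp, vComp, Chain.single, Chain.cons_append, Chain.nil_append]; ring
    | cons d p =>
      rw [idComp_eq_zero (by simp), idComp_eq_zero (by simp [Chain.single]),
        vComp_eq_zero (by simp), vComp_eq_zero (by simp [Chain.single])]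
      ring

theorem insertSum_μ (c : Chain (cyc k s).Hom X Y) : (cyc k s).insertSum (cyc k s).μ c = 0 := by
  have hid : idc _ _ ((cyc k s).insertSum (cyc k s).μ c) =
      (cyc k s).insertSum idComp c + (cyc k s).insertSum (vProdOf (n + 1)) c := by
    rw [← insertSum_add]
    refine (map_insertSum (idc X Y).toAddMonoidHom _ c).trans ?_
    exact congrArg (fun F => (cyc k s).insertSum F c) (funext idc_μ)
  have hv : vc _ _ ((cyc k s).insertSum (cyc k s).μ c) = (cyc k s).insertSum vComp c :=
    (map_insertSum (vc X Y).toAddMonoidHom _ c).trans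
      (congrArg (fun F => (cyc k s).insertSum F c) (funext vc_μ))
  have h0 (W : (cyc k s).Ob) : (cyc k s).μ (.nil W) = 0 := CycGen.μ_nil _ _
  refine ext (hid.trans ?_) (hv.trans ?_) <;> rw [map_zero] <;>
    obtain ⟨rfl, rfl⟩ | ⟨Z, p, b, rfl⟩ := c.eq_nil_or_append_single
  · rw [insertSum_nil, insertSum_nil, h0]
    simp [idComp, vProdOf, vProd]
  · cases p with
    | nil =>
      refine (congrArg₂ (· + ·) (insertSum_idComp_single b)
        (insertSum_vProdOf (n + 1) b (.nil _))).trans ?_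
      simp
    | cons a p =>
      refine (congrArg₂ (· + ·) (insertSum_idComp a p b) (insertSum_vProdOf _ _ _)).trans ?_
      rw [idc_μ, idc_μ, ← Chain.cons_append, vProdId_append_single, vProd_append_single, add_mul,
        idComp_assoc]
      by_cases hl : p.length + 1 = n + 1
      · rw [vProdOf_of_eq (c := Chain.cons a p) hl, vProdOf_of_eq (by simpa using hl), vProd_append_single, vProd,
          if_pos (by simpa using hl)]
        ring
      · rw [vProdOf_of_ne (c := Chain.cons a p) hl, vProdOf_of_ne (by simpa using hl), if_neg (by simpa using hl)]
        ring
  · rw [insertSum_nil, h0]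
    simp [vComp]
  · cases p with
    | nil => exact insertSum_vComp_single b
    | cons a p =>
      refine (insertSum_vComp a p b).trans ?_
      rw [idc_μ, idc_μ, add_mul, mul_add, add_sub_right_comm, vComp_assoc]
      by_cases hl : p.length + 1 = n + 1
      · rw [vProdOf_of_eq (c := Chain.cons a p) hl, vProdOf_of_eq (by simpa using hl), vProd_append_single, vProd]
        ring
      · rw [vProdOf_of_ne (c := Chain.cons a p) hl, vProdOf_of_ne (by simpa using hl)]
        ring

theorem vProd_append (p : Chain (cyc k s).Hom X Z) (q : Chain (cyc k s).Hom Z Y) :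
    vProd (p.append q) = vProd p * vProd q := by
  induction p with
  | nil => rw [Chain.nil_append, vProd, one_mul]
  | cons a p ih => rw [Chain.cons_append, vProd, ih, vProd, mul_assoc]

theorem vProdOf_multilin (j : ℕ) :
    (cyc k s).Multilin (vProdOf j : Chain (cyc k s).Hom X Y → k) := by
  constructor
  · intro Z W p a b q
    simp only [vProdOf, Chain.length_append, Chain.length_cons, vProd_append, vProd, map_add]
    split_ifs <;> ring
  · intro Z W p r a q
    simp only [vProdOf, Chain.length_append, Chain.length_cons, vProd_append, vProd, map_smul,
      smul_eq_mul]
    split_ifs <;> ring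

theorem idComp_multilin : (cyc k s).Multilin (idComp : Chain (cyc k s).Hom X Y → k) := by
  constructor
  · intro Z W p a b q
    by_cases h : p.length + q.length = 1
    · cases p with
      | nil => cases q with
        | nil => simp at h
        | cons c q => cases q with
          | nil => simp [idComp, add_mul]
          | cons d q => simp at h
      | cons c p => cases p with
        | cons d p => simp only [Chain.length_cons] at h; omega
        | nil => cases q with
          | nil => simp [idComp, mul_add]
          | cons d q => simp at h
    · rw [idComp_eq_zero, idComp_eq_zero, idComp_eq_zero, add_zero] <;>
        simp only [Chain.length_append, Chain.length_cons] <;> omega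
  · intro Z W p r a q
    by_cases h : p.length + q.length = 1
    · cases p with
      | nil => cases q with
        | nil => simp at h
        | cons c q => cases q with
          | nil => simp [idComp, mul_assoc]
          | cons d q => simp at h
      | cons c p => cases p with
        | cons d p => simp only [Chain.length_cons] at h; omega
        | nil => cases q with
          | nil => simp [idComp, mul_left_comm]
          | cons d q => simp at h
    · rw [idComp_eq_zero, idComp_eq_zero, smul_zero] <;>
        simp only [Chain.length_append, Chain.length_cons] <;> omega

theorem vComp_multilin : (cyc k s).Multilin (vComp : Chain (cyc k s).Hom X Y → k) := by
  constructor
  · intro Z W p a b q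
    by_cases h : p.length + q.length = 1
    · cases p with
      | nil => cases q with
        | nil => simp at h
        | cons c q => cases q with
          | nil => simp only [Chain.nil_append, vComp, map_add]; ring
          | cons d q => simp at h
      | cons c p => cases p with
        | cons d p => simp only [Chain.length_cons] at h; omega
        | nil => cases q with
          | nil => simp only [Chain.nil_append, Chain.cons_append, vComp, map_add]; ring
          | cons d q => simp at h
    · rw [vComp_eq_zero, vComp_eq_zero, vComp_eq_zero, add_zero] <;>
        simp only [Chain.length_append, Chain.length_cons] <;> omega
  · intro Z W p r a q
    by_cases h : p.length + q.length = 1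
    · cases p with
      | nil => cases q with
        | nil => simp at h
        | cons c q => cases q with
          | nil => simp only [Chain.nil_append, vComp, map_smul, smul_eq_mul]; ring
          | cons d q => simp at h
      | cons c p => cases p with
        | cons d p => simp only [Chain.length_cons] at h; omega
        | nil => cases q with
          | nil =>
            simp only [Chain.nil_append, Chain.cons_append, vComp, map_smul, smul_eq_mul]; ring
          | cons d q => simp at h
    · rw [vComp_eq_zero, vComp_eq_zero, smul_zero] <;>
        simp only [Chain.length_append, Chain.length_cons] <;> omega

theorem IsHomog.idc_eq_zero {p : ZMod 2} {a : (cyc k s).Hom X Y} (h : (cyc k s).IsHomog p a)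
    (hp : p ≠ 0) : idc _ _ a = 0 := by
  rw [← show (cyc k s).proj p a = a from h, idc_proj, if_neg hp]

theorem IsHomog.vc_eq_zero {p : ZMod 2} {a : (cyc k s).Hom X Y} (h : (cyc k s).IsHomog p a)
    (hp : p ≠ 1) : vc _ _ a = 0 := by
  rw [← show (cyc k s).proj p a = a from h, vc_proj, if_neg hp]

theorem degree_of_vProd_ne_zero {p : ZMod 2} {c : Chain (cyc k s).Hom X Y}
    (h : (cyc k s).ChainHomog c p) (h0 : vProd c ≠ 0) : p = c.length := by
  induction c generalizing p with
  | nil => simpa [ChainHomog] using h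
  | cons a c ih =>
    obtain ⟨q, r, hq, hr, rfl⟩ := h
    have h1 : q = 1 := by
      by_contra h1
      exact h0 (by rw [vProd, IsHomog.vc_eq_zero hq h1, zero_mul])
    rw [ih hr (right_ne_zero_of_mul h0), h1, Chain.length_cons]
    push_cast
    ring

theorem degree_of_idComp_ne_zero {p : ZMod 2} {c : Chain (cyc k s).Hom X Y}
    (h : (cyc k s).ChainHomog c p) (h0 : idComp c ≠ 0) : p + 2 - (c.length : ZMod 2) = 0 := by
  cases c with
  | nil => exact absurd rfl h0
  | cons a c => cases c with
    | nil => exact absurd rfl h0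
    | cons b c => cases c with
      | cons d c => exact absurd rfl h0
      | nil =>
        obtain ⟨q, _, hq, ⟨r, _, hr, rfl, rfl⟩, rfl⟩ := h
        have h1 : q = 0 := by
          by_contra h1
          exact h0 (by rw [idComp, IsHomog.idc_eq_zero hq h1, zero_mul])
        have h2 : r = 0 := by
          by_contra h2
          exact h0 (by rw [idComp, IsHomog.idc_eq_zero hr h2, mul_zero])
        subst h1 h2
        change (0 : ZMod 2) + (0 + 0) + 2 - ((2 : ℕ) : ZMod 2) = 0
        decide

theorem degree_of_vComp_ne_zero {p : ZMod 2} {c : Chain (cyc k s).Hom X Y}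
    (h : (cyc k s).ChainHomog c p) (h0 : vComp c ≠ 0) : p + 2 - (c.length : ZMod 2) = 1 := by
  cases c with
  | nil => exact absurd rfl h0
  | cons a c => cases c with
    | nil => exact absurd rfl h0
    | cons b c => cases c with
      | cons d c => exact absurd rfl h0
      | nil =>
        obtain ⟨q, _, hq, ⟨r, _, hr, rfl, rfl⟩, rfl⟩ := h
        obtain rfl | rfl := zmod_two_cases q <;> obtain rfl | rfl := zmod_two_cases r
        · exact absurd (by rw [vComp, IsHomog.vc_eq_zero hr zero_ne_one,
            IsHomog.vc_eq_zero hq zero_ne_one]; ring) h0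
        · change (0 : ZMod 2) + (1 + 0) + 2 - ((2 : ℕ) : ZMod 2) = 1
          decide
        · change (1 : ZMod 2) + (0 + 0) + 2 - ((2 : ℕ) : ZMod 2) = 1
          decide
        · exact absurd (by rw [vComp, IsHomog.idc_eq_zero hr one_ne_zero,
            IsHomog.idc_eq_zero hq one_ne_zero]; ring) h0

theorem idc_one : idc X X ((cyc k s).one X) = 1 := (idc_mkHom 1 0).trans (if_pos rfl)

theorem vc_one : vc X X ((cyc k s).one X) = 0 := (vc_mkHom 1 0).trans (ite_self _)

theorem isAInf : (cyc k s).IsAInf where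
  μ_nil X := CycGen.μ_nil _ _
  μ_add p a b q := by
    refine ext ?_ ?_
    · simp only [map_add, idc_μ, idComp_multilin.add, (vProdOf_multilin _).add]; ring
    · simp only [map_add, vc_μ, vComp_multilin.add]
  μ_smul p r a q := by
    refine ext ?_ ?_
    · simp only [map_smul, idc_μ, idComp_multilin.smul, (vProdOf_multilin _).smul, smul_add]
    · simp only [map_smul, vc_μ, vComp_multilin.smul]
  μ_deg c p hc := by
    refine ext ?_ ?_
    · rw [idc_proj, ite_eq_left_iff]
      intro h
      rw [idc_μ]
      have h1 : idComp c = 0 := by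
        by_contra h1
        exact h (degree_of_idComp_ne_zero hc h1)
      rw [h1, zero_add, vProdOf]
      split_ifs
      · by_contra h2
        rw [degree_of_vProd_ne_zero hc (Ne.symm h2)] at h
        exact h (by rw [add_sub_cancel_left]; rfl)
      · rfl
    · rw [vc_proj, ite_eq_left_iff]
      intro h
      rw [vc_μ]
      by_contra h1
      exact h (degree_of_vComp_ne_zero hc (Ne.symm h1))
  relation := insertSum_μ
  one_deg X := by
    refine ext ?_ ?_
    · rw [idc_proj, if_pos rfl]
    · rw [vc_proj, if_neg zero_ne_one, vc_one]
  μ_one_left a := by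
    refine ext ?_ ?_
    · rw [sgn_eq_neg_redSgn, map_neg, idc_redSgn, idc_μ]
      simp [Chain.pair, Chain.single, idComp, vProdOf, vProd, vc_one, idc_one]
    · rw [sgn_eq_neg_redSgn, map_neg, vc_redSgn, vc_μ]
      simp [Chain.pair, Chain.single, vComp, vc_one, idc_one]
  μ_one_right a := by
    refine ext ?_ ?_
    · rw [idc_μ]
      simp [Chain.pair, Chain.single, idComp, vProdOf, vProd, vc_one, idc_one]
    · rw [vc_μ]
      simp [Chain.pair, Chain.single, vComp, vc_one, idc_one]
  μ_one p q h := by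
    have hl : (p.append (.cons ((cyc k s).one _) q)).length ≠ 2 := by
      simp only [Chain.length_append, Chain.length_cons]; omega
    refine ext ?_ ?_
    · rw [idc_μ, idComp_eq_zero hl, vProdOf, vProd_append, vProd, vc_one]
      simp
    · rw [vc_μ, vComp_eq_zero hl, map_zero]

end cyc

namespace AInfData

variable {k : Type u} [Field k] {A : AInfData.{u, v, w} k} {M : Type*} [AddCommGroup M]

theorem isHomog_one_of_chainHomog_single {X Y : A.Ob} {a : A.Hom X Y} {p : ZMod 2}
    (h : A.ChainHomog (.single a) p) : A.IsHomog p a := by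
  obtain ⟨q, _, hq, rfl, rfl⟩ := h
  rwa [add_zero]

/-- The axioms of an `A_∞`-category, in the case that there are no operations with at least three
entries. -/
theorem IsAInf.of_dg (nil : ∀ X : A.Ob, A.μ (.nil X) = 0)
    (long : ∀ {X Y : A.Ob} (c : Chain A.Hom X Y), 3 ≤ c.length → A.μ c = 0)
    (d_add : ∀ {X Y : A.Ob} (a b : A.Hom X Y),
      A.μ (.single (a + b)) = A.μ (.single a) + A.μ (.single b))
    (d_smul : ∀ {X Y : A.Ob} (r : k) (a : A.Hom X Y), A.μ (.single (r • a)) = r • A.μ (.single a))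
    (add_mul : ∀ {X Y Z : A.Ob} (a b : A.Hom X Y) (c : A.Hom Y Z),
      A.μ (.pair (a + b) c) = A.μ (.pair a c) + A.μ (.pair b c))
    (mul_add : ∀ {X Y Z : A.Ob} (a : A.Hom X Y) (b c : A.Hom Y Z),
      A.μ (.pair a (b + c)) = A.μ (.pair a b) + A.μ (.pair a c))
    (smul_mul : ∀ {X Y Z : A.Ob} (r : k) (a : A.Hom X Y) (c : A.Hom Y Z),
      A.μ (.pair (r • a) c) = r • A.μ (.pair a c))
    (mul_smul : ∀ {X Y Z : A.Ob} (r : k) (a : A.Hom X Y) (c : A.Hom Y Z),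
      A.μ (.pair a (r • c)) = r • A.μ (.pair a c))
    (d_deg : ∀ {X Y : A.Ob} (a : A.Hom X Y) (p : ZMod 2), A.IsHomog p a →
      A.IsHomog (p + 1) (A.μ (.single a)))
    (mul_deg : ∀ {X Y Z : A.Ob} (a : A.Hom X Y) (b : A.Hom Y Z) (p q : ZMod 2), A.IsHomog p a →
      A.IsHomog q b → A.IsHomog (p + q) (A.μ (.pair a b)))
    (d_d : ∀ {X Y : A.Ob} (a : A.Hom X Y), A.μ (.single (A.μ (.single a))) = 0)
    (d_mul : ∀ {X Y Z : A.Ob} (a : A.Hom X Y) (b : A.Hom Y Z), A.μ (.single (A.μ (.pair a b))) =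
      -A.μ (.pair (A.μ (.single a)) b) - A.μ (.pair (A.redSgn a) (A.μ (.single b))))
    (assoc : ∀ {X Y Z W : A.Ob} (a : A.Hom X Y) (b : A.Hom Y Z) (c : A.Hom Z W),
      A.μ (.pair (A.μ (.pair a b)) c) = -A.μ (.pair (A.redSgn a) (A.μ (.pair b c))))
    (one_deg : ∀ X : A.Ob, A.IsHomog 0 (A.one X))
    (mul_one : ∀ {X Y : A.Ob} (a : A.Hom X Y), A.μ (.pair a (A.one Y)) = A.sgn a)
    (one_mul : ∀ {X Y : A.Ob} (a : A.Hom X Y), A.μ (.pair (A.one X) a) = a)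
    (d_one : ∀ X : A.Ob, A.μ (.single (A.one X)) = 0) : A.IsAInf where
  μ_nil := nil
  μ_add {X Y Z W} p a b q := by
    by_cases h : p.length + q.length ≤ 1
    · cases p with
      | nil => cases q with
        | nil => exact d_add a b
        | cons c q => cases q with
          | nil => exact add_mul a b c
          | cons d q => simp only [Chain.length_cons] at h; omega
      | cons c p => cases p with
        | cons d p => simp only [Chain.length_cons] at h; omega
        | nil => cases q with
          | nil => exact mul_add c a b
          | cons d q => simp only [Chain.length_cons] at h; omega
    · rw [long, long, long, add_zero] <;>
        simp only [Chain.length_append, Chain.length_cons] <;> omega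
  μ_smul {X Y Z W} p r a q := by
    by_cases h : p.length + q.length ≤ 1
    · cases p with
      | nil => cases q with
        | nil => exact d_smul r a
        | cons c q => cases q with
          | nil => exact smul_mul r a c
          | cons d q => simp only [Chain.length_cons] at h; omega
      | cons c p => cases p with
        | cons d p => simp only [Chain.length_cons] at h; omega
        | nil => cases q with
          | nil => exact mul_smul r c a
          | cons d q => simp only [Chain.length_cons] at h; omega
    · rw [long, long, smul_zero] <;>
        simp only [Chain.length_append, Chain.length_cons] <;> omega
  μ_deg {X Y} c p hc := by
    cases c with
    | nil => rw [nil]; exact isHomog_zero _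
    | cons a c => cases c with
      | nil =>
        have := d_deg a p (isHomog_one_of_chainHomog_single hc)
        rwa [show p + 1 = p + 2 - ((1 : ℕ) : ZMod 2) by
          obtain rfl | rfl := zmod_two_cases p <;> decide] at this
      | cons b c => cases c with
        | nil =>
          obtain ⟨q, r, hq, hr, rfl⟩ := hc
          have := mul_deg a b q r hq (isHomog_one_of_chainHomog_single hr)
          rwa [show q + r = q + r + 2 - ((2 : ℕ) : ZMod 2) by simp] at this
        | cons d c => rw [long _ (by simp)]; exact isHomog_zero _
  relation {X Y} c := by
    have d_zero {X Y : A.Ob} : A.μ (.cons (0 : A.Hom X Y) (.nil Y)) = 0 := by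
      have := d_smul 0 (0 : A.Hom X Y)
      rwa [zero_smul, zero_smul] at this
    have zero_mul {X Y Z : A.Ob} (c : A.Hom Y Z) : A.μ (.cons (0 : A.Hom X Y) (.cons c (.nil Z))) = 0 := by
      have := smul_mul 0 (0 : A.Hom X Y) c
      rwa [zero_smul, zero_smul] at this
    have mul_zero {X Y Z : A.Ob} (c : A.Hom X Y) : A.μ (.cons c (.cons (0 : A.Hom Y Z) (.nil Z))) = 0 := by
      have := mul_smul 0 c (0 : A.Hom Y Z)
      rwa [zero_smul, zero_smul] at this
    by_cases h : 4 ≤ c.length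
    · rw [insertSum_eq]
      refine Chain.splitSum_eq_zero fun Z p q e => Chain.splitSum_eq_zero fun Z' p' q' e' => ?_
      by_cases hp' : 3 ≤ p'.length
      · rw [long _ hp']
        by_cases hl : 3 ≤ p.length + 1 + q'.length
        · exact long _ (by simp only [Chain.length_append, Chain.length_map, Chain.length_cons]; omega)
        · cases p with
          | nil => cases q' with
            | nil => exact d_zero
            | cons a q' => cases q' with
              | nil => exact zero_mul a
              | cons b q' => simp only [Chain.length_cons] at hl; omega
          | cons a p => cases p with
            | cons b p => simp only [Chain.length_cons] at hl; omega
            | nil => cases q' with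
              | nil => exact mul_zero _
              | cons b q' => simp only [Chain.length_cons] at hl; omega
      · refine long _ ?_
        have h1 := congrArg Chain.length e
        have h2 := congrArg Chain.length e'
        simp only [Chain.length_append, Chain.length_map, Chain.length_cons] at h1 h2 ⊢
        omega
    · have l3 {X Y Z W : A.Ob} (a : A.Hom X Y) (b : A.Hom Y Z) (c : A.Hom Z W) :
          A.μ (.cons a (.cons b (.cons c (.nil W)))) = 0 := long _ (by simp)
      have l4 {X Y Z W V : A.Ob} (a : A.Hom X Y) (b : A.Hom Y Z) (c : A.Hom Z W) (d : A.Hom W V) :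
          A.μ (.cons a (.cons b (.cons c (.cons d (.nil V))))) = 0 := long _ (by simp)
      cases c with
      | nil => rw [insertSum_nil, nil]; exact d_zero
      | cons a c => cases c with
        | nil =>
          have := d_d a
          simp only [Chain.single, insertSum_cons, insertSum_nil, headSum, nil, zero_mul,
            mul_zero, Chain.splitSum_cons, Chain.splitSum_nil] at this ⊢
          rw [this]; simp
        | cons b c => cases c with
          | nil =>
            have := d_mul a b
            simp only [Chain.single, Chain.pair, insertSum_cons, insertSum_nil, headSum, nil,
              l3, Chain.splitSum_cons, Chain.splitSum_nil] at this ⊢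
            rw [this]; abel
          | cons d c => cases c with
            | nil =>
              have := assoc a b d
              simp only [Chain.single, Chain.pair, insertSum_cons, insertSum_nil, headSum, nil,
                d_zero, l3, l4, Chain.splitSum_cons, Chain.splitSum_nil] at this ⊢
              rw [this]; abel
            | cons e c => simp only [Chain.length_cons] at h; omega
  one_deg := one_deg
  μ_one_left := mul_one
  μ_one_right := one_mul
  μ_one {X Y Z} p q h := by
    cases p with
    | nil => cases q with
      | nil => exact d_one _
      | cons a q => cases q with
        | nil => exact absurd rfl h
        | cons b q => exact long _ (by simp)
    | cons a p => cases p with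
      | nil => cases q with
        | nil => exact absurd rfl h
        | cons b q => exact long _ (by simp)
      | cons b p => exact long _ (by simp; omega)

end AInfData

/-! ### Two-periodic complexes -/

namespace PerComplex

variable {𝒜 : Type v} [Category.{w} 𝒜] [Preadditive 𝒜] {X Y Z W : PerComplex 𝒜}

theorem comp_assoc (a : Hom X Y) (b : Hom Y Z) (c : Hom Z W) :
    comp (comp a b) c = comp a (comp b c) := by
  funext i j
  simp only [comp, Preadditive.sum_comp, Preadditive.comp_sum, Category.assoc]
  rw [Finset.sum_comm]

theorem comp_d_d (X : PerComplex 𝒜) : comp X.d X.d = 0 := by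
  funext i j
  exact X.d_sq i j

theorem sgn_sgn (a : Hom X Y) : sgn (sgn a) = a := by
  funext i j
  simp only [sgn]
  split_ifs <;> simp

theorem sgn_d (X : PerComplex 𝒜) : sgn X.d = -X.d := by
  funext i j
  simp only [sgn]
  split_ifs with h
  · subst h
    have : i ≠ i + 1 := by revert i; decide
    simp [X.d_deg i i this]
  · rfl

theorem sgn_comp (a : Hom X Y) (b : Hom Y Z) : sgn (comp a b) = comp (sgn a) (sgn b) := by
  have key (i j l : ZMod 2) : (if i = j then a i l ≫ b l j else -(a i l ≫ b l j)) =
      (if i = l then a i l else -a i l) ≫ (if l = j then b l j else -b l j) := by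
    obtain rfl | h1 := eq_or_ne i l
    · obtain rfl | h2 := eq_or_ne i j
      · rw [if_pos rfl, if_pos rfl, if_pos rfl]
      · rw [if_neg h2, if_pos rfl, if_neg h2, Preadditive.comp_neg]
    · obtain rfl | h2 := eq_or_ne l j
      · rw [if_neg h1, if_neg h1, if_pos rfl, Preadditive.neg_comp]
      · have h3 : i = j := by revert i j l; decide
        rw [if_pos h3, if_neg h1, if_neg h2, Preadditive.neg_comp, Preadditive.comp_neg, neg_neg]
  funext i j
  simp only [sgn, comp]
  rw [← Finset.sum_congr rfl fun l _ => key i j l]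
  split_ifs
  · rfl
  · rw [Finset.sum_neg_distrib]

theorem add_comp (a b : Hom X Y) (c : Hom Y Z) : comp (a + b) c = comp a c + comp b c := by
  funext i j
  simp [comp, Preadditive.add_comp, Finset.sum_add_distrib]

theorem comp_add (a : Hom X Y) (b c : Hom Y Z) : comp a (b + c) = comp a b + comp a c := by
  funext i j
  simp [comp, Preadditive.comp_add, Finset.sum_add_distrib]

theorem neg_comp (a : Hom X Y) (c : Hom Y Z) : comp (-a) c = -comp a c := by
  funext i j
  simp [comp, Finset.sum_neg_distrib]

theorem comp_neg (a : Hom X Y) (c : Hom Y Z) : comp a (-c) = -comp a c := by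
  funext i j
  simp [comp, Finset.sum_neg_distrib]

theorem sgn_add (a b : Hom X Y) : sgn (a + b) = sgn a + sgn b := by
  funext i j
  simp only [sgn, Pi.add_apply]
  split_ifs
  · rfl
  · rw [neg_add]

theorem sgn_neg (a : Hom X Y) : sgn (-a) = -sgn a := by
  funext i j
  simp only [sgn, Pi.neg_apply]
  split_ifs <;> rfl

section Linear

variable {k : Type u} [Field k] [Linear k 𝒜]

theorem smul_comp (r : k) (a : Hom X Y) (c : Hom Y Z) : comp (r • a) c = r • comp a c := by
  funext i j
  simp [comp, Finset.smul_sum]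

theorem comp_smul (r : k) (a : Hom X Y) (c : Hom Y Z) : comp a (r • c) = r • comp a c := by
  funext i j
  simp [comp, Finset.smul_sum]

theorem sgn_smul (r : k) (a : Hom X Y) : sgn (r • a) = r • sgn a := by
  funext i j
  simp only [sgn, Pi.smul_apply]
  split_ifs <;> simp

end Linear

/-- The differential of a morphism, with the sign of `μ₁`. -/
def dif (a : Hom X Y) : Hom X Y := comp (sgn a) Y.d - comp X.d a

theorem dif_add (a b : Hom X Y) : dif (a + b) = dif a + dif b := by
  rw [dif, sgn_add, add_comp, comp_add]
  exact add_sub_add_comm _ _ _ _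

theorem dif_smul {k : Type u} [Field k] [Linear k 𝒜] (r : k) (a : Hom X Y) :
    dif (r • a) = r • dif a := by
  rw [dif, sgn_smul, smul_comp, comp_smul]
  exact (smul_sub r _ _).symm

theorem dif_dif (a : Hom X Y) : dif (dif a) = 0 := by
  have z1 : comp a (comp Y.d Y.d) = 0 := by
    rw [comp_d_d]; funext i j; simp [comp]
  have z2 : comp X.d (comp X.d a) = 0 := by
    rw [← comp_assoc, comp_d_d]; funext i j; simp [comp]
  simp only [dif, sub_eq_add_neg, sgn_add, sgn_neg, sgn_comp, sgn_sgn, sgn_d, add_comp, comp_add,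
    neg_comp, comp_neg, comp_assoc, z1, z2]
  abel

theorem dif_mul (a : Hom X Y) (b : Hom Y Z) : dif (comp (sgn a) b) =
    -comp (sgn (dif a)) b - comp (sgn (-sgn a)) (dif b) := by
  simp only [dif, sub_eq_add_neg, sgn_add, sgn_neg, sgn_comp, sgn_sgn, sgn_d, add_comp, comp_add,
    neg_comp, comp_neg, comp_assoc, neg_neg, neg_add]
  abel

theorem mul_assoc (a : Hom X Y) (b : Hom Y Z) (c : Hom Z W) :
    comp (sgn (comp (sgn a) b)) c = -comp (sgn (-sgn a)) (comp (sgn b) c) := by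
  simp only [sgn_neg, sgn_comp, sgn_sgn, neg_comp, comp_assoc, neg_neg]

end PerComplex

namespace perDG

open AInfData PerComplex

variable {k : Type u} [Field k] {𝒜 : Type v} [Category.{w} 𝒜] [Preadditive 𝒜] [Linear k 𝒜]
  {P : 𝒜 → Prop} {X Y Z : (perDG k P).Ob}

theorem sgn_eq (a : (perDG k P).Hom X Y) : (perDG k P).sgn a = PerComplex.sgn a := by
  funext i j
  change (if j = i + 0 then a i j else 0) - (if j = i + 1 then a i j else 0) =
    if i = j then a i j else -a i j
  have : j = i ∨ j = i + 1 := by revert i j; decide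
  have h1 : ¬ (1 : ZMod 2) = 0 := by decide
  rcases this with rfl | rfl <;> simp

theorem redSgn_eq (a : (perDG k P).Hom X Y) : (perDG k P).redSgn a = -PerComplex.sgn a := by
  refine Eq.trans ?_ (congrArg Neg.neg (sgn_eq a))
  rw [sgn_eq_neg_redSgn]
  exact (neg_neg _).symm

theorem isHomog_iff {p : ZMod 2} {a : (perDG k P).Hom X Y} :
    (perDG k P).IsHomog p a ↔ ∀ i j, j ≠ i + p → a i j = 0 := by
  constructor
  · intro h i j hij
    rw [← show (perDG k P).proj p a = a from h]
    exact if_neg hij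
  · intro h
    funext i j
    change (if j = i + p then a i j else 0) = a i j
    split_ifs with hij
    · rfl
    · exact (h i j hij).symm

theorem isHomog_comp {p q : ZMod 2} {a : (perDG k P).Hom X Y} {b : (perDG k P).Hom Y Z}
    (ha : (perDG k P).IsHomog p a) (hb : (perDG k P).IsHomog q b) :
    (perDG k P).IsHomog (X := X) (Y := Z) (p + q) (comp a b) := by
  rw [isHomog_iff] at ha hb
  refine isHomog_iff.2 fun i j hij => ?_
  refine Finset.sum_eq_zero fun l _ => ?_
  by_cases hl : l = i + p
  · rw [hb l j (by rw [hl, add_assoc]; exact hij), Limits.comp_zero]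
  · rw [ha i l hl, Limits.zero_comp]

theorem isHomog_sgn {p : ZMod 2} {a : (perDG k P).Hom X Y} (ha : (perDG k P).IsHomog p a) :
    (perDG k P).IsHomog (X := X) (Y := Y) p (PerComplex.sgn a) := by
  rw [isHomog_iff] at ha
  refine isHomog_iff.2 fun i j hij => ?_
  simp [PerComplex.sgn, ha i j hij]

theorem isHomog_d (X : (perDG k P).Ob) : (perDG k P).IsHomog (X := X) (Y := X) 1 X.1.d :=
  isHomog_iff.2 X.1.d_deg

theorem one_comp (a : PerComplex.Hom X.1 Y.1) : comp ((perDG k P).one X) a = a := by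
  funext i j
  change ∑ l, (if h : i = l then eqToHom (by rw [h]) else 0 : X.1.X i ⟶ X.1.X l) ≫ a l j = a i j
  rw [Finset.sum_eq_single i]
  · simp
  · intro l _ hl
    rw [dif_neg (Ne.symm hl), Limits.zero_comp]
  · simp

theorem comp_one (a : PerComplex.Hom X.1 Y.1) : comp a ((perDG k P).one Y) = a := by
  funext i j
  change ∑ l, a i l ≫ (if h : l = j then eqToHom (by rw [h]) else 0 : Y.1.X l ⟶ Y.1.X j) = a i j
  rw [Finset.sum_eq_single j]
  · simp
  · intro l _ hl
    rw [dif_neg hl, Limits.comp_zero]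
  · simp

theorem one_deg (X : (perDG k P).Ob) : (perDG k P).IsHomog 0 ((perDG k P).one X) :=
  isHomog_iff.2 fun i j h => dif_neg fun e => h (by rw [e, add_zero])

theorem sgn_one (X : (perDG k P).Ob) :
    PerComplex.sgn (X := X.1) (Y := X.1) ((perDG k P).one X) = (perDG k P).one X := by
  funext i j
  change (if i = j then (perDG k P).one X i j else -(perDG k P).one X i j) = _
  split_ifs with h
  · rfl
  · rw [isHomog_iff.1 (one_deg X) i j fun e => h (by rw [e, add_zero]), neg_zero]

theorem isAInf : (perDG k P).IsAInf := by
  refine IsAInf.of_dg (fun _ => rfl) ?_ ?_ ?_ ?_ ?_ ?_ ?_ ?_ ?_ ?_ ?_ ?_ one_deg ?_ ?_ ?_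
  · intro X Y c hc
    cases c with
    | nil => rfl
    | cons a c => cases c with
      | nil => simp at hc
      | cons b c => cases c with
        | nil => simp at hc
        | cons d c => rfl
  · exact fun a b => dif_add _ _
  · exact fun r a => dif_smul _ _
  · intro X Y Z a b c
    exact (congrArg (comp · c) (PerComplex.sgn_add (X := X.1) a b)).trans (PerComplex.add_comp _ _ _)
  · exact fun a b c => PerComplex.comp_add _ _ _
  · intro X Y Z r a c
    exact (congrArg (comp · c) (PerComplex.sgn_smul (X := X.1) r a)).trans
      (PerComplex.smul_comp _ _ _)
  · exact fun r a c => PerComplex.comp_smul _ _ _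
  · intro X Y a p ha
    refine (congrArg ((perDG k P).IsHomog (X := X) (Y := Y) (p + 1)) (sub_eq_add_neg
      (comp (PerComplex.sgn (X := X.1) a) Y.1.d) (comp X.1.d a))).mpr ?_
    refine (isHomog_comp (isHomog_sgn ha) (isHomog_d Y)).add (IsHomog.neg ?_)
    rw [add_comm]
    exact isHomog_comp (isHomog_d X) ha
  · exact fun a b p q ha hb => isHomog_comp (isHomog_sgn ha) hb
  · exact fun a => dif_dif _
  · intro X Y Z a b
    rw [redSgn_eq]
    exact dif_mul _ _
  · intro X Y Z W a b c
    rw [redSgn_eq]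
    exact PerComplex.mul_assoc _ _ _
  · intro X Y a
    rw [sgn_eq]
    exact comp_one _
  · intro X Y a
    exact (congrArg (comp · a) (sgn_one X)).trans (one_comp a)
  · intro X
    refine (congrArg (fun a => comp a X.1.d - comp X.1.d ((perDG k P).one X)) (sgn_one X)).trans ?_
    rw [one_comp, comp_one]
    exact sub_self _

end perDG

/-! ### The differential and the product of an `A_∞`-category -/

namespace AInfData

section Basic

variable {k : Type u} [Field k] (A : AInfData.{u, v, w} k) {X Y Z W : A.Ob}

/-- The differential `μ₁`. -/
def d (a : A.Hom X Y) : A.Hom X Y := A.μ (.single a)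

/-- The product `μ₂`, with its arguments in the order of composition. -/
def mul (a : A.Hom X Y) (b : A.Hom Y Z) : A.Hom X Z := A.μ (.pair a b)

end Basic

/-- The product `μ₂`, with its arguments in the order of composition. -/
notation:70 a:71 " ⊚ " b:70 => AInfData.mul _ a b

variable {k : Type u} [Field k] {A : AInfData.{u, v, w} k} {X Y Z W : A.Ob}

namespace IsAInf

/-- The differential as a linear map. -/
def dₗ (h : A.IsAInf) (X Y : A.Ob) : A.Hom X Y →ₗ[k] A.Hom X Y where
  toFun := A.d
  map_add' a b := h.μ_add (.nil X) a b (.nil Y)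
  map_smul' r a := h.μ_smul (.nil X) r a (.nil Y)

/-- The product as a bilinear map. -/
def mulₗ (h : A.IsAInf) (X Y Z : A.Ob) : A.Hom X Y →ₗ[k] A.Hom Y Z →ₗ[k] A.Hom X Z :=
  LinearMap.mk₂ k (A.mul) (fun a b c => h.μ_add (.nil X) a b (.single c))
    (fun r a c => h.μ_smul (.nil X) r a (.single c))
    (fun a b c => h.μ_add (.single a) b c (.nil Z))
    (fun r a c => h.μ_smul (.single a) r c (.nil Z))

theorem d_add (h : A.IsAInf) (a b : A.Hom X Y) : A.d (a + b) = A.d a + A.d b := (h.dₗ X Y).map_add a b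
theorem d_sub (h : A.IsAInf) (a b : A.Hom X Y) : A.d (a - b) = A.d a - A.d b := (h.dₗ X Y).map_sub a b
theorem d_neg (h : A.IsAInf) (a : A.Hom X Y) : A.d (-a) = -A.d a := (h.dₗ X Y).map_neg a
theorem d_zero (h : A.IsAInf) : A.d (0 : A.Hom X Y) = 0 := (h.dₗ X Y).map_zero
theorem d_smul (h : A.IsAInf) (r : k) (a : A.Hom X Y) : A.d (r • a) = r • A.d a := (h.dₗ X Y).map_smul r a
theorem dd (h : A.IsAInf) (a : A.Hom X Y) : A.d (A.d a) = 0 := h.d_d a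

theorem add_mul (h : A.IsAInf) (a b : A.Hom X Y) (c : A.Hom Y Z) : (a + b) ⊚ c = a ⊚ c + b ⊚ c :=
  LinearMap.map_add₂ (h.mulₗ X Y Z) a b c
theorem sub_mul (h : A.IsAInf) (a b : A.Hom X Y) (c : A.Hom Y Z) : (a - b) ⊚ c = a ⊚ c - b ⊚ c :=
  LinearMap.map_sub₂ (h.mulₗ X Y Z) a b c
theorem neg_mul (h : A.IsAInf) (a : A.Hom X Y) (c : A.Hom Y Z) : (-a) ⊚ c = -(a ⊚ c) :=
  LinearMap.map_neg₂ (h.mulₗ X Y Z) a c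
theorem zero_mul (h : A.IsAInf) (c : A.Hom Y Z) : (0 : A.Hom X Y) ⊚ c = 0 := LinearMap.map_zero₂ (h.mulₗ X Y Z) c
theorem smul_mul (h : A.IsAInf) (r : k) (a : A.Hom X Y) (c : A.Hom Y Z) : (r • a) ⊚ c = r • (a ⊚ c) :=
  LinearMap.map_smul₂ (h.mulₗ X Y Z) r a c
theorem mul_add (h : A.IsAInf) (a : A.Hom X Y) (b c : A.Hom Y Z) : a ⊚ (b + c) = a ⊚ b + a ⊚ c :=
  (h.mulₗ X Y Z a).map_add b c
theorem mul_sub (h : A.IsAInf) (a : A.Hom X Y) (b c : A.Hom Y Z) : a ⊚ (b - c) = a ⊚ b - a ⊚ c :=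
  (h.mulₗ X Y Z a).map_sub b c
theorem mul_neg (h : A.IsAInf) (a : A.Hom X Y) (c : A.Hom Y Z) : a ⊚ (-c) = -(a ⊚ c) :=
  (h.mulₗ X Y Z a).map_neg c
theorem mul_zero (h : A.IsAInf) (a : A.Hom X Y) : a ⊚ (0 : A.Hom Y Z) = 0 := (h.mulₗ X Y Z a).map_zero
theorem mul_smul (h : A.IsAInf) (r : k) (a : A.Hom X Y) (c : A.Hom Y Z) : a ⊚ (r • c) = r • (a ⊚ c) :=
  (h.mulₗ X Y Z a).map_smul r c

theorem d_mul (h : A.IsAInf) (a : A.Hom X Y) (b : A.Hom Y Z) :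
    A.d (a ⊚ b) = -(A.d a ⊚ b) - A.redSgn a ⊚ A.d b := h.d_pair a b

theorem one_mul (h : A.IsAInf) (a : A.Hom X Y) : A.one X ⊚ a = a := h.μ_one_right a

theorem mul_one (h : A.IsAInf) (a : A.Hom X Y) : a ⊚ A.one Y = A.sgn a := h.μ_one_left a

theorem d_one (h : A.IsAInf) (X : A.Ob) : A.d (A.one X) = 0 := h.μ_one (.nil X) (.nil X) (by simp)

theorem redSgn_d (h : A.IsAInf) (a : A.Hom X Y) : A.redSgn (A.d a) = -A.d (A.redSgn a) := h.redSgn_μ (.single a)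

theorem redSgn_mul (h : A.IsAInf) (a : A.Hom X Y) (b : A.Hom Y Z) :
    A.redSgn (a ⊚ b) = -(A.redSgn a ⊚ A.redSgn b) := h.redSgn_μ (.pair a b)

theorem isHomog_d (h : A.IsAInf) {p : ZMod 2} {a : A.Hom X Y} (ha : A.IsHomog p a) : A.IsHomog (p + 1) (A.d a) := by
  have := h.μ_deg (.single a) p ⟨p, 0, ha, rfl, (add_zero p).symm⟩
  rwa [Chain.length_single, show p + 2 - ((1 : ℕ) : ZMod 2) = p + 1 by
    obtain rfl | rfl := zmod_two_cases p <;> decide] at this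

theorem isHomog_mul (h : A.IsAInf) {p q : ZMod 2} {a : A.Hom X Y} {b : A.Hom Y Z} (ha : A.IsHomog p a)
    (hb : A.IsHomog q b) : A.IsHomog (p + q) (a ⊚ b) := by
  have := h.μ_deg (.pair a b) (p + q) ⟨p, q, ha, ⟨q, 0, hb, rfl, (add_zero q).symm⟩, rfl⟩
  rwa [show ((Chain.pair a b).length : ZMod 2) = 2 from rfl, add_sub_cancel_right] at this

end IsAInf

theorem IsHomog.redSgn_of_zero {a : A.Hom X Y} (h : A.IsHomog 0 a) : A.redSgn a = -a := by
  rw [h.redSgn_eq, if_neg zero_ne_one]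

theorem IsHomog.redSgn_of_one {a : A.Hom X Y} (h : A.IsHomog 1 a) : A.redSgn a = a := by
  rw [h.redSgn_eq, if_pos rfl]

theorem redSgn_sgn (a : A.Hom X Y) : A.redSgn (A.sgn a) = -a := by
  rw [sgn_eq_neg_redSgn, redSgn_neg, redSgn_redSgn]

/-! ### Associativity -/

/-- All objects of a composable sequence satisfy `O`. -/
def Within (O : A.Ob → Prop) : {X Y : A.Ob} → Chain A.Hom X Y → Prop
  | _, _, .nil X => O X
  | X, _, .cons _ c => O X ∧ Within O c

/-- There are no operations with at least three entries between the objects which satisfy `O`. -/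
def StrictOn (A : AInfData.{u, v, w} k) (O : A.Ob → Prop) : Prop :=
  ∀ {X Y : A.Ob} (c : Chain A.Hom X Y), Within O c → 3 ≤ c.length → A.μ c = 0

theorem StrictOn.mul_assoc {O : A.Ob → Prop} (hO : A.StrictOn O) (h : A.IsAInf) (hX : O X)
    (hY : O Y) (hZ : O Z) (hW : O W) (a : A.Hom X Y) (b : A.Hom Y Z) (c : A.Hom Z W) :
    (a ⊚ b) ⊚ c = -(A.redSgn a ⊚ (b ⊚ c)) := by
  have z (a : A.Hom X Y) (b : A.Hom Y Z) (c : A.Hom Z W) : A.μ (.cons a (.pair b c)) = 0 :=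
    hO _ ⟨hX, hY, hZ, hW⟩ (le_refl 3)
  have := h.relation_three a b c
  rw [z, z, z, z, show A.μ (.single (0 : A.Hom X W)) = 0 from h.d_zero, add_zero, add_zero,
    add_zero, add_zero] at this
  exact eq_neg_of_add_eq_zero_left this

end AInfData

/-! ### Functors obtained by homological perturbation -/

/-- A strict functor `f` from a differential graded category to an `A_∞`-category, together with
deformation retractions of the objects of its image to other objects. -/
structure RetractData {k : Type u} [Field k] (A B : AInfData k) (O : B.Ob → Prop) where
  big : A.Ob → B.Ob
  big_mem : ∀ X, O (big X)
  f : ∀ {X Y : A.Ob}, A.Hom X Y →ₗ[k] B.Hom (big X) (big Y)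
  f_deg : ∀ {X Y : A.Ob} {p : ZMod 2} {a : A.Hom X Y}, A.IsHomog p a → B.IsHomog p (f a)
  f_d : ∀ {X Y : A.Ob} (a : A.Hom X Y), f (A.d a) = B.d (f a)
  f_mul : ∀ {X Y Z : A.Ob} (a : A.Hom X Y) (b : A.Hom Y Z), f (a ⊚ b) = f a ⊚ f b
  f_one : ∀ X : A.Ob, f (A.one X) = B.one (big X)
  obj : A.Ob → B.Ob
  obj_mem : ∀ X, O (obj X)
  i : ∀ X, B.Hom (obj X) (big X)
  p : ∀ X, B.Hom (big X) (obj X)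
  h : ∀ X, B.Hom (big X) (big X)
  i_deg : ∀ X, B.IsHomog 0 (i X)
  p_deg : ∀ X, B.IsHomog 0 (p X)
  h_deg : ∀ X, B.IsHomog 1 (h X)
  d_i : ∀ X, B.d (i X) = 0
  d_p : ∀ X, B.d (p X) = 0
  d_h : ∀ X, B.d (h X) = p X ⊚ i X - B.one (big X)
  i_p : ∀ X, i X ⊚ p X = B.one (obj X)
  h_h : ∀ X, h X ⊚ h X = 0
  i_h : ∀ X, i X ⊚ h X = 0
  h_p : ∀ X, h X ⊚ p X = 0

namespace RetractData

open AInfData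

variable {k : Type u} [Field k] {A B : AInfData k} {O : B.Ob → Prop} (D : RetractData A B O)
  {X Y Z W : A.Ob}

/-- The strict functor with the sign conventions of the perturbation. -/
def g (a : A.Hom X Y) : B.Hom (D.big X) (D.big Y) := B.sgn (D.f a)

/-- The part of the perturbation formula which follows an occurrence of `g`. -/
def tail : {X Y : A.Ob} → Chain A.Hom X Y → B.Hom (D.big X) (D.obj Y)
  | _, _, .nil X => D.p X
  | X, _, .cons a c => D.h X ⊚ (D.g a ⊚ tail c)

/-- The perturbation formula, without the first inclusion. -/
def body : {X Y : A.Ob} → Chain A.Hom X Y → B.Hom (D.big X) (D.obj Y)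
  | _, _, .nil _ => 0
  | _, _, .cons a c => D.g a ⊚ D.tail c

/-- The components of the functor obtained by perturbation. -/
def map (c : Chain A.Hom X Y) : B.Hom (D.obj X) (D.obj Y) := D.i X ⊚ D.body c

theorem tail_cons (a : A.Hom X Z) (c : Chain A.Hom Z Y) :
    D.tail (.cons a c) = D.h X ⊚ D.body (.cons a c) := rfl

theorem f_redSgn (a : A.Hom X Y) : D.f (A.redSgn a) = B.redSgn (D.f a) := by
  have e (q : ZMod 2) : D.f (A.proj q a) = B.proj q (D.f a) := by
    have h0 : B.proj q (D.f (A.proj q a)) = D.f (A.proj q a) := D.f_deg (isHomog_proj q a)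
    have h1 : B.proj q (D.f (A.proj (q + 1) a)) = 0 := by
      rw [← show B.proj (q + 1) (D.f (A.proj (q + 1) a)) = D.f (A.proj (q + 1) a) from
        D.f_deg (isHomog_proj _ a), B.proj_proj, if_neg]
      clear h0; revert q; decide
    have h2 : A.proj q a + A.proj (q + 1) a = a := by
      obtain rfl | rfl := zmod_two_cases q
      · exact A.proj_add a
      · exact (add_comm _ _).trans (A.proj_add a)
    rw [← h0]
    conv_rhs => rw [← h2, map_add, map_add, h1, add_zero]
  rw [redSgn, map_sub, e, e, redSgn]

theorem g_redSgn (a : A.Hom X Y) : D.g (A.redSgn a) = B.redSgn (D.g a) := by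
  rw [g, g, f_redSgn, sgn_eq_neg_redSgn, sgn_eq_neg_redSgn, redSgn_neg]

theorem g_add (a b : A.Hom X Y) : D.g (a + b) = D.g a + D.g b := by
  simp only [g, sgn_eq_neg_redSgn, map_add, redSgn_add, neg_add]

theorem g_smul (r : k) (a : A.Hom X Y) : D.g (r • a) = r • D.g a := by
  simp only [g, sgn_eq_neg_redSgn, map_smul, redSgn_smul, smul_neg]

theorem g_zero : D.g (0 : A.Hom X Y) = 0 := by
  simp only [g, sgn_eq_neg_redSgn, map_zero, redSgn_zero, neg_zero]

theorem g_deg {q : ZMod 2} {a : A.Hom X Y} (h : A.IsHomog q a) : B.IsHomog q (D.g a) := by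
  rw [g, sgn_eq_neg_redSgn]
  exact (D.f_deg h).redSgn.neg

theorem redSgn_i (X : A.Ob) : B.redSgn (D.i X) = -D.i X := (D.i_deg X).redSgn_of_zero

theorem redSgn_p (X : A.Ob) : B.redSgn (D.p X) = -D.p X := (D.p_deg X).redSgn_of_zero

theorem redSgn_h (X : A.Ob) : B.redSgn (D.h X) = D.h X := (D.h_deg X).redSgn_of_one

theorem d_g (hB : B.IsAInf) (a : A.Hom X Y) : B.d (D.g a) = -D.g (A.d a) := by
  rw [g, g, D.f_d, sgn_eq_neg_redSgn, sgn_eq_neg_redSgn, hB.d_neg, hB.redSgn_d,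
    neg_neg]

theorem g_mul (hB : B.IsAInf) (a : A.Hom X Y) (b : A.Hom Y Z) : D.g (a ⊚ b) = D.g a ⊚ D.g b := by
  simp only [g, D.f_mul, sgn_eq_neg_redSgn, hB.redSgn_mul, hB.neg_mul, hB.mul_neg]

theorem i_mul (hB : B.IsAInf) (hO : B.StrictOn O) {Z W : B.Ob} (hZ : O Z) (hW : O W)
    (a : B.Hom (D.big X) Z) (b : B.Hom Z W) : (D.i X ⊚ a) ⊚ b = D.i X ⊚ (a ⊚ b) := by
  rw [hO.mul_assoc hB (D.obj_mem X) (D.big_mem X) hZ hW, redSgn_i, hB.neg_mul, neg_neg]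

theorem p_mul (hB : B.IsAInf) (hO : B.StrictOn O) {Z W : B.Ob} (hZ : O Z) (hW : O W)
    (a : B.Hom (D.obj X) Z) (b : B.Hom Z W) : (D.p X ⊚ a) ⊚ b = D.p X ⊚ (a ⊚ b) := by
  rw [hO.mul_assoc hB (D.big_mem X) (D.obj_mem X) hZ hW, redSgn_p, hB.neg_mul, neg_neg]

theorem h_mul (hB : B.IsAInf) (hO : B.StrictOn O) {Z W : B.Ob} (hZ : O Z) (hW : O W)
    (a : B.Hom (D.big X) Z) (b : B.Hom Z W) : (D.h X ⊚ a) ⊚ b = -(D.h X ⊚ (a ⊚ b)) := by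
  rw [hO.mul_assoc hB (D.big_mem X) (D.big_mem X) hZ hW, redSgn_h]

theorem g_mul_mul (hB : B.IsAInf) (hO : B.StrictOn O) {Z W : B.Ob} (hZ : O Z) (hW : O W)
    (x : A.Hom X Y) (a : B.Hom (D.big Y) Z) (b : B.Hom Z W) :
    (D.g x ⊚ a) ⊚ b = -(D.g (A.redSgn x) ⊚ (a ⊚ b)) := by
  rw [hO.mul_assoc hB (D.big_mem X) (D.big_mem Y) hZ hW, g_redSgn]

theorem insertSum_tail (hB : B.IsAInf) (c : Chain A.Hom X Y) :
    A.insertSum D.tail c = D.h X ⊚ A.insertSum D.body c := by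
  refine Eq.trans ?_ (map_insertSum (hB.mulₗ _ _ _ (D.h X)).toAddMonoidHom D.body c).symm
  rw [insertSum_eq, insertSum_eq]
  refine Chain.splitSum_congr fun Z p q _ => Chain.splitSum_congr fun Z' p' q' _ => ?_
  cases p <;> rfl

theorem d_h_mul (hB : B.IsAInf) (hO : B.StrictOn O) (c : Chain A.Hom X Y) :
    B.d (D.h X ⊚ D.body c) = D.body c - D.p X ⊚ D.map c - D.h X ⊚ B.d (D.body c) := by
  rw [hB.d_mul, D.d_h, redSgn_h, hB.sub_mul, hB.one_mul,
    D.p_mul hB hO (D.big_mem X) (D.obj_mem Y), neg_sub]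
  rfl

/-- The sum of the products of the two values at the parts of a sequence. -/
def bodyMap (c : Chain A.Hom X Y) : B.Hom (D.big X) (D.obj Y) :=
  c.splitSum fun _ q r => D.body q ⊚ D.map r

theorem bodyMap_nil (hB : B.IsAInf) : D.bodyMap (.nil X) = 0 := by
  rw [bodyMap, Chain.splitSum_nil, body, hB.zero_mul]

theorem bodyMap_single (hB : B.IsAInf) (a : A.Hom X Y) :
    D.bodyMap (.cons a (.nil Y)) = 0 := by
  rw [bodyMap, Chain.splitSum_cons, Chain.splitSum_nil, body, hB.zero_mul, zero_add, map, body,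
    hB.mul_zero, hB.mul_zero]

theorem bodyMap_cons (hB : B.IsAInf) (hO : B.StrictOn O) (a : A.Hom X Z) (b : A.Hom Z W)
    (c : Chain A.Hom W Y) : D.bodyMap (.cons a (.cons b c)) =
      D.g (A.redSgn a) ⊚ (D.h Z ⊚ D.bodyMap (.cons b c)) -
        D.g (A.redSgn a) ⊚ (D.p Z ⊚ D.map (.cons b c)) := by
  have e : ∀ V (q : Chain A.Hom W V) (r : Chain A.Hom V Y),
      D.body (.cons a (.cons b q)) ⊚ D.map r =
        D.g (A.redSgn a) ⊚ (D.h Z ⊚ (D.body (.cons b q) ⊚ D.map r)) := by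
    intro V q r
    rw [body, tail_cons, D.g_mul_mul hB hO (D.obj_mem V) (D.obj_mem Y),
      D.h_mul hB hO (D.obj_mem V) (D.obj_mem Y), hB.mul_neg, neg_neg]
  have m := Chain.map_splitSum ((hB.mulₗ _ _ _ (D.g (A.redSgn a))).toAddMonoidHom.comp
    (hB.mulₗ _ _ _ (D.h Z)).toAddMonoidHom) (fun V q r => D.body (.cons b q) ⊚ D.map r) c
  have m' : D.g (A.redSgn a) ⊚ (D.h Z ⊚ c.splitSum fun V q r => D.body (.cons b q) ⊚ D.map r) =
      c.splitSum fun V q r => D.g (A.redSgn a) ⊚ (D.h Z ⊚ (D.body (.cons b q) ⊚ D.map r)) := m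
  rw [bodyMap, bodyMap, Chain.splitSum_cons, Chain.splitSum_cons, Chain.splitSum_cons]
  rw [body, hB.zero_mul, zero_add, body, hB.zero_mul, zero_add, m', body, tail,
    D.g_mul_mul hB hO (D.obj_mem Z) (D.obj_mem Y), Chain.splitSum_congr fun V q r _ => e V q r]
  abel

theorem headSum_body (hA : A.IsAInf) (hB : B.IsAInf)
    (hA3 : ∀ {X Y : A.Ob} (c : Chain A.Hom X Y), 3 ≤ c.length → A.μ c = 0)
    (a : A.Hom X Z) (b : A.Hom Z W) (c : Chain A.Hom W Y) :
    headSum D.body (.cons a (.cons b c)) =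
      D.g (A.d a) ⊚ D.tail (.cons b c) + D.g (a ⊚ b) ⊚ D.tail c := by
  rw [headSum, Chain.splitSum_cons, Chain.splitSum_cons, hA.μ_nil, body, g_zero, hB.zero_mul,
    zero_add]
  cases c with
  | nil => rw [Chain.splitSum_nil]; rfl
  | cons d c =>
    rw [Chain.splitSum_cons, Chain.splitSum_eq_zero, add_zero]
    · rfl
    · intro V p q _
      rw [hA3 _ (by simp), body, g_zero, hB.zero_mul]

theorem headSum_body_single (hA : A.IsAInf) (hB : B.IsAInf) (a : A.Hom X Y) :
    headSum D.body (.cons a (.nil Y)) = D.g (A.d a) ⊚ D.p Y := by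
  rw [headSum, Chain.splitSum_cons, Chain.splitSum_nil, hA.μ_nil, body, g_zero, hB.zero_mul,
    zero_add]
  rfl

theorem insertSum_body_redSgn (hB : B.IsAInf) (a : A.Hom X Z) (c : Chain A.Hom Z Y) :
    A.insertSum (fun q => D.body (.cons (A.redSgn a) q)) c =
      D.g (A.redSgn a) ⊚ (D.h Z ⊚ A.insertSum D.body c) := by
  rw [← insertSum_tail D hB]
  exact (map_insertSum (hB.mulₗ _ _ _ (D.g (A.redSgn a))).toAddMonoidHom D.tail c).symm

theorem d_body (hA : A.IsAInf) (hB : B.IsAInf) (hO : B.StrictOn O)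
    (hA3 : ∀ {X Y : A.Ob} (c : Chain A.Hom X Y), 3 ≤ c.length → A.μ c = 0)
    (c : Chain A.Hom X Y) : B.d (D.body c) + D.bodyMap c = A.insertSum D.body c := by
  induction c with
  | nil X =>
    rw [insertSum_nil, body, hB.d_zero, bodyMap_nil D hB, hA.μ_nil, body, g_zero, hB.zero_mul,
      add_zero]
  | @cons X Z Y a c ih =>
    rw [insertSum_cons, insertSum_body_redSgn D hB, body, hB.d_mul, d_g D hB, ← g_redSgn,
      hB.neg_mul, neg_neg]
    cases c with
    | nil Z =>
      have z : A.insertSum D.body (.nil Z) = 0 := by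
        rw [insertSum_nil, hA.μ_nil, body, g_zero, hB.zero_mul]
      rw [tail, D.d_p, hB.mul_zero, sub_zero, bodyMap_single D hB, add_zero,
        headSum_body_single D hA hB, z, hB.mul_zero, hB.mul_zero, add_zero]
    | @cons Z W Y b c =>
      rw [tail_cons, d_h_mul D hB hO, bodyMap_cons D hB hO, headSum_body D hA hB hA3, ← ih,
        tail_cons, hB.mul_sub, hB.mul_sub, hB.mul_add, hB.mul_add, g_mul D hB]
      have e : (D.g a ⊚ D.g b) ⊚ D.tail c = -(D.g (A.redSgn a) ⊚ D.body (.cons b c)) :=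
        D.g_mul_mul hB hO (D.big_mem W) (D.obj_mem Y) a (D.g b) (D.tail c)
      rw [e]
      abel

theorem d_map (hB : B.IsAInf) (c : Chain A.Hom X Y) : B.d (D.map c) = D.i X ⊚ B.d (D.body c) := by
  rw [map, hB.d_mul, D.d_i, hB.zero_mul, neg_zero, zero_sub, redSgn_i, hB.neg_mul, neg_neg]

theorem map_mul_map (hB : B.IsAInf) (hO : B.StrictOn O) (c : Chain A.Hom X Z)
    (e : Chain A.Hom Z Y) : D.map c ⊚ D.map e = D.i X ⊚ (D.body c ⊚ D.map e) :=
  D.i_mul hB hO (D.obj_mem Z) (D.obj_mem Y) _ _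

theorem within_map (c : Chain (fun X Y => Chain A.Hom X Y) X Y) :
    Within O (c.map (H' := B.Hom) D.obj D.map) := by
  induction c with
  | nil X => exact D.obj_mem X
  | cons a c ih => exact ⟨D.obj_mem _, ih⟩

theorem map_relation (hA : A.IsAInf) (hB : B.IsAInf) (hO : B.StrictOn O)
    (hA3 : ∀ {X Y : A.Ob} (c : Chain A.Hom X Y), 3 ≤ c.length → A.μ c = 0)
    (c : Chain A.Hom X Y) :
    c.blockSum (fun b => B.μ (b.map D.obj D.map)) = A.insertSum D.map c := by
  have e : A.insertSum D.map c = D.i X ⊚ A.insertSum D.body c :=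
    (map_insertSum (hB.mulₗ _ _ _ (D.i X)).toAddMonoidHom D.body c).symm
  rw [e, ← d_body D hA hB hO hA3, hB.mul_add, ← d_map D hB]
  have e' : D.i X ⊚ D.bodyMap c = c.splitSum fun _ q r => D.map q ⊚ D.map r := by
    refine (Chain.map_splitSum (hB.mulₗ _ _ _ (D.i X)).toAddMonoidHom _ c).trans ?_
    exact Chain.splitSum_congr fun V q r _ => (map_mul_map D hB hO q r).symm
  have z (X : A.Ob) : D.map (.nil X) = 0 := hB.mul_zero _
  rw [e']
  cases c with
  | nil X =>
    rw [Chain.blockSum_nil, Chain.splitSum_nil, z, hB.d_zero, hB.mul_zero, add_zero]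
    exact hB.μ_nil _
  | cons a p =>
    rw [Chain.blockSum_of_two, Chain.splitSum_cons, z, hB.zero_mul, zero_add]
    · rfl
    · exact fun b hb => hO _ (D.within_map b) (by simpa using hb)
    · intro q
      change D.map q ⊚ D.map (.nil _) = 0
      rw [z, hB.mul_zero]

theorem tail_multilin (hB : B.IsAInf) : A.Multilin (D.tail : Chain A.Hom X Y → _) := by
  constructor
  · intro Z W p a b q
    induction p with
    | nil => simp only [Chain.nil_append, tail, g_add, hB.add_mul, hB.mul_add]
    | cons c p ih => simp only [Chain.cons_append, tail, ih, hB.mul_add]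
  · intro Z W p r a q
    induction p with
    | nil => simp only [Chain.nil_append, tail, g_smul, hB.smul_mul, hB.mul_smul]
    | cons c p ih => simp only [Chain.cons_append, tail, ih, hB.mul_smul]

theorem map_multilin (hB : B.IsAInf) : A.Multilin (D.map : Chain A.Hom X Y → _) := by
  constructor
  · intro Z W p a b q
    cases p with
    | nil => simp only [Chain.nil_append, map, body, g_add, hB.add_mul, hB.mul_add]
    | cons c p => simp only [Chain.cons_append, map, body, (tail_multilin D hB).add, hB.mul_add]
  · intro Z W p r a q
    cases p with
    | nil => simp only [Chain.nil_append, map, body, g_smul, hB.smul_mul, hB.mul_smul]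
    | cons c p => simp only [Chain.cons_append, map, body, (tail_multilin D hB).smul, hB.mul_smul]

theorem tail_deg (hB : B.IsAInf) (c : Chain A.Hom X Y) (q : ZMod 2) (hc : A.ChainHomog c q) :
    B.IsHomog (q + c.length) (D.tail c) := by
  induction c generalizing q with
  | nil X =>
    obtain rfl : q = 0 := hc
    exact D.p_deg X
  | cons a c ih =>
    obtain ⟨r, r', hr, hr', rfl⟩ := hc
    have := hB.isHomog_mul (D.h_deg _) (hB.isHomog_mul (D.g_deg hr) (ih r' hr'))
    rw [tail]
    convert this using 1
    rw [Chain.length_cons]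
    push_cast
    ring

theorem map_deg (hB : B.IsAInf) (c : Chain A.Hom X Y) (q : ZMod 2) (hc : A.ChainHomog c q) :
    B.IsHomog (q + 1 - (c.length : ZMod 2)) (D.map c) := by
  cases c with
  | nil X =>
    rw [map, body, hB.mul_zero]
    exact isHomog_zero _
  | cons a c =>
    obtain ⟨r, r', hr, hr', rfl⟩ := hc
    have := hB.isHomog_mul (D.i_deg _) (hB.isHomog_mul (D.g_deg hr) (tail_deg D hB c r' hr'))
    rw [map, body]
    convert this using 1
    rw [Chain.length_cons, CharTwo.sub_eq_add]
    push_cast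
    have : (1 : ZMod 2) + 1 = 0 := rfl
    linear_combination this

theorem g_one (hB : B.IsAInf) (X : A.Ob) : D.g (A.one X) = B.one (D.big X) := by
  rw [g, D.f_one, sgn_eq_neg_redSgn, (hB.one_deg _).redSgn_of_zero, neg_neg]

theorem h_tail (hB : B.IsAInf) (hO : B.StrictOn O) (c : Chain A.Hom X Y) :
    D.h X ⊚ D.tail c = 0 := by
  cases c with
  | nil => exact D.h_p _
  | cons a c =>
    rw [tail, ← neg_neg (D.h X ⊚ (D.h X ⊚ _)), ← D.h_mul hB hO (D.big_mem X) (D.obj_mem _), D.h_h,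
      hB.zero_mul, neg_zero]

theorem tail_one (hB : B.IsAInf) (hO : B.StrictOn O) (p : Chain A.Hom X Z)
    (q : Chain A.Hom Z Y) : D.tail (p.append (.cons (A.one Z) q)) = 0 := by
  induction p with
  | nil => rw [Chain.nil_append, tail, g_one D hB, hB.one_mul, h_tail D hB hO]
  | cons a p ih => rw [Chain.cons_append, tail, ih, hB.mul_zero, hB.mul_zero]

theorem map_one (hB : B.IsAInf) (hO : B.StrictOn O) (p : Chain A.Hom X Z)
    (q : Chain A.Hom Z Y) (h : 2 ≤ p.length + 1 + q.length) :
    D.map (p.append (.cons (A.one Z) q)) = 0 := by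
  cases p with
  | cons a p => rw [Chain.cons_append, map, body, tail_one D hB hO, hB.mul_zero, hB.mul_zero]
  | nil => cases q with
    | nil => simp at h
    | cons b q =>
      rw [Chain.nil_append, map, body, g_one D hB, hB.one_mul, tail,
        ← D.i_mul hB hO (D.big_mem X) (D.obj_mem _), D.i_h, hB.zero_mul]

/-- The functor obtained by perturbation. -/
def functor (hA : A.IsAInf) (hB : B.IsAInf) (hO : B.StrictOn O)
    (hA3 : ∀ {X Y : A.Ob} (c : Chain A.Hom X Y), 3 ≤ c.length → A.μ c = 0) :
    AInfFunctor A B where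
  obj := D.obj
  map := D.map
  map_nil X := hB.mul_zero _
  map_add := (map_multilin D hB).add
  map_smul := (map_multilin D hB).smul
  map_deg := map_deg D hB
  relation := map_relation D hA hB hO hA3
  map_single_one X := by
    rw [Chain.single, map, body, tail, g_one D hB, hB.one_mul, D.i_p]
  map_one := map_one D hB hO

/-! The functor induces isomorphisms on cohomology if `f` does. -/

theorem sandwich_sandwich (hB : B.IsAInf) (hO : B.StrictOn O) (b : B.Hom (D.obj X) (D.obj Y)) :
    D.i X ⊚ ((D.p X ⊚ (b ⊚ D.i Y)) ⊚ D.p Y) = b := by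
  rw [D.p_mul hB hO (D.big_mem Y) (D.obj_mem Y), ← D.i_mul hB hO (D.obj_mem X) (D.obj_mem Y),
    D.i_p, hB.one_mul, hO.mul_assoc hB (D.obj_mem X) (D.obj_mem Y) (D.big_mem Y) (D.obj_mem Y),
    D.i_p, hB.mul_one, sgn_eq_neg_redSgn, redSgn_redSgn, neg_neg]

theorem d_p_mul (hB : B.IsAInf) (b : B.Hom (D.obj X) (D.obj Y)) :
    B.d (D.p X ⊚ (b ⊚ D.i Y)) = -(D.p X ⊚ (B.d b ⊚ D.i Y)) := by
  rw [hB.d_mul, D.d_p, hB.zero_mul, neg_zero, zero_sub, redSgn_p, hB.neg_mul, neg_neg, hB.d_mul,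
    D.d_i, hB.mul_zero, sub_zero, hB.mul_neg]

theorem d_i_mul (hB : B.IsAInf) (b : B.Hom (D.big X) (D.big Y)) :
    B.d (D.i X ⊚ (b ⊚ D.p Y)) = -(D.i X ⊚ (B.d b ⊚ D.p Y)) := by
  rw [hB.d_mul, D.d_i, hB.zero_mul, neg_zero, zero_sub, redSgn_i, hB.neg_mul, neg_neg, hB.d_mul,
    D.d_p, hB.mul_zero, sub_zero, hB.mul_neg]

theorem functor_injective (hB : B.IsAInf) (hO : B.StrictOn O)
    (hf : ∀ a : A.Hom X Y, A.d a = 0 → B.Exact (D.f a) → A.Exact a) (a : A.Hom X Y)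
    (ha : A.d a = 0) (hm : B.Exact (D.map (.single a))) : A.Exact a := by
  obtain ⟨y, hy⟩ := hm
  have hy : B.d y = D.i X ⊚ (D.g a ⊚ D.p Y) := hy
  have hx : B.d (D.g (A.redSgn a)) = 0 := by
    rw [g_redSgn, ← neg_eq_zero, ← hB.redSgn_d, d_g D hB, ha, g_zero, neg_zero, redSgn_zero]
  have hpi (X : A.Ob) : D.p X ⊚ D.i X = B.d (D.h X) + B.one _ := by rw [D.d_h, sub_add_cancel]
  have e1 : B.d (D.p X ⊚ (y ⊚ D.i Y)) =
      (D.p X ⊚ D.i X) ⊚ (D.g (A.redSgn a) ⊚ (D.p Y ⊚ D.i Y)) := by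
    rw [d_p_mul D hB, hy, D.i_mul hB hO (D.obj_mem Y) (D.big_mem Y),
      ← D.p_mul hB hO (D.big_mem X) (D.big_mem Y), D.g_mul_mul hB hO (D.obj_mem Y) (D.big_mem Y),
      hB.mul_neg, neg_neg]
  have e2 : D.g (A.redSgn a) ⊚ (D.p Y ⊚ D.i Y) = -(D.g a + B.d (D.g a ⊚ D.h Y)) := by
    rw [hpi, hB.mul_add, hB.mul_one, hB.d_mul, d_g D hB, ha, g_zero, neg_zero, hB.zero_mul,
      ← g_redSgn, sgn_eq_neg_redSgn, ← g_redSgn, redSgn_redSgn]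
    abel
  have e3 : B.d (D.g a + B.d (D.g a ⊚ D.h Y)) = 0 := by
    rw [hB.d_add, hB.dd, d_g D hB, ha, g_zero, neg_zero, add_zero]
  have e4 : B.d (D.h X ⊚ (D.g a + B.d (D.g a ⊚ D.h Y))) =
      -(B.d (D.h X) ⊚ (D.g a + B.d (D.g a ⊚ D.h Y))) := by
    rw [hB.d_mul, e3, hB.mul_zero, sub_zero]
  rw [e2, hpi, hB.mul_neg, hB.add_mul, hB.one_mul, neg_add, ← e4] at e1
  have e5 : D.g a = B.d (D.h X ⊚ (D.g a + B.d (D.g a ⊚ D.h Y)) - D.p X ⊚ (y ⊚ D.i Y) -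
      D.g a ⊚ D.h Y) := by
    rw [hB.d_sub, hB.d_sub, e1]
    abel
  refine hf a ha ⟨B.redSgn (D.h X ⊚ (D.g a + B.d (D.g a ⊚ D.h Y)) - D.p X ⊚ (y ⊚ D.i Y) -
      D.g a ⊚ D.h Y), ?_⟩
  change B.d _ = _
  rw [← neg_neg (B.d _), ← hB.redSgn_d, ← e5, g, redSgn_sgn, neg_neg]

theorem functor_surjective (hB : B.IsAInf) (hO : B.StrictOn O)
    (hf : ∀ b : B.Hom (D.big X) (D.big Y), B.d b = 0 → ∃ a : A.Hom X Y, A.d a = 0 ∧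
      B.Exact (b - D.f a)) (b : B.Hom (D.obj X) (D.obj Y)) (hb : B.d b = 0) :
    ∃ a : A.Hom X Y, A.d a = 0 ∧ B.Exact (b - D.map (.single a)) := by
  have hb' : B.d (B.sgn b) = 0 := by
    rw [sgn_eq_neg_redSgn, hB.d_neg, ← hB.redSgn_d, hb, redSgn_zero]
  obtain ⟨a, ha, t, ht⟩ := hf (D.p X ⊚ (B.sgn b ⊚ D.i Y)) (by
    rw [d_p_mul D hB, hb', hB.zero_mul, hB.mul_zero, neg_zero])
  have ht : B.d t = D.p X ⊚ (B.sgn b ⊚ D.i Y) - D.f a := ht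
  refine ⟨a, ha, -(D.i X ⊚ (B.redSgn t ⊚ D.p Y)), ?_⟩
  change B.d _ = b - D.i X ⊚ (D.g a ⊚ D.p Y)
  have e : B.d (B.redSgn t) = D.p X ⊚ (b ⊚ D.i Y) - D.g a := by
    rw [← neg_neg (B.d _), ← hB.redSgn_d, ht, sub_eq_add_neg, redSgn_add, redSgn_neg,
      hB.redSgn_mul, hB.redSgn_mul, redSgn_sgn, redSgn_i, redSgn_p, g, sgn_eq_neg_redSgn]
    simp only [hB.neg_mul, hB.mul_neg, neg_neg]
    abel
  rw [hB.d_neg, d_i_mul D hB, e, hB.sub_mul, hB.mul_sub, sandwich_sandwich D hB hO, neg_neg]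

end RetractData

namespace AInfData

variable {k : Type u} [Field k] {A : AInfData.{u, v, w} k} {X Y Z W : A.Ob}

/-! ### Homotopies -/

theorem exact_iff {a : A.Hom X Y} : A.Exact a ↔ ∃ b, A.d b = a := Iff.rfl

theorem exact_d (a : A.Hom X Y) : A.Exact (A.d a) := ⟨a, rfl⟩

namespace IsAInf

theorem exact_zero (h : A.IsAInf) : A.Exact (0 : A.Hom X Y) := ⟨0, h.d_zero⟩

theorem exact_add (h : A.IsAInf) {a b : A.Hom X Y} (ha : A.Exact a) (hb : A.Exact b) :
    A.Exact (a + b) := by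
  obtain ⟨s, rfl⟩ := exact_iff.1 ha
  obtain ⟨t, rfl⟩ := exact_iff.1 hb
  exact ⟨s + t, h.d_add s t⟩

theorem exact_neg (h : A.IsAInf) {a : A.Hom X Y} (ha : A.Exact a) : A.Exact (-a) := by
  obtain ⟨s, rfl⟩ := exact_iff.1 ha
  exact ⟨-s, h.d_neg s⟩

theorem exact_sub (h : A.IsAInf) {a b : A.Hom X Y} (ha : A.Exact a) (hb : A.Exact b) :
    A.Exact (a - b) := by
  rw [sub_eq_add_neg]
  exact h.exact_add ha (h.exact_neg hb)

theorem exact_mul (h : A.IsAInf) {a : A.Hom X Y} {b : A.Hom Y Z} (ha : A.Exact a)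
    (hb : A.d b = 0) : A.Exact (a ⊚ b) := by
  obtain ⟨s, rfl⟩ := exact_iff.1 ha
  refine ⟨-(s ⊚ b), ?_⟩
  change A.d _ = _
  rw [h.d_neg, h.d_mul, hb, h.mul_zero, sub_zero, neg_neg]

theorem d_redSgn (h : A.IsAInf) (a : A.Hom X Y) : A.d (A.redSgn a) = -A.redSgn (A.d a) := by
  rw [h.redSgn_d, neg_neg]

theorem mul_exact (h : A.IsAInf) {a : A.Hom X Y} {b : A.Hom Y Z} (ha : A.d a = 0)
    (hb : A.Exact b) : A.Exact (a ⊚ b) := by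
  obtain ⟨s, rfl⟩ := exact_iff.1 hb
  refine ⟨-(A.redSgn a ⊚ s), ?_⟩
  change A.d _ = _
  rw [h.d_neg, h.d_mul, h.d_redSgn, ha, redSgn_zero, neg_zero, h.zero_mul, redSgn_redSgn, neg_zero,
    zero_sub, neg_neg]

theorem closed_mul (h : A.IsAInf) {a : A.Hom X Y} {b : A.Hom Y Z} (ha : A.d a = 0)
    (hb : A.d b = 0) : A.d (a ⊚ b) = 0 := by
  rw [h.d_mul, ha, hb, h.zero_mul, h.mul_zero, neg_zero, sub_zero]

theorem closed_redSgn (h : A.IsAInf) {a : A.Hom X Y} (ha : A.d a = 0) : A.d (A.redSgn a) = 0 := by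
  rw [h.d_redSgn, ha, redSgn_zero, neg_zero]

theorem exact_assoc (h : A.IsAInf) {a : A.Hom X Y} {b : A.Hom Y Z} {c : A.Hom Z W}
    (ha : A.d a = 0) (hb : A.d b = 0) (hc : A.d c = 0) :
    A.Exact ((a ⊚ b) ⊚ c + A.redSgn a ⊚ (b ⊚ c)) := by
  have := h.relation_three a b c
  have z1 : A.μ (.cons (A.μ (.single a)) (.pair b c)) = 0 := by
    rw [show A.μ (.single a) = 0 from ha]; exact h.multilin.zero' _
  have z2 : A.μ (.cons (A.redSgn a) (.pair (A.μ (.single b)) c)) = 0 := by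
    rw [show A.μ (.single b) = 0 from hb]; exact h.multilin.zero (.single (A.redSgn a)) (.single c)
  have z3 : A.μ (.cons (A.redSgn a) (.pair (A.redSgn b) (A.μ (.single c)))) = 0 := by
    rw [show A.μ (.single c) = 0 from hc]; exact h.multilin.zero (.pair (A.redSgn a) (A.redSgn b)) (.nil W)
  rw [z1, z2, z3, add_zero, add_zero, add_zero] at this
  refine ⟨-A.μ (.cons a (.pair b c)), ?_⟩
  change A.d _ = _
  rw [h.d_neg]
  exact (eq_neg_of_add_eq_zero_left this).symm

theorem d_proj (h : A.IsAInf) (p : ZMod 2) (a : A.Hom X Y) :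
    A.d (A.proj p a) = A.proj (p + 1) (A.d a) := by
  have h1 : A.proj p a + A.proj (p + 1) a = a := by
    obtain rfl | rfl := zmod_two_cases p
    · exact A.proj_add a
    · exact (add_comm _ _).trans (A.proj_add a)
  have h2 := h.isHomog_d (isHomog_proj p a)
  have h3 : A.proj (p + 1) (A.d (A.proj (p + 1) a)) = 0 := by
    rw [← show A.proj (p + 1 + 1) (A.d (A.proj (p + 1) a)) = _ from
      h.isHomog_d (isHomog_proj (p + 1) a), A.proj_proj, if_neg]
    clear h1 h2; revert p; decide
  conv_rhs => rw [← h1, h.d_add, map_add, h3, add_zero]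
  exact h2.symm

theorem proj_mul (h : A.IsAInf) (p : ZMod 2) (a : A.Hom X Y) {b : A.Hom Y Z} (hb : A.IsHomog 0 b) :
    A.proj p (a ⊚ b) = A.proj p a ⊚ b := by
  have h1 : A.proj p a + A.proj (p + 1) a = a := by
    obtain rfl | rfl := zmod_two_cases p
    · exact A.proj_add a
    · exact (add_comm _ _).trans (A.proj_add a)
  have h2 := h.isHomog_mul (isHomog_proj p a) hb
  have h3 : A.proj p (A.proj (p + 1) a ⊚ b) = 0 := by
    rw [← show A.proj (p + 1 + 0) (A.proj (p + 1) a ⊚ b) = _ from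
      h.isHomog_mul (isHomog_proj (p + 1) a) hb, A.proj_proj, if_neg]
    clear h1 h2; revert p; decide
  conv_lhs => rw [← h1, h.add_mul, map_add, h3, add_zero]
  rw [add_zero] at h2
  exact h2

theorem hIso_trans (h : A.IsAInf) (h1 : A.HIso X Y) (h2 : A.HIso Y Z) : A.HIso X Z := by
  have key : ∀ {X Y Z : A.Ob} {f : A.Hom X Y} {g : A.Hom Y X} {f' : A.Hom Y Z} {g' : A.Hom Z Y},
      A.IsHomog 0 f → A.IsHomog 0 f' → A.d f = 0 → A.d g = 0 → A.d f' = 0 →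
      A.d g' = 0 → A.Exact (f ⊚ g - A.one X) → A.Exact (f' ⊚ g' - A.one Y) →
      A.Exact ((f ⊚ f') ⊚ (g' ⊚ g) - A.one X) := by
    intro X Y Z f g f' g' df df' hf hg hf' hg' e e'
    have a1 := h.exact_assoc hf hf' (h.closed_mul hg' hg)
    have a2 := h.mul_exact hf (h.exact_assoc hf' hg' hg)
    have a3 := h.mul_exact hf (h.exact_mul e' hg)
    rw [df.redSgn_of_zero, h.neg_mul] at a1
    rw [df'.redSgn_of_zero, h.neg_mul, h.mul_add, h.mul_neg] at a2
    rw [h.sub_mul, h.one_mul, h.mul_sub] at a3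
    convert h.exact_add (h.exact_sub a1 a2) (h.exact_add a3 e) using 1
    abel
  obtain ⟨f, g, df, dg, hf, hg, e, e'⟩ := h1
  obtain ⟨f', g', df', dg', hf', hg', e2, e2'⟩ := h2
  exact ⟨f ⊚ f', g' ⊚ g, h.isHomog_mul df df', h.isHomog_mul dg' dg, h.closed_mul hf hf',
    h.closed_mul hg' hg, key df df' hf hg hf' hg' e e2, key dg' dg hg' hf' hg hf e2' e'⟩

end IsAInf

/-! ### Tests for isomorphisms -/

/-- Composition with `f` induces an isomorphism from the cohomology of `Hom W Z` to that of
`Hom W Y`. -/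
structure DetectsIso (f : A.Hom Z Y) (W : A.Ob) : Prop where
  injective : ∀ φ : A.Hom W Z, A.d φ = 0 → A.Exact (φ ⊚ f) → A.Exact φ
  surjective : ∀ ψ : A.Hom W Y, A.d ψ = 0 → ∃ φ : A.Hom W Z, A.d φ = 0 ∧ A.Exact (ψ - φ ⊚ f)

theorem IsAInf.hIso_of_detectsIso (h : A.IsAInf) {f : A.Hom Z Y} (df : A.IsHomog 0 f)
    (hf : A.d f = 0) (hY : DetectsIso f Y) (hZ : DetectsIso f Z) : A.HIso Z Y := by
  obtain ⟨φ, hφ, t, ht⟩ := hY.surjective _ (h.d_one Y)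
  have ht : A.d t = A.one Y - φ ⊚ f := ht
  have c0 : A.d (A.proj 0 φ) = 0 := by rw [h.d_proj, hφ, map_zero]
  have e0 : A.d (A.proj (-1) t) = A.one Y - A.proj 0 φ ⊚ f := by
    rw [h.d_proj, ht, map_sub, neg_add_cancel, h.proj_mul 0 _ df,
      show A.proj 0 (A.one Y) = A.one Y from h.one_deg Y]
  have e1 : A.Exact (A.proj 0 φ ⊚ f - A.one Y) := by
    rw [← neg_sub, ← e0]
    exact h.exact_neg (exact_d _)
  refine ⟨f, A.proj 0 φ, df, isHomog_proj 0 φ, hf, c0, ?_, e1⟩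
  refine hZ.injective _ ?_ ?_
  · rw [h.d_sub, show A.μ (.pair f (A.proj 0 φ)) = f ⊚ A.proj 0 φ from rfl, h.closed_mul hf c0,
      h.d_one, sub_zero]
  · have a1 := h.exact_assoc hf c0 hf
    have a2 := h.mul_exact hf e1
    rw [df.redSgn_of_zero, h.neg_mul] at a1
    rw [h.mul_sub, h.mul_one, sgn_eq_neg_redSgn, df.redSgn_of_zero, neg_neg] at a2
    change A.Exact ((f ⊚ A.proj 0 φ - A.one Z) ⊚ f)
    rw [h.sub_mul, h.one_mul]
    convert h.exact_add a1 a2 using 1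
    abel

/-- The test with `W'` implies the test with its retracts in the cohomology category. -/
theorem DetectsIso.of_retract (h : A.IsAInf) {f : A.Hom Z Y} (hf : A.d f = 0) {W' : A.Ob}
    (hW : DetectsIso f W') {p : A.Hom W W'} {q : A.Hom W' W} (hp : A.d p = 0) (hq : A.d q = 0)
    (e : A.Exact (A.redSgn p ⊚ q - A.one W)) : DetectsIso f W := by
  have hp' := h.closed_redSgn hp
  constructor
  · intro φ hφ eφ
    have a1 := h.exact_assoc hq hφ hf
    have a2 := h.mul_exact (h.closed_redSgn hq) eφ
    have a3 := hW.injective _ (h.closed_mul hq hφ) (by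
      convert h.exact_sub a1 a2 using 1
      abel)
    have a4 := h.mul_exact hp a3
    have a5 := h.exact_assoc hp' hq hφ
    have a6 := h.exact_mul e hφ
    rw [redSgn_redSgn] at a5
    rw [h.sub_mul, h.one_mul] at a6
    convert h.exact_sub (h.exact_sub a5 a4) a6 using 1
    abel
  · intro ψ hψ
    obtain ⟨φ, hφ, e'⟩ := hW.surjective _ (h.closed_mul hq hψ)
    refine ⟨A.redSgn p ⊚ φ, h.closed_mul hp' hφ, ?_⟩
    have a1 := h.exact_assoc hp' hφ hf
    have a2 := h.exact_assoc hp' hq hψ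
    have a3 := h.mul_exact hp e'
    have a4 := h.exact_mul e hψ
    rw [redSgn_redSgn] at a1 a2
    rw [h.mul_sub] at a3
    rw [h.sub_mul, h.one_mul] at a4
    convert h.exact_sub (h.exact_sub (h.exact_sub a2 a1) a3) a4 using 1
    abel

theorem DetectsIso.of_hIso (h : A.IsAInf) {f : A.Hom Z Y} (hf : A.d f = 0) {W' : A.Ob}
    (hW : DetectsIso f W') (e : A.HIso W W') : DetectsIso f W := by
  obtain ⟨p, q, dp, dq, hp, hq, e, -⟩ := e
  refine hW.of_retract h hf (p := -p) (q := q) ?_ hq ?_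
  · rw [h.d_neg, show A.d p = 0 from hp, neg_zero]
  · rwa [redSgn_neg, dp.redSgn_of_zero, neg_neg]

/-- The mapping cone of composition with `f` is acyclic. -/
def ConeAcyclic (f : A.Hom Z Y) (W : A.Ob) : Prop :=
  ∀ (φ : A.Hom W Z) (ψ : A.Hom W Y), A.d φ = 0 → A.d ψ + φ ⊚ f = 0 →
    ∃ (α : A.Hom W Z) (β : A.Hom W Y), A.d α = φ ∧ A.d β + α ⊚ f = ψ

theorem IsAInf.coneAcyclic_iff (h : A.IsAInf) {f : A.Hom Z Y} (hf : A.d f = 0) :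
    ConeAcyclic f W ↔ DetectsIso f W := by
  constructor
  · intro hc
    constructor
    · rintro φ hφ ⟨χ, hχ⟩
      obtain ⟨α, -, hα, -⟩ := hc φ (-χ) hφ (by
        rw [h.d_neg, show A.d χ = φ ⊚ f from hχ, neg_add_cancel])
      exact ⟨α, hα⟩
    · intro ψ hψ
      obtain ⟨α, β, hα, hβ⟩ := hc 0 ψ h.d_zero (by rw [hψ, h.zero_mul, add_zero])
      exact ⟨α, hα, β, by rw [← hβ, add_sub_cancel_right]; rfl⟩
  · intro hd φ ψ hφ hψ
    obtain ⟨α, hα⟩ := exact_iff.1 (hd.injective φ hφ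
      (by rw [← neg_eq_of_add_eq_zero_right hψ]; exact h.exact_neg (exact_d ψ)))
    obtain ⟨α', hα', β, hβ⟩ := hd.surjective (ψ - α ⊚ f) (by
      rw [h.d_sub, h.d_mul, hα, hf, h.mul_zero, sub_zero, sub_neg_eq_add, hψ])
    refine ⟨α + α', β, by rw [h.d_add, hα, hα', add_zero], ?_⟩
    rw [show A.d β = _ from hβ, h.add_mul]
    abel

end AInfData

/-! ### Triangular complexes -/

section Triangular

variable {N : ℕ} {M : Fin N → Type*} [∀ x, AddCommGroup (M x)] {D : (∀ x, M x) →+ ∀ x, M x}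
  {D' : ∀ x, M x →+ M x}

theorem exists_sub_eq_zero_of_triangular
    (hD : ∀ Φ x, (∀ z, x < z → Φ z = 0) → D Φ x = D' x (Φ x)) (hDD : ∀ Φ, D (D Φ) = 0)
    (t : ℕ) (hex : ∀ x : Fin N, t ≤ x → ∀ m, D' x m = 0 → ∃ m', D' x m' = m)
    (Φ : ∀ x, M x) (hΦ : ∀ x : Fin N, t ≤ x → D Φ x = 0) :
    ∃ Ψ, ∀ x : Fin N, t ≤ x → Φ x = D Ψ x := by
  have key : ∀ j s : ℕ, t ≤ s → s + j = N → ∃ Ψ, ∀ x : Fin N, s ≤ x → Φ x = D Ψ x := by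
    intro j
    induction j with
    | zero => exact fun s _ hs => ⟨0, fun x hx => by have := x.2; omega⟩
    | succ j ih =>
      intro s hts hs
      obtain ⟨Ψ, hΨ⟩ := ih (s + 1) (by omega) (by omega)
      let y : Fin N := ⟨s, by omega⟩
      have h1 : D (Φ - D Ψ) y = D' y ((Φ - D Ψ) y) :=
        hD _ y fun z hz => sub_eq_zero.2 (hΨ z (Fin.lt_def.1 hz))
      rw [map_sub, hDD, sub_zero, hΦ y hts] at h1
      obtain ⟨m, hm⟩ := hex y hts _ h1.symm
      refine ⟨Ψ + Pi.single y m, fun x hx => ?_⟩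
      rw [map_add, Pi.add_apply, ← sub_eq_iff_eq_add']
      have h2 : D (Pi.single y m) x = D' x ((Pi.single y m : ∀ x, M x) x) := by
        refine hD _ x fun z hz => Pi.single_eq_of_ne (fun e => ?_) _
        rw [e] at hz
        exact absurd (Fin.lt_def.1 hz) (not_lt.2 hx)
      rw [h2]
      by_cases hxy : x = y
      · subst hxy
        rw [Pi.single_eq_same, hm]
        rfl
      · rw [Pi.single_eq_of_ne hxy, map_zero, sub_eq_zero]
        refine hΨ x (Nat.succ_le_of_lt (lt_of_le_of_ne hx fun e => hxy (Fin.ext e.symm)))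
  obtain h | h := le_total t N
  · exact key (N - t) t le_rfl (by omega)
  · exact ⟨0, fun x hx => by have := x.2; omega⟩

theorem exact_of_triangular
    (hD : ∀ Φ x, (∀ z, x < z → Φ z = 0) → D Φ x = D' x (Φ x)) (hDD : ∀ Φ, D (D Φ) = 0)
    (hex : ∀ (x : Fin N) m, D' x m = 0 → ∃ m', D' x m' = m)
    (Φ : ∀ x, M x) (hΦ : D Φ = 0) : ∃ Ψ, D Ψ = Φ := by
  obtain ⟨Ψ, h⟩ := exists_sub_eq_zero_of_triangular hD hDD 0 (fun x _ => hex x) Φ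
    fun x _ => congrFun hΦ x
  exact ⟨Ψ, funext fun x => (h x (Nat.zero_le _)).symm⟩

theorem exact_first_of_triangular
    (hD : ∀ Φ x, (∀ z, x < z → Φ z = 0) → D Φ x = D' x (Φ x)) (hDD : ∀ Φ, D (D Φ) = 0)
    (x : Fin N) (hx : (x : ℕ) = 0)
    (hex : ∀ (z : Fin N), x < z → ∀ m, D' z m = 0 → ∃ m', D' z m' = m)
    (hex' : ∀ Φ, D Φ = 0 → ∃ Ψ, D Ψ = Φ) (m : M x) (hm : D' x m = 0) : ∃ m', D' x m' = m := by
  have hlt : ∀ z : Fin N, 1 ≤ (z : ℕ) ↔ x < z := fun z => by rw [Fin.lt_def, hx]; rfl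
  have hs : ∀ z w : Fin N, z < w → (Pi.single x m : ∀ x, M x) w = 0 := fun z w hw =>
    Pi.single_eq_of_ne (fun e => by rw [e, Fin.lt_def, hx] at hw; omega) _
  obtain ⟨Ψ, hΨ⟩ := hex' (Pi.single x m) (funext fun z => by
    rw [hD _ z (hs z)]
    by_cases hzx : z = x
    · subst hzx; rw [Pi.single_eq_same, hm]; rfl
    · rw [Pi.single_eq_of_ne hzx, map_zero]; rfl)
  obtain ⟨Θ, hΘ⟩ := exists_sub_eq_zero_of_triangular hD hDD 1 (fun z hz => hex z ((hlt z).1 hz)) Ψ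
    fun z hz => by rw [hΨ]; exact hs x z ((hlt z).1 hz)
  refine ⟨(Ψ - D Θ) x, ?_⟩
  rw [← hD (Ψ - D Θ) x fun z hz => sub_eq_zero.2 (hΘ z ((hlt z).2 hz)), map_sub, hDD, sub_zero, hΨ,
    Pi.single_eq_same]

end Triangular

/-! ### Rows of morphisms of twisted complexes -/

namespace AInfData

variable {k : Type u} [Field k] {A : AInfData.{u, v, w} k} {M : Type*} [AddCommGroup M]

/-- A shifted object regarded as a twisted complex. -/
def singleTw (hA : A.IsAInf) (X : A.Ob) (σ : ZMod 2) : A.TwOb :=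
  ⟨{ N := 1, obj := fun _ => X, shift := fun _ => σ, δ := fun _ _ => 0 }, by
    refine ⟨map_zero (Fam.proj 1), fun _ _ _ => rfl, ?_⟩
    funext x y
    obtain rfl : x = y := Subsingleton.elim x y
    simp only [List.range_succ, List.range_zero, List.nil_append, List.map_append, List.map_cons,
      List.map_nil, List.sum_append, List.sum_cons, List.sum_nil]
    obtain rfl : x = 0 := Subsingleton.elim (α := Fin 1) x 0
    have h₁ : A.μ (Chain.cons (0 : A.Hom X X) (.nil X)) = 0 := hA.multilin.zero' _
    simp [Fam.μ, Chain.rep, Fam.expand, List.finRange_succ, hA.μ_nil, h₁]⟩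

/-- A summand of a twisted complex. -/
def rowTw (hA : A.IsAInf) (W : A.TwOb) (x : Fin W.1.N) : A.TwOb :=
  singleTw hA (W.1.obj x) (W.1.shift x)

theorem twSum_cons_of_rows_eq_zero (σ : ZMod 2) {W Z Y : A.TwOb}
    {φ : Fam.Hom W.1.toFam Z.1.toFam} (c : A.TwChain Z Y) (x : Fin W.1.N) (y : Fin Y.1.N)
    {Φ : Chain A.Hom (W.1.obj x) (Y.1.obj y) → M} (hΦ : KillsZero Φ)
    (h : ∀ w, x ≤ w → φ w = 0) : twSum σ (.cons φ c) x y Φ = 0 := by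
  suffices H : ∀ x : Fin W.1.N, (∀ w, x ≤ w → φ w = 0) →
      ∀ {Φ : Chain A.Hom (W.1.obj x) (Y.1.obj y) → M}, KillsZero Φ →
        twSum σ (.cons φ c) x y Φ = 0 from H x h hΦ
  intro x
  induction x using WellFoundedGT.induction with | _ x ih => ?_
  intro h Φ hΦ
  rw [twSum_cons _ _ _ _ _ hΦ]
  refine (congrArg₂ (· + ·) (Finset.sum_eq_zero fun z _ => ?_)
    (Finset.sum_eq_zero fun z hz => ?_)).trans (add_zero 0)
  · rw [h x le_rfl, Pi.zero_apply, twist_zero]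
    simp only [hΦ.zero', twSum_zero]
  · have hz := Finset.mem_Ioi.1 hz
    exact ih z hz (fun w hw => h w (hz.le.trans hw)) (hΦ.cons _)

theorem tw_μ_row (hA : A.IsAInf) {W Z Y : A.TwOb} (φ : Fam.Hom W.1.toFam Z.1.toFam)
    (c : A.TwChain Z Y) (x : Fin W.1.N) (h : ∀ w, x < w → φ w = 0) :
    (A.tw.μ (X := W) (.cons φ c) : Fam.Hom W.1.toFam Y.1.toFam) x =
      (A.tw.μ (X := rowTw hA W x) (Y := Y) (.cons (Y := Z) (fun _ => φ x) c) :
        Fam.Hom (rowTw hA W x).1.toFam Y.1.toFam) (0 : Fin 1) := by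
  funext y
  refine (tw_μ _ x y).trans (Eq.trans ?_ (tw_μ (X := rowTw hA W x) _ (0 : Fin 1) y).symm)
  refine (twSum_cons _ _ _ _ _ hA.multilin.killsZero).trans
    (Eq.trans ?_ (twSum_cons (X := rowTw hA W x) _ (fun _ => φ x) c (0 : Fin 1) y
      hA.multilin.killsZero).symm)
  refine congrArg₂ (· + ·) rfl ((Finset.sum_eq_zero fun z hz => ?_).trans (Eq.symm ?_))
  · have hz := Finset.mem_Ioi.1 hz
    exact twSum_cons_of_rows_eq_zero _ _ _ _ (hA.multilin.cons _).killsZero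
      fun w hw => h w (hz.trans_le hw)
  · refine Finset.sum_eq_zero fun z hz => ?_
    have : z = (0 : Fin 1) := Subsingleton.elim (α := Fin 1) _ _
    exact absurd (Finset.mem_Ioi.1 hz) (this ▸ lt_irrefl _)

theorem IsAInf.d_add_add_add_mul (hA : A.IsAInf) {X Y Z : A.Ob} (a a' : A.Hom X Y) (f : A.Hom Y Z)
    (b b' : A.Hom X Z) :
    A.d (b + b') + (a + a') ⊚ f = (A.d b + a ⊚ f) + (A.d b' + a' ⊚ f) := by
  rw [hA.d_add, hA.add_mul]
  abel

/-- The rows of a morphism in the mapping cone of composition with a morphism `Z → Y`. -/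
abbrev ConeRow (W Z Y : A.TwOb) (x : Fin W.1.N) : Type v :=
  (∀ z : Fin Z.1.N, A.Hom (W.1.obj x) (Z.1.obj z)) × (∀ y : Fin Y.1.N, A.Hom (W.1.obj x) (Y.1.obj y))

/-- The differential of the mapping cone of composition with `f`. -/
def coneD (hA : A.IsAInf) {Z Y : A.TwOb} (f : Fam.Hom Z.1.toFam Y.1.toFam) (W : A.TwOb) :
    (∀ x, ConeRow W Z Y x) →+ ∀ x, ConeRow W Z Y x :=
  AddMonoidHom.mk' (fun Φ x =>
    ((A.tw.d (X := W) (Y := Z) (fun x => (Φ x).1) : Fam.Hom W.1.toFam Z.1.toFam) x,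
      (A.tw.d (X := W) (Y := Y) (fun x => (Φ x).2) : Fam.Hom W.1.toFam Y.1.toFam) x +
      (A.tw.mul (X := W) (Y := Z) (Z := Y) (fun x => (Φ x).1) f :
        Fam.Hom W.1.toFam Y.1.toFam) x)) fun Φ Ψ => by
    have e1 := hA.tw.d_add (X := W) (Y := Z) (fun x => (Φ x).1) (fun x => (Ψ x).1)
    have e2 := hA.tw.d_add_add_add_mul (X := W) (Y := Z) (Z := Y) (fun x => (Φ x).1)
      (fun x => (Ψ x).1) f (fun x => (Φ x).2) (fun x => (Ψ x).2)
    funext x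
    exact Prod.ext (congrFun e1 x) (congrFun e2 x)

theorem coneAcyclic_iff_exact (hA : A.IsAInf) {Z Y W : A.TwOb} (f : Fam.Hom Z.1.toFam Y.1.toFam) :
    ConeAcyclic (A := A.tw) (Z := Z) (Y := Y) f W ↔
      ∀ Φ, coneD hA f W Φ = 0 → ∃ Ψ, coneD hA f W Ψ = Φ := by
  constructor
  · intro h Φ hΦ
    obtain ⟨α, β, hα, hβ⟩ := h (fun x => (Φ x).1) (fun x => (Φ x).2)
      (funext fun x => congrArg Prod.fst (congrFun hΦ x))
      (funext fun x => congrArg Prod.snd (congrFun hΦ x))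
    exact ⟨fun x => (α x, β x), funext fun x => Prod.ext (congrFun hα x) (congrFun hβ x)⟩
  · intro h φ ψ hφ hψ
    obtain ⟨Ψ, hΨ⟩ := h (fun x => (φ x, ψ x))
      (funext fun x => Prod.ext (congrFun hφ x) (congrFun hψ x))
    exact ⟨fun x => (Ψ x).1, fun x => (Ψ x).2,
      funext fun x => congrArg Prod.fst (congrFun hΨ x),
      funext fun x => congrArg Prod.snd (congrFun hΨ x)⟩

theorem IsAInf.d_add_mul_add_d_mul (hA : A.IsAInf) {X Y Z : A.Ob} (a : A.Hom X Y) (f : A.Hom Y Z)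
    (b : A.Hom X Z) (hf : A.d f = 0) : A.d (A.d b + a ⊚ f) + A.d a ⊚ f = 0 := by
  rw [hA.d_add, hA.dd, hA.d_mul, hf, hA.mul_zero, sub_zero, zero_add, neg_add_cancel]

theorem coneD_coneD (hA : A.IsAInf) {Z Y W : A.TwOb} {f : Fam.Hom Z.1.toFam Y.1.toFam}
    (hf : A.tw.d (X := Z) (Y := Y) f = (0 : Fam.Hom Z.1.toFam Y.1.toFam))
    (Φ : ∀ x, ConeRow W Z Y x) : coneD hA f W (coneD hA f W Φ) = 0 := by
  have e1 := hA.tw.dd (X := W) (Y := Z) (fun x => (Φ x).1)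
  have e4 := hA.tw.d_add_mul_add_d_mul (X := W) (Y := Z) (Z := Y) (fun x => (Φ x).1) f
    (fun x => (Φ x).2) hf
  funext x
  exact Prod.ext (congrFun e1 x) (congrFun e4 x)

theorem coneD_row (hA : A.IsAInf) {Z Y W : A.TwOb} (f : Fam.Hom Z.1.toFam Y.1.toFam)
    (Φ : ∀ x, ConeRow W Z Y x) (x : Fin W.1.N) (h : ∀ w, x < w → Φ w = 0) :
    coneD hA f W Φ x = coneD hA f (rowTw hA W x) (fun _ => Φ x) (0 : Fin 1) :=
  Prod.ext (tw_μ_row hA _ _ x fun w hw => congrArg Prod.fst (h w hw))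
    (congrArg₂ (· + ·) (tw_μ_row hA _ _ x fun w hw => congrArg Prod.snd (h w hw))
      (tw_μ_row hA _ _ x fun w hw => congrArg Prod.fst (h w hw)))

/-- The differential of the mapping cone of composition with `f`, for a single row. -/
def rowD (hA : A.IsAInf) {Z Y : A.TwOb} (f : Fam.Hom Z.1.toFam Y.1.toFam) (W : A.TwOb)
    (x : Fin W.1.N) : ConeRow W Z Y x →+ ConeRow W Z Y x :=
  AddMonoidHom.mk' (fun m => coneD hA f (rowTw hA W x) (fun _ => m) (0 : Fin 1)) fun m m' =>
    congrFun (map_add (coneD hA f (rowTw hA W x)) (fun _ => m) (fun _ => m')) (0 : Fin 1)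

theorem coneAcyclic_row_iff (hA : A.IsAInf) {Z Y W : A.TwOb} (f : Fam.Hom Z.1.toFam Y.1.toFam)
    (x : Fin W.1.N) : ConeAcyclic (A := A.tw) (Z := Z) (Y := Y) f (rowTw hA W x) ↔
      ∀ m, rowD hA f W x m = 0 → ∃ m', rowD hA f W x m' = m := by
  rw [coneAcyclic_iff_exact hA]
  have e : ∀ Φ : ∀ i, ConeRow (rowTw hA W x) Z Y i, Φ = fun _ => Φ (0 : Fin 1) := fun Φ =>
    funext fun i => by
      obtain rfl : i = (0 : Fin 1) := Subsingleton.elim (α := Fin 1) _ _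
      rfl
  constructor
  · intro h m hm
    obtain ⟨Ψ, hΨ⟩ := h (fun _ => m) ((e _).trans (funext fun _ => hm))
    rw [e Ψ] at hΨ
    exact ⟨Ψ (0 : Fin 1), congrFun hΨ (0 : Fin 1)⟩
  · intro h Φ hΦ
    rw [e Φ] at hΦ
    obtain ⟨m', hm'⟩ := h (Φ (0 : Fin 1)) (congrFun hΦ (0 : Fin 1))
    exact ⟨fun _ => m', (e _).trans ((funext fun _ => hm').trans (e Φ).symm)⟩

/-- The test whether a morphism is an isomorphism may be performed with all summands. -/
theorem detectsIso_of_rows (hA : A.IsAInf) {Z Y W : A.TwOb} {f : Fam.Hom Z.1.toFam Y.1.toFam}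
    (hf : A.tw.d (X := Z) (Y := Y) f = (0 : Fam.Hom Z.1.toFam Y.1.toFam))
    (h : ∀ x, DetectsIso (A := A.tw) (Z := Z) (Y := Y) f (rowTw hA W x)) :
    DetectsIso (A := A.tw) (Z := Z) (Y := Y) f W := by
  refine (hA.tw.coneAcyclic_iff hf).1 ((coneAcyclic_iff_exact hA f).2 ?_)
  exact exact_of_triangular (D' := rowD hA f W) (coneD_row hA f) (coneD_coneD hA hf) fun x =>
    (coneAcyclic_row_iff hA f x).1 ((hA.tw.coneAcyclic_iff hf).2 (h x))

/-- The test with the first summand follows from the tests with the whole and with all other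
summands. -/
theorem detectsIso_first_row (hA : A.IsAInf) {Z Y W : A.TwOb} {f : Fam.Hom Z.1.toFam Y.1.toFam}
    (hf : A.tw.d (X := Z) (Y := Y) f = (0 : Fam.Hom Z.1.toFam Y.1.toFam))
    (hW : DetectsIso (A := A.tw) (Z := Z) (Y := Y) f W) (x : Fin W.1.N) (hx : (x : ℕ) = 0)
    (h : ∀ z, x < z → DetectsIso (A := A.tw) (Z := Z) (Y := Y) f (rowTw hA W z)) :
    DetectsIso (A := A.tw) (Z := Z) (Y := Y) f (rowTw hA W x) := by
  refine (hA.tw.coneAcyclic_iff hf).1 ((coneAcyclic_row_iff hA f x).2 ?_)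
  exact exact_first_of_triangular (D' := rowD hA f W) (coneD_row hA f) (coneD_coneD hA hf) x hx
    (fun z hz => (coneAcyclic_row_iff hA f z).1 ((hA.tw.coneAcyclic_iff hf).2 (h z hz)))
    ((coneAcyclic_iff_exact hA f).1 ((hA.tw.coneAcyclic_iff hf).2 hW))

end AInfData

namespace AInfData

variable {k : Type u} [Field k] {A : AInfData.{u, v, w} k} {M : Type*} [AddCommGroup M]

theorem twSum_single_of_two (σ : ZMod 2) {X Y : A.TwOb} (a : Fam.Hom X.1.toFam Y.1.toFam)
    (x : Fin X.1.N) (y : Fin Y.1.N) {Φ : Chain A.Hom (X.1.obj x) (Y.1.obj y) → M}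
    (hΦ : KillsZero Φ) (h : ∀ e, e.length ≠ 2 → Φ e = 0) :
    twSum σ (.single a) x y Φ =
      ∑ z, Φ (.pair (A.twist (X.1.shift x - σ) (a x z)) (A.twist (Y.1.shift z - σ) (Y.1.δ z y))) +
      ∑ z, Φ (.pair (A.twist (X.1.shift x - σ) (X.1.δ x z)) (A.twist (X.1.shift z - σ) (a z y))) := by
  rw [Chain.single, twSum_cons _ _ _ _ _ hΦ]
  refine congrArg₂ (· + ·) (Finset.sum_congr rfl fun z _ => ?_) ?_
  · exact twSum_nil_of_length_one _ _ _ (hΦ.cons _) fun e he => h _ (by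
      simp only [Chain.length_cons]; omega)
  · refine (Finset.sum_congr rfl fun z _ => twSum_single σ a z y (hΦ.cons _) fun e he => h _ (by
      simp only [Chain.length_cons]; omega)).trans
      (Finset.sum_subset (Finset.subset_univ _) fun z _ hz => ?_)
    rw [X.2.triangular x z fun h' => hz (Finset.mem_Ioi.2 h'), twist_zero]
    exact hΦ.zero' _

theorem Within.cons {O : A.Ob → Prop} {X Y Z : A.Ob} {c : Chain A.Hom Z Y} (hX : O X)
    (hc : Within O c) (a : A.Hom X Z) : Within O (.cons a c) := ⟨hX, hc⟩

theorem twSum_eq_zero_of_within (σ : ZMod 2) {O : A.Ob → Prop} {X Y : A.TwOb} (c : A.TwChain X Y)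
    (x : Fin X.1.N) (y : Fin Y.1.N)
    (hc : Within (A := A.tw) (X := X) (Y := Y) (fun X => ∀ x, O (X.1.obj x)) c)
    {Φ : Chain A.Hom (X.1.obj x) (Y.1.obj y) → M} (hΦ : KillsZero Φ)
    (h : ∀ e, Within O e → Φ e = 0) : twSum σ c x y Φ = 0 := by
  refine TwOb.induction (motive := fun {X Y} c x => ∀ (y : Fin Y.1.N)
    {Φ : Chain A.Hom (X.1.obj x) (Y.1.obj y) → M},
    Within (A := A.tw) (X := X) (Y := Y) (fun X => ∀ x, O (X.1.obj x)) c → KillsZero Φ →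
    (∀ e, Within O e → Φ e = 0) → twSum σ c x y Φ = 0) ?_ ?_ c x y hc hΦ h
  · intro X x ih y Φ hX hΦ h
    have hX : ∀ x, O (X.1.obj x) := hX
    rw [twSum_nil _ _ _ _ hΦ, Finset.sum_eq_zero fun z hz =>
      ih z (Finset.mem_Ioi.1 hz) y hX (hΦ.cons _) fun e he => h (.cons _ e) (.cons (hX x) he _), add_zero]
    split_ifs with hxy
    · subst hxy; exact h (.nil _) (hX x)
    · rfl
  · intro X Y Z a c x ih ih2 y Φ hc hΦ h
    rw [twSum_cons _ _ _ _ _ hΦ, Finset.sum_eq_zero fun z _ =>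
        ih z y hc.2 (hΦ.cons _) fun e he => h (.cons _ e) (.cons (hc.1 x) he _), zero_add]
    exact Finset.sum_eq_zero fun z hz => ih2 z (Finset.mem_Ioi.1 hz) y hc (hΦ.cons _)
      fun e he => h (.cons _ e) (.cons (hc.1 x) he _)

theorem Fam.expandSum_rep_eq_zero (σ : ZMod 2) {O : A.Ob → Prop} {X : A.Fam} (hX : ∀ x, O (X.obj x))
    (δ : Fam.Hom X X) (r : ℕ) (x y : Fin X.N) {Φ : Chain A.Hom (X.obj x) (X.obj y) → M}
    (h : ∀ e, Within O e → e.length = r → Φ e = 0) :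
    Fam.expandSum σ (Chain.rep δ r) x y Φ = 0 := by
  induction r generalizing x with
  | zero =>
    rw [Chain.rep, Fam.expandSum, Fam.expand]
    split_ifs with hxy
    · subst hxy; simpa using h (.nil _) (hX x) rfl
    · rfl
  | succ r ih =>
    rw [Chain.rep, Fam.expandSum_cons]
    exact Finset.sum_eq_zero fun z _ => ih z fun e he hr => h (.cons _ e) (.cons (hX x) he _)
      (by rw [Chain.length_cons, hr])

theorem Fam.expandSum_rep_two (σ : ZMod 2) {X : A.Fam} (δ : Fam.Hom X X) (x y : Fin X.N)
    (Φ : Chain A.Hom (X.obj x) (X.obj y) → M) :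
    Fam.expandSum σ (Chain.rep δ 2) x y Φ =
      ∑ z, Φ (.pair (A.twist (X.shift x - σ) (δ x z)) (A.twist (X.shift z - σ) (δ z y))) := by
  have e : ∀ (z z' : Fin X.N) (a : A.Hom (X.obj x) (X.obj z)) (b : A.Hom (X.obj z) (X.obj z')),
      Fam.expandSum σ (.nil X) z' y (fun e => Φ (.cons a (.cons b e))) =
        if h : z' = y then Φ (h ▸ .pair a b) else 0 := by
    intro z z' a b
    rw [Fam.expandSum, Fam.expand]
    split_ifs with h
    · subst h; simp; rfl
    · rfl
  simp only [Chain.rep, Fam.expandSum_cons, e]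
  refine Finset.sum_congr rfl fun z _ => ?_
  rw [Finset.sum_eq_single y (fun z' _ h => dif_neg h) (fun h => absurd (Finset.mem_univ _) h),
    dif_pos rfl]

end AInfData

open AInfData

namespace cyc

variable {k : Type u} [Field k] {n : ℕ} {S : Type w} {s : ZMod (n + 1) ≃ S}

theorem val_add_length_le {X Y : (cyc k s).Ob} (j : ZMod (n + 1)) (c : Chain (cyc k s).Hom X Y)
    (hc : Within (fun Z => Z ≠ s j) c) (h : vProd c ≠ 0) :
    (s.symm X - j).val + c.length ≤ n := by
  induction c with
  | nil X => simpa using Nat.lt_succ_iff.1 (ZMod.val_lt (s.symm X - j))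
  | @cons X Z Y a c ih =>
    have h1 : s.symm X + 1 = s.symm Z := by
      by_contra h1
      exact h (by rw [vProd, vc_eq_zero h1, zero_mul])
    have h2 := ih hc.2 fun h2 => h (by rw [vProd, h2, mul_zero])
    have h3 : s.symm Z - j ≠ 0 := by
      intro h3
      have : Z ≠ s j := by cases c with
        | nil => exact hc.2
        | cons => exact hc.2.1
      exact this ((s.apply_symm_apply Z).symm.trans (congrArg s (sub_eq_zero.1 h3)))
    have h4 : s.symm Z - j = (s.symm X - j) + 1 := by rw [← h1]; ring
    rw [Chain.length_cons]
    have h5 : (s.symm Z - j).val = (s.symm X - j).val + 1 := by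
      rw [h4] at h3 ⊢
      have h9 : s.symm X - j + 1 = (((s.symm X - j).val + 1 : ℕ) : ZMod (n + 1)) := by
        rw [Nat.cast_add, ZMod.natCast_zmod_val, Nat.cast_one]
      rw [h9] at h3 ⊢
      refine ZMod.val_natCast_of_lt (lt_of_le_of_ne (ZMod.val_lt _) fun h8 => h3 ?_)
      rw [h8, ZMod.natCast_self]
    omega

theorem vProdOf_eq_zero_of_within {X Y : (cyc k s).Ob} (j : ZMod (n + 1))
    (c : Chain (cyc k s).Hom X Y) (hc : Within (fun Z => Z ≠ s j) c) : vProdOf (n + 1) c = 0 := by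
  by_contra h
  rw [vProdOf] at h
  split_ifs at h with hl
  · have := val_add_length_le j c hc h
    omega
  · exact h rfl

/-! ### The coefficient matrices of a morphism of twisted complexes -/

/-- The sign `(-1)^p`. -/
def sg (k : Type u) [Field k] (p : ZMod 2) : k := if p = 0 then 1 else -1

theorem sg_zero : sg k 0 = 1 := if_pos rfl

theorem sg_one : sg k 1 = -1 := if_neg one_ne_zero

theorem sg_add (p q : ZMod 2) : sg k (p + q) = sg k p * sg k q := by
  obtain rfl | rfl := zmod_two_cases p <;> obtain rfl | rfl := zmod_two_cases q <;>
    simp [sg_zero, sg_one, show (1 : ZMod 2) + 1 = 0 from rfl]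

theorem idc_twist (p : ZMod 2) {X Y : (cyc k s).Ob} (a : (cyc k s).Hom X Y) :
    idc X Y ((cyc k s).twist p a) = sg k p * idc X Y a := by
  obtain rfl | rfl := zmod_two_cases p
  · rw [twist_zero_left, sg_zero, one_mul]
  · rw [twist_one, idc_redSgn, sg_one, neg_one_mul]

theorem vc_twist (p : ZMod 2) {X Y : (cyc k s).Ob} (a : (cyc k s).Hom X Y) :
    vc X Y ((cyc k s).twist p a) = vc X Y a := by
  obtain rfl | rfl := zmod_two_cases p
  · rw [twist_zero_left]
  · rw [twist_one, vc_redSgn]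

variable {X Y Z : (cyc k s).Fam}

/-- The matrix of the coefficients of the identities. -/
def idM (a : Fam.Hom X Y) : Matrix (Fin X.N) (Fin Y.N) k := fun x y => idc _ _ (a x y)

/-- The matrix of the coefficients of the generators of degree one. -/
def vM (a : Fam.Hom X Y) : Matrix (Fin X.N) (Fin Y.N) k := fun x y => vc _ _ (a x y)

/-- The morphism with given matrices of coefficients. -/
def mat (X Y : (cyc k s).Fam) (a b : Matrix (Fin X.N) (Fin Y.N) k) : Fam.Hom X Y :=
  fun x y => mkHom _ _ (a x y) (b x y)

theorem hom_ext {a b : Fam.Hom X Y} (h : idM a = idM b) (h' : vM a = vM b) : a = b :=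
  funext fun x => funext fun y => ext (congrFun (congrFun h x) y) (congrFun (congrFun h' x) y)

theorem idM_mat {a b : Matrix (Fin X.N) (Fin Y.N) k}
    (h : ∀ x y, s.symm (X.obj x) ≠ s.symm (Y.obj y) → a x y = 0) : idM (mat X Y a b) = a := by
  funext x y
  refine (idc_mkHom _ _).trans ?_
  split_ifs with h'
  · rfl
  · exact (h x y h').symm

theorem vM_mat {a b : Matrix (Fin X.N) (Fin Y.N) k}
    (h : ∀ x y, s.symm (X.obj x) + 1 ≠ s.symm (Y.obj y) → b x y = 0) : vM (mat X Y a b) = b := by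
  funext x y
  refine (vc_mkHom _ _).trans ?_
  split_ifs with h'
  · rfl
  · exact (h x y h').symm

/-- Multiply the entries of a matrix by signs. -/
def conj (X Y : (cyc k s).Fam) (a : Matrix (Fin X.N) (Fin Y.N) k) : Matrix (Fin X.N) (Fin Y.N) k :=
  fun x y => sg k (Y.shift y - X.shift x) * a x y

theorem idM_proj (p : ZMod 2) (a : Fam.Hom X Y) (x : Fin X.N) (y : Fin Y.N) :
    idM (Fam.proj p a) x y = if p = Y.shift y - X.shift x then idM a x y else 0 := by
  refine (idc_proj _ _).trans ?_
  congr 1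
  rw [add_sub_assoc, ← eq_neg_iff_add_eq_zero, neg_sub]

theorem vM_proj (p : ZMod 2) (a : Fam.Hom X Y) (x : Fin X.N) (y : Fin Y.N) :
    vM (Fam.proj p a) x y = if p = Y.shift y - X.shift x + 1 then vM a x y else 0 := by
  refine (vc_proj _ _).trans ?_
  congr 1
  rw [add_sub_assoc, ← eq_sub_iff_add_eq, eq_iff_iff]
  constructor <;> (rintro h; rw [h]; ring)

theorem mul_sub_mul_apply {l m o : ℕ} (a : Matrix (Fin l) (Fin m) k) (b : Matrix (Fin m) (Fin o) k)
    (c : Matrix (Fin l) (Fin m) k) (d : Matrix (Fin m) (Fin o) k) (x : Fin l) (y : Fin o) :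
    (a * b - c * d) x y = ∑ z, (a x z * b z y - c x z * d z y) := by
  rw [Matrix.sub_apply, Matrix.mul_apply, Matrix.mul_apply, Finset.sum_sub_distrib]

section Tw

variable {X Y Z : (cyc k s).TwOb}

theorem idc_tw_μ (c : (cyc k s).TwChain X Y) (x : Fin X.1.N) (y : Fin Y.1.N) :
    idM ((cyc k s).tw.μ c : Fam.Hom X.1.toFam Y.1.toFam) x y =
      twSum (X.1.shift x) c x y idComp + twSum (X.1.shift x) c x y (vProdOf (n + 1)) := by
  rw [← twSum_add]
  refine (congrArg (idc _ _) (tw_μ c x y)).trans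
    ((map_twSum (X.1.shift x) c x y (idc _ _).toAddMonoidHom (cyc k s).μ).symm.trans ?_)
  exact congrArg (twSum (X.1.shift x) c x y) (funext fun e => idc_μ e)

theorem vc_tw_μ (c : (cyc k s).TwChain X Y) (x : Fin X.1.N) (y : Fin Y.1.N) :
    vM ((cyc k s).tw.μ c : Fam.Hom X.1.toFam Y.1.toFam) x y = twSum (X.1.shift x) c x y vComp := by
  refine (congrArg (vc _ _) (tw_μ c x y)).trans
    ((map_twSum (X.1.shift x) c x y (vc _ _).toAddMonoidHom (cyc k s).μ).symm.trans ?_)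
  exact congrArg (twSum (X.1.shift x) c x y) (funext fun e => vc_μ e)

/-- The part of a composition which arises from the operation with `n + 1` entries. -/
def cycM (c : (cyc k s).TwChain X Y) : Matrix (Fin X.1.N) (Fin Y.1.N) k :=
  fun x y => twSum (X.1.shift x) c x y (vProdOf (n + 1))

theorem cycM_eq_zero (j : ZMod (n + 1)) (c : (cyc k s).TwChain X Y)
    (hc : Within (A := (cyc k s).tw) (X := X) (Y := Y) (fun X => ∀ x, X.1.obj x ≠ s j) c) :
    cycM c = 0 :=
  funext fun x => funext fun y => twSum_eq_zero_of_within (O := fun X => X ≠ s j) _ c x y hc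
    (vProdOf_multilin _).killsZero fun e he => vProdOf_eq_zero_of_within j e he

theorem idM_mul (a : Fam.Hom X.1.toFam Y.1.toFam) (b : Fam.Hom Y.1.toFam Z.1.toFam) :
    idM ((cyc k s).tw.mul (X := X) (Y := Y) (Z := Z) a b : Fam.Hom X.1.toFam Z.1.toFam) =
      conj _ _ (idM a) * idM b + cycM (.pair a b) := by
  funext x z
  refine (idc_tw_μ _ x z).trans (congrArg (· + cycM (.pair a b) x z) ?_)
  refine (twSum_pair _ a b x z idComp_multilin.killsZero fun e he =>
    idComp_eq_zero (by omega)).trans (Finset.sum_congr rfl fun y _ => ?_)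
  refine (congrArg₂ (· * ·) (idc_twist _ (a x y)) (idc_twist _ (b y z))).trans ?_
  rw [sub_self, sg_zero, one_mul, mul_left_comm]
  exact (mul_assoc _ _ _).symm

theorem vM_mul (a : Fam.Hom X.1.toFam Y.1.toFam) (b : Fam.Hom Y.1.toFam Z.1.toFam) :
    vM ((cyc k s).tw.mul (X := X) (Y := Y) (Z := Z) a b : Fam.Hom X.1.toFam Z.1.toFam) =
      idM a * vM b - conj _ _ (vM a) * idM b := by
  funext x z
  refine (vc_tw_μ _ x z).trans ((twSum_pair _ a b x z vComp_multilin.killsZero fun e he =>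
    vComp_eq_zero (by omega)).trans (Eq.trans ?_ (mul_sub_mul_apply _ _ _ _ _ _).symm))
  refine Finset.sum_congr rfl fun y _ => ?_
  refine (congrArg₂ (· - ·) (congrArg₂ (· * ·) (idc_twist _ (a x y)) (vc_twist _ (b y z)))
    (congrArg₂ (· * ·) (vc_twist _ (a x y)) (idc_twist _ (b y z)))).trans ?_
  rw [sub_self, sg_zero, one_mul, mul_left_comm, ← mul_assoc (sg k _)]
  rfl

theorem conj_idM_δ (X : (cyc k s).PreTw) (hX : Fam.proj 1 X.δ = X.δ) :
    conj _ _ (idM X.δ) = -idM X.δ := by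
  funext x y
  have h := congrFun (congrFun (congrArg idM hX) x) y
  rw [idM_proj] at h
  rw [conj, Matrix.neg_apply]
  split_ifs at h with h'
  · rw [← h', sg_one, neg_one_mul]
  · rw [← h, mul_zero, neg_zero]

theorem conj_vM_δ (X : (cyc k s).PreTw) (hX : Fam.proj 1 X.δ = X.δ) :
    conj _ _ (vM X.δ) = vM X.δ := by
  funext x y
  have h := congrFun (congrFun (congrArg vM hX) x) y
  rw [vM_proj] at h
  rw [conj]
  split_ifs at h with h'
  · rw [show X.shift y - X.shift x = 0 from right_eq_add.1 h', sg_zero, one_mul]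
  · rw [← h, mul_zero]

theorem idM_d (a : Fam.Hom X.1.toFam Y.1.toFam) :
    idM ((cyc k s).tw.d (X := X) (Y := Y) a : Fam.Hom X.1.toFam Y.1.toFam) =
      conj _ _ (idM a) * idM Y.1.δ - idM X.1.δ * idM a + cycM (.single a) := by
  rw [sub_eq_add_neg, ← Matrix.neg_mul, ← conj_idM_δ X.1 X.2.deg]
  funext x y
  refine (idc_tw_μ _ x y).trans (congrArg (· + cycM (.single a) x y) ?_)
  refine (twSum_single_of_two _ a x y idComp_multilin.killsZero fun e he =>
    idComp_eq_zero he).trans (congrArg₂ (· + ·) (Finset.sum_congr rfl fun z _ => ?_)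
      (Finset.sum_congr rfl fun z _ => ?_))
  · refine (congrArg₂ (· * ·) (idc_twist _ (a x z)) (idc_twist _ (Y.1.δ z y))).trans ?_
    rw [sub_self, sg_zero, one_mul, mul_left_comm]
    exact (mul_assoc _ _ _).symm
  · refine (congrArg₂ (· * ·) (idc_twist _ (X.1.δ x z)) (idc_twist _ (a z y))).trans ?_
    rw [sub_self, sg_zero, one_mul, mul_left_comm]
    exact (mul_assoc _ _ _).symm

theorem vM_d (a : Fam.Hom X.1.toFam Y.1.toFam) :
    vM ((cyc k s).tw.d (X := X) (Y := Y) a : Fam.Hom X.1.toFam Y.1.toFam) =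
      (idM a * vM Y.1.δ - conj _ _ (vM a) * idM Y.1.δ) +
        (idM X.1.δ * vM a - vM X.1.δ * idM a) := by
  rw [← conj_vM_δ X.1 X.2.deg]
  funext x y
  refine (vc_tw_μ _ x y).trans ((twSum_single_of_two _ a x y vComp_multilin.killsZero fun e he =>
    vComp_eq_zero he).trans (congrArg₂ (· + ·) (Eq.trans ?_ (mul_sub_mul_apply _ _ _ _ _ _).symm)
      (Eq.trans ?_ (mul_sub_mul_apply _ _ _ _ _ _).symm)))
  · refine Finset.sum_congr rfl fun z _ => ?_
    refine (congrArg₂ (· - ·) (congrArg₂ (· * ·) (idc_twist _ (a x z)) (vc_twist _ (Y.1.δ z y)))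
      (congrArg₂ (· * ·) (vc_twist _ (a x z)) (idc_twist _ (Y.1.δ z y)))).trans ?_
    rw [sub_self, sg_zero, one_mul, mul_left_comm, ← mul_assoc (sg k _)]
    rfl
  · refine Finset.sum_congr rfl fun z _ => ?_
    refine (congrArg₂ (· - ·) (congrArg₂ (· * ·) (idc_twist _ (X.1.δ x z)) (vc_twist _ (a z y)))
      (congrArg₂ (· * ·) (vc_twist _ (X.1.δ x z)) (idc_twist _ (a z y)))).trans ?_
    rw [sub_self, sg_zero, one_mul, mul_left_comm, ← mul_assoc (sg k _)]
    rfl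

/-- There are no operations with at least three entries between twisted complexes which avoid one
of the objects. -/
theorem strictOn_avoid (j : ZMod (n + 1)) :
    (cyc k s).tw.StrictOn fun X => ∀ x, X.1.obj x ≠ s j := by
  intro X Y c hc hl
  refine hom_ext (funext fun x => funext fun y => ?_) (funext fun x => funext fun y => ?_)
  · refine (idc_tw_μ c x y).trans ((congrArg₂ (· + ·) (twSum_eq_zero_of_length _ c x y fun e he =>
      idComp_eq_zero (by have := hl.trans he; omega))
      (congrFun (congrFun (cycM_eq_zero j c hc) x) y)).trans ((add_zero 0).trans ?_))
    exact (map_zero (idc _ _)).symm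
  · refine (vc_tw_μ c x y).trans ((twSum_eq_zero_of_length _ c x y fun e he =>
      vComp_eq_zero (by have := hl.trans he; omega)).trans ?_)
    exact (map_zero (vc _ _)).symm

theorem isTwisted_of_avoid (X : (cyc k s).PreTw) (j : ZMod (n + 1)) (hj : ∀ x, X.obj x ≠ s j)
    (deg : Fam.proj 1 X.δ = X.δ) (triangular : ∀ x y : Fin X.N, ¬ x < y → X.δ x y = 0)
    (h : idM X.δ * idM X.δ = 0) (h' : idM X.δ * vM X.δ = vM X.δ * idM X.δ) : X.IsTwisted := by
  refine ⟨deg, triangular, List.sum_eq_zero fun m hm => ?_⟩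
  obtain ⟨r, -, rfl⟩ := List.mem_map.1 hm
  have e1 : ∀ (Φ : ∀ {X Y : (cyc k s).Ob}, Chain (cyc k s).Hom X Y → k) x y,
      (∀ {X Y : (cyc k s).Ob} (e : Chain (cyc k s).Hom X Y), e.length ≠ 2 → Φ e = 0) →
      (∑ z, Φ (.pair ((cyc k s).twist (X.shift x - X.shift x) (X.δ x z))
        ((cyc k s).twist (X.shift z - X.shift x) (X.δ z y))) = 0) →
      Fam.expandSum (X.shift x) (Chain.rep X.δ r) x y Φ = 0 := by
    intro Φ x y hΦ h2
    by_cases hr : r = 2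
    · rw [hr, Fam.expandSum_rep_two]
      exact h2
    · exact Fam.expandSum_rep_eq_zero _ (O := fun _ => True) (fun _ => trivial) _ _ _ _
        fun e _ he => hΦ e (by rwa [he])
  have e2 : ∀ x y, idc _ _ ((Fam.μ (Chain.rep X.δ r) : Fam.Hom X.toFam X.toFam) x y) =
      Fam.expandSum (X.shift x) (Chain.rep X.δ r) x y (fun e => idComp e + vProdOf (n + 1) e) := by
    intro x y
    refine (map_list_sum (idc _ _).toAddMonoidHom _).trans ?_
    rw [List.map_map]
    exact congrArg (fun Φ => ((Fam.expand _ _ x y).map Φ).sum) (funext fun e => idc_μ e)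
  have e3 : ∀ x y, vc _ _ ((Fam.μ (Chain.rep X.δ r) : Fam.Hom X.toFam X.toFam) x y) =
      Fam.expandSum (X.shift x) (Chain.rep X.δ r) x y vComp := by
    intro x y
    refine (map_list_sum (vc _ _).toAddMonoidHom _).trans ?_
    rw [List.map_map]
    exact congrArg (fun Φ => ((Fam.expand _ _ x y).map Φ).sum) (funext fun e => vc_μ e)
  have e4 : ∀ x y, Fam.expandSum (X.shift x) (Chain.rep X.δ r) x y (vProdOf (n + 1)) = 0 :=
    fun x y => Fam.expandSum_rep_eq_zero _ (O := fun Z => Z ≠ s j) hj _ _ _ _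
      fun e he _ => vProdOf_eq_zero_of_within j e he
  refine hom_ext (funext fun x => funext fun y => ?_) (funext fun x => funext fun y => ?_)
  · refine (e2 x y).trans (Eq.trans ?_ (map_zero (idc _ _)).symm)
    refine (List.sum_map_add (f := idComp) (g := vProdOf (n + 1))).trans ?_
    refine (congrArg₂ (· + ·) (e1 idComp x y (fun e he => idComp_eq_zero he) ?_) (e4 x y)).trans
      (add_zero 0)
    have h1 : conj _ _ (idM X.δ) * idM X.δ = 0 := by rw [conj_idM_δ X deg, Matrix.neg_mul, h, neg_zero]
    have h2 : conj _ _ (idM X.δ) = fun x z => sg k (X.shift z - X.shift x) * idc _ _ (X.δ x z) := rfl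
    rw [conj_idM_δ X deg] at h2
    refine Eq.trans (Finset.sum_congr rfl fun z _ => ?_) (congrFun (congrFun h1 x) y)
    refine (congrArg₂ (· * ·) (idc_twist _ (X.δ x z)) (idc_twist _ (X.δ z y))).trans ?_
    rw [sub_self, sg_zero, one_mul, mul_left_comm]
    exact (mul_assoc _ _ _).symm
  · refine (e3 x y).trans (Eq.trans (e1 vComp x y (fun e he => vComp_eq_zero he) ?_)
      (map_zero (vc _ _)).symm)
    have h1 : idM X.δ * vM X.δ - conj _ _ (vM X.δ) * idM X.δ = 0 := by
      rw [conj_vM_δ X deg, h', sub_self]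
    refine Eq.trans (Eq.trans (Finset.sum_congr rfl fun z _ => ?_) (Finset.sum_sub_distrib _ _))
      (congrFun (congrFun h1 x) y)
    refine (congrArg₂ (· - ·) (congrArg₂ (· * ·) (idc_twist _ (X.δ x z)) (vc_twist _ (X.δ z y)))
      (congrArg₂ (· * ·) (vc_twist _ (X.δ x z)) (idc_twist _ (X.δ z y)))).trans ?_
    rw [sub_self, sg_zero, one_mul, mul_left_comm, ← mul_assoc (sg k _)]
    rfl

end Tw

end cyc

/-! ### Free representations -/

namespace QuiverRep

variable {k : Type u} [Field k] {n : ℕ}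

/-- The representation which is freely generated by the spaces `V x` at the vertices `x`. -/
def free (V : Fin n → ModuleCat.{u} k) : QuiverRep k n where
  obj a := ModuleCat.of k (∀ x : Fin n, PLift (x ≤ a) → V x)
  map {a b} _ := ModuleCat.ofHom
    { toFun := fun u x _ => if h : x ≤ a then u x ⟨h⟩ else 0
      map_add' := fun u u' => by funext x h; simp only [Pi.add_apply]; split_ifs <;> simp
      map_smul' := fun r u => by funext x h; simp }
  map_id a := by
    refine ModuleCat.hom_ext (LinearMap.ext fun u => funext fun x => funext fun h => ?_)
    exact dif_pos h.down
  map_comp {a b c} f g := by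
    refine ModuleCat.hom_ext (LinearMap.ext fun u => funext fun x => funext fun h => ?_)
    by_cases h' : x ≤ a
    · exact (dif_pos h').trans (Eq.symm ((dif_pos (h'.trans (leOfHom f))).trans (dif_pos h')))
    · refine (dif_neg h').trans (Eq.symm ?_)
      change (if h : x ≤ b then if h'' : x ≤ a then _ else _ else _) = _
      rw [dif_neg h']
      exact ite_self (c := x ≤ b) 0

variable {V : Fin n → ModuleCat.{u} k} {Y : QuiverRep k n}

theorem free_map_apply {a b : Fin n} (f : a ⟶ b) (u : (free V).obj a) (x : Fin n) (h : PLift (x ≤ b)) :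
    ((free V).map f).hom u x h = if h : x ≤ a then u x ⟨h⟩ else 0 := rfl

/-- The value at `a` of the morphism from a free representation given by `φ`. -/
def freeDescApp (φ : ∀ x, V x →ₗ[k] Y.obj x) (a : Fin n) : (free V).obj a →ₗ[k] Y.obj a where
  toFun u := ∑ x, if h : x ≤ a then (Y.map (homOfLE h)).hom (φ x (u x ⟨h⟩)) else 0
  map_add' u u' := by
    rw [← Finset.sum_add_distrib]
    refine Finset.sum_congr rfl fun x _ => ?_
    split_ifs with h
    · exact (congrArg _ (map_add _ _ _)).trans (map_add _ _ _)
    · exact (add_zero 0).symm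
  map_smul' r u := by
    rw [Finset.smul_sum]
    refine Finset.sum_congr rfl fun x _ => ?_
    split_ifs with h
    · exact (congrArg _ (map_smul _ _ _)).trans (map_smul _ _ _)
    · exact (smul_zero _).symm

theorem freeDescApp_apply (φ : ∀ x, V x →ₗ[k] Y.obj x) (a : Fin n) (u : (free V).obj a) :
    freeDescApp φ a u =
      ∑ x, if h : x ≤ a then (Y.map (homOfLE h)).hom (φ x (u x ⟨h⟩)) else 0 := rfl

/-- The morphism from a free representation given by maps `V x → Y x`. -/
def freeDesc (φ : ∀ x, V x →ₗ[k] Y.obj x) : free V ⟶ Y where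
  app a := ModuleCat.ofHom (freeDescApp φ a)
  naturality a b f := by
    refine ModuleCat.hom_ext (LinearMap.ext fun u => ?_)
    refine Eq.trans ?_ (map_sum (Y.map f).hom (fun x : Fin n =>
      if h : x ≤ a then (Y.map (homOfLE h)).hom (φ x (u x ⟨h⟩)) else 0) Finset.univ).symm
    have e (x : Fin n) : (if h : x ≤ b then
        (Y.map (homOfLE h)).hom (φ x (((free V).map f).hom u x ⟨h⟩)) else 0) =
        (Y.map f).hom (if h : x ≤ a then (Y.map (homOfLE h)).hom (φ x (u x ⟨h⟩)) else 0) := ?_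
    · refine Eq.trans ?_ (Fintype.sum_congr _ _ e)
      exact freeDescApp_apply φ b _
    by_cases h : x ≤ a
    · rw [dif_pos h, dif_pos (h.trans (leOfHom f)), free_map_apply, dif_pos h]
      exact ConcreteCategory.congr_hom (Y.map_comp (homOfLE h) f) _
    · rw [dif_neg h, map_zero]
      split_ifs with h'
      · rw [free_map_apply, dif_neg h, map_zero, map_zero]
      · rfl

theorem freeDesc_app_apply (φ : ∀ x, V x →ₗ[k] Y.obj x) (a : Fin n) (u : (free V).obj a) :
    ((freeDesc φ).app a).hom u =
      ∑ x, if h : x ≤ a then (Y.map (homOfLE h)).hom (φ x (u x ⟨h⟩)) else 0 := rfl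

/-- The inclusion of the generators. -/
def freeGen (V : Fin n → ModuleCat.{u} k) (a : Fin n) : V a →ₗ[k] (free V).obj a where
  toFun v x _ := (Pi.single a v : ∀ x, V x) x
  map_add' v w := funext fun x => funext fun _ => congrFun (Pi.single_add (f := fun x => V x) a v w) x
  map_smul' r v := funext fun x => funext fun _ =>
    congrFun (Pi.single_smul (f := fun x => V x) a r v) x

theorem freeGen_apply_same (a : Fin n) (v : V a) (h : PLift (a ≤ a)) : freeGen V a v a h = v :=
  Pi.single_eq_same (M := fun x => V x) a v

theorem freeGen_apply_of_ne {a x : Fin n} (hx : x ≠ a) (v : V a) (h : PLift (x ≤ a)) :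
    freeGen V a v x h = 0 := Pi.single_eq_of_ne (M := fun x => V x) hx v

/-- The components of the elements of a free representation. -/
def freeCoord (V : Fin n → ModuleCat.{u} k) (a x : Fin n) : (free V).obj a →ₗ[k] V x where
  toFun u := if h : x ≤ a then u x ⟨h⟩ else 0
  map_add' u u' := by
    split_ifs
    · rfl
    · exact (add_zero 0).symm
  map_smul' r u := by
    split_ifs
    · rfl
    · exact (smul_zero r).symm

theorem freeCoord_apply {a x : Fin n} (u : (free V).obj a) (h : PLift (x ≤ a)) : freeCoord V a x u = u x h :=
  dif_pos h.down

theorem freeDesc_freeGen (φ : ∀ x, V x →ₗ[k] Y.obj x) (a : Fin n) (v : V a) :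
    ((freeDesc φ).app a).hom (freeGen V a v) = φ a v := by
  rw [freeDesc_app_apply, Finset.sum_eq_single a]
  · rw [dif_pos le_rfl]
    refine (ConcreteCategory.congr_hom (Y.map_id a) _).trans ?_
    exact congrArg (φ a) (freeGen_apply_same a v _)
  · intro x _ hx
    split_ifs with h
    · rw [freeGen_apply_of_ne hx, map_zero, map_zero]
    · rfl
  · exact fun h => absurd (Finset.mem_univ _) h

theorem free_hom_ext {f g : free V ⟶ Y}
    (h : ∀ x v, (f.app x).hom (freeGen V x v) = (g.app x).hom (freeGen V x v)) : f = g := by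
  refine NatTrans.ext (funext fun a => ModuleCat.hom_ext (LinearMap.ext fun u => ?_))
  have e : u = ∑ x, if h : x ≤ a then ((free V).map (homOfLE h)).hom (freeGen V x (u x ⟨h⟩)) else 0 := by
    funext y hy
    have : ∀ x, freeCoord V a y (if h : x ≤ a then
        ((free V).map (homOfLE h)).hom (freeGen V x (u x ⟨h⟩)) else 0) =
          if x = y then u y hy else 0 := by
      intro x
      by_cases hxy : x = y
      · subst hxy
        rw [dif_pos hy.down, if_pos rfl]
        exact (freeCoord_apply _ hy).trans ((dif_pos le_rfl).trans (freeGen_apply_same _ _ _))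
      · rw [if_neg hxy]
        split_ifs with hx
        · refine (freeCoord_apply _ hy).trans
            ((free_map_apply (homOfLE hx) (freeGen V x (u x ⟨hx⟩)) y hy).trans ?_)
          split_ifs
          · exact freeGen_apply_of_ne (fun e => hxy e.symm) _ _
          · rfl
        · exact map_zero _
    refine Eq.trans ?_ ((map_sum (freeCoord V a y) (fun x => if h : x ≤ a then
      ((free V).map (homOfLE h)).hom (freeGen V x (u x ⟨h⟩)) else 0) Finset.univ).symm.trans (freeCoord_apply _ hy))
    rw [Finset.sum_congr rfl fun x _ => this x, Finset.sum_ite_eq', if_pos (Finset.mem_univ _)]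
  rw [e, map_sum, map_sum]
  refine Finset.sum_congr rfl fun x _ => ?_
  split_ifs with hx
  · have e1 := ConcreteCategory.congr_hom (f.naturality (homOfLE hx)) (freeGen V x (u x ⟨hx⟩))
    have e2 := ConcreteCategory.congr_hom (g.naturality (homOfLE hx)) (freeGen V x (u x ⟨hx⟩))
    exact e1.trans ((congrArg _ (h x _)).trans e2.symm)
  · rw [map_zero, map_zero]

instance : Projective (free V) where
  factors {E X} f e _ := by
    have hs (x : Fin n) : Function.Surjective (e.app x).hom :=
      (ModuleCat.epi_iff_surjective _).1 (inferInstance : Epi (e.app x))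
    have hg (x : Fin n) := LinearMap.exists_rightInverse_of_surjective (e.app x).hom
      (LinearMap.range_eq_top.2 (hs x))
    choose g hg using hg
    let φ (x : Fin n) := (g x).comp ((f.app x).hom.comp (freeGen V x))
    refine ⟨freeDesc φ, free_hom_ext fun x v => ?_⟩
    refine (congrArg (e.app x).hom (freeDesc_freeGen φ x v)).trans ?_
    exact LinearMap.congr_fun (hg x) _

theorem free_map_injective {a b : Fin n} (f : a ⟶ b) :
    Function.Injective ((free V).map f).hom := by
  intro u u' h
  funext x hx
  have := congrFun (congrFun h x) ⟨hx.down.trans (leOfHom f)⟩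
  rwa [free_map_apply, free_map_apply, dif_pos hx.down, dif_pos hx.down] at this

/-- The structure maps of a projective representation are injective. -/
theorem injective_of_projective (X : QuiverRep k n) [Projective X] {a b : Fin n} (f : a ⟶ b) :
    Function.Injective (X.map f).hom := by
  let π : free X.obj ⟶ X := freeDesc fun x => LinearMap.id
  have : Epi π := by
    have : ∀ x, Epi (π.app x) := fun x => (ModuleCat.epi_iff_surjective _).2 fun v =>
      ⟨freeGen X.obj x v, freeDesc_freeGen _ x v⟩
    exact NatTrans.epi_of_epi_app π
  let σ := Projective.factorThru (𝟙 X) π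
  have hσ : ∀ x (v : X.obj x), (π.app x).hom ((σ.app x).hom v) = v := fun x v =>
    ConcreteCategory.congr_hom (congrArg (fun φ => φ.app x) (Projective.factorThru_comp (𝟙 X) π)) v
  have hσ' : ∀ v, ((free X.obj).map f).hom ((σ.app a).hom v) = (σ.app b).hom ((X.map f).hom v) :=
    fun v => (ConcreteCategory.congr_hom (σ.naturality f) v).symm
  intro v v' h
  have := free_map_injective f ((hσ' v).trans ((congrArg (σ.app b).hom h).trans (hσ' v').symm))
  rw [← hσ a v, this, hσ]

end QuiverRep

/-! ### The total space of a complex of representations -/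

namespace PerComplex

variable {k : Type u} [Field k] {n : ℕ} {X Y Z : PerComplex (QuiverRep k n)}

/-- The sum of the spaces at all vertices in both degrees. -/
abbrev Total (X : PerComplex (QuiverRep k n)) : Type u := ∀ q : ZMod 2 × Fin n, (X.X q.1).obj q.2

/-- The action of a morphism on the total spaces. -/
def tot (a : Hom X Y) : Total X →ₗ[k] Total Y :=
  LinearMap.pi fun q => ∑ i, ((a i q.1).app q.2).hom ∘ₗ LinearMap.proj (i, q.2)

theorem tot_apply (a : Hom X Y) (u : Total X) (q : ZMod 2 × Fin n) :
    tot a u q = ∑ i, ((a i q.1).app q.2).hom (u (i, q.2)) := by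
  simp [tot]

theorem tot_add (a b : Hom X Y) : tot (a + b) = tot a + tot b := by
  refine LinearMap.ext fun u => funext fun q => ?_
  rw [LinearMap.add_apply, Pi.add_apply, tot_apply, tot_apply, tot_apply, ← Finset.sum_add_distrib]
  rfl

theorem tot_smul (r : k) (a : Hom X Y) : tot (r • a) = r • tot a := by
  refine LinearMap.ext fun u => funext fun q => ?_
  rw [LinearMap.smul_apply, Pi.smul_apply, tot_apply, tot_apply, Finset.smul_sum]
  rfl

/-- The action of morphisms on the total spaces, as a linear map. -/
def totₗ (X Y : PerComplex (QuiverRep k n)) : Hom X Y →ₗ[k] Total X →ₗ[k] Total Y where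
  toFun := tot
  map_add' := tot_add
  map_smul' := tot_smul

theorem tot_sub (a b : Hom X Y) : tot (a - b) = tot a - tot b := (totₗ X Y).map_sub a b

theorem tot_comp (a : Hom X Y) (b : Hom Y Z) : tot (comp a b) = tot b ∘ₗ tot a := by
  refine LinearMap.ext fun u => funext fun q => ?_
  rw [LinearMap.comp_apply, tot_apply, tot_apply]
  simp only [tot_apply, map_sum]
  rw [Finset.sum_comm]
  refine Finset.sum_congr rfl fun i _ => ?_
  rw [comp, NatTrans.app_sum, ModuleCat.hom_sum, LinearMap.sum_apply]
  rfl

theorem tot_single (a : Hom X Y) (i j : ZMod 2) (v : Fin n) (x : (X.X i).obj v) :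
    tot a (Pi.single (i, v) x) (j, v) = ((a i j).app v).hom x := by
  rw [tot_apply, Finset.sum_eq_single i]
  · exact congrArg ((a i j).app v).hom (Pi.single_eq_same (M := fun q : ZMod 2 × Fin n => _) (i, v) x)
  · intro i' _ h
    rw [Pi.single_eq_of_ne (fun e => h (congrArg Prod.fst e)), map_zero]
  · exact fun h => absurd (Finset.mem_univ _) h

theorem tot_injective : Function.Injective (tot : Hom X Y → _) := by
  intro a b h
  refine funext fun i => funext fun j => NatTrans.ext (funext fun v =>
    ModuleCat.hom_ext (LinearMap.ext fun x => ?_))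
  rw [← tot_single, h, tot_single]

/-- The sum of the structure maps between adjacent vertices. -/
def suc (X : PerComplex (QuiverRep k n)) : Total X →ₗ[k] Total X :=
  LinearMap.pi fun q => ∑ w : Fin n, if h : w.val + 1 = q.2.val then
    ((X.X q.1).map (homOfLE (Fin.le_def.2 (Nat.le_of_succ_le h.le)))).hom ∘ₗ LinearMap.proj (q.1, w)
    else 0

theorem suc_apply (u : Total X) (i : ZMod 2) {v w : Fin n} (h : v.val + 1 = w.val) :
    suc X u (i, w) =
      ((X.X i).map (homOfLE (Fin.le_def.2 (Nat.le_of_succ_le h.le)))).hom (u (i, v)) := by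
  rw [suc, LinearMap.pi_apply, LinearMap.sum_apply, Finset.sum_eq_single v]
  · rw [dif_pos h]; rfl
  · intro v' _ hv
    rw [dif_neg fun h' => hv (Fin.ext (by simp only at h'; omega))]; rfl
  · exact fun h => absurd (Finset.mem_univ _) h

theorem suc_apply_zero (u : Total X) (i : ZMod 2) {w : Fin n} (h : w.val = 0) :
    suc X u (i, w) = 0 := by
  rw [suc, LinearMap.pi_apply, LinearMap.sum_apply]
  refine Finset.sum_eq_zero fun v' _ => ?_
  rw [dif_neg (by simp [h])]; rfl

theorem val_eq_zero_or (w : Fin n) : w.val = 0 ∨ ∃ v : Fin n, v.val + 1 = w.val := by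
  obtain h | h := Nat.eq_zero_or_pos w.val
  · exact .inl h
  · exact .inr ⟨⟨w.val - 1, by omega⟩, by simp only; omega⟩

theorem tot_suc (a : Hom X Y) : tot a ∘ₗ suc X = suc Y ∘ₗ tot a := by
  refine LinearMap.ext fun u => funext fun ⟨j, w⟩ => ?_
  rw [LinearMap.comp_apply, LinearMap.comp_apply, tot_apply]
  obtain h | ⟨v, h⟩ := val_eq_zero_or w
  · rw [suc_apply_zero _ _ h]
    refine Finset.sum_eq_zero fun i _ => ?_
    rw [suc_apply_zero _ _ h, map_zero]
  · rw [suc_apply _ _ h, tot_apply, map_sum]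
    refine Finset.sum_congr rfl fun i _ => ?_
    rw [suc_apply _ _ h]
    exact ConcreteCategory.congr_hom ((a i j).naturality _) _

/-- Multiply the elements of degree `p` by `(-1)^p`. -/
def par (X : PerComplex (QuiverRep k n)) : Total X →ₗ[k] Total X :=
  LinearMap.pi fun q => cyc.sg k q.1 • LinearMap.proj q

theorem par_apply (u : Total X) (q : ZMod 2 × Fin n) : par X u q = cyc.sg k q.1 • u q := rfl

theorem tot_sgn (a : Hom X Y) : tot (sgn a) = par Y ∘ₗ tot a ∘ₗ par X := by
  refine LinearMap.ext fun u => funext fun q => ?_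
  rw [LinearMap.comp_apply, LinearMap.comp_apply, par_apply, tot_apply, tot_apply, Finset.smul_sum]
  refine Finset.sum_congr rfl fun i _ => ?_
  rw [par_apply, map_smul, smul_smul, ← cyc.sg_add, sgn]
  have : q.1 + i = 0 ↔ i = q.1 := by
    generalize q.1 = j; revert i j; decide
  rw [cyc.sg]
  simp only [this]
  split_ifs with h
  · rw [one_smul]
  · rw [neg_one_smul]; rfl

/-- Left inverses of the structure maps. -/
theorem exists_leftInverse_suc (h : ∀ i (a b : Fin n) (f : a ⟶ b),
    Function.Injective ((X.X i).map f).hom) :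
    ∃ R : Total X →ₗ[k] Total X,
      (∀ u i v, (∀ w : Fin n, v.val + 1 = w.val → u (i, w) = 0) → R u (i, v) = 0) ∧
      ∀ u i v, R (suc X u) (i, v) = if v.val + 1 < n then u (i, v) else 0 := by
  have hr (i : ZMod 2) (a b : Fin n) (hab : a.val + 1 = b.val) :=
    LinearMap.exists_leftInverse_of_injective
      ((X.X i).map (homOfLE (Fin.le_def.2 (Nat.le_of_succ_le hab.le)))).hom
      (LinearMap.ker_eq_bot.2 (h i a b _))
  choose r hr using hr
  refine ⟨LinearMap.pi fun q => if h : q.2.val + 1 < n then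
    r q.1 q.2 ⟨q.2.val + 1, h⟩ rfl ∘ₗ
      LinearMap.proj (φ := fun q : ZMod 2 × Fin n => (X.X q.1).obj q.2) (q.1, ⟨q.2.val + 1, h⟩)
    else 0, ?_, ?_⟩
  · intro u i v hu
    rw [LinearMap.pi_apply]
    split_ifs with h
    · exact (congrArg (r i v ⟨v.val + 1, h⟩ rfl) (hu ⟨v.val + 1, h⟩ rfl)).trans (map_zero _)
    · rfl
  · intro u i v
    rw [LinearMap.pi_apply]
    split_ifs with h
    · exact (congrArg _ (suc_apply u i (show v.val + 1 = (⟨v.val + 1, h⟩ : Fin n).val from rfl))).trans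
        (LinearMap.congr_fun (hr i v ⟨v.val + 1, h⟩ rfl) (u (i, v)))
    · rfl

/-- Maps between total spaces which are compatible with the structure maps. -/
theorem exists_tot_eq {L : Total X →ₗ[k] Total Y}
    (hL : ∀ i j (v w : Fin n) (x : (X.X i).obj v), v ≠ w → L (Pi.single (i, v) x) (j, w) = 0)
    (hs : L ∘ₗ suc X = suc Y ∘ₗ L) : ∃ a : Hom X Y, tot a = L := by
  have hsuc (i : ZMod 2) {v w : Fin n} (h : v.val + 1 = w.val) (x : (X.X i).obj v) :
      suc X (Pi.single (i, v) x) = Pi.single (i, w)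
        (((X.X i).map (homOfLE (Fin.le_def.2 (Nat.le_of_succ_le h.le)))).hom x) := by
    funext ⟨j, w'⟩
    obtain hw | ⟨v', hw⟩ := val_eq_zero_or w'
    · rw [suc_apply_zero _ _ hw, Pi.single_eq_of_ne]
      intro e
      have := congrArg (fun q => q.2.val) e
      simp only at this
      omega
    · rw [suc_apply _ _ hw]
      by_cases e : (j, v') = (i, v)
      · obtain ⟨rfl, rfl⟩ := Prod.ext_iff.1 e
        obtain rfl : w = w' := Fin.ext (by simp only at h hw; omega)
        rw [Pi.single_eq_same, Pi.single_eq_same]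
      · rw [Pi.single_eq_of_ne e, map_zero, Pi.single_eq_of_ne]
        intro e'
        obtain ⟨rfl, rfl⟩ := Prod.ext_iff.1 e'
        exact e (Prod.ext rfl (Fin.ext (by simp only at h hw ⊢; omega)))
  let c (i j : ZMod 2) (v : Fin n) : (X.X i).obj v →ₗ[k] (Y.X j).obj v :=
    LinearMap.proj (j, v) ∘ₗ L ∘ₗ LinearMap.single k (fun q : ZMod 2 × Fin n => (X.X q.1).obj q.2) (i, v)
  have hc (i j : ZMod 2) (v : Fin n) (x) : c i j v x = L (Pi.single (i, v) x) (j, v) := rfl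
  have step (i j : ZMod 2) {v w : Fin n} (h : v.val + 1 = w.val) (x) :
      c i j w (((X.X i).map (homOfLE (Fin.le_def.2 (Nat.le_of_succ_le h.le)))).hom x) =
        ((Y.X j).map (homOfLE (Fin.le_def.2 (Nat.le_of_succ_le h.le)))).hom (c i j v x) := by
    rw [hc, ← hsuc i h, ← LinearMap.comp_apply, hs, LinearMap.comp_apply, suc_apply _ _ h, hc]
  have nat (i j : ZMod 2) (v : Fin n) (m : ℕ) : ∀ (w : Fin n) (_ : w.val = v.val + m) (f : v ⟶ w) (x),
      c i j w (((X.X i).map f).hom x) = ((Y.X j).map f).hom (c i j v x) := by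
    induction m with
    | zero =>
      intro w hw f x
      obtain rfl : w = v := Fin.ext hw
      obtain rfl : f = 𝟙 _ := Subsingleton.elim _ _
      rw [CategoryTheory.Functor.map_id, CategoryTheory.Functor.map_id]
      rfl
    | succ m ih =>
      intro w hw f x
      let w' : Fin n := ⟨v.val + m, by omega⟩
      have h : w'.val + 1 = w.val := by simp only [w']; omega
      have f' : v ⟶ w' := homOfLE (Fin.le_def.2 (by simp [w']))
      obtain rfl : f = f' ≫ homOfLE (Fin.le_def.2 (Nat.le_of_succ_le h.le)) := Subsingleton.elim _ _
      rw [Functor.map_comp, Functor.map_comp]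
      refine (step i j h _).trans ?_
      exact congrArg _ (ih w' rfl f' x)
  refine ⟨fun i j => { app := fun v => ModuleCat.ofHom (c i j v), naturality := fun v w f => ?_ },
    LinearMap.pi_ext fun q x => funext fun ⟨j, w⟩ => ?_⟩
  · refine ModuleCat.hom_ext (LinearMap.ext fun x => ?_)
    exact nat i j v (w.val - v.val) w (by have := Fin.le_def.1 (leOfHom f); omega) f x
  · obtain ⟨i, v⟩ := q
    by_cases h : v = w
    · subst h
      exact tot_single _ i j v x
    · rw [hL i j v w x h, tot_apply]
      refine Finset.sum_eq_zero fun i' _ => ?_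
      rw [Pi.single_eq_of_ne fun e => h (congrArg Prod.snd e).symm, map_zero]

end PerComplex

/-! ### Matrices of linear maps -/

section Mx

variable {k : Type u} [Field k] {N N' N'' : ℕ} {U U' U'' : Type*} [AddCommGroup U] [Module k U]
  [AddCommGroup U'] [Module k U'] [AddCommGroup U''] [Module k U'']

/-- The matrix of a linear map; its rows correspond to the basis of the source. -/
noncomputable def mx (b : Module.Basis (Fin N) k U) (b' : Module.Basis (Fin N') k U') :
    (U →ₗ[k] U') →ₗ[k] Matrix (Fin N) (Fin N') k where
  toFun L x y := b'.repr (L (b x)) y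
  map_add' L L' := by ext x y; simp; rfl
  map_smul' r L := by ext x y; simp; rfl

variable (b : Module.Basis (Fin N) k U) (b' : Module.Basis (Fin N') k U')
  (b'' : Module.Basis (Fin N'') k U'')

theorem mx_apply (L : U →ₗ[k] U') (x : Fin N) (y : Fin N') : mx b b' L x y = b'.repr (L (b x)) y := rfl

theorem mx_comp (L : U →ₗ[k] U') (L' : U' →ₗ[k] U'') :
    mx b b'' (L' ∘ₗ L) = mx b b' L * mx b' b'' L' := by
  funext x z
  rw [Matrix.mul_apply, mx_apply, LinearMap.comp_apply]
  conv_lhs => rw [← b'.sum_repr (L (b x)), map_sum, map_sum, Finsupp.finsetSum_apply]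
  refine Finset.sum_congr rfl fun y _ => ?_
  rw [map_smul, map_smul]
  rfl

theorem mx_id : mx b b LinearMap.id = 1 := by
  funext x y
  rw [mx_apply, LinearMap.id_apply, b.repr_self, Finsupp.single_apply, Matrix.one_apply]

theorem mx_injective : Function.Injective (mx b b') := by
  intro L L' h
  refine b.ext fun x => b'.repr.injective (Finsupp.ext fun y => ?_)
  exact congrFun (congrFun h x) y

theorem mx_surjective : Function.Surjective (mx b b') := by
  intro A
  refine ⟨b.constr k fun x => ∑ y, A x y • b' y, ?_⟩
  funext x y
  rw [mx_apply, b.constr_basis, b'.repr_sum_self]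

end Mx

/-- All nonzero entries of the matrix raise the given integer by `r`. -/
def Raises {k : Type u} [Field k] {N N' n : ℕ} (f : Fin N → Fin n) (g : Fin N' → Fin n) (r : ℤ)
    (M : Matrix (Fin N) (Fin N') k) : Prop :=
  ∀ x y, M x y ≠ 0 → ((g y).val : ℤ) = (f x).val + r

namespace Raises

variable {k : Type u} [Field k] {N N' N'' n : ℕ} {f : Fin N → Fin n} {g : Fin N' → Fin n}
  {h : Fin N'' → Fin n} {r r' : ℤ}

theorem mul {M : Matrix (Fin N) (Fin N') k} {M' : Matrix (Fin N') (Fin N'') k}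
    (hM : Raises f g r M) (hM' : Raises g h r' M') : Raises f h (r + r') (M * M') := by
  intro x z hz
  rw [Matrix.mul_apply] at hz
  obtain ⟨y, -, hy⟩ := Finset.exists_ne_zero_of_sum_ne_zero hz
  rw [hM' y z (right_ne_zero_of_mul hy), hM x y (left_ne_zero_of_mul hy), add_assoc]

theorem sum {ι : Type*} {s : Finset ι} {M : ι → Matrix (Fin N) (Fin N') k}
    (hM : ∀ i ∈ s, Raises f g r (M i)) : Raises f g r (∑ i ∈ s, M i) := by
  intro x y hz
  rw [Matrix.sum_apply] at hz
  obtain ⟨i, hi, hy⟩ := Finset.exists_ne_zero_of_sum_ne_zero hz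
  exact hM i hi x y hy

theorem pow {M : Matrix (Fin N) (Fin N) k} (hM : Raises f f r M) (m : ℕ) :
    Raises f f (m * r) (M ^ m) := by
  induction m with
  | zero =>
    intro x y h
    rw [pow_zero, Matrix.one_apply] at h
    obtain rfl : x = y := by by_contra e; exact h (if_neg e)
    simp
  | succ m ih =>
    rw [pow_succ]
    convert ih.mul hM using 1
    push_cast
    ring

theorem neg {M : Matrix (Fin N) (Fin N') k} (hM : Raises f g r M) : Raises f g r (-M) :=
  fun x y h => hM x y fun e => h (by rw [Matrix.neg_apply, e, neg_zero])

/-- Solution of the equation `T C - C T' = B`, where `T` has a right inverse except at the last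
vertex. -/
theorem exists_mul_sub_mul_eq {T R : Matrix (Fin N) (Fin N) k} {T' : Matrix (Fin N') (Fin N') k}
    {B : Matrix (Fin N) (Fin N') k} (hR : Raises f f (-1) R) (hT' : Raises g g 1 T')
    (hTR : T * R = Matrix.diagonal fun x => if (f x).val + 1 < n then 1 else 0)
    (hB : Raises f g 1 B) : ∃ C : Matrix (Fin N) (Fin N') k, Raises f g 0 C ∧ T * C - C * T' = B := by
  have hG (m : ℕ) : Raises f g 1 (R ^ m * B * T' ^ m) := by
    convert ((hR.pow m).mul hB).mul (hT'.pow m) using 1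
    ring
  have h1 (m : ℕ) : T * R * (R ^ m * B * T' ^ m) = R ^ m * B * T' ^ m := by
    rw [hTR]
    funext x y
    rw [Matrix.diagonal_mul]
    split_ifs with h
    · exact one_mul _
    · rw [zero_mul]
      by_contra h'
      have := hG m x y fun e => h' e.symm
      have := (g y).2
      omega
  refine ⟨∑ m ∈ Finset.range n, R ^ (m + 1) * B * T' ^ m, Raises.sum fun m _ => ?_, ?_⟩
  · convert ((hR.pow (m + 1)).mul hB).mul (hT'.pow m) using 1
    push_cast
    ring
  · rw [Matrix.mul_sum, Matrix.sum_mul, ← Finset.sum_sub_distrib]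
    have h2 (m : ℕ) : T * (R ^ (m + 1) * B * T' ^ m) - R ^ (m + 1) * B * T' ^ m * T' =
        R ^ m * B * T' ^ m - R ^ (m + 1) * B * T' ^ (m + 1) := by
      rw [← h1 m, pow_succ' R, pow_succ T']
      simp only [Matrix.mul_assoc]
    rw [Finset.sum_congr rfl fun m _ => h2 m,
      Finset.sum_range_sub' (fun m => R ^ m * B * T' ^ m), pow_zero, pow_zero, Matrix.one_mul, Matrix.mul_one]
    have h3 : R ^ n = 0 := by
      funext x y
      by_contra h
      have := hR.pow n x y h
      have := (f x).2
      omega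
    rw [h3, Matrix.zero_mul, Matrix.zero_mul, sub_zero]

end Raises

/-! ### Homogeneous bases of complexes of representations -/

/-- A homogeneous basis of the total space in which the differential and the structure maps are
strictly triangular. -/
structure Frame {k : Type u} [Field k] {n : ℕ} (X : PerComplex (QuiverRep k n)) where
  N : ℕ
  deg : Fin N → ZMod 2
  vert : Fin N → Fin n
  basis : Module.Basis (Fin N) k X.Total
  homog : ∀ x q, q ≠ (deg x, vert x) → basis x q = 0
  d_triangular : ∀ x y, ¬ x < y → mx basis basis (PerComplex.tot X.d) x y = 0
  suc_triangular : ∀ x y, ¬ x < y → mx basis basis (PerComplex.suc X) x y = 0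

namespace Frame

open PerComplex

variable {k : Type u} [Field k] {n : ℕ} {X Y : PerComplex (QuiverRep k n)} (F : Frame X) (G : Frame Y)

theorem single_basis (q : ZMod 2 × Fin n) (x : Fin F.N) :
    (Pi.single q (F.basis x q) : X.Total) = if q = (F.deg x, F.vert x) then F.basis x else 0 := by
  split_ifs with h
  · funext q'
    by_cases hq : q' = q
    · subst hq; rw [Pi.single_eq_same]
    · rw [Pi.single_eq_of_ne hq, F.homog x q' fun e => hq (e.trans h.symm)]
  · rw [F.homog x q h, Pi.single_zero]

theorem repr_single (q : ZMod 2 × Fin n) (u : X.Total) (y : Fin F.N) :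
    F.basis.repr (Pi.single q (u q)) y =
      if q = (F.deg y, F.vert y) then F.basis.repr u y else 0 := by
  let L : X.Total →ₗ[k] k := Finsupp.lapply y ∘ₗ F.basis.repr.toLinearMap ∘ₗ
    LinearMap.single k _ q ∘ₗ LinearMap.proj q
  let L' : X.Total →ₗ[k] k := if q = (F.deg y, F.vert y) then
    Finsupp.lapply y ∘ₗ F.basis.repr.toLinearMap else 0
  have e : L = L' := F.basis.ext fun x => by
    change F.basis.repr (Pi.single q (F.basis x q)) y = _
    rw [F.single_basis]
    by_cases hxy : x = y
    · subst hxy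
      simp only [L']
      split_ifs
      · rfl
      · simp
    · have h1 : F.basis.repr (F.basis x) y = 0 := by
        rw [F.basis.repr_self, Finsupp.single_eq_of_ne (fun e => hxy e.symm)]
      have h2 : L' (F.basis x) = 0 := by
        simp only [L']
        split_ifs
        · exact h1
        · rfl
      rw [h2]
      split_ifs
      · exact h1
      · simp
  have := LinearMap.congr_fun e u
  refine this.trans ?_
  simp only [L']
  split_ifs <;> rfl

theorem repr_eq_zero {u : X.Total} {y : Fin F.N} (h : u (F.deg y, F.vert y) = 0) :
    F.basis.repr u y = 0 := by
  have := F.repr_single (F.deg y, F.vert y) u y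
  rw [if_pos rfl, h, Pi.single_zero, map_zero] at this
  exact this.symm

theorem repr_single_eq_zero {q : ZMod 2 × Fin n} (z : (X.X q.1).obj q.2) {y : Fin F.N}
    (h : q ≠ (F.deg y, F.vert y)) : F.basis.repr (Pi.single q z) y = 0 :=
  F.repr_eq_zero (Pi.single_eq_of_ne (fun e => h e.symm) _)

theorem raises_tot (a : Hom X Y) : Raises F.vert G.vert 0 (mx F.basis G.basis (tot a)) := by
  intro x y h
  by_contra hv
  refine h (G.repr_eq_zero ?_)
  rw [tot_apply]
  refine Finset.sum_eq_zero fun i _ => ?_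
  rw [F.homog x _ fun e => hv ?_, map_zero]
  rw [show G.vert y = F.vert x from congrArg Prod.snd e, add_zero]

theorem raises_suc : Raises F.vert F.vert 1 (mx F.basis F.basis (suc X)) := by
  intro x y h
  by_contra hv
  refine h (F.repr_eq_zero ?_)
  obtain hw | ⟨v, hw⟩ := val_eq_zero_or (F.vert y)
  · exact suc_apply_zero _ _ hw
  · rw [suc_apply _ _ hw, F.homog x _ fun e => hv ?_, map_zero]
    rw [← show _ = F.vert x from congrArg Prod.snd e, ← hw]
    push_cast
    rfl

theorem par_basis (x : Fin F.N) : par X (F.basis x) = cyc.sg k (F.deg x) • F.basis x := by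
  funext q
  rw [par_apply, Pi.smul_apply]
  by_cases h : q = (F.deg x, F.vert x)
  · rw [h]
  · rw [F.homog x q h, smul_zero, smul_zero]

theorem repr_par (u : X.Total) (y : Fin F.N) :
    F.basis.repr (par X u) y = cyc.sg k (F.deg y) * F.basis.repr u y := by
  rw [← smul_eq_mul, ← Finsupp.smul_apply, ← map_smul]
  refine sub_eq_zero.1 ?_
  rw [← Finsupp.sub_apply, ← map_sub]
  exact F.repr_eq_zero (sub_self _)

theorem mx_tot_sgn (a : Hom X Y) (x : Fin F.N) (y : Fin G.N) :
    mx F.basis G.basis (tot (sgn a)) x y =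
      cyc.sg k (G.deg y - F.deg x) * mx F.basis G.basis (tot a) x y := by
  rw [mx_apply, tot_sgn, LinearMap.comp_apply, LinearMap.comp_apply, F.par_basis, map_smul, map_smul,
    map_smul, Finsupp.smul_apply, G.repr_par, smul_eq_mul, CharTwo.sub_eq_add, cyc.sg_add, mx_apply]
  ring

theorem exists_tot_eq {A : Matrix (Fin F.N) (Fin G.N) k} (hA : Raises F.vert G.vert 0 A)
    (hs : mx F.basis F.basis (suc X) * A = A * mx G.basis G.basis (suc Y)) :
    ∃ a : Hom X Y, mx F.basis G.basis (tot a) = A := by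
  obtain ⟨L, rfl⟩ := mx_surjective F.basis G.basis A
  rw [← mx_comp, ← mx_comp] at hs
  have hL : ∀ i j (v w : Fin n) (x : (X.X i).obj v), v ≠ w → L (Pi.single (i, v) x) (j, w) = 0 := ?_
  · obtain ⟨a, ha⟩ := PerComplex.exists_tot_eq hL (mx_injective _ _ hs)
    exact ⟨a, congrArg _ ha⟩
  · intro i j v w x hvw
    have e : ∀ u : X.Total, L u (j, w) = ∑ x, F.basis.repr u x • L (F.basis x) (j, w) := by
      intro u
      conv_lhs => rw [← F.basis.sum_repr u, map_sum, Finset.sum_apply]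
      exact Finset.sum_congr rfl fun x _ => by rw [map_smul, Pi.smul_apply]
    rw [e]
    refine Finset.sum_eq_zero fun x' _ => ?_
    by_cases hx : F.vert x' = w
    · rw [F.repr_single_eq_zero (q := (i, v)) x fun e =>
        hvw ((show v = F.vert x' from congrArg Prod.snd e).trans hx), zero_smul]
    · rw [← G.basis.sum_repr (L (F.basis x')), Finset.sum_apply, Finset.sum_eq_zero, smul_zero]
      intro y _
      rw [Pi.smul_apply]
      by_cases hy : G.vert y = w
      · have : mx F.basis G.basis L x' y = 0 := by
          by_contra h
          have := hA x' y h
          exact hx (Fin.ext (by rw [← hy]; omega))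
        rw [mx_apply] at this
        rw [this, zero_smul]
      · rw [G.homog y _ fun e => hy (congrArg Prod.snd e).symm, smul_zero]

theorem exists_mul_sub_mul_eq (h : ∀ i (a b : Fin n) (f : a ⟶ b),
    Function.Injective ((X.X i).map f).hom) {B : Matrix (Fin F.N) (Fin G.N) k}
    (hB : Raises F.vert G.vert 1 B) : ∃ C : Matrix (Fin F.N) (Fin G.N) k, Raises F.vert G.vert 0 C ∧
      mx F.basis F.basis (suc X) * C - C * mx G.basis G.basis (suc Y) = B := by
  obtain ⟨R, hR, hR'⟩ := exists_leftInverse_suc h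
  refine Raises.exists_mul_sub_mul_eq (R := mx F.basis F.basis R) ?_ G.raises_suc ?_ hB
  · intro x y hxy
    by_contra hv
    refine hxy (F.repr_eq_zero (hR _ _ _ fun w hw => F.homog x _ fun e => hv ?_))
    rw [← show _ = F.vert x from congrArg Prod.snd e, ← hw]
    push_cast
    ring
  · rw [← mx_comp]
    funext x y
    have e : R (suc X (F.basis x)) =
        (if (F.vert x).val + 1 < n then (1 : k) else 0) • F.basis x := by
      funext ⟨i, v⟩
      rw [hR', Pi.smul_apply]
      by_cases hv : (i, v) = (F.deg x, F.vert x)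
      · rw [← show v = F.vert x from congrArg Prod.snd hv]
        split_ifs
        · rw [one_smul]
        · rw [zero_smul]
      · rw [F.homog x _ hv, smul_zero, ite_self]
    rw [mx_apply, LinearMap.comp_apply, e, map_smul, F.basis.repr_self, Finsupp.smul_apply,
      Matrix.diagonal_apply, Finsupp.single_apply, smul_eq_mul, mul_ite, mul_one, mul_zero]

end Frame

/-! ### Existence of homogeneous bases -/

theorem exists_equiv_monotone {ι : Type*} [Fintype ι] (key : ι → ℕ) :
    ∃ e : Fin (Fintype.card ι) ≃ ι, Monotone fun x => key (e x) :=
  ⟨(Tuple.sort (key ∘ (Fintype.equivFin ι).symm)).trans (Fintype.equivFin ι).symm,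
    Tuple.monotone_sort (key ∘ (Fintype.equivFin ι).symm)⟩

/-- A basis which is adapted to a subspace; the second part consists of elements of the subspace. -/
theorem exists_adapted_basis {k V : Type*} [Field k] [AddCommGroup V] [Module k V]
    [Module.Finite k V] (R : Submodule k V) :
    ∃ (c r : ℕ) (b : Module.Basis (Fin c ⊕ Fin r) k V),
      (∀ i, b (.inr i) ∈ R) ∧ ∀ v ∈ R, ∀ i, b.repr v (.inl i) = 0 := by
  obtain ⟨C, hC⟩ := R.exists_isCompl
  let b := ((Module.finBasis k C).prod (Module.finBasis k R)).map
    (Submodule.prodEquivOfIsCompl C R hC.symm)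
  refine ⟨_, _, b, fun i => ?_, fun v hv i => ?_⟩
  · simp [b]
  · have : (Submodule.prodEquivOfIsCompl C R hC.symm).symm v = (0, ⟨v, hv⟩) :=
      Submodule.prodEquivOfIsCompl_symm_apply_right _ _ hC.symm ⟨v, hv⟩
    simp [b, this]

namespace PerComplex

variable {k : Type u} [Field k] {n : ℕ} {X : PerComplex (QuiverRep k n)}

theorem d_comp_d (X : PerComplex (QuiverRep k n)) (i j : ZMod 2) : X.d (i + 1) i ≫ X.d i j = 0 := by
  rw [← X.d_sq (i + 1) j, Finset.sum_eq_single i]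
  · intro l _ hl
    rw [X.d_deg (i + 1) l, Limits.zero_comp]
    revert i l; decide
  · exact fun h => absurd (Finset.mem_univ _) h

theorem tot_single_of_ne {Y : PerComplex (QuiverRep k n)} (a : Hom X Y) {q q' : ZMod 2 × Fin n}
    (x : (X.X q.1).obj q.2) (h : q.2 ≠ q'.2) : tot a (Pi.single q x) q' = 0 := by
  rw [tot_apply]
  refine Finset.sum_eq_zero fun i _ => ?_
  have : (Pi.single q x : X.Total) (i, q'.2) = 0 :=
    Pi.single_eq_of_ne (M := fun q : ZMod 2 × Fin n => (X.X q.1).obj q.2) (i := q)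
      (i' := (i, q'.2)) (fun e => h (congrArg Prod.snd e).symm) x
  exact (congrArg ((a i q'.1).app q'.2).hom this).trans (map_zero _)

theorem tot_d_mem (u : X.Total) (q : ZMod 2 × Fin n) :
    tot X.d u q ∈ LinearMap.range ((X.d (q.1 + 1) q.1).app q.2).hom := by
  rw [tot_apply]
  refine Submodule.sum_mem _ fun i _ => ?_
  by_cases h : i = q.1 + 1
  · subst h
    exact ⟨_, rfl⟩
  · rw [X.d_deg i q.1 fun e => h (by rw [e]; generalize i = l; revert l; decide)]
    exact Submodule.zero_mem _

theorem tot_d_single_of_mem {q : ZMod 2 × Fin n} {x : (X.X q.1).obj q.2}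
    (hx : x ∈ LinearMap.range ((X.d (q.1 + 1) q.1).app q.2).hom) :
    tot X.d (Pi.single q x) = 0 := by
  obtain ⟨w, rfl⟩ := hx
  funext ⟨j, v⟩
  by_cases h : v = q.2
  · subst h
    refine (tot_single X.d q.1 j q.2 _).trans ?_
    exact ConcreteCategory.congr_hom (congrArg (fun φ => φ.app q.2) (d_comp_d X q.1 j)) w
  · exact tot_single_of_ne _ _ fun e => h e.symm

end PerComplex

open PerComplex in
theorem Frame.exists_frame {k : Type u} [Field k] {n : ℕ} (X : PerComplex (QuiverRep k n))
    (hX : ∀ i v, Module.Finite k ((X.X i).obj v)) : Nonempty (Frame X) := by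
  have := fun q : ZMod 2 × Fin n => exists_adapted_basis (V := (X.X q.1).obj q.2)
    (LinearMap.range ((X.d (q.1 + 1) q.1).app q.2).hom)
  choose c r b hb hb' using this
  let key : (Σ q, Fin (c q) ⊕ Fin (r q)) → ℕ := fun x =>
    2 * x.1.2.val + Sum.elim (fun _ => 0) (fun _ => 1) x.2
  obtain ⟨e, he⟩ := exists_equiv_monotone key
  let B := (Pi.basis b).reindex e.symm
  have hB (x) : B x = Pi.single (e x).1 (b _ (e x).2) := by
    rw [Module.Basis.reindex_apply, Equiv.symm_symm]
    exact Pi.basis_apply b (e x)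
  have hB' (u : X.Total) (y) : B.repr u y = (b (e y).1).repr (u (e y).1) (e y).2 := by
    rw [Module.Basis.repr_reindex_apply, Equiv.symm_symm, Pi.basis_repr]
  have hk {x y} (h : ¬ x < y) : key (e y) ≤ key (e x) := he (not_lt.1 h)
  refine ⟨⟨_, fun x => (e x).1.1, fun x => (e x).1.2, B, fun x q hq => ?_, fun x y h => ?_,
    fun x y h => ?_⟩⟩
  · rw [hB, Pi.single_eq_of_ne hq]
  · rw [mx_apply, hB', hB]
    have hk := hk h
    generalize e x = x' at hk ⊢
    generalize e y = y' at hk ⊢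
    obtain ⟨q, i | i⟩ := x'
    · obtain ⟨q', j | j⟩ := y'
      · exact hb' _ _ (tot_d_mem _ _) j
      · by_cases hv : q.2 = q'.2
        · simp only [key, hv, Sum.elim_inl, Sum.elim_inr] at hk
          omega
        · rw [tot_single_of_ne _ _ hv, map_zero]
          rfl
    · rw [tot_d_single_of_mem (hb q i)]
      simp
  · rw [mx_apply, hB', hB]
    have hk := hk h
    generalize e x = x' at hk ⊢
    generalize e y = y' at hk ⊢
    have : suc X (Pi.single x'.1 (b x'.1 x'.2)) y'.1 = 0 := by
      obtain hw | ⟨v, hw⟩ := val_eq_zero_or y'.1.2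
      · exact suc_apply_zero _ _ hw
      · refine (suc_apply _ _ hw).trans ?_
        rw [Pi.single_eq_of_ne, map_zero]
        intro e
        have e := congrArg (fun q => q.2.val) e
        simp only [key] at hk e
        have h1 : ∀ z : Σ q, Fin (c q) ⊕ Fin (r q),
            Sum.elim (fun _ => 0) (fun _ => 1) z.2 ≤ (1 : ℕ) := by
          rintro ⟨q, i | i⟩ <;> simp
        have := h1 x'
        omega
    rw [this, map_zero]
    rfl

/-! ### The twisted complex of a complex of representations -/

namespace cyc

variable {k : Type u} [Field k] {n : ℕ} {S : Type w} {s : ZMod (n + 1) ≃ S}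

theorem natCast_inj {a b : ℕ} (ha : a ≤ n) (hb : b ≤ n) : (a : ZMod (n + 1)) = b ↔ a = b := by
  refine ⟨fun h => ?_, fun h => by rw [h]⟩
  rw [← ZMod.val_natCast_of_lt (Nat.lt_succ_of_le ha), h, ZMod.val_natCast_of_lt (Nat.lt_succ_of_le hb)]

theorem symm_ob (k : Type u) [Field k] (s : ZMod (n + 1) ≃ S) (a : ℕ) :
    s.symm (ob k s a) = (a : ZMod (n + 1)) := s.symm_apply_apply _

theorem ob_ne_zero {a : ℕ} (ha : a < n) : ob k s (a + 1) ≠ s 0 := fun h => by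
  have h1 : ((a + 1 : ℕ) : ZMod (n + 1)) = (0 : ℕ) := by rw [Nat.cast_zero]; exact s.injective h
  have := (natCast_inj (by omega) (by omega)).1 h1
  omega

end cyc

namespace cyc

open AInfData

variable {k : Type u} [Field k] {n : ℕ} {S : Type w} {s : ZMod (n + 1) ≃ S} {X Y : (cyc k s).Fam}

theorem mat_add (a a' b b' : Matrix (Fin X.N) (Fin Y.N) k) :
    mat X Y (a + a') (b + b') = mat X Y a b + mat X Y a' b' := by
  funext x y g
  rcases g with g | g <;> rfl

theorem mat_smul (r : k) (a b : Matrix (Fin X.N) (Fin Y.N) k) :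
    mat X Y (r • a) (r • b) = r • mat X Y a b := by
  funext x y g
  rcases g with g | g <;> rfl

end cyc

namespace Frame

open PerComplex AInfData

variable {k : Type u} [Field k] {n : ℕ} {X Y Z : PerComplex (QuiverRep k n)} (F : Frame X) (G : Frame Y)
  {S : Type w} (s : ZMod (n + 1) ≃ S)

/-- The sum of shifted objects which corresponds to a homogeneous basis. -/
abbrev fam : (cyc k s).Fam where
  N := F.N
  obj x := cyc.ob k s ((F.vert x).val + 1)
  shift := F.deg

theorem symm_fam_obj (x : Fin F.N) :
    s.symm ((F.fam s).obj x) = (((F.vert x).val + 1 : ℕ) : ZMod (n + 1)) := cyc.symm_ob k s _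

theorem fam_obj_ne (x : Fin F.N) : (F.fam s).obj x ≠ s 0 := cyc.ob_ne_zero (F.vert x).2

variable {F G s}

theorem conj_zero : cyc.conj (F.fam s) (G.fam s) 0 = 0 :=
  funext fun _ => funext fun _ => mul_zero _

theorem idM_mat_of_raises {a b : Matrix (Fin F.N) (Fin G.N) k} (ha : Raises F.vert G.vert 0 a) :
    cyc.idM (cyc.mat (F.fam s) (G.fam s) a b) = a := by
  refine cyc.idM_mat fun x y h => ?_
  by_contra h'
  have := ha x y h'
  refine h ((F.symm_fam_obj s x).trans (Eq.trans ?_ (G.symm_fam_obj s y).symm))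
  rw [show (F.vert x).val = (G.vert y).val by omega]

theorem vM_mat_of_raises {a b : Matrix (Fin F.N) (Fin G.N) k} (hb : Raises F.vert G.vert 1 b) :
    cyc.vM (cyc.mat (F.fam s) (G.fam s) a b) = b := by
  refine cyc.vM_mat fun x y h => ?_
  by_contra h'
  have := hb x y h'
  refine h ((congrArg (· + 1) (F.symm_fam_obj s x)).trans (Eq.trans ?_ (G.symm_fam_obj s y).symm))
  rw [show (G.vert y).val = (F.vert x).val + 1 by omega]
  push_cast
  rfl

theorem raises_idM (b : Fam.Hom (F.fam s) (G.fam s)) : Raises F.vert G.vert 0 (cyc.idM b) := by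
  intro x y h
  have h1 : s.symm ((F.fam s).obj x) = s.symm ((G.fam s).obj y) := by
    by_contra h'
    exact h (cyc.idc_eq_zero h' _)
  have h1 := (F.symm_fam_obj s x).symm.trans (h1.trans (G.symm_fam_obj s y))
  have := (cyc.natCast_inj (F.vert x).2 (G.vert y).2).1 h1
  omega

theorem raises_vM (b : Fam.Hom (F.fam s) (G.fam s)) : Raises F.vert G.vert 1 (cyc.vM b) := by
  intro x y h
  have h1 : s.symm ((F.fam s).obj x) + 1 = s.symm ((G.fam s).obj y) := by
    by_contra h'
    exact h (cyc.vc_eq_zero h' _)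
  have h1 := (congrArg (· + 1) (F.symm_fam_obj s x)).symm.trans (h1.trans (G.symm_fam_obj s y))
  have h2 : (((F.vert x).val + 1 + 1 : ℕ) : ZMod (n + 1)) = ((G.vert y).val + 1 : ℕ) := by
    rw [← h1]; push_cast; rfl
  have h3 := (F.vert x).2
  obtain h4 | h4 := Nat.lt_or_ge ((F.vert x).val + 1) n
  · have := (cyc.natCast_inj h4 (G.vert y).2).1 h2
    omega
  · have h5 : (F.vert x).val + 1 + 1 = n + 1 := by omega
    rw [h5, ZMod.natCast_self, ← Nat.cast_zero] at h2
    have := (cyc.natCast_inj (Nat.zero_le _) (G.vert y).2).1 h2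
    omega

theorem conj_mx_tot (a : Hom X Y) : cyc.conj (F.fam s) (G.fam s) (mx F.basis G.basis (tot a)) =
    mx F.basis G.basis (tot (sgn a)) :=
  funext fun x => funext fun y => (F.mx_tot_sgn G a x y).symm

theorem deg_of_mx_tot_ne_zero {p : ZMod 2} {a : Hom X Y} (ha : ∀ i j, j ≠ i + p → a i j = 0)
    {x : Fin F.N} {y : Fin G.N} (h : mx F.basis G.basis (tot a) x y ≠ 0) :
    p = G.deg y - F.deg x := by
  by_contra hp
  refine h (G.repr_eq_zero ?_)
  rw [tot_apply]
  refine Finset.sum_eq_zero fun i _ => ?_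
  by_cases hi : i = F.deg x
  · rw [ha i _ fun e => hp ?_]
    · rfl
    · have e : G.deg y = i + p := e
      rw [e, hi, add_sub_cancel_left]
  · rw [F.homog x _ fun e => hi (congrArg Prod.fst e), map_zero]

theorem deg_of_mx_suc_ne_zero {x y : Fin F.N} (h : mx F.basis F.basis (suc X) x y ≠ 0) :
    F.deg y = F.deg x := by
  by_contra hp
  refine h (F.repr_eq_zero ?_)
  obtain hw | ⟨v, hw⟩ := val_eq_zero_or (F.vert y)
  · exact suc_apply_zero _ _ hw
  · rw [suc_apply _ _ hw, F.homog x _ fun e => hp (congrArg Prod.fst e), map_zero]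

variable (F s)

/-- The twisted complex which corresponds to a homogeneous basis. -/
noncomputable def preTw : (cyc k s).PreTw where
  toFam := F.fam s
  δ := cyc.mat _ _ (mx F.basis F.basis (tot X.d)) (-mx F.basis F.basis (suc X))

theorem idM_δ : cyc.idM (F.preTw s).δ = mx F.basis F.basis (tot X.d) :=
  idM_mat_of_raises (F.raises_tot F X.d)

theorem vM_δ : cyc.vM (F.preTw s).δ = -mx F.basis F.basis (suc X) :=
  vM_mat_of_raises F.raises_suc.neg

theorem mx_d_mul_mx_d : mx F.basis F.basis (tot X.d) * mx F.basis F.basis (tot X.d) = 0 := by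
  rw [← mx_comp, ← tot_comp, ← map_zero (mx F.basis F.basis)]
  congr 1
  have : comp X.d X.d = 0 := funext fun i => funext fun j => X.d_sq i j
  rw [this]
  exact (totₗ X X).map_zero

theorem mx_d_mul_mx_suc : mx F.basis F.basis (tot X.d) * -mx F.basis F.basis (suc X) =
    -mx F.basis F.basis (suc X) * mx F.basis F.basis (tot X.d) := by
  rw [Matrix.mul_neg, Matrix.neg_mul, ← mx_comp, ← mx_comp, tot_suc]

theorem isTwisted : (F.preTw s).IsTwisted := by
  refine cyc.isTwisted_of_avoid _ 0 (F.fam_obj_ne s) ?_ ?_ ?_ ?_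
  · refine cyc.hom_ext (funext fun x => funext fun y => ?_) (funext fun x => funext fun y => ?_)
    · rw [cyc.idM_proj, ite_eq_left_iff, idM_δ]
      intro h
      by_contra h'
      exact h (deg_of_mx_tot_ne_zero X.d_deg fun e => h' e.symm)
    · rw [cyc.vM_proj, ite_eq_left_iff, vM_δ]
      intro h
      by_contra h'
      refine h ?_
      have h1 : F.deg y = F.deg x := deg_of_mx_suc_ne_zero fun e => h' (by
        exact ((congrArg Neg.neg e).trans neg_zero).symm)
      change 1 = F.deg y - F.deg x + 1
      rw [h1, sub_self, zero_add]
  · intro x y h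
    refine cyc.ext ?_ ?_
    · rw [map_zero]
      exact (congrFun (congrFun (F.idM_δ s) x) y).trans (F.d_triangular x y h)
    · rw [map_zero]
      refine (congrFun (congrFun (F.vM_δ s) x) y).trans ?_
      exact (congrArg Neg.neg (F.suc_triangular x y h)).trans neg_zero
  · exact (congrArg₂ (fun a b : Matrix (Fin F.N) (Fin F.N) k => a * b) (F.idM_δ s) (F.idM_δ s)).trans
      F.mx_d_mul_mx_d
  · exact (congrArg₂ (fun a b : Matrix (Fin F.N) (Fin F.N) k => a * b) (F.idM_δ s) (F.vM_δ s)).trans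
      (F.mx_d_mul_mx_suc.trans
        (congrArg₂ (fun a b : Matrix (Fin F.N) (Fin F.N) k => a * b) (F.vM_δ s) (F.idM_δ s)).symm)

/-- The twisted complex which corresponds to a homogeneous basis. -/
noncomputable def tw : (cyc k s).TwOb := ⟨F.preTw s, F.isTwisted s⟩

variable (G)

/-- The differential of morphisms of twisted complexes. -/
noncomputable def twD (b : Fam.Hom (F.fam s) (G.fam s)) : Fam.Hom (F.fam s) (G.fam s) :=
  (cyc k s).tw.d (X := F.tw s) (Y := G.tw s) b

/-- The product of morphisms of twisted complexes. -/
noncomputable def twMul {H : Frame Z} (a : Fam.Hom (F.fam s) (G.fam s))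
    (b : Fam.Hom (G.fam s) (H.fam s)) : Fam.Hom (F.fam s) (H.fam s) :=
  (cyc k s).tw.mul (X := F.tw s) (Y := G.tw s) (Z := H.tw s) a b

/-- The morphism of twisted complexes which corresponds to a morphism of complexes. -/
noncomputable def hom : Hom X Y →ₗ[k] Fam.Hom (F.fam s) (G.fam s) where
  toFun a := cyc.mat _ _ (mx F.basis G.basis (tot a)) 0
  map_add' a b := by
    rw [tot_add, map_add, ← cyc.mat_add, add_zero]
  map_smul' r a := by
    rw [tot_smul, map_smul, RingHom.id_apply, ← cyc.mat_smul, smul_zero]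

theorem idM_hom (a : Hom X Y) : cyc.idM (F.hom G s a) = mx F.basis G.basis (tot a) :=
  idM_mat_of_raises (F.raises_tot G a)

theorem vM_hom (a : Hom X Y) : cyc.vM (F.hom G s a) = 0 :=
  vM_mat_of_raises fun _ _ h => absurd rfl h

theorem avoid (x : Fin (F.tw s).1.N) : (F.tw s).1.obj x ≠ s 0 := F.fam_obj_ne s x

/-- The differential of twisted complexes in terms of matrices. -/
theorem idM_d (b : Fam.Hom (F.fam s) (G.fam s)) :
    cyc.idM (F.twD G s b) =
      cyc.conj _ _ (cyc.idM b) * mx G.basis G.basis (tot Y.d) -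
        mx F.basis F.basis (tot X.d) * cyc.idM b := by
  refine (cyc.idM_d (X := F.tw s) (Y := G.tw s) b).trans ?_
  have h := cyc.cycM_eq_zero (X := F.tw s) (Y := G.tw s) 0 (.single b) ⟨F.avoid s, G.avoid s⟩
  have h1 := F.idM_δ s
  have h2 := G.idM_δ s
  exact (congrArg₂ (fun a b : Matrix (Fin F.N) (Fin G.N) k => a + b)
    (congrArg₂ (fun (a : Matrix (Fin F.N) (Fin F.N) k) (b' : Matrix (Fin G.N) (Fin G.N) k) =>
      cyc.conj (F.fam s) (G.fam s) (cyc.idM b) * b' - a * cyc.idM b) h1 h2)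
      h).trans (add_zero _)

theorem vM_d (b : Fam.Hom (F.fam s) (G.fam s)) :
    cyc.vM (F.twD G s b) =
      (-(cyc.idM b * mx G.basis G.basis (suc Y)) -
        cyc.conj _ _ (cyc.vM b) * mx G.basis G.basis (tot Y.d)) +
      (mx F.basis F.basis (tot X.d) * cyc.vM b + mx F.basis F.basis (suc X) * cyc.idM b) := by
  refine (cyc.vM_d (X := F.tw s) (Y := G.tw s) b).trans ?_
  rw [← Matrix.mul_neg, ← sub_neg_eq_add (_ * cyc.vM b), ← Matrix.neg_mul]
  exact congrArg₂ (fun a b : Matrix (Fin F.N) (Fin G.N) k => a + b)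
    (congrArg₂ (fun a b' : Matrix (Fin G.N) (Fin G.N) k =>
      cyc.idM b * a - cyc.conj (F.fam s) (G.fam s) (cyc.vM b) * b') (G.vM_δ s) (G.idM_δ s))
    (congrArg₂ (fun a b' : Matrix (Fin F.N) (Fin F.N) k =>
      a * cyc.vM b - b' * cyc.idM b) (F.idM_δ s) (F.vM_δ s))

theorem hom_d (a : Hom X Y) : F.hom G s (comp (sgn a) Y.d - comp X.d a) =
    F.twD G s (F.hom G s a) := by
  refine cyc.hom_ext ?_ ?_
  · rw [idM_d, idM_hom, idM_hom, conj_mx_tot, ← mx_comp, ← mx_comp, ← map_sub, tot_sub, tot_comp,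
      tot_comp]
  · rw [vM_d, idM_hom, vM_hom, vM_hom, ← mx_comp, ← mx_comp, tot_suc, Matrix.mul_zero, zero_add,
      conj_zero,
      Matrix.zero_mul, sub_zero, neg_add_cancel]

theorem hom_comp (H : Frame Z) (a : Hom X Y) (b : Hom Y Z) : F.hom H s (comp (sgn a) b) =
    F.twMul G s (F.hom G s a) (G.hom H s b) := by
  have h := cyc.cycM_eq_zero (X := F.tw s) (Y := H.tw s) 0 (.pair (Y := G.tw s) (F.hom G s a) (G.hom H s b))
    (show _ ∧ _ ∧ _ from ⟨F.avoid s, G.avoid s, H.avoid s⟩)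
  refine cyc.hom_ext ?_ ?_
  · rw [idM_hom, tot_comp, mx_comp F.basis G.basis, ← conj_mx_tot (s := s), ← idM_hom, ← idM_hom]
    refine Eq.symm ((cyc.idM_mul (X := F.tw s) (Y := G.tw s) (Z := H.tw s) _ _).trans ?_)
    exact (congrArg (fun c : Matrix (Fin F.N) (Fin H.N) k => cyc.conj (F.fam s) (G.fam s)
      (cyc.idM (F.hom G s a)) * cyc.idM (G.hom H s b) + c) h).trans (add_zero _)
  · refine (vM_hom _ _ _ _).trans (Eq.symm ?_)
    refine (cyc.vM_mul (X := F.tw s) (Y := G.tw s) (Z := H.tw s) _ _).trans ?_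
    have h1 := F.vM_hom G s a
    have h2 := G.vM_hom H s b
    refine (congrArg₂ (fun (a' : Matrix (Fin F.N) (Fin G.N) k) (b' : Matrix (Fin G.N) (Fin H.N) k) =>
      cyc.idM (F.hom G s a) * b' - cyc.conj (F.fam s) (G.fam s) a' * cyc.idM (G.hom H s b)) h1 h2).trans ?_
    simp only [conj_zero, Matrix.mul_zero, Matrix.zero_mul, sub_zero]

/-- Morphisms without components of degree one arise from morphisms of complexes if their
differentials have no components of degree one. -/
theorem exists_hom_eq (b : Fam.Hom (F.fam s) (G.fam s)) (hb : cyc.vM b = 0)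
    (hd : cyc.vM (F.twD G s b) = 0) :
    ∃ a : Hom X Y, F.hom G s a = b := by
  rw [vM_d, hb, conj_zero,
    Matrix.zero_mul, sub_zero, Matrix.mul_zero, zero_add, neg_add_eq_zero] at hd
  obtain ⟨a, ha⟩ := F.exists_tot_eq G (raises_idM b) hd.symm
  exact ⟨a, cyc.hom_ext ((F.idM_hom G s a).trans ha) ((F.vM_hom G s a).trans hb.symm)⟩

theorem hom_injective : Function.Injective (F.hom G s) := by
  intro a b h
  have := congrArg cyc.idM h
  rw [idM_hom, idM_hom] at this
  exact tot_injective (mx_injective _ _ this)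

/-- Up to boundaries, all morphisms have no components of degree one. -/
theorem exists_vM_sub_d_eq_zero (h : ∀ i (a b : Fin n) (f : a ⟶ b),
    Function.Injective ((X.X i).map f).hom) (b : Fam.Hom (F.fam s) (G.fam s)) :
    ∃ c : Fam.Hom (F.fam s) (G.fam s), cyc.vM (b -
      F.twD G s c) = 0 := by
  obtain ⟨C, hC, e⟩ := F.exists_mul_sub_mul_eq G h (raises_vM b)
  refine ⟨cyc.mat _ _ C 0, ?_⟩
  have h1 : cyc.idM (cyc.mat (F.fam s) (G.fam s) C 0) = C := idM_mat_of_raises hC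
  have h2 : cyc.vM (cyc.mat (F.fam s) (G.fam s) C 0) = 0 := vM_mat_of_raises fun _ _ h => absurd rfl h
  have h3 : ∀ b c : Fam.Hom (F.fam s) (G.fam s), cyc.vM (b - c) = cyc.vM b - cyc.vM c :=
    fun b c => funext fun x => funext fun y => map_sub (cyc.vc _ _) (b x y) (c x y)
  rw [h3, vM_d, h1, h2, conj_zero, Matrix.zero_mul, sub_zero, Matrix.mul_zero, zero_add,
    neg_add_eq_sub, e, sub_self]

end Frame

namespace cyc

variable {k : Type u} [Field k] {n : ℕ} {S : Type w} {s : ZMod (n + 1) ≃ S}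

section Fam

variable {X Y : (cyc k s).Fam} {f : Fin X.N → Fin n} {g : Fin Y.N → Fin n}

theorem idM_mat_of_raises (hf : ∀ x, X.obj x = ob k s ((f x).val + 1))
    (hg : ∀ x, Y.obj x = ob k s ((g x).val + 1)) {a b : Matrix (Fin X.N) (Fin Y.N) k}
    (ha : Raises f g 0 a) : idM (mat X Y a b) = a := by
  refine idM_mat fun x y h => ?_
  by_contra h'
  have := ha x y h'
  refine h ?_
  rw [hf, hg, show (f x).val = (g y).val by omega]

theorem vM_mat_of_raises (hf : ∀ x, X.obj x = ob k s ((f x).val + 1))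
    (hg : ∀ x, Y.obj x = ob k s ((g x).val + 1)) {a b : Matrix (Fin X.N) (Fin Y.N) k}
    (hb : Raises f g 1 b) : vM (mat X Y a b) = b := by
  refine vM_mat fun x y h => ?_
  by_contra h'
  have := hb x y h'
  refine h ?_
  rw [hf, hg, symm_ob, symm_ob, show (g y).val = (f x).val + 1 by omega]
  push_cast
  rfl

theorem conj_eq_smul {p : ZMod 2} {a : Matrix (Fin X.N) (Fin Y.N) k}
    (h : ∀ x y, a x y ≠ 0 → Y.shift y - X.shift x = p) : conj X Y a = sg k p • a := by
  funext x y
  rw [conj, Matrix.smul_apply, smul_eq_mul]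
  by_cases h' : a x y = 0
  · rw [h', mul_zero, mul_zero]
  · rw [h x y h']

theorem conj_zero : conj X Y 0 = 0 := funext fun _ => funext fun _ => mul_zero _

theorem isHomog_of {p : ZMod 2} (a : Fam.Hom X Y)
    (h : ∀ x y, idM a x y ≠ 0 → Y.shift y - X.shift x = p)
    (h' : ∀ x y, vM a x y ≠ 0 → Y.shift y - X.shift x = p + 1) : Fam.proj p a = a := by
  refine hom_ext (funext fun x => funext fun y => ?_) (funext fun x => funext fun y => ?_)
  · rw [idM_proj, ite_eq_left_iff]
    intro e
    by_contra e'
    exact e (h x y fun e => e' e.symm).symm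
  · rw [vM_proj, ite_eq_left_iff]
    intro e
    by_contra e'
    rw [h' x y fun e => e' e.symm, add_assoc] at e
    exact e (add_zero p).symm

end Fam

section Avoid

variable {X Y Z : (cyc k s).TwOb} (j : ZMod (n + 1))

theorem idM_d_of_avoid (hX : ∀ x, X.1.obj x ≠ s j) (hY : ∀ x, Y.1.obj x ≠ s j)
    (a : Fam.Hom X.1.toFam Y.1.toFam) :
    idM ((cyc k s).tw.d (X := X) (Y := Y) a : Fam.Hom X.1.toFam Y.1.toFam) =
      conj _ _ (idM a) * idM Y.1.δ - idM X.1.δ * idM a := by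
  rw [idM_d, cycM_eq_zero j (.single a) ⟨hX, hY⟩, add_zero]

theorem idM_mul_of_avoid (hX : ∀ x, X.1.obj x ≠ s j) (hY : ∀ x, Y.1.obj x ≠ s j)
    (hZ : ∀ x, Z.1.obj x ≠ s j) (a : Fam.Hom X.1.toFam Y.1.toFam)
    (b : Fam.Hom Y.1.toFam Z.1.toFam) :
    idM ((cyc k s).tw.mul (X := X) (Y := Y) (Z := Z) a b : Fam.Hom X.1.toFam Z.1.toFam) =
      conj _ _ (idM a) * idM b := by
  rw [idM_mul, cycM_eq_zero j (.pair a b) (show _ ∧ _ ∧ _ from ⟨hX, hY, hZ⟩), add_zero]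

end Avoid

end cyc

/-- A strong deformation retract of an object. -/
structure Retraction {k : Type u} [Field k] (B : AInfData k) (O : B.Ob → Prop) (Z : B.Ob) where
  obj : B.Ob
  obj_mem : O obj
  i : B.Hom obj Z
  p : B.Hom Z obj
  h : B.Hom Z Z
  i_deg : B.IsHomog 0 i
  p_deg : B.IsHomog 0 p
  h_deg : B.IsHomog 1 h
  d_i : B.d i = 0
  d_p : B.d p = 0
  d_h : B.d h = p ⊚ i - B.one Z
  i_p : i ⊚ p = B.one obj
  h_h : h ⊚ h = 0
  i_h : i ⊚ h = 0
  h_p : h ⊚ p = 0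

/-- The identity. -/
def Retraction.refl {k : Type u} [Field k] {B : AInfData k} (hB : B.IsAInf) (O : B.Ob → Prop)
    (Z : B.Ob) (hZ : O Z) : Retraction B O Z where
  obj := Z
  obj_mem := hZ
  i := B.one Z
  p := B.one Z
  h := 0
  i_deg := hB.one_deg Z
  p_deg := hB.one_deg Z
  h_deg := map_zero _
  d_i := hB.d_one Z
  d_p := hB.d_one Z
  d_h := by rw [hB.d_zero, hB.one_mul, sub_self]
  i_p := hB.one_mul _
  h_h := hB.zero_mul _
  i_h := hB.mul_zero _
  h_p := hB.zero_mul _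

theorem Retraction.hIso {k : Type u} [Field k] {B : AInfData k} (hB : B.IsAInf) {O : B.Ob → Prop}
    {Z : B.Ob} (R : Retraction B O Z) : B.HIso R.obj Z :=
  ⟨R.i, R.p, R.i_deg, R.p_deg, R.d_i, R.d_p,
    by rw [show B.μ (.pair R.i R.p) = B.one _ from R.i_p, sub_self]; exact hB.exact_zero, R.h, R.d_h⟩

/-! ### The total spaces of the simple modules -/

namespace QuiverRep

open PerComplex

/-- The projective resolution of a simple module. -/
def simpleCx (k : Type u) [Field k] {n : ℕ} (i : Fin n) : PerComplex (QuiverRep k n) :=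
  (simpleOb k n i).1

variable {k : Type u} [Field k] {n : ℕ} (i : Fin n)

theorem simpleOb_tot_d_zero (u : Total (simpleCx k i)) (l : Fin n) :
    tot (simpleCx k i).d u (0, l) =
      lineMap k (i.val + 1 ≤ l.val) (i.val ≤ l.val) (u (1, l)) := by
  refine (tot_apply _ _ _).trans ((Fin.sum_univ_two _).trans ?_)
  exact zero_add _

theorem simpleOb_tot_d_one (u : Total (simpleCx k i)) (l : Fin n) :
    tot (simpleCx k i).d u (1, l) = 0 := by
  refine (tot_apply _ _ _).trans ((Fin.sum_univ_two _).trans ?_)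
  exact zero_add _

/-- The inclusion of the generator at the vertex `i`. -/
def totIncl : k →ₗ[k] Total (simpleCx k i) :=
  LinearMap.toSpanSingleton k _ (Pi.single (0, i) (fun _ => 1 : Line k (i.val ≤ i.val)))

/-- The augmentation. -/
def totAug : Total (simpleCx k i) →ₗ[k] k where
  toFun u := (u (0, i) : Line k (i.val ≤ i.val)) ⟨le_rfl⟩
  map_add' _ _ := rfl
  map_smul' _ _ := rfl

/-- The contracting homotopy away from the vertex `i`. -/
def totHtpy : Total (simpleCx k i) →ₗ[k] Total (simpleCx k i) where
  toFun u := fun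
    | ((0 : Fin 2), l) => (0 : Line k (i.val ≤ l.val))
    | ((1 : Fin 2), l) => lineMap k (i.val ≤ l.val) (i.val + 1 ≤ l.val) (u (0, l))
  map_add' u u' := by
    funext ⟨(j : Fin 2), l⟩
    fin_cases j
    · exact (add_zero (0 : Line k (i.val ≤ l.val))).symm
    · exact map_add (lineMap k (i.val ≤ l.val) (i.val + 1 ≤ l.val)) (u (0, l)) (u' (0, l))
  map_smul' r u := by
    funext ⟨(j : Fin 2), l⟩
    fin_cases j
    · exact (smul_zero (A := Line k (i.val ≤ l.val)) r).symm
    · exact map_smul (lineMap k (i.val ≤ l.val) (i.val + 1 ≤ l.val)) r (u (0, l))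

variable {i}

theorem totHtpy_one (u : Total (simpleCx k i)) (l : Fin n) :
    totHtpy i u (1, l) = lineMap k (i.val ≤ l.val) (i.val + 1 ≤ l.val) (u (0, l)) := rfl

theorem lineMap_apply (p q : Prop) [Decidable p] (a : Line k p) (h : PLift q) (hp : p) :
    lineMap k p q a h = a ⟨hp⟩ := dif_pos hp

theorem lineMap_apply_zero (p q : Prop) [Decidable p] (a : Line k p) (h : PLift q) (hp : ¬ p) :
    lineMap k p q a h = 0 := dif_neg hp

theorem totIncl_same (r : k) : totIncl i r (0, i) = (fun _ => r : Line k (i.val ≤ i.val)) := by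
  refine (congrArg (r • ·) (Pi.single_eq_same (M := fun q : ZMod 2 × Fin n =>
    ((simpleCx k i).X q.1).obj q.2) (0, i) _)).trans ?_
  exact funext fun _ => mul_one r

theorem totIncl_of_ne (r : k) {q : ZMod 2 × Fin n} (hq : q ≠ (0, i)) : totIncl i r q = 0 := by
  refine (congrArg (r • ·) (Pi.single_eq_of_ne (M := fun q : ZMod 2 × Fin n =>
    ((simpleCx k i).X q.1).obj q.2) hq _)).trans ?_
  exact smul_zero r

theorem tot_ext {u u' : Total (simpleCx k i)}
    (h0 : ∀ (l : Fin n) (h : PLift (i.val ≤ l.val)), (u (0, l) : Line k (i.val ≤ l.val)) h =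
      (u' (0, l) : Line k (i.val ≤ l.val)) h)
    (h1 : ∀ (l : Fin n) (h : PLift (i.val + 1 ≤ l.val)), (u (1, l) : Line k (i.val + 1 ≤ l.val)) h =
      (u' (1, l) : Line k (i.val + 1 ≤ l.val)) h) : u = u' := by
  funext ⟨(j : Fin 2), l⟩
  fin_cases j
  · exact funext (h0 l)
  · exact funext (h1 l)

variable (k i)

theorem tot_d_comp_totIncl : tot (simpleCx k i).d ∘ₗ totIncl i = 0 := by
  refine LinearMap.ext fun r => funext fun ⟨(j : Fin 2), l⟩ => ?_
  fin_cases j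
  · refine (simpleOb_tot_d_zero i _ l).trans ?_
    rw [totIncl_of_ne r (by simp)]
    exact map_zero _
  · exact simpleOb_tot_d_one i _ l

theorem totAug_comp_tot_d : totAug i ∘ₗ tot (simpleCx k i).d = 0 := by
  refine LinearMap.ext fun u => ?_
  refine (congrFun (simpleOb_tot_d_zero i u i) _).trans ?_
  exact lineMap_apply_zero _ _ _ _ (by omega)

theorem totAug_comp_totIncl : totAug i ∘ₗ totIncl i = (LinearMap.id : k →ₗ[k] k) :=
  LinearMap.ext fun r => congrFun (totIncl_same r) ⟨le_rfl⟩

theorem totHtpy_comp_totHtpy : totHtpy (k := k) i ∘ₗ totHtpy i = 0 := by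
  refine LinearMap.ext fun u => tot_ext (fun l h => rfl) fun l h => ?_
  exact congrFun (map_zero (lineMap k (i.val ≤ l.val) (i.val + 1 ≤ l.val))) h

theorem totHtpy_comp_totIncl : totHtpy (k := k) i ∘ₗ totIncl i = 0 := by
  refine LinearMap.ext fun r => tot_ext (fun l h => rfl) fun l h => ?_
  change lineMap k _ _ (totIncl i r (0, l)) h = 0
  rw [totIncl_of_ne r (fun e => ?_)]
  · exact congrFun (map_zero (lineMap k (i.val ≤ l.val) (i.val + 1 ≤ l.val))) h
  · have e := congrArg (fun q => q.2.val) e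
    simp only at e
    have := h.down
    omega

theorem totAug_comp_totHtpy : totAug (k := k) i ∘ₗ totHtpy i = 0 := rfl

theorem tot_d_totHtpy : tot (simpleCx k i).d ∘ₗ totHtpy i + totHtpy i ∘ₗ tot (simpleCx k i).d =
    LinearMap.id - totIncl i ∘ₗ totAug i := by
  refine LinearMap.ext fun u => tot_ext (fun l h => ?_) fun l h => ?_
  · refine (add_zero ((tot (simpleCx k i).d (totHtpy i u) (0, l) : Line k (i.val ≤ l.val)) h)).trans ?_
    change _ = (u (0, l) : Line k (i.val ≤ l.val)) h -
      (totIncl i (totAug i u) (0, l) : Line k (i.val ≤ l.val)) h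
    rw [simpleOb_tot_d_zero, totHtpy_one]
    by_cases hl : i.val + 1 ≤ l.val
    · rw [lineMap_apply _ _ _ _ hl, totIncl_of_ne _ (fun e => ?_)]
      · exact (lineMap_apply _ _ _ _ h.down).trans (sub_zero _).symm
      · have e := congrArg (fun q => q.2.val) e
        simp only at e
        omega
    · obtain rfl : l = i := Fin.ext (by have := h.down; omega)
      rw [lineMap_apply_zero _ _ _ _ hl]
      refine (sub_eq_zero.2 ?_).symm
      exact (congrFun (totIncl_same _) h).symm
  · change (tot (simpleCx k i).d (totHtpy i u) (1, l) : Line k (i.val + 1 ≤ l.val)) h +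
      lineMap k (i.val ≤ l.val) (i.val + 1 ≤ l.val) (tot (simpleCx k i).d u (0, l)) h =
      (u (1, l) : Line k (i.val + 1 ≤ l.val)) h -
        (totIncl i (totAug i u) (1, l) : Line k (i.val + 1 ≤ l.val)) h
    have hl := h.down
    have hl' : i.val ≤ l.val := by omega
    rw [simpleOb_tot_d_one, simpleOb_tot_d_zero, totIncl_of_ne _ (by simp)]
    refine (zero_add _).trans (((lineMap_apply _ _ _ h hl').trans ?_).trans (sub_zero _).symm)
    exact lineMap_apply _ _ _ _ hl

theorem simpleOb_suc_zero (u : Total (simpleCx k i)) {v l : Fin n} (h : v.val + 1 = l.val) :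
    suc (simpleCx k i) u (0, l) = lineMap k (i.val ≤ v.val) (i.val ≤ l.val) (u (0, v)) :=
  suc_apply u 0 h

theorem simpleOb_suc_one (u : Total (simpleCx k i)) {v l : Fin n} (h : v.val + 1 = l.val) :
    suc (simpleCx k i) u (1, l) = lineMap k (i.val + 1 ≤ v.val) (i.val + 1 ≤ l.val) (u (1, v)) :=
  suc_apply u 1 h

theorem totAug_comp_suc : totAug i ∘ₗ suc (simpleCx k i) = 0 := by
  refine LinearMap.ext fun u => ?_
  obtain h | ⟨v, h⟩ := val_eq_zero_or i
  · exact congrFun (suc_apply_zero u 0 h) _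
  · refine (congrFun (simpleOb_suc_zero k i u h) _).trans ?_
    exact lineMap_apply_zero _ _ _ _ (by omega)

theorem totHtpy_suc : totHtpy i ∘ₗ suc (simpleCx k i) - suc (simpleCx k i) ∘ₗ totHtpy i =
    totHtpy i ∘ₗ suc (simpleCx k i) ∘ₗ totIncl i ∘ₗ totAug i := by
  refine LinearMap.ext fun u => tot_ext (fun l h => ?_) fun l h => ?_
  · refine (zero_sub _).trans ((neg_eq_zero).2 ?_)
    obtain hl | ⟨v, hl⟩ := val_eq_zero_or l
    · exact congrFun (suc_apply_zero (totHtpy i u) 0 hl) h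
    · refine (congrFun (simpleOb_suc_zero k i _ hl) _).trans ?_
      exact congrFun (map_zero (lineMap k (i.val ≤ v.val) (i.val ≤ l.val))) h
  · have hl := h.down
    obtain hl' | ⟨v, hl'⟩ := val_eq_zero_or l
    · omega
    change lineMap k (i.val ≤ l.val) (i.val + 1 ≤ l.val) (suc (simpleCx k i) u (0, l)) h -
      (suc (simpleCx k i) (totHtpy i u) (1, l) : Line k (i.val + 1 ≤ l.val)) h =
      lineMap k (i.val ≤ l.val) (i.val + 1 ≤ l.val)
        (suc (simpleCx k i) (totIncl i (totAug i u)) (0, l)) h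
    rw [simpleOb_suc_zero k i _ hl', simpleOb_suc_zero k i _ hl', simpleOb_suc_one k i _ hl',
      totHtpy_one]
    have key (a b : Line k (i.val ≤ v.val)) (hb : i.val + 1 ≤ v.val → b = 0)
        (hb' : ¬ i.val + 1 ≤ v.val → b = a) :
        lineMap k (i.val ≤ l.val) (i.val + 1 ≤ l.val) (lineMap k (i.val ≤ v.val) (i.val ≤ l.val) a) h -
          lineMap k (i.val + 1 ≤ v.val) (i.val + 1 ≤ l.val)
            (lineMap k (i.val ≤ v.val) (i.val + 1 ≤ v.val) a) h =
        lineMap k (i.val ≤ l.val) (i.val + 1 ≤ l.val)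
          (lineMap k (i.val ≤ v.val) (i.val ≤ l.val) b) h := by
      have h1 : i.val ≤ l.val := by omega
      have h2 : i.val ≤ v.val := by omega
      rw [lineMap_apply _ _ _ _ h1, lineMap_apply _ _ _ _ h2, lineMap_apply _ _ _ _ h1,
        lineMap_apply _ _ _ _ h2]
      by_cases hv : i.val + 1 ≤ v.val
      · rw [lineMap_apply _ _ _ _ hv, lineMap_apply _ _ _ _ h2, hb hv, sub_self]
        rfl
      · rw [lineMap_apply_zero _ _ _ _ hv, hb' hv, sub_zero]
    refine key (u (0, v)) (totIncl i (totAug i u) (0, v)) (fun hv => totIncl_of_ne _ fun e => ?_)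
      fun hv => ?_
    · have e := congrArg (fun q => q.2.val) e
      simp only at e
      omega
    · obtain rfl : v = i := Fin.ext (by omega)
      exact totIncl_same _

theorem tot_d_totHtpy_suc_totIncl : tot (simpleCx k i).d ∘ₗ totHtpy i ∘ₗ
    suc (simpleCx k i) ∘ₗ totIncl i = suc (simpleCx k i) ∘ₗ totIncl i := by
  refine LinearMap.ext fun r => ?_
  have h1 := LinearMap.congr_fun (tot_d_totHtpy k i) (suc (simpleCx k i) (totIncl i r))
  have h2 := LinearMap.congr_fun (totAug_comp_suc k i) (totIncl i r)
  have h3 := LinearMap.congr_fun (tot_suc (simpleCx k i).d) (totIncl i r)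
  have h4 := LinearMap.congr_fun (tot_d_comp_totIncl k i) r
  simp only [LinearMap.comp_apply, LinearMap.add_apply, LinearMap.sub_apply, LinearMap.id_apply,
    LinearMap.zero_apply] at h1 h2 h3 h4 ⊢
  rw [h3, h4, map_zero, map_zero, add_zero, h2, map_zero, sub_zero] at h1
  exact h1

end QuiverRep

namespace cyc

variable {k : Type u} [Field k] {n : ℕ} {S : Type w} {s : ZMod (n + 1) ≃ S}

theorem idM_one (X : (cyc k s).Fam) : idM (Fam.one X) = 1 := by
  funext x y
  rw [Matrix.one_apply]
  refine (?_ : idc _ _ (Fam.one X x y) = _)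
  split_ifs with h
  · subst h
    rw [Fam.one_self]
    exact (idc_mkHom 1 0).trans (if_pos rfl)
  · rw [Fam.one_ne X h, map_zero]

theorem vM_one (X : (cyc k s).Fam) : vM (Fam.one X) = 0 := by
  funext x y
  refine (?_ : vc _ _ (Fam.one X x y) = 0)
  by_cases h : x = y
  · subst h
    rw [Fam.one_self]
    exact (vc_mkHom 1 0).trans (ite_self _)
  · rw [Fam.one_ne X h, map_zero]

theorem idM_zero (X Y : (cyc k s).Fam) : idM (0 : Fam.Hom X Y) = 0 :=
  funext fun _ => funext fun _ => map_zero (idc _ _)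

theorem vM_zero (X Y : (cyc k s).Fam) : vM (0 : Fam.Hom X Y) = 0 :=
  funext fun _ => funext fun _ => map_zero (vc _ _)

theorem idM_sub {X Y : (cyc k s).Fam} (a b : Fam.Hom X Y) : idM (a - b) = idM a - idM b :=
  funext fun x => funext fun y => map_sub (idc _ _) (a x y) (b x y)

theorem vM_sub {X Y : (cyc k s).Fam} (a b : Fam.Hom X Y) : vM (a - b) = vM a - vM b :=
  funext fun x => funext fun y => map_sub (vc _ _) (a x y) (b x y)

end cyc

/-! ### The retraction onto the object which corresponds to a simple module -/

namespace Frame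

open PerComplex QuiverRep

variable {k : Type u} [Field k] {n : ℕ} {i : Fin n} (F : Frame (simpleCx k i)) {S : Type w}
  (s : ZMod (n + 1) ≃ S)

/-- The object `s_{i+1}` as a twisted complex. -/
def simpleTw (k : Type u) [Field k] (s : ZMod (n + 1) ≃ S) (i : Fin n) : (cyc k s).TwOb :=
  cyc.twOb k s (i.val + 1)

/-- The standard basis of the line `k`. -/
noncomputable def lineBasis (k : Type u) [Field k] (s : ZMod (n + 1) ≃ S) (i : Fin n) :
    Module.Basis (Fin (simpleTw k s i).1.N) k k := Module.Basis.singleton (Fin 1) k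

/-- The basis, indexed by the summands of the twisted complex. -/
noncomputable def twBasis : Module.Basis (Fin (F.tw s).1.N) k (simpleCx k i).Total := F.basis

/-- The vertices, indexed by the summands of the twisted complex. -/
def twVert : Fin (F.tw s).1.N → Fin n := F.vert

/-- The matrix of the inclusion of the generator. -/
noncomputable def inclM : Matrix (Fin (simpleTw k s i).1.N) (Fin (F.tw s).1.N) k := mx (lineBasis k s i) (F.twBasis s) (totIncl i)

/-- The matrix of the components of degree one of the inclusion. -/
noncomputable def corrM : Matrix (Fin (simpleTw k s i).1.N) (Fin (F.tw s).1.N) k :=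
  mx (lineBasis k s i) (F.twBasis s) (totHtpy i ∘ₗ suc (simpleCx k i) ∘ₗ totIncl i)

/-- The matrix of the augmentation. -/
noncomputable def augM : Matrix (Fin (F.tw s).1.N) (Fin (simpleTw k s i).1.N) k := mx (F.twBasis s) (lineBasis k s i) (totAug i)

/-- The matrix of the homotopy. -/
noncomputable def htpyM : Matrix (Fin (F.tw s).1.N) (Fin (F.tw s).1.N) k := mx (F.twBasis s) (F.twBasis s) (totHtpy i)

variable {F s}

theorem twBasis_repr_eq_zero {u : (simpleCx k i).Total} {y : Fin (F.tw s).1.N}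
    (h : u ((F.tw s).1.shift y, F.twVert s y) = 0) : (F.twBasis s).repr u y = 0 := F.repr_eq_zero h

theorem twBasis_apply_of_ne {x : Fin (F.tw s).1.N} {q : ZMod 2 × Fin n}
    (h : q ≠ ((F.tw s).1.shift x, F.twVert s x)) : F.twBasis s x q = 0 := F.homog x q h

theorem inclM_ne_zero {x y} (h : F.inclM s x y ≠ 0) :
    (F.tw s).1.shift y = 0 ∧ F.twVert s y = i := by
  by_contra h'
  exact h (twBasis_repr_eq_zero (totIncl_of_ne _ fun e => h' (Prod.ext_iff.1 e)))

theorem corrM_ne_zero {x y} (h : F.corrM s x y ≠ 0) :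
    (F.tw s).1.shift y = 1 ∧ (F.twVert s y).val = i.val + 1 := by
  by_contra h'
  refine h (twBasis_repr_eq_zero ?_)
  obtain h0 | h1 := zmod_two_cases ((F.tw s).1.shift y)
  · rw [h0]; rfl
  · rw [h1]
    refine (congrArg (lineMap k (i.val ≤ (F.twVert s y).val) (i.val + 1 ≤ (F.twVert s y).val)) ?_).trans
      (map_zero _)
    obtain hv | ⟨v, hv⟩ := val_eq_zero_or (F.twVert s y)
    · exact suc_apply_zero _ 0 hv
    · refine (suc_apply _ 0 hv).trans ?_
      rw [totIncl_of_ne _ fun e => h' ⟨h1, hv.symm.trans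
        (congrArg (fun v : Fin n => v.val + 1) (congrArg Prod.snd e))⟩, map_zero]
      rfl

theorem augM_ne_zero {x y} (h : F.augM s x y ≠ 0) :
    (F.tw s).1.shift x = 0 ∧ F.twVert s x = i := by
  by_contra h'
  refine h ?_
  have : totAug i (F.twBasis s x) = 0 := by
    refine congrFun (twBasis_apply_of_ne (q := (0, i)) fun e => h' ?_) (⟨le_rfl⟩ : PLift (i.val ≤ i.val))
    exact (Prod.ext_iff.1 e).imp Eq.symm Eq.symm
  rw [augM, mx_apply, this, map_zero]
  rfl

theorem htpyM_ne_zero {x y} (h : F.htpyM s x y ≠ 0) :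
    (F.tw s).1.shift y - (F.tw s).1.shift x = 1 ∧ F.twVert s y = F.twVert s x := by
  by_contra h'
  refine h (twBasis_repr_eq_zero ?_)
  obtain h0 | h1 := zmod_two_cases ((F.tw s).1.shift y)
  · rw [h0]; rfl
  · rw [h1]
    refine (congrArg (lineMap k (i.val ≤ (F.twVert s y).val) (i.val + 1 ≤ (F.twVert s y).val)) ?_).trans
      (map_zero _)
    refine twBasis_apply_of_ne fun e => h' ?_
    rw [h1, ← show (0 : ZMod 2) = (F.tw s).1.shift x from congrArg Prod.fst e]
    exact ⟨sub_zero _, congrArg Prod.snd e⟩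

theorem raises_inclM : Raises (fun _ => i) (F.twVert s) 0 (F.inclM s) := fun x y h => by
  rw [(inclM_ne_zero h).2, add_zero]

theorem raises_corrM : Raises (fun _ => i) (F.twVert s) 1 (F.corrM s) := fun x y h => by
  rw [(corrM_ne_zero h).2]; push_cast; rfl

theorem raises_augM : Raises (F.twVert s) (fun _ => i) 0 (F.augM s) := fun x y h => by
  rw [(augM_ne_zero h).2, add_zero]

theorem raises_htpyM : Raises (F.twVert s) (F.twVert s) 0 (F.htpyM s) := fun x y h => by
  rw [(htpyM_ne_zero h).2, add_zero]

variable (F s)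

/-- The inclusion of the retract. -/
noncomputable def incl : Fam.Hom (simpleTw k s i).1.toFam (F.tw s).1.toFam :=
  cyc.mat _ _ (F.inclM s) (F.corrM s)

/-- The projection onto the retract. -/
noncomputable def aug : Fam.Hom (F.tw s).1.toFam (simpleTw k s i).1.toFam :=
  cyc.mat _ _ (F.augM s) 0

/-- The homotopy. -/
noncomputable def htpy : Fam.Hom (F.tw s).1.toFam (F.tw s).1.toFam :=
  cyc.mat _ _ (F.htpyM s) 0

theorem idM_incl : cyc.idM (F.incl s) = F.inclM s :=
  cyc.idM_mat_of_raises (f := fun _ => i) (g := F.twVert s) (fun _ => rfl) (fun _ => rfl) raises_inclM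

theorem vM_incl : cyc.vM (F.incl s) = F.corrM s :=
  cyc.vM_mat_of_raises (f := fun _ => i) (g := F.twVert s) (fun _ => rfl) (fun _ => rfl) raises_corrM

theorem idM_aug : cyc.idM (F.aug s) = F.augM s :=
  cyc.idM_mat_of_raises (f := F.twVert s) (g := fun _ => i) (fun _ => rfl) (fun _ => rfl) raises_augM

theorem vM_aug : cyc.vM (F.aug s) = 0 :=
  cyc.vM_mat_of_raises (f := F.twVert s) (g := fun _ => i) (fun _ => rfl) (fun _ => rfl)
    fun _ _ h => absurd rfl h

theorem idM_htpy : cyc.idM (F.htpy s) = F.htpyM s :=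
  cyc.idM_mat_of_raises (f := F.twVert s) (g := F.twVert s) (fun _ => rfl) (fun _ => rfl) raises_htpyM

theorem vM_htpy : cyc.vM (F.htpy s) = 0 :=
  cyc.vM_mat_of_raises (f := F.twVert s) (g := F.twVert s) (fun _ => rfl) (fun _ => rfl)
    fun _ _ h => absurd rfl h

theorem conj_inclM : cyc.conj (simpleTw k s i).1.toFam (F.tw s).1.toFam (F.inclM s) = F.inclM s := by
  rw [cyc.conj_eq_smul (p := 0), cyc.sg_zero, one_smul]
  intro x y h
  exact (sub_zero _).trans (inclM_ne_zero h).1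

theorem conj_corrM : cyc.conj (simpleTw k s i).1.toFam (F.tw s).1.toFam (F.corrM s) = -F.corrM s := by
  rw [cyc.conj_eq_smul (p := 1), cyc.sg_one, neg_one_smul]
  intro x y h
  exact (sub_zero _).trans (corrM_ne_zero h).1

theorem conj_augM : cyc.conj (F.tw s).1.toFam (simpleTw k s i).1.toFam (F.augM s) = F.augM s := by
  rw [cyc.conj_eq_smul (p := 0), cyc.sg_zero, one_smul]
  intro x y h
  exact (zero_sub _).trans (neg_eq_zero.2 (augM_ne_zero h).1)

theorem conj_htpyM : cyc.conj (F.tw s).1.toFam (F.tw s).1.toFam (F.htpyM s) = -F.htpyM s := by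
  rw [cyc.conj_eq_smul (p := 1), cyc.sg_one, neg_one_smul]
  intro x y h
  exact (htpyM_ne_zero h).1

theorem simpleTw_avoid (k : Type u) [Field k] (s : ZMod (n + 1) ≃ S) (i : Fin n) (x) :
    (simpleTw k s i).1.obj x ≠ s 0 := cyc.ob_ne_zero i.2

theorem simpleTw_idM_δ (k : Type u) [Field k] (s : ZMod (n + 1) ≃ S) (i : Fin n) :
    cyc.idM (simpleTw k s i).1.δ = 0 :=
  funext fun _ => funext fun _ => map_zero (cyc.idc _ _)

theorem simpleTw_vM_δ (k : Type u) [Field k] (s : ZMod (n + 1) ≃ S) (i : Fin n) :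
    cyc.vM (simpleTw k s i).1.δ = 0 :=
  funext fun _ => funext fun _ => map_zero (cyc.vc _ _)

theorem tw_idM_δ : cyc.idM (F.tw s).1.δ = mx (F.twBasis s) (F.twBasis s) (tot (simpleCx k i).d) := F.idM_δ s

theorem tw_vM_δ : cyc.vM (F.tw s).1.δ = -mx (F.twBasis s) (F.twBasis s) (suc (simpleCx k i)) := F.vM_δ s

theorem isHomog_incl : (cyc k s).tw.IsHomog (X := simpleTw k s i) (Y := F.tw s) 0 (F.incl s) := by
  refine cyc.isHomog_of _ (fun x y h => ?_) (fun x y h => ?_)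
  · rw [idM_incl] at h
    exact (sub_zero _).trans (inclM_ne_zero h).1
  · rw [vM_incl] at h
    exact (sub_zero _).trans (corrM_ne_zero h).1

theorem isHomog_aug : (cyc k s).tw.IsHomog (X := F.tw s) (Y := simpleTw k s i) 0 (F.aug s) := by
  refine cyc.isHomog_of _ (fun x y h => ?_) (fun x y h => ?_)
  · rw [idM_aug] at h
    exact (zero_sub _).trans (neg_eq_zero.2 (augM_ne_zero h).1)
  · rw [vM_aug] at h
    exact absurd rfl h

theorem isHomog_htpy : (cyc k s).tw.IsHomog (X := F.tw s) (Y := F.tw s) 1 (F.htpy s) := by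
  refine cyc.isHomog_of _ (fun x y h => ?_) (fun x y h => ?_)
  · rw [idM_htpy] at h
    exact (htpyM_ne_zero h).1
  · rw [vM_htpy] at h
    exact absurd rfl h

theorem d_incl : (cyc k s).tw.d (X := simpleTw k s i) (Y := F.tw s) (F.incl s) =
    (0 : Fam.Hom (simpleTw k s i).1.toFam (F.tw s).1.toFam) := by
  refine cyc.hom_ext ?_ ?_
  · rw [cyc.idM_d_of_avoid 0 (simpleTw_avoid k s i) (F.avoid s), idM_incl, conj_inclM, tw_idM_δ,
      simpleTw_idM_δ, Matrix.zero_mul, sub_zero, inclM, ← mx_comp, tot_d_comp_totIncl, map_zero]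
    exact (cyc.idM_zero _ _).symm
  · rw [cyc.vM_d, idM_incl, vM_incl, conj_corrM, tw_idM_δ, tw_vM_δ, simpleTw_idM_δ, simpleTw_vM_δ,
      Matrix.zero_mul, Matrix.zero_mul, sub_zero, add_zero, Matrix.mul_neg, Matrix.neg_mul,
      sub_neg_eq_add, inclM, corrM, ← mx_comp, ← mx_comp, tot_d_totHtpy_suc_totIncl, neg_add_cancel]
    exact (cyc.vM_zero _ _).symm

theorem d_aug : (cyc k s).tw.d (X := F.tw s) (Y := simpleTw k s i) (F.aug s) =
    (0 : Fam.Hom (F.tw s).1.toFam (simpleTw k s i).1.toFam) := by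
  refine cyc.hom_ext ?_ ?_
  · rw [cyc.idM_d_of_avoid 0 (F.avoid s) (simpleTw_avoid k s i), idM_aug, tw_idM_δ,
      simpleTw_idM_δ, Matrix.mul_zero, zero_sub, augM, ← mx_comp, totAug_comp_tot_d, map_zero, neg_zero]
    exact (cyc.idM_zero _ _).symm
  · rw [cyc.vM_d, idM_aug, vM_aug, tw_vM_δ, simpleTw_idM_δ, simpleTw_vM_δ,
      Matrix.mul_zero, Matrix.mul_zero, Matrix.mul_zero, sub_zero, zero_add, zero_sub,
      Matrix.neg_mul, neg_neg, augM, ← mx_comp, totAug_comp_suc, map_zero]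
    exact (cyc.vM_zero _ _).symm

/-- The composition of the augmentation and the inclusion. -/
noncomputable def augIncl : Fam.Hom (F.tw s).1.toFam (F.tw s).1.toFam :=
  (cyc k s).tw.mul (X := F.tw s) (Y := simpleTw k s i) (Z := F.tw s) (F.aug s) (F.incl s)

theorem d_htpy : (cyc k s).tw.d (X := F.tw s) (Y := F.tw s) (F.htpy s) =
    F.augIncl s - Fam.one (F.tw s).1.toFam := by
  refine cyc.hom_ext ?_ ?_
  · rw [cyc.idM_d_of_avoid 0 (F.avoid s) (F.avoid s), cyc.idM_sub, augIncl,
      cyc.idM_mul_of_avoid 0 (F.avoid s) (simpleTw_avoid k s i) (F.avoid s), idM_aug, conj_augM,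
      idM_htpy, conj_htpyM, idM_incl, tw_idM_δ, cyc.idM_one, augM, inclM, ← mx_comp, htpyM,
      Matrix.neg_mul, ← mx_comp, ← mx_comp, ← neg_add', ← map_add, tot_d_totHtpy, map_sub, mx_id,
      neg_sub]
  · rw [cyc.vM_d, cyc.vM_sub, augIncl, cyc.vM_mul, idM_aug, vM_aug, idM_htpy, vM_htpy, vM_incl,
      cyc.conj_zero, cyc.conj_zero, tw_vM_δ, cyc.vM_one, augM, htpyM, corrM, Matrix.zero_mul,
      Matrix.zero_mul, Matrix.mul_zero, sub_zero, sub_zero, sub_zero, zero_sub, Matrix.mul_neg,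
      Matrix.neg_mul, neg_neg, ← mx_comp, ← mx_comp, ← mx_comp, neg_add_eq_sub, ← map_sub]
    exact congrArg _ (totHtpy_suc k i)

theorem incl_aug : (cyc k s).tw.mul (X := simpleTw k s i) (Y := F.tw s) (Z := simpleTw k s i)
    (F.incl s) (F.aug s) = Fam.one (simpleTw k s i).1.toFam := by
  refine cyc.hom_ext ?_ ?_
  · rw [cyc.idM_mul_of_avoid 0 (simpleTw_avoid k s i) (F.avoid s) (simpleTw_avoid k s i), idM_incl,
      idM_aug, conj_inclM, cyc.idM_one, inclM, augM, ← mx_comp, totAug_comp_totIncl, mx_id]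
  · rw [cyc.vM_mul, vM_aug, vM_incl, idM_incl, idM_aug, conj_corrM, cyc.vM_one, Matrix.mul_zero,
      zero_sub, Matrix.neg_mul, neg_neg, corrM, augM, ← mx_comp, ← LinearMap.comp_assoc,
      totAug_comp_totHtpy, LinearMap.zero_comp, map_zero]

theorem htpy_htpy : (cyc k s).tw.mul (X := F.tw s) (Y := F.tw s) (Z := F.tw s)
    (F.htpy s) (F.htpy s) = (0 : Fam.Hom (F.tw s).1.toFam (F.tw s).1.toFam) := by
  refine cyc.hom_ext ?_ ?_
  · rw [cyc.idM_mul_of_avoid 0 (F.avoid s) (F.avoid s) (F.avoid s), idM_htpy, conj_htpyM,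
      Matrix.neg_mul, htpyM, ← mx_comp, totHtpy_comp_totHtpy, map_zero, neg_zero, cyc.idM_zero]
  · rw [cyc.vM_mul, vM_htpy, cyc.conj_zero, Matrix.mul_zero, Matrix.zero_mul, sub_zero, cyc.vM_zero]

theorem incl_htpy : (cyc k s).tw.mul (X := simpleTw k s i) (Y := F.tw s) (Z := F.tw s)
    (F.incl s) (F.htpy s) = (0 : Fam.Hom (simpleTw k s i).1.toFam (F.tw s).1.toFam) := by
  refine cyc.hom_ext ?_ ?_
  · rw [cyc.idM_mul_of_avoid 0 (simpleTw_avoid k s i) (F.avoid s) (F.avoid s), idM_incl, idM_htpy,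
      conj_inclM, inclM, htpyM, ← mx_comp, totHtpy_comp_totIncl, map_zero, cyc.idM_zero]
  · rw [cyc.vM_mul, vM_htpy, vM_incl, idM_htpy, conj_corrM, Matrix.mul_zero, zero_sub,
      Matrix.neg_mul, neg_neg, corrM, htpyM, ← mx_comp, ← LinearMap.comp_assoc,
      totHtpy_comp_totHtpy, LinearMap.zero_comp, map_zero, cyc.vM_zero]

theorem htpy_aug : (cyc k s).tw.mul (X := F.tw s) (Y := F.tw s) (Z := simpleTw k s i)
    (F.htpy s) (F.aug s) = (0 : Fam.Hom (F.tw s).1.toFam (simpleTw k s i).1.toFam) := by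
  refine cyc.hom_ext ?_ ?_
  · rw [cyc.idM_mul_of_avoid 0 (F.avoid s) (F.avoid s) (simpleTw_avoid k s i), idM_aug, idM_htpy,
      conj_htpyM, Matrix.neg_mul, augM, htpyM, ← mx_comp, totAug_comp_totHtpy, map_zero, neg_zero,
      cyc.idM_zero]
  · rw [cyc.vM_mul, vM_htpy, vM_aug, cyc.conj_zero, Matrix.mul_zero, Matrix.zero_mul, sub_zero,
      cyc.vM_zero]

/-- The strong deformation retraction onto the object which corresponds to a simple module. -/
noncomputable def retraction :
    Retraction (cyc k s).tw (fun X => ∀ x, X.1.obj x ≠ s 0) (F.tw s) where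
  obj := simpleTw k s i
  obj_mem := simpleTw_avoid k s i
  i := F.incl s
  p := F.aug s
  h := F.htpy s
  i_deg := F.isHomog_incl s
  p_deg := F.isHomog_aug s
  h_deg := F.isHomog_htpy s
  d_i := F.d_incl s
  d_p := F.d_aug s
  d_h := F.d_htpy s
  i_p := F.incl_aug s
  h_h := F.htpy_htpy s
  i_h := F.incl_htpy s
  h_p := F.htpy_aug s

end Frame

/-! ### The functor -/

namespace QuiverRep

open PerComplex Frame

variable (k : Type u) [Field k] {n : ℕ}

theorem totAug_extHom {i : ℕ} (hi : i + 1 < n) (u : Total (simpleCx k ⟨i, Nat.lt_of_succ_lt hi⟩)) :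
    totAug ⟨i + 1, hi⟩ (tot (extHom k n i hi) u) =
      (u (1, ⟨i + 1, hi⟩) : Line k (i + 1 ≤ i + 1)) ⟨le_rfl⟩ := by
  refine (congrFun (tot_apply (X := simpleCx k ⟨i, Nat.lt_of_succ_lt hi⟩)
    (Y := simpleCx k ⟨i + 1, hi⟩) (extHom k n i hi) u (0, ⟨i + 1, hi⟩)) _).trans ?_
  refine (congrFun (Fin.sum_univ_two _) _).trans ?_
  exact zero_add _

theorem totAug_extHom_comp_totIncl {i : ℕ} (hi : i + 1 < n) :
    totAug ⟨i + 1, hi⟩ ∘ₗ tot (X := simpleCx k ⟨i, Nat.lt_of_succ_lt hi⟩)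
      (Y := simpleCx k ⟨i + 1, hi⟩) (extHom k n i hi) ∘ₗ totIncl ⟨i, Nat.lt_of_succ_lt hi⟩ = 0 := by
  refine LinearMap.ext fun r => (totAug_extHom k hi _).trans ?_
  exact congrFun (totIncl_of_ne (i := ⟨i, Nat.lt_of_succ_lt hi⟩) r (q := (1, ⟨i + 1, hi⟩)) (by simp)) (⟨le_rfl⟩ : PLift (i + 1 ≤ i + 1))

theorem totAug_extHom_comp_totHtpy {i : ℕ} (hi : i + 1 < n) :
    totAug ⟨i + 1, hi⟩ ∘ₗ tot (X := simpleCx k ⟨i, Nat.lt_of_succ_lt hi⟩)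
      (Y := simpleCx k ⟨i + 1, hi⟩) (extHom k n i hi) ∘ₗ totHtpy ⟨i, Nat.lt_of_succ_lt hi⟩ ∘ₗ
        suc (simpleCx k ⟨i, Nat.lt_of_succ_lt hi⟩) ∘ₗ totIncl ⟨i, Nat.lt_of_succ_lt hi⟩ =
      LinearMap.id := by
  refine LinearMap.ext fun r => (totAug_extHom k hi _).trans ?_
  refine (lineMap_apply (i ≤ i + 1) (i + 1 ≤ i + 1)
    (suc (simpleCx k ⟨i, Nat.lt_of_succ_lt hi⟩) (totIncl ⟨i, Nat.lt_of_succ_lt hi⟩ r) (0, ⟨i + 1, hi⟩))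
    ⟨le_rfl⟩ (Nat.le_succ i)).trans ?_
  refine (congrFun (simpleOb_suc_zero k ⟨i, Nat.lt_of_succ_lt hi⟩ _ (v := ⟨i, Nat.lt_of_succ_lt hi⟩)
    (l := ⟨i + 1, hi⟩) rfl) (⟨Nat.le_succ i⟩ : PLift (i ≤ i + 1))).trans ?_
  refine (lineMap_apply (i ≤ i) (i ≤ i + 1)
    (totIncl ⟨i, Nat.lt_of_succ_lt hi⟩ r (0, ⟨i, Nat.lt_of_succ_lt hi⟩)) _ le_rfl).trans ?_
  exact congrFun (totIncl_same (i := ⟨i, Nat.lt_of_succ_lt hi⟩) r) (⟨le_rfl⟩ : PLift (i ≤ i))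

theorem isHomog_extHom {i : ℕ} (hi : i + 1 < n) : (quiverDG k n).IsHomog 1 (extHom k n i hi) := by
  refine perDG.isHomog_iff.2 ?_
  intro (i : Fin 2) (j : Fin 2) h
  fin_cases i <;> fin_cases j <;> first | rfl | exact absurd rfl h

theorem simpleOb_injective : Function.Injective (simpleOb k n) := by
  intro i i' h
  have e (i l : Fin n) : Subsingleton (((simpleOb k n i).1.X 0).obj l) ↔ ¬ i ≤ l := by
    change Subsingleton (Line k (i.val ≤ l.val)) ↔ _
    constructor
    · intro hs hl
      have := congrFun (hs.elim (fun _ => 1) (fun _ => 0)) ⟨hl⟩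
      exact one_ne_zero this
    · exact fun hl => ⟨fun a b => funext fun h => absurd h.down hl⟩
  have e' (l : Fin n) : i ≤ l ↔ i' ≤ l := by
    rw [← not_iff_not, ← e, ← e, h]
  exact le_antisymm ((e' i').2 le_rfl) ((e' i).1 le_rfl)

end QuiverRep

theorem PerComplex.tot_one {k : Type u} [Field k] {n : ℕ} (X : (quiverDG k n).Ob) :
    PerComplex.tot (X := X.1) (Y := X.1) ((quiverDG k n).one X) = LinearMap.id := by
  refine LinearMap.ext fun u => funext fun q => ?_
  refine (PerComplex.tot_apply _ _ _).trans ?_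
  rw [Finset.sum_eq_single q.1]
  · change ((dite (q.1 = q.1) _ _ : X.1.X q.1 ⟶ X.1.X q.1).app q.2).hom _ = _
    rw [dif_pos rfl]
    rfl
  · intro i _ hi
    change ((dite (i = q.1) _ _ : X.1.X i ⟶ X.1.X q.1).app q.2).hom _ = _
    rw [dif_neg hi]
    rfl
  · exact fun h => absurd (Finset.mem_univ _) h

namespace Frame

open PerComplex QuiverRep

variable {k : Type u} [Field k] {n : ℕ} {S : Type w} (s : ZMod (n + 1) ≃ S)

theorem hom_one {X : (quiverDG k n).Ob} (F : Frame X.1) :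
    F.hom F s ((quiverDG k n).one X) = Fam.one (F.tw s).1.toFam := by
  refine cyc.hom_ext ?_ ?_
  · refine (idM_hom _ _ _ _).trans (Eq.trans ?_ (cyc.idM_one _).symm)
    exact (congrArg _ (tot_one X)).trans (mx_id _)
  · exact (vM_hom _ _ _ _).trans (cyc.vM_one _).symm

theorem isHomog_hom {X Y : (quiverDG k n).Ob} (F : Frame X.1) (G : Frame Y.1) {p : ZMod 2}
    {a : (quiverDG k n).Hom X Y} (ha : (quiverDG k n).IsHomog p a) :
    (cyc k s).tw.IsHomog (X := F.tw s) (Y := G.tw s) p (F.hom G s a) := by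
  refine cyc.isHomog_of _ (fun x y h => ?_) fun x y h => ?_
  · have e : cyc.idM (F.hom G s a) = _ := F.idM_hom G s a
    exact (deg_of_mx_tot_ne_zero (perDG.isHomog_iff.1 ha) (fun e' => h
      ((congrFun (congrFun e x) y).trans e'))).symm
  · exact absurd (congrFun (congrFun (F.vM_hom G s a) x) y) h

/-- The inclusion, the morphism `extHom`, and the augmentation compose to a generator. -/
theorem incl_hom_aug {i : ℕ} (hi : i + 1 < n) (F : Frame (simpleCx k ⟨i, Nat.lt_of_succ_lt hi⟩))
    (G : Frame (simpleCx k ⟨i + 1, hi⟩)) :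
    (cyc k s).tw.mul (X := simpleTw k s _) (Y := F.tw s) (Z := simpleTw k s _) (F.incl s)
      ((cyc k s).tw.mul (X := F.tw s) (Y := G.tw s) (Z := simpleTw k s _)
        ((cyc k s).tw.sgn (X := F.tw s) (Y := G.tw s) (F.hom G s (extHom k n i hi))) (G.aug s)) =
    cyc.twV k s (i + 1) := by
  have h1 : (cyc k s).tw.sgn (X := F.tw s) (Y := G.tw s) (F.hom G s (extHom k n i hi)) =
      (-F.hom G s (extHom k n i hi) : Fam.Hom (F.tw s).1.toFam (G.tw s).1.toFam) := by
    have := (isHomog_hom s (X := simpleOb k n _) (Y := simpleOb k n _) F G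
      (isHomog_extHom k hi)).redSgn_of_one
    exact (sgn_eq_neg_redSgn (A := (cyc k s).tw) _).trans
      (congrArg (fun a : Fam.Hom (F.tw s).1.toFam (G.tw s).1.toFam => -a) this)
  rw [h1]
  set a : Fam.Hom (F.tw s).1.toFam (G.tw s).1.toFam := F.hom G s (extHom k n i hi) with ha
  have ha1 : cyc.idM a = mx (F.twBasis s) (G.twBasis s) (tot (extHom k n i hi)) :=
    F.idM_hom G s (extHom k n i hi)
  have ha2 : cyc.vM a = 0 := F.vM_hom G s (extHom k n i hi)
  have ha3 : cyc.idM (-a) = -cyc.idM a := funext fun x => funext fun y => map_neg (cyc.idc _ _) (a x y)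
  have ha4 : cyc.vM (-a) = -cyc.vM a := funext fun x => funext fun y => map_neg (cyc.vc _ _) (a x y)
  have ha5 : cyc.conj _ _ (-cyc.idM a) = cyc.idM a := by
    rw [cyc.conj_eq_smul (p := 1), cyc.sg_one, neg_one_smul, neg_neg]
    intro x y h
    refine (deg_of_mx_tot_ne_zero (F := F) (G := G) (perDG.isHomog_iff.1 (isHomog_extHom k hi))
      (fun e => h ?_)).symm
    rw [Matrix.neg_apply, ha1]
    exact neg_eq_zero.2 e
  set b : Fam.Hom (F.tw s).1.toFam (simpleTw k s ⟨i + 1, hi⟩).1.toFam := (cyc k s).tw.mul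
    (X := F.tw s) (Y := G.tw s) (Z := simpleTw k s ⟨i + 1, hi⟩) (-a) (G.aug s) with hb
  have hb1 : cyc.idM b = cyc.idM a * G.augM s := by
    rw [hb, cyc.idM_mul_of_avoid 0 (F.avoid s) (G.avoid s) (simpleTw_avoid k s _), ha3, ha5, idM_aug]
  have hb2 : cyc.vM b = 0 := by
    rw [hb, cyc.vM_mul, vM_aug, ha4, ha2, neg_zero, cyc.conj_zero, Matrix.mul_zero, Matrix.zero_mul,
      sub_zero]
  refine cyc.hom_ext (X := (simpleTw k s _).1.toFam) (Y := (simpleTw k s _).1.toFam) ?_ ?_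
  · change cyc.idM ((cyc k s).tw.mul (X := simpleTw k s ⟨i, Nat.lt_of_succ_lt hi⟩) (Y := F.tw s)
      (Z := simpleTw k s ⟨i + 1, hi⟩) (F.incl s) b : Fam.Hom (simpleTw k s _).1.toFam
        (simpleTw k s _).1.toFam) = _
    rw [cyc.idM_mul_of_avoid 0 (simpleTw_avoid k s _) (F.avoid s) (simpleTw_avoid k s _), idM_incl,
      conj_inclM, hb1, ha1, inclM, augM, ← mx_comp, ← mx_comp, LinearMap.comp_assoc,
      totAug_extHom_comp_totIncl, map_zero]
    exact (funext fun _ => funext fun _ => (cyc.idc_mkHom 0 1).trans (ite_self _)).symm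
  · change cyc.vM ((cyc k s).tw.mul (X := simpleTw k s ⟨i, Nat.lt_of_succ_lt hi⟩) (Y := F.tw s)
      (Z := simpleTw k s ⟨i + 1, hi⟩) (F.incl s) b : Fam.Hom (simpleTw k s _).1.toFam
        (simpleTw k s _).1.toFam) = _
    rw [cyc.vM_mul, vM_incl, hb1, hb2, ha1, conj_corrM, Matrix.mul_zero, zero_sub, Matrix.neg_mul,
      neg_neg, corrM, augM, ← mx_comp, ← mx_comp, LinearMap.comp_assoc, totAug_extHom_comp_totHtpy]
    funext x y
    refine Eq.trans (b := 1) ?_ (Eq.symm ((cyc.vc_mkHom 0 1).trans (if_pos ?_)))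
    · obtain rfl : x = y := Subsingleton.elim (α := Fin 1) x y
      exact (congrFun (congrFun (mx_id (Module.Basis.singleton (Fin 1) k)) x) x).trans
        (Matrix.one_apply_eq x)
    · refine (congrArg (· + 1) (cyc.symm_ob k s (i + 1))).trans (Eq.trans ?_
        (cyc.symm_ob k s (i + 1 + 1)).symm)
      push_cast
      rfl

end Frame

section QuiverFunctor

open Frame QuiverRep

variable (k : Type u) [Field k] {n : ℕ} {S : Type w} (s : ZMod (n + 1) ≃ S)

/-- A homogeneous basis. -/
noncomputable def quiverFrame (X : (quiverDG k n).Ob) : Frame X.1 :=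
  (Frame.exists_frame X.1 fun i v => (X.2 i).2 v).some

/-- The retractions onto the objects which correspond to the simple modules. -/
noncomputable def simpleRetraction (i : Fin n) : Retraction (cyc k s).tw
    (fun X => ∀ x, X.1.obj x ≠ s 0) ((quiverFrame k (simpleOb k n i)).tw s) :=
  retraction (i := i) (quiverFrame k (simpleOb k n i)) s

open Classical in
/-- The retractions onto the objects which correspond to the simple modules, and trivial
retractions of the other objects. -/
noncomputable def quiverRetraction (X : (quiverDG k n).Ob) :
    Retraction (cyc k s).tw (fun X => ∀ x, X.1.obj x ≠ s 0) ((quiverFrame k X).tw s) :=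
  if h : ∃ i, simpleOb k n i = X then
    h.choose_spec ▸ simpleRetraction k s h.choose
  else .refl cyc.isAInf.tw _ _ ((quiverFrame k X).avoid s)

theorem quiverRetraction_simpleOb (i : Fin n) : quiverRetraction k s (simpleOb k n i) =
    simpleRetraction k s i := by
  have h : ∃ i', simpleOb k n i' = simpleOb k n i := ⟨i, rfl⟩
  have key : ∀ i' (e : simpleOb k n i' = simpleOb k n i),
      (e ▸ simpleRetraction k s i' : Retraction (cyc k s).tw (fun X => ∀ x, X.1.obj x ≠ s 0)
        ((quiverFrame k (simpleOb k n i)).tw s)) = simpleRetraction k s i := by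
    intro i' e
    obtain rfl := simpleOb_injective k e
    rfl
  rw [quiverRetraction, dif_pos h]
  exact key _ h.choose_spec

/-- The data which define the functor from complexes of representations to twisted complexes. -/
noncomputable def quiverRetractData :
    RetractData (quiverDG k n) (cyc k s).tw (fun X => ∀ x, X.1.obj x ≠ s 0) where
  big X := (quiverFrame k X).tw s
  big_mem X := (quiverFrame k X).avoid s
  f {X Y} := (quiverFrame k X).hom (quiverFrame k Y) s
  f_deg ha := isHomog_hom s _ _ ha
  f_d {X Y} a := (quiverFrame k X).hom_d (quiverFrame k Y) s a
  f_mul {X Y Z} a b := (quiverFrame k X).hom_comp (quiverFrame k Y) s (quiverFrame k Z) a b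
  f_one X := hom_one s (quiverFrame k X)
  obj X := (quiverRetraction k s X).obj
  obj_mem X := (quiverRetraction k s X).obj_mem
  i X := (quiverRetraction k s X).i
  p X := (quiverRetraction k s X).p
  h X := (quiverRetraction k s X).h
  i_deg X := (quiverRetraction k s X).i_deg
  p_deg X := (quiverRetraction k s X).p_deg
  h_deg X := (quiverRetraction k s X).h_deg
  d_i X := (quiverRetraction k s X).d_i
  d_p X := (quiverRetraction k s X).d_p
  d_h X := (quiverRetraction k s X).d_h
  i_p X := (quiverRetraction k s X).i_p
  h_h X := (quiverRetraction k s X).h_h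
  i_h X := (quiverRetraction k s X).i_h
  h_p X := (quiverRetraction k s X).h_p

namespace Frame

open PerComplex

variable {k s} {X Y : PerComplex (QuiverRep k n)} (F : Frame X) (G : Frame Y)

theorem twD_sub (b c : Fam.Hom (F.fam s) (G.fam s)) :
    F.twD G s (b - c) = F.twD G s b - F.twD G s c :=
  let X' : (cyc k s).tw.Ob := F.tw s
  let Y' : (cyc k s).tw.Ob := G.tw s
  cyc.isAInf.tw.d_sub (X := X') (Y := Y') b c

theorem twD_twD (b : Fam.Hom (F.fam s) (G.fam s)) : F.twD G s (F.twD G s b) = 0 :=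
  let X' : (cyc k s).tw.Ob := F.tw s
  let Y' : (cyc k s).tw.Ob := G.tw s
  cyc.isAInf.tw.dd (X := X') (Y := Y') b

theorem exists_d_eq_of_hom_eq_twD (h : ∀ i (a b : Fin n) (f : a ⟶ b),
    Function.Injective ((X.X i).map f).hom) {a : Hom X Y} {b : Fam.Hom (F.fam s) (G.fam s)}
    (hb : F.twD G s b = F.hom G s a) : ∃ a', comp (sgn a') Y.d - comp X.d a' = a := by
  obtain ⟨c, hc⟩ := F.exists_vM_sub_d_eq_zero G s h b
  have e : F.twD G s (b - F.twD G s c) = F.hom G s a := by rw [twD_sub, twD_twD, sub_zero, hb]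
  obtain ⟨a', ha'⟩ := F.exists_hom_eq G s _ hc (by rw [e, vM_hom])
  exact ⟨a', F.hom_injective G s (by rw [hom_d, ha', e])⟩

theorem exists_sub_hom_eq_twD (h : ∀ i (a b : Fin n) (f : a ⟶ b),
    Function.Injective ((X.X i).map f).hom) {b : Fam.Hom (F.fam s) (G.fam s)}
    (hb : F.twD G s b = 0) :
    ∃ (a : Hom X Y) (c : _), comp (sgn a) Y.d - comp X.d a = 0 ∧ F.twD G s c = b - F.hom G s a := by
  obtain ⟨c, hc⟩ := F.exists_vM_sub_d_eq_zero G s h b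
  have e : F.twD G s (b - F.twD G s c) = 0 := by rw [twD_sub, twD_twD, sub_zero, hb]
  obtain ⟨a, ha⟩ := F.exists_hom_eq G s _ hc (by rw [e]; exact cyc.vM_zero _ _)
  refine ⟨a, c, F.hom_injective G s ?_, by rw [ha, sub_sub_cancel]⟩
  rw [hom_d, ha, e, map_zero]

end Frame

variable {k s}

theorem quiverDG_map_injective (X : (quiverDG k n).Ob) (i) (a b : Fin n) (f : a ⟶ b) :
    Function.Injective ((X.1.X i).map f).hom := by
  have := (X.2 i).1
  exact injective_of_projective _ f

theorem quiver_exact_of_exact {X Y : (quiverDG k n).Ob} (a : (quiverDG k n).Hom X Y)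
    (h : (cyc k s).tw.Exact ((quiverRetractData k s).f a)) : (quiverDG k n).Exact a := by
  obtain ⟨b, hb⟩ := h
  exact exists_d_eq_of_hom_eq_twD (quiverFrame k X) (quiverFrame k Y) (quiverDG_map_injective X) hb

theorem quiver_exists_exact {X Y : (quiverDG k n).Ob}
    (b : (cyc k s).tw.Hom ((quiverRetractData k s).big X) ((quiverRetractData k s).big Y))
    (hb : (cyc k s).tw.d b = 0) : ∃ a : (quiverDG k n).Hom X Y, (quiverDG k n).d a = 0 ∧
      (cyc k s).tw.Exact (b - (quiverRetractData k s).f a) := by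
  obtain ⟨a, c, ha, hc⟩ := exists_sub_hom_eq_twD (quiverFrame k X) (quiverFrame k Y)
    (quiverDG_map_injective X) (s := s) (b := b) hb
  exact ⟨a, ha, c, hc⟩

variable (k s)

theorem quiverDG_μ_long {X Y : (quiverDG k n).Ob} (c : Chain (quiverDG k n).Hom X Y)
    (hc : 3 ≤ c.length) : (quiverDG k n).μ c = 0 := by
  cases c with
  | nil => simp at hc
  | cons a c => cases c with
    | nil => simp at hc
    | cons b c => cases c with
      | nil => simp at hc
      | cons d c => rfl

/-- The functor from complexes of representations to twisted complexes. -/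
noncomputable def quiverFunctor : AInfFunctor (quiverDG k n) (cyc k s).tw :=
  (quiverRetractData k s).functor perDG.isAInf cyc.isAInf.tw (cyc.strictOn_avoid 0)
    (quiverDG_μ_long k)

theorem quiverFunctor_simpleOb (i : Fin n) :
    (quiverFunctor k s).obj (simpleOb k n i) = cyc.twOb k s (i.val + 1) :=
  congrArg (·.obj) (quiverRetraction_simpleOb k s i)

theorem quiverFunctor_extHom {i : ℕ} (hi : i + 1 < n)
    (h : (quiverFunctor k s).obj (simpleOb k n ⟨i, Nat.lt_of_succ_lt hi⟩) = cyc.twOb k s (i + 1))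
    (h' : (quiverFunctor k s).obj (simpleOb k n ⟨i + 1, hi⟩) = cyc.twOb k s (i + 1 + 1)) :
    AInfData.castHom (cyc k s).tw h h' ((quiverFunctor k s).map (.single (extHom k n i hi))) =
      cyc.twV k s (i + 1) := by
  have key : ∀ (R R' : Retraction (cyc k s).tw (fun X => ∀ x, X.1.obj x ≠ s 0) _)
      (_ : R = simpleRetraction k s ⟨i, Nat.lt_of_succ_lt hi⟩)
      (_ : R' = simpleRetraction k s ⟨i + 1, hi⟩)
      (h : R.obj = cyc.twOb k s (i + 1)) (h' : R'.obj = cyc.twOb k s (i + 1 + 1)),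
      AInfData.castHom (cyc k s).tw h h'
        (R.i ⊚ ((quiverRetractData k s).g (extHom k n i hi) ⊚ R'.p)) = cyc.twV k s (i + 1) := by
    rintro _ _ rfl rfl h h'
    exact incl_hom_aug s hi _ _
  exact key _ _ (quiverRetraction_simpleOb k s _) (quiverRetraction_simpleOb k s _) h h'

end QuiverFunctor

namespace AInfData

variable {k : Type u} [Field k] {A : AInfData.{u, v, w} k} {X Y Z : A.Ob}

/-- Being an isomorphism in the cohomology category. -/
def IsHIso (f : A.Hom X Y) : Prop :=
  ∃ g : A.Hom Y X, A.IsHomog 0 f ∧ A.IsHomog 0 g ∧ A.Closed f ∧ A.Closed g ∧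
    A.Exact (A.μ (.pair f g) - A.one X) ∧ A.Exact (A.μ (.pair g f) - A.one Y)

theorem IsHIso.exact_of_exact_mul (h : A.IsAInf) {f : A.Hom X Y} (hf : IsHIso f) {a : A.Hom Y Z}
    (ha : A.d a = 0) (e : A.Exact (f ⊚ a)) : A.Exact a := by
  obtain ⟨g, -, dg, hf, hg, -, e'⟩ := hf
  have a1 := h.exact_assoc hg hf ha
  have a2 := h.mul_exact hg e
  have a3 := h.exact_mul e' ha
  rw [dg.redSgn_of_zero, h.neg_mul] at a1
  rw [h.sub_mul, h.one_mul] at a3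
  convert h.exact_sub (h.exact_add a1 a2) a3 using 1
  change _ = (g ⊚ f) ⊚ a + -(g ⊚ (f ⊚ a)) + g ⊚ (f ⊚ a) - ((g ⊚ f) ⊚ a - a)
  abel

theorem IsHIso.exists_exact_sub_mul (h : A.IsAInf) {f : A.Hom X Y} (hf : IsHIso f) {a : A.Hom X Z}
    (ha : A.d a = 0) : ∃ b : A.Hom Y Z, A.d b = 0 ∧ A.Exact (a - f ⊚ b) := by
  obtain ⟨g, df, -, hf, hg, e, -⟩ := hf
  refine ⟨g ⊚ a, h.closed_mul hg ha, ?_⟩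
  have a1 := h.exact_assoc hf hg ha
  have a3 := h.exact_mul e ha
  rw [df.redSgn_of_zero, h.neg_mul] at a1
  rw [h.sub_mul, h.one_mul] at a3
  convert h.exact_sub a1 a3 using 1
  change _ = (f ⊚ g) ⊚ a + -(f ⊚ (g ⊚ a)) - ((f ⊚ g) ⊚ a - a)
  abel

end AInfData

namespace cyc

variable {k : Type u} [Field k] {n : ℕ} {S : Type w} {s : ZMod (n + 1) ≃ S}

section Sums

variable {X Y Z W : (cyc k s).TwOb} (σ : ZMod 2)

theorem mul_twSum (r : k) (c : (cyc k s).TwChain X Y) (x : Fin X.1.N) (y : Fin Y.1.N)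
    (Φ : Chain (cyc k s).Hom (X.1.obj x) (Y.1.obj y) → k) :
    twSum σ c x y (fun e => r * Φ e) = r * twSum σ c x y Φ :=
  map_twSum σ c x y (AddMonoidHom.mulLeft r) Φ

theorem twSum_cons_vProdOf_zero (a : Fam.Hom X.1.toFam Z.1.toFam) (c : (cyc k s).TwChain Z Y)
    (x : Fin X.1.N) (y : Fin Y.1.N) : twSum σ (.cons a c) x y (vProdOf 0) = 0 :=
  twSum_eq_zero_of_length _ _ _ _ fun e he => vProdOf_of_ne (by
    have : 1 ≤ e.length := le_trans (by simp) he
    omega)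

theorem twSum_cons_vProdOf (j : ℕ) (a : Fam.Hom X.1.toFam Z.1.toFam) (c : (cyc k s).TwChain Z Y)
    (x : Fin X.1.N) (y : Fin Y.1.N) : twSum σ (.cons a c) x y (vProdOf (j + 1)) =
      ∑ z, vM a x z * twSum σ c z y (vProdOf j) +
        ∑ z ∈ Finset.Ioi x, vM X.1.δ x z * twSum σ (.cons a c) z y (vProdOf j) := by
  rw [twSum_cons _ _ _ _ _ (vProdOf_multilin _).killsZero]
  simp only [vProdOf_cons, mul_twSum, vc_twist]
  rfl

theorem twSum_nil_vProdOf_zero (x y : Fin X.1.N) :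
    twSum σ (.nil X) x y (vProdOf 0) = if x = y then (1 : k) else 0 := by
  rw [twSum_nil_of_length_zero _ _ _ (vProdOf_multilin _).killsZero fun e he =>
    vProdOf_of_ne (by omega)]
  split_ifs with h
  · subst h; exact vProdOf_of_eq rfl
  · rfl

theorem twSum_nil_vProdOf (j : ℕ) (x y : Fin X.1.N) :
    twSum σ (.nil X) x y (vProdOf (j + 1)) =
      ∑ z ∈ Finset.Ioi x, vM X.1.δ x z * twSum σ (.nil X) z y (vProdOf j) := by
  rw [twSum_nil _ _ _ _ (vProdOf_multilin _).killsZero]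
  have : (if h : x = y then (vProdOf (j + 1) (h ▸ .nil (X.1.obj x) :
      Chain (cyc k s).Hom (X.1.obj x) (X.1.obj y)) : k) else 0) = 0 := by
    split_ifs with h
    · subst h; exact vProdOf_of_ne (by simp)
    · rfl
  rw [this, zero_add]
  simp only [vProdOf_cons, mul_twSum, vc_twist]
  rfl

/-- Sequences which contain a morphism without components of degree one do not contribute to the
operation with `n + 1` entries. -/
theorem twSum_cons_vProdOf_eq_zero (j : ℕ) (a : Fam.Hom X.1.toFam Z.1.toFam)
    (c : (cyc k s).TwChain Z Y) (y : Fin Y.1.N)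
    (h : vM a = 0 ∨ ∀ j z, twSum σ c z y (vProdOf j) = 0) (x : Fin X.1.N) :
    twSum σ (.cons a c) x y (vProdOf j) = 0 := by
  induction j generalizing x with
  | zero => exact twSum_cons_vProdOf_zero σ a c x y
  | succ j ih =>
    rw [twSum_cons_vProdOf, Finset.sum_eq_zero, Finset.sum_eq_zero, add_zero]
    · exact fun z _ => by rw [ih, mul_zero]
    · intro z _
      obtain h | h := h
      · rw [h]; exact zero_mul _
      · rw [h, mul_zero]

theorem cycM_cons_eq_zero {a : Fam.Hom X.1.toFam Z.1.toFam} (ha : vM a = 0)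
    (c : (cyc k s).TwChain Z Y) : cycM (.cons a c) = 0 :=
  funext fun x => funext fun y => twSum_cons_vProdOf_eq_zero _ _ a c y (.inl ha) x

theorem idM_mul_of_left {a : Fam.Hom X.1.toFam Y.1.toFam} (ha : vM a = 0)
    (b : Fam.Hom Y.1.toFam Z.1.toFam) :
    idM ((cyc k s).tw.mul (X := X) (Y := Y) (Z := Z) a b : Fam.Hom X.1.toFam Z.1.toFam) =
      conj _ _ (idM a) * idM b := by
  rw [idM_mul, Chain.pair, cycM_cons_eq_zero ha, add_zero]

theorem vM_mul_of_left {a : Fam.Hom X.1.toFam Y.1.toFam} (ha : vM a = 0)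
    (b : Fam.Hom Y.1.toFam Z.1.toFam) :
    vM ((cyc k s).tw.mul (X := X) (Y := Y) (Z := Z) a b : Fam.Hom X.1.toFam Z.1.toFam) =
      idM a * vM b := by
  rw [vM_mul, ha, conj_zero, Matrix.zero_mul, sub_zero]

end Sums

/-! ### Arcs -/

/-- Twisted complexes whose summands are the objects of an arc of the cyclic order, and whose
differential consists of multiples of the generators. -/
structure IsArc (X : (cyc k s).TwOb) (t : ZMod (n + 1)) (σ : ZMod 2) (τ : k) : Prop where
  obj : ∀ x, s.symm (X.1.obj x) = t + (x.val : ℕ)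
  shift : ∀ x, X.1.shift x = σ
  idM_δ : idM X.1.δ = 0
  vM_δ : ∀ x y, vM X.1.δ x y = if x.val + 1 = y.val then τ else 0

/-- The matrix with a single entry from the last row to the first column. -/
def cornerM (k : Type u) [Field k] (m m' : ℕ) : Matrix (Fin m) (Fin m') k :=
  fun x y => if x.val + 1 = m ∧ y.val = 0 then 1 else 0

/-- The morphism from the last object of an arc to the first object of the next arc. -/
def corner (X Y : (cyc k s).TwOb) : Fam.Hom X.1.toFam Y.1.toFam := mat _ _ 0 (cornerM k X.1.N Y.1.N)

namespace IsArc

variable {X Y Z : (cyc k s).TwOb} {t t' : ZMod (n + 1)} {σ σ' : ZMod 2} {τ τ' : k}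

theorem sum_Ioi (hX : IsArc X t σ τ) (x : Fin X.1.N) (f : Fin X.1.N → k) :
    ∑ z ∈ Finset.Ioi x, vM X.1.δ x z * f z =
      if h : x.val + 1 < X.1.N then τ * f ⟨x.val + 1, h⟩ else 0 := by
  split_ifs with h
  · rw [Finset.sum_eq_single ⟨x.val + 1, h⟩]
    · rw [hX.vM_δ, if_pos rfl]
    · intro z _ hz
      rw [hX.vM_δ, if_neg fun e => hz (Fin.ext e.symm), zero_mul]
    · exact fun h' => absurd (Finset.mem_Ioi.2 (Fin.lt_def.2 (Nat.lt_succ_self _))) h'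
  · refine Finset.sum_eq_zero fun z hz => ?_
    have := Finset.mem_Ioi.1 hz
    have := z.2
    omega

theorem twSum_nil (hX : IsArc X t σ τ) (ρ : ZMod 2) (r : ℕ) (x y : Fin X.1.N) :
    twSum ρ (.nil X) x y (vProdOf r) = if x.val + r = y.val then τ ^ r else 0 := by
  induction r generalizing x with
  | zero =>
    rw [twSum_nil_vProdOf_zero, pow_zero]
    simp only [Fin.ext_iff, add_zero]
  | succ r ih =>
    rw [twSum_nil_vProdOf, hX.sum_Ioi]
    split_ifs with h h' h'
    · rw [ih, if_pos (by simp only; omega), pow_succ']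
    · rw [ih, if_neg (by simp only; omega), mul_zero]
    · have := y.2
      omega
    · rfl

theorem twSum_cons (hX : IsArc X t σ τ) (ρ : ZMod 2) {a : Fam.Hom X.1.toFam Z.1.toFam}
    (ha : vM a = cornerM k X.1.N Z.1.N) (hZ : 0 < Z.1.N) (c : (cyc k s).TwChain Z Y) (r i : ℕ)
    (x : Fin X.1.N) (y : Fin Y.1.N) (hi : x.val + i + 1 = X.1.N) :
    twSum ρ (.cons a c) x y (vProdOf (r + i + 1)) = τ ^ i * twSum ρ c ⟨0, hZ⟩ y (vProdOf r) := by
  induction i generalizing x with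
  | zero =>
    rw [twSum_cons_vProdOf, hX.sum_Ioi, dif_neg (by omega), add_zero, pow_zero, one_mul,
      Finset.sum_eq_single ⟨0, hZ⟩, ha, cornerM, if_pos ⟨hi, rfl⟩, one_mul]
    · intro z _ hz
      rw [ha, cornerM, if_neg fun e => hz (Fin.ext e.2), zero_mul]
    · exact fun h => absurd (Finset.mem_univ _) h
  | succ i ih =>
    rw [twSum_cons_vProdOf, hX.sum_Ioi, dif_pos (by omega), Finset.sum_eq_zero, zero_add]
    · have := ih ⟨x.val + 1, by omega⟩ (by simp only; omega)
      rw [show r + (i + 1) = r + i + 1 from rfl, this, pow_succ', mul_assoc]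
    · intro z _
      rw [ha, cornerM, if_neg (by omega), zero_mul]

theorem vM_corner (hX : IsArc X t σ τ) (hY : IsArc Y t' σ' τ') (ht : t + (X.1.N : ℕ) = t') :
    vM (corner X Y) = cornerM k X.1.N Y.1.N := by
  refine vM_mat fun x y h => if_neg fun e => h ?_
  have h1 : ((X.1.N : ℕ) : ZMod (n + 1)) = (x.val : ℕ) + 1 :=
    (congrArg Nat.cast e.1.symm).trans (Nat.cast_succ _)
  rw [hX.obj, hY.obj, ← ht, e.2, h1, Nat.cast_zero, add_zero, add_assoc]

theorem obj_ne (hX : IsArc X t σ τ) (hY : IsArc Y t' σ' τ') (ht : t + (X.1.N : ℕ) = t')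
    (hN : X.1.N + Y.1.N ≤ n + 1) (x : Fin X.1.N) (y : Fin Y.1.N) :
    s.symm (X.1.obj x) ≠ s.symm (Y.1.obj y) := by
  rw [hX.obj, hY.obj, ← ht, add_assoc, Ne, add_right_inj, ← Nat.cast_add]
  have := x.2
  have := y.2
  rw [natCast_inj (by omega) (by omega)]
  omega

theorem idM_eq_zero (hX : IsArc X t σ τ) (hY : IsArc Y t' σ' τ') (ht : t + (X.1.N : ℕ) = t')
    (hN : X.1.N + Y.1.N ≤ n + 1) (a : Fam.Hom X.1.toFam Y.1.toFam) : idM a = 0 :=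
  funext fun x => funext fun y => idc_eq_zero (hX.obj_ne hY ht hN x y) _

theorem d_corner (hX : IsArc X t σ τ) (hY : IsArc Y t' σ' τ') (ht : t + (X.1.N : ℕ) = t')
    (hN : X.1.N + Y.1.N ≤ n + 1) :
    (cyc k s).tw.d (X := X) (Y := Y) (corner X Y) = (0 : Fam.Hom X.1.toFam Y.1.toFam) := by
  refine hom_ext ?_ ?_
  · exact (hX.idM_eq_zero hY ht hN _).trans (hX.idM_eq_zero hY ht hN _).symm
  · rw [vM_d, hX.idM_eq_zero hY ht hN, hX.idM_δ, hY.idM_δ, vM_zero]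
    simp only [Matrix.zero_mul, Matrix.mul_zero, sub_zero, add_zero]

theorem isHomog_corner (hX : IsArc X t σ τ) (hY : IsArc Y t' σ' τ') (ht : t + (X.1.N : ℕ) = t')
    (hN : X.1.N + Y.1.N ≤ n + 1) :
    (cyc k s).tw.IsHomog (X := X) (Y := Y) (σ' - σ - 1) (corner X Y) := by
  refine isHomog_of _ (fun x y h => ?_) fun x y _ => ?_
  · rw [hX.idM_eq_zero hY ht hN] at h
    exact absurd rfl h
  · rw [hX.shift, hY.shift, sub_add_cancel]

/-- The morphisms between complementary arcs are inverse to each other up to a factor. -/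
theorem corner_mul_corner (hX : IsArc X t σ τ) (hY : IsArc Y t' σ' τ') (ht : t + (X.1.N : ℕ) = t')
    (hN : X.1.N + Y.1.N = n + 1) (hX0 : 0 < X.1.N) (hY0 : 0 < Y.1.N) :
    (cyc k s).tw.mul (X := X) (Y := Y) (Z := X) (corner X Y) (corner Y X) =
      (τ ^ (X.1.N - 1) * τ' ^ (Y.1.N - 1)) • Fam.one X.1.toFam := by
  have ht' : t' + (Y.1.N : ℕ) = t := by
    rw [← ht, add_assoc, ← Nat.cast_add, hN, ZMod.natCast_self, add_zero]
  have e1 := hX.vM_corner hY ht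
  have e2 := hY.vM_corner hX ht'
  refine hom_ext ?_ ?_
  · rw [idM_mul, hX.idM_eq_zero hY ht hN.le, conj_zero, Matrix.zero_mul, zero_add]
    funext x z
    have h1 := hX.twSum_cons (X.1.shift x) e1 hY0 (.single (corner Y X)) (x.val + (Y.1.N - 1) + 1)
      (X.1.N - 1 - x.val) x z (by omega)
    have h2 := hY.twSum_cons (X.1.shift x) e2 hX0 (.nil X) x.val (Y.1.N - 1) ⟨0, hY0⟩ z
      (by simp only; omega)
    rw [show x.val + (Y.1.N - 1) + 1 + (X.1.N - 1 - x.val) + 1 = n + 1 by omega] at h1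
    refine h1.trans ((congrArg _ h2).trans ?_)
    rw [hX.twSum_nil]
    have h3 : idM ((τ ^ (X.1.N - 1) * τ' ^ (Y.1.N - 1)) • Fam.one X.1.toFam) x z =
        (τ ^ (X.1.N - 1) * τ' ^ (Y.1.N - 1)) * idM (Fam.one X.1.toFam) x z :=
      map_smul (idc _ _) _ _
    rw [h3, idM_one, Matrix.one_apply]
    simp only [zero_add, Fin.ext_iff]
    split_ifs with h
    · rw [mul_left_comm, ← pow_add, Nat.sub_add_cancel (by omega), mul_one, mul_comm]
    · rw [mul_zero, mul_zero, mul_zero]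
  · rw [vM_mul, hX.idM_eq_zero hY ht hN.le, hY.idM_eq_zero hX ht' (by omega)]
    have h3 : vM ((τ ^ (X.1.N - 1) * τ' ^ (Y.1.N - 1)) • Fam.one X.1.toFam) =
        (τ ^ (X.1.N - 1) * τ' ^ (Y.1.N - 1)) • vM (Fam.one X.1.toFam) :=
      funext fun x => funext fun y => map_smul (vc _ _) _ _
    rw [h3, vM_one, smul_zero, Matrix.zero_mul, Matrix.mul_zero, sub_zero]

/-- The morphisms between complementary arcs are isomorphisms. -/
theorem isHIso_corner (hX : IsArc X t σ τ) (hY : IsArc Y t' (σ + 1) τ') (ht : t + (X.1.N : ℕ) = t')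
    (hN : X.1.N + Y.1.N = n + 1) (hX0 : 0 < X.1.N) (hY0 : 0 < Y.1.N) (hτ : τ ≠ 0) (hτ' : τ' ≠ 0) :
    (cyc k s).tw.IsHIso (X := X) (Y := Y) (corner X Y) := by
  have ht' : t' + (Y.1.N : ℕ) = t := by
    rw [← ht, add_assoc, ← Nat.cast_add, hN, ZMod.natCast_self, add_zero]
  have hB := (cyc.isAInf (k := k) (s := s)).tw
  have hN' : Y.1.N + X.1.N = n + 1 := (add_comm _ _).trans hN
  set r := τ ^ (X.1.N - 1) * τ' ^ (Y.1.N - 1) with hr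
  have hr0 : r ≠ 0 := mul_ne_zero (pow_ne_zero _ hτ) (pow_ne_zero _ hτ')
  let X' : (cyc k s).tw.Ob := X
  let Y' : (cyc k s).tw.Ob := Y
  let f : (cyc k s).tw.Hom X' Y' := corner X Y
  let g : (cyc k s).tw.Hom Y' X' := corner Y X
  have df : (cyc k s).tw.d f = 0 := hX.d_corner hY ht hN.le
  have dg : (cyc k s).tw.d g = 0 := hY.d_corner hX ht' hN'.le
  have fg : f ⊚ g = r • (cyc k s).tw.one X' := hX.corner_mul_corner hY ht hN hX0 hY0
  have gf : g ⊚ f = r • (cyc k s).tw.one Y' := by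
    refine (hY.corner_mul_corner hX ht' hN' hY0 hX0).trans ?_
    rw [mul_comm]
    rfl
  refine ⟨r⁻¹ • g, ?_, ?_, df, ?_, ?_, ?_⟩
  · have := hX.isHomog_corner hY ht hN.le
    rwa [show σ + 1 - σ - 1 = 0 by ring] at this
  · have := hY.isHomog_corner hX ht' hN'.le
    rw [show σ - (σ + 1) - 1 = 0 by ring_nf; rfl] at this
    exact (LinearMap.map_smul (Fam.proj 0) _ _).trans (congrArg _ this)
  · change (cyc k s).tw.d _ = 0
    exact (hB.d_smul r⁻¹ g).trans ((congrArg _ dg).trans (smul_zero _))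
  · change (cyc k s).tw.Exact (f ⊚ (r⁻¹ • g) - _)
    rw [hB.mul_smul, fg, smul_smul, inv_mul_cancel₀ hr0, one_smul, sub_self]
    exact hB.exact_zero
  · change (cyc k s).tw.Exact ((r⁻¹ • g) ⊚ f - _)
    rw [hB.smul_mul, gf, smul_smul, inv_mul_cancel₀ hr0, one_smul, sub_self]
    exact hB.exact_zero

end IsArc

/-- The differential of an arc given by the generators. -/
def arcPre {m : ℕ} (o : Fin m → (cyc k s).Ob) (σ : ZMod 2) : (cyc k s).PreTw where
  N := m
  obj := o
  shift _ := σ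
  δ x y := if x.val + 1 = y.val then gen k s (o x) (o y) else 0

section ArcPre

variable {m : ℕ} {o : Fin m → (cyc k s).Ob} {σ : ZMod 2} {t : ZMod (n + 1)}

theorem idM_arcPre_δ : idM (arcPre o σ).δ = 0 := by
  funext x y
  refine (congrArg (idc _ _) (?_ : (arcPre o σ).δ x y = mkHom _ _ 0
    (if x.val + 1 = y.val then 1 else 0))).trans ((idc_mkHom _ _).trans (ite_self _))
  change (if x.val + 1 = y.val then mkHom (o x) (o y) 0 1 else 0) = _
  split_ifs
  · rfl
  · exact ext ((map_zero _).trans (ite_self _).symm) ((map_zero _).trans (ite_self _).symm)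

theorem vM_arcPre_δ (ho : ∀ x, s.symm (o x) = t + (x.val : ℕ)) (x y : Fin m) :
    vM (arcPre o σ).δ x y = if x.val + 1 = y.val then 1 else 0 := by
  change vc _ _ (if x.val + 1 = y.val then mkHom (o x) (o y) 0 1 else 0) = _
  split_ifs with h
  · refine (vc_mkHom _ _).trans (if_pos ?_)
    rw [ho, ho, ← h]
    push_cast
    ring
  · exact map_zero _

theorem arcPre_isTwisted (ho : ∀ x, s.symm (o x) = t + (x.val : ℕ)) (hm : m ≤ n) :
    (arcPre o σ).IsTwisted := by
  refine isTwisted_of_avoid _ (t + (m : ℕ)) (fun x h => ?_) ?_ (fun x y h => ?_) ?_ ?_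
  · have h1 : s.symm (o x) = t + (m : ℕ) := by rw [show o x = _ from h]; exact s.symm_apply_apply _
    have h2 := (natCast_inj (x.2.le.trans hm) hm).1 (add_left_cancel ((ho x).symm.trans h1))
    have := x.2
    exact absurd h2 this.ne
  · refine isHomog_of _ (fun x y h => ?_) fun x y _ => ?_
    · rw [idM_arcPre_δ] at h
      exact absurd rfl h
    · exact (sub_self σ).trans rfl
  · exact if_neg fun e => h (Fin.lt_def.2 (by omega))
  · rw [idM_arcPre_δ, Matrix.zero_mul]
  · rw [idM_arcPre_δ, Matrix.zero_mul, Matrix.mul_zero]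

theorem isArc_arcPre (ho : ∀ x, s.symm (o x) = t + (x.val : ℕ)) (h : (arcPre o σ).IsTwisted) :
    IsArc ⟨arcPre o σ, h⟩ t σ 1 :=
  ⟨ho, fun _ => rfl, idM_arcPre_δ, vM_arcPre_δ ho⟩

end ArcPre

end cyc

/-- Objects whose identity morphisms are boundaries are isomorphic. -/
theorem AInfData.IsAInf.hIso_of_exact_one {k : Type u} [Field k] {A : AInfData.{u, v, w} k}
    (h : A.IsAInf) {X Y : A.Ob} (hX : A.Exact (A.one X)) (hY : A.Exact (A.one Y)) : A.HIso X Y := by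
  have e : ∀ {X Y : A.Ob}, A.Exact (A.one X) →
      A.Exact (A.μ (.pair (0 : A.Hom X Y) (0 : A.Hom Y X)) - A.one X) := by
    intro X Y hX
    change A.Exact (_ ⊚ _ - _)
    rw [h.zero_mul, zero_sub]
    exact h.exact_neg hX
  exact ⟨0, 0, map_zero _, map_zero _, h.d_zero, h.d_zero, e hX, e hY⟩

namespace cyc

variable (k : Type u) [Field k] {n : ℕ} {S : Type w} (s : ZMod (n + 1) ≃ S)

theorem symm_ob_add (a m : ℕ) (x : Fin m) :
    s.symm (ob k s (x.val + a)) = (a : ZMod (n + 1)) + (x.val : ℕ) := by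
  rw [symm_ob]
  push_cast
  exact add_comm _ _

/-- The arc `s_a → ⋯ → s_{a+m-1}`. -/
def arcTw (a m : ℕ) (σ : ZMod 2) (hm : m ≤ n) : (cyc k s).TwOb :=
  ⟨arcPre (fun x : Fin m => ob k s (x.val + a)) σ, arcPre_isTwisted (symm_ob_add k s a m) hm⟩

theorem isArc_arcTw (a m : ℕ) (σ : ZMod 2) (hm : m ≤ n) :
    IsArc (arcTw k s a m σ hm) (a : ZMod (n + 1)) σ 1 :=
  isArc_arcPre (symm_ob_add k s a m) _

theorem isArc_twOb (a : ℕ) : IsArc (X := (cyc.twOb k s a : (cyc k s).TwOb)) (a : ZMod (n + 1)) 0 1 where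
  obj := fun (x : Fin 1) => by
    refine (symm_ob k s a).trans ?_
    rw [Subsingleton.elim x 0]
    exact (add_zero _).symm.trans (congrArg _ Nat.cast_zero.symm)
  shift _ := rfl
  idM_δ := funext fun _ => funext fun _ => map_zero (idc _ _)
  vM_δ := fun (x y : Fin 1) => (map_zero (vc _ _)).trans (if_neg (show ¬ x.val + 1 = y.val by omega)).symm

/-- The arc `s_0 → ⋯ → s_{m-1}`, shifted by one. -/
def seg (m : ℕ) (hm : m ≤ n) : (cyc k s).TwOb := arcTw k s 0 m 1 hm

theorem isArc_seg (m : ℕ) (hm : m ≤ n) : IsArc (seg k s m hm) 0 1 1 :=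
  Nat.cast_zero (R := ZMod (n + 1)) ▸ isArc_arcTw k s 0 m 1 hm

theorem twOb_hIso : (cyc k s).tw.HIso (twOb k s 0) (arcTw k s 1 n 1 le_rfl) := by
  obtain rfl | hn := Nat.eq_zero_or_pos n
  · refine cyc.isAInf.tw.hIso_of_exact_one (X := twOb k s 0) ⟨mat _ _ 0 1, hom_ext ?_ ?_⟩
      ⟨(fun x => Fin.elim0 x : Fam.Hom (arcTw k s 1 0 1 le_rfl).1.toFam
        (arcTw k s 1 0 1 le_rfl).1.toFam), funext fun x => Fin.elim0 x⟩
    · refine (idM_d (X := twOb k s 0) (Y := twOb k s 0) _).trans ?_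
      rw [(isArc_twOb k s 0).idM_δ, Matrix.mul_zero, Matrix.zero_mul, sub_zero, zero_add]
      refine Eq.trans ?_ (idM_one _).symm
      funext (x : Fin 1) (y : Fin 1)
      refine (twSum_cons_vProdOf (X := twOb k s 0) _ 0 _ (.nil (twOb k s 0)) x y).trans ?_
      refine (congrArg₂ (· + ·) (Fin.sum_univ_one _) (((isArc_twOb k s 0).sum_Ioi _ _).trans
        (dif_neg (show ¬ (x.val + 1 < 1) by omega)))).trans ((add_zero _).trans ?_)
      have h1 : vM (mat (twOb k s 0 : (cyc k s).TwOb).1.toFam (twOb k s 0 : (cyc k s).TwOb).1.toFam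
          0 1) = 1 := vM_mat fun _ _ h => absurd (Subsingleton.elim (α := Fin 1) _ _) h
      refine (congrArg₂ (· * ·) (congrFun (congrFun h1 x) (0 : Fin 1))
        (twSum_nil_vProdOf_zero (X := (twOb k s 0 : (cyc k s).TwOb)) _ (0 : Fin 1) y)).trans ?_
      rw [Subsingleton.elim x 0, Subsingleton.elim y 0]
      exact mul_one 1
    · refine (vM_d (X := twOb k s 0) (Y := twOb k s 0) _).trans ?_
      have h1 : idM (mat (X := (twOb k s 0 : (cyc k s).TwOb).1.toFam)
        (Y := (twOb k s 0 : (cyc k s).TwOb).1.toFam) 0 1) = 0 := idM_mat fun _ _ _ => rfl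
      rw [(isArc_twOb k s 0).idM_δ, h1]
      simp only [Matrix.mul_zero, Matrix.zero_mul, sub_zero, add_zero]
      exact (vM_one _).symm
  · refine ⟨_, (isArc_twOb k s 0).isHIso_corner (isArc_arcTw k s 1 n 1 le_rfl) ?_ (add_comm 1 n) Nat.one_pos hn
      one_ne_zero one_ne_zero⟩
    rw [Nat.cast_zero, zero_add]
    rfl

/-! ### Initial segments of an arc -/

/-- The matrix which sends rows to the rows with the same number. -/
def padM (m m' : ℕ) : Matrix (Fin m) (Fin m') k := fun x y => if x.val = y.val then 1 else 0

variable {k s}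

theorem padM_mul_of_lt {m m' l : ℕ} (M : Matrix (Fin m') (Fin l) k) (x : Fin m) (h : x.val < m') :
    (padM k m m' * M) x = M ⟨x.val, h⟩ := by
  funext y
  rw [Matrix.mul_apply, Finset.sum_eq_single ⟨x.val, h⟩]
  · rw [padM, if_pos rfl, one_mul]
  · intro z _ hz
    rw [padM, if_neg fun e => hz (Fin.ext e.symm), zero_mul]
  · exact fun h' => absurd (Finset.mem_univ _) h'

theorem padM_mul_of_le {m m' l : ℕ} (M : Matrix (Fin m') (Fin l) k) (x : Fin m) (h : m' ≤ x.val) :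
    (padM k m m' * M) x = 0 := by
  funext y
  rw [Matrix.mul_apply]
  refine Finset.sum_eq_zero fun z _ => ?_
  have := z.2
  rw [padM, if_neg (by omega), zero_mul]

/-- The restriction of a morphism to the first rows. -/
def cut (m : ℕ) (hm : m ≤ n) (Y : (cyc k s).TwOb) :
    Fam.Hom (seg k s n le_rfl).1.toFam Y.1.toFam →ₗ[k]
      Fam.Hom (seg k s m hm).1.toFam Y.1.toFam where
  toFun b x := b (Fin.castLE (show (seg k s m hm).1.N ≤ _ from hm) x)
  map_add' _ _ := rfl
  map_smul' _ _ := rfl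

variable (k s) in
/-- The matrix which sends the rows of an initial segment to the corresponding rows. -/
def padMat (m : ℕ) (hm : m ≤ n) : Matrix (Fin (seg k s n le_rfl).1.N) (Fin (seg k s m hm).1.N) k :=
  padM k _ _

variable (k s) in
/-- The projection of an arc to an initial segment. -/
def padHom (m : ℕ) (hm : m ≤ n) :
    Fam.Hom (seg k s n le_rfl).1.toFam (seg k s m hm).1.toFam :=
  mat _ _ (padMat k s m hm) 0

section

variable {m : ℕ} {hm : m ≤ n}

theorem idM_padHom : idM (padHom k s m hm) = padMat k s m hm :=
  idM_mat fun _ _ h => if_neg fun e => h (congrArg (fun a => s.symm (ob k s (a + 0))) e)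

theorem vM_padHom : vM (padHom k s m hm) = 0 := vM_mat fun _ _ _ => rfl

theorem conj_padHom : conj _ _ (idM (padHom k s m hm)) = idM (padHom k s m hm) := by
  rw [conj_eq_smul (p := 0) fun _ _ _ => sub_self (1 : ZMod 2), sg_zero, one_smul]

theorem isHomog_padHom : Fam.proj 0 (padHom k s m hm) = padHom k s m hm :=
  isHomog_of _ (fun _ _ _ => sub_self (1 : ZMod 2)) fun x y h =>
    absurd (congrFun (congrFun vM_padHom x) y) h

theorem d_padHom : (cyc k s).tw.d (X := seg k s n le_rfl) (Y := seg k s m hm)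
    (padHom k s m hm) = (0 : Fam.Hom (seg k s n le_rfl).1.toFam (seg k s m hm).1.toFam) := by
  have hX := isArc_seg k s n le_rfl
  have hY := isArc_seg k s m hm
  refine hom_ext ?_ ?_
  · rw [idM_d, hX.idM_δ, hY.idM_δ, Chain.single, cycM_cons_eq_zero vM_padHom]
    simp only [Matrix.zero_mul, Matrix.mul_zero, sub_zero, add_zero]
    exact (idM_zero _ _).symm
  · rw [vM_d, hX.idM_δ, hY.idM_δ, idM_padHom, vM_padHom, conj_zero]
    simp only [Matrix.mul_zero, sub_zero, zero_sub]
    refine Eq.trans ?_ (vM_zero _ _).symm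
    rw [← sub_eq_add_neg, sub_eq_zero]
    funext (x : Fin n) (y : Fin m)
    have h1 : (vM (seg k s n le_rfl).1.δ * padMat k s m hm) x y =
        if x.val + 1 = y.val then 1 else 0 := by
      have hy := y.2
      refine Matrix.mul_apply.trans ((Finset.sum_eq_single (⟨y.val, by omega⟩ : Fin n) ?_ ?_).trans ?_)
      rotate_left 2
      · refine (congrArg (_ * ·) (if_pos rfl)).trans ((mul_one _).trans ?_)
        exact hX.vM_δ _ _
      · intro z _ hz
        exact (congrArg (_ * ·) (if_neg fun e => hz (Fin.ext e))).trans (mul_zero _)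
      · exact fun h' => absurd (Finset.mem_univ _) h'
    refine Eq.trans ?_ h1.symm
    obtain h | h := Nat.lt_or_ge x.val m
    · exact (congrFun (padM_mul_of_lt (m := n) (m' := m) _ x h) y).trans (hY.vM_δ _ _)
    · refine (congrFun (padM_mul_of_le (m := n) (m' := m) _ x h) y).trans (if_neg ?_).symm
      have := y.2
      omega

variable {Y : (cyc k s).TwOb}

/-- The extension of a morphism by zero. -/
def pad (c : Fam.Hom (seg k s m hm).1.toFam Y.1.toFam) :
    Fam.Hom (seg k s n le_rfl).1.toFam Y.1.toFam :=
  (cyc k s).tw.mul (X := seg k s n le_rfl) (Y := seg k s m hm) (Z := Y) (padHom k s m hm) c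

theorem idM_pad (c : Fam.Hom (seg k s m hm).1.toFam Y.1.toFam) :
    idM (pad c) = padMat k s m hm * idM c := by
  refine (idM_mul_of_left vM_padHom c).trans ?_
  rw [conj_padHom, idM_padHom]

theorem vM_pad (c : Fam.Hom (seg k s m hm).1.toFam Y.1.toFam) :
    vM (pad c) = padMat k s m hm * vM c := by
  refine (vM_mul_of_left vM_padHom c).trans ?_
  rw [idM_padHom]

theorem cut_pad (c : Fam.Hom (seg k s m hm).1.toFam Y.1.toFam) : cut m hm Y (pad c) = c := by
  funext (x : Fin m)
  have h : (Fin.castLE hm x).val < m := x.2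
  exact funext fun y => ext
    ((congrFun (congrFun (idM_pad c) (Fin.castLE hm x)) y).trans
      (congrFun (padM_mul_of_lt (m := n) (m' := m) (idM c) (Fin.castLE hm x) h) y))
    ((congrFun (congrFun (vM_pad c) (Fin.castLE hm x)) y).trans
      (congrFun (padM_mul_of_lt (m := n) (m' := m) (vM c) (Fin.castLE hm x) h) y))

theorem pad_eq_zero (c : Fam.Hom (seg k s m hm).1.toFam Y.1.toFam) (x : Fin n) (h : m ≤ x.val) :
    pad c x = 0 :=
  funext fun y => ext
    ((congrFun (congrFun (idM_pad c) x) y).trans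
      ((congrFun (padM_mul_of_le (m := n) (m' := m) (idM c) x h) y).trans (map_zero (idc _ _)).symm))
    ((congrFun (congrFun (vM_pad c) x) y).trans
      ((congrFun (padM_mul_of_le (m := n) (m' := m) (vM c) x h) y).trans (map_zero (vc _ _)).symm))

theorem pad_cut (b : Fam.Hom (seg k s n le_rfl).1.toFam Y.1.toFam)
    (hb : ∀ x : Fin n, m ≤ x.val → b x = 0) : pad (cut m hm Y b) = b := by
  funext (x : Fin n)
  obtain h | h := Nat.lt_or_ge x.val m
  · exact congrFun (cut_pad (cut m hm Y b)) ⟨x.val, h⟩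
  · exact (pad_eq_zero _ x h).trans (hb x h).symm

theorem d_pad (c : Fam.Hom (seg k s m hm).1.toFam Y.1.toFam) :
    (cyc k s).tw.d (X := seg k s n le_rfl) (Y := Y) (pad c) =
      pad ((cyc k s).tw.d (X := seg k s m hm) (Y := Y) c) := by
  let X' : (cyc k s).tw.Ob := seg k s n le_rfl
  let Z' : (cyc k s).tw.Ob := seg k s m hm
  let Y' : (cyc k s).tw.Ob := Y
  let c' : (cyc k s).tw.Hom Z' Y' := c
  have hB := (cyc.isAInf (k := k) (s := s)).tw
  let f : (cyc k s).tw.Hom X' Z' := padHom k s m hm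
  have h1 : (cyc k s).tw.d f = 0 := d_padHom
  have h2 : (cyc k s).tw.IsHomog 0 f := isHomog_padHom
  have h3 := hB.d_mul f c'
  rw [h1, h2.redSgn_of_zero, hB.zero_mul, hB.neg_mul, neg_zero, zero_sub, neg_neg] at h3
  exact h3

theorem d_eq_zero_of_rows (b : Fam.Hom (seg k s n le_rfl).1.toFam Y.1.toFam) (hm : m ≤ n)
    (hb : ∀ x : Fin n, m ≤ x.val → b x = 0) (x : Fin n) (hx : m ≤ x.val) :
    ((cyc k s).tw.d (X := seg k s n le_rfl) (Y := Y) b : Fam.Hom _ Y.1.toFam) x = 0 := by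
  rw [← pad_cut (hm := hm) b hb, d_pad]
  exact pad_eq_zero _ x hx

theorem cut_d (b : Fam.Hom (seg k s n le_rfl).1.toFam Y.1.toFam)
    (hb : ∀ x : Fin n, m ≤ x.val → b x = 0) :
    cut m hm Y ((cyc k s).tw.d (X := seg k s n le_rfl) (Y := Y) b) =
      (cyc k s).tw.d (X := seg k s m hm) (Y := Y) (cut m hm Y b) := by
  conv_lhs => rw [← pad_cut (hm := hm) b hb, d_pad]
  exact cut_pad _

theorem twSum_cut (ρ : ZMod 2) (b : Fam.Hom (seg k s n le_rfl).1.toFam Y.1.toFam)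
    (hb : ∀ x : Fin n, m ≤ x.val → b x = 0) (r : ℕ) (x : Fin m) (y : Fin Y.1.N) :
    twSum (X := seg k s m hm) ρ (.single (cut m hm Y b)) x y (vProdOf r) =
      twSum (X := seg k s n le_rfl) ρ (.single b) (Fin.castLE hm x) y (vProdOf r) := by
  have hX := isArc_seg k s n le_rfl
  have hZ := isArc_seg k s m hm
  induction r generalizing x with
  | zero => exact (twSum_cons_vProdOf_zero _ _ _ _ _).trans (twSum_cons_vProdOf_zero _ _ _ _ _).symm
  | succ r ih =>
    refine (twSum_cons_vProdOf (X := seg k s m hm) ρ r _ (.nil Y) x y).trans (Eq.trans ?_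
      (twSum_cons_vProdOf (X := seg k s n le_rfl) ρ r _ (.nil Y) (Fin.castLE hm x) y).symm)
    refine congrArg₂ (· + ·) rfl ((hZ.sum_Ioi _ _).trans (Eq.trans ?_ (hX.sum_Ioi _ _).symm))
    obtain h | h := Nat.lt_or_ge (x.val + 1) m
    · refine (dif_pos h).trans (Eq.trans ?_ (dif_pos (h.trans_le hm)).symm)
      exact congrArg (1 * ·) (ih ⟨x.val + 1, h⟩)
    · refine (dif_neg h.not_gt).trans (Eq.symm ?_)
      by_cases h' : x.val + 1 < n
      · refine (dif_pos h').trans ((congrArg (1 * ·) ?_).trans (mul_zero _))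
        exact twSum_cons_of_rows_eq_zero ρ (.nil Y) _ y (vProdOf_multilin r).killsZero fun w hw =>
          hb w (h.trans (Fin.le_def.1 hw))
      · exact dif_neg h'

end

end cyc

/-! ### The indecomposable projective representations -/

namespace QuiverRep

open PerComplex

variable (k : Type u) [Field k] {n : ℕ}

/-- The representation `P_a` as a complex in degree zero; the zero representation in degree one is
written as `P_n`. -/
def projCx (a : Fin n) : PerComplex (QuiverRep k n) where
  X j := P k n (if j = 0 then a.val else n)
  d _ _ := 0
  d_deg _ _ _ := rfl
  d_sq _ _ := Finset.sum_eq_zero fun _ _ => Limits.zero_comp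

variable {k} {a : Fin n}

theorem projCx_le {q : ZMod 2 × Fin n} (h : (if q.1 = 0 then a.val else n) ≤ q.2.val) :
    q.1 = 0 ∧ a ≤ q.2 := by
  have := q.2.2
  split_ifs at h with h'
  · exact ⟨h', h⟩
  · omega

/-- The components of a vector with respect to the standard basis. -/
def projCoord (u : Total (projCx k a)) (l : Fin (n - a.val)) : k :=
  (u (0, ⟨a.val + l.val, by omega⟩) : Line k (a.val ≤ a.val + l.val)) ⟨Nat.le_add_right _ _⟩

theorem projCoord_apply (u : Total (projCx k a)) (q : ZMod 2 × Fin n)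
    (h : PLift ((if q.1 = 0 then a.val else n) ≤ q.2.val)) (l : Fin (n - a.val))
    (hl : a.val + l.val = q.2.val) :
    (u q : Line k ((if q.1 = 0 then a.val else n) ≤ q.2.val)) h = projCoord u l := by
  obtain ⟨j, v⟩ := q
  obtain ⟨rfl, -⟩ := projCx_le h.down
  have key : ∀ v' : Fin n, v' = v → ∀ h' : PLift (a.val ≤ v'.val),
      (u (0, v) : Line k (a.val ≤ v.val)) h = (u (0, v') : Line k (a.val ≤ v'.val)) h' := by
    rintro _ rfl h'
    exact congrArg (u (0, _) : Line k _) (Subsingleton.elim h h')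
  exact key ⟨a.val + l.val, by omega⟩ (Fin.ext hl) _

/-- The coordinates with respect to the standard basis. -/
def projEquiv (k : Type u) [Field k] (a : Fin n) : Total (projCx k a) ≃ₗ[k] (Fin (n - a.val) → k) where
  toFun := projCoord
  map_add' _ _ := rfl
  map_smul' _ _ := rfl
  invFun w q := (fun _ => w ⟨q.2.val - a.val, by omega⟩ : Line k ((if q.1 = 0 then a.val else n) ≤ q.2.val))
  left_inv u := by
    refine funext fun q => funext fun h => ?_
    refine (projCoord_apply u q h ⟨q.2.val - a.val, by omega⟩ ?_).symm
    have := Fin.le_def.1 (projCx_le h.down).2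
    simp only
    omega
  right_inv w := by
    refine funext fun l => congrArg w (Fin.ext ?_)
    simp only
    omega

/-- The standard basis of the total space. -/
noncomputable def projBasis (k : Type u) [Field k] (a : Fin n) :
    Module.Basis (Fin (n - a.val)) k (Total (projCx k a)) := .ofEquivFun (projEquiv k a)

theorem projCoord_basis (l l' : Fin (n - a.val)) :
    projCoord (projBasis k a l) l' = if l' = l then 1 else 0 := by
  have : projCoord (projBasis k a l) = projEquiv k a (projBasis k a l) := rfl
  rw [this, projBasis, Module.Basis.coe_ofEquivFun, LinearEquiv.apply_symm_apply, Pi.single_apply]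

theorem mx_suc_projBasis (x y : Fin (n - a.val)) :
    mx (projBasis k a) (projBasis k a) (suc (projCx k a)) x y =
      if x.val + 1 = y.val then 1 else 0 := by
  have h1 : mx (projBasis k a) (projBasis k a) (suc (projCx k a)) x y =
      projCoord (suc (projCx k a) (projBasis k a x)) y := by
    rw [mx_apply, projBasis, Module.Basis.ofEquivFun_repr_apply]
    rfl
  rw [h1, projCoord]
  obtain hw | ⟨v, hw⟩ := val_eq_zero_or (⟨a.val + y.val, by omega⟩ : Fin n)
  · refine Eq.trans ?_ (if_neg (by simp only at hw; omega)).symm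
    exact congrFun (suc_apply_zero (X := projCx k a) _ 0 hw) (⟨Nat.le_add_right _ _⟩ : PLift _)
  · refine (congrFun (suc_apply (X := projCx k a) _ 0 hw) (⟨Nat.le_add_right _ _⟩ : PLift _)).trans ?_
    simp only at hw
    by_cases hv : a.val ≤ v.val
    · refine (lineMap_apply (a.val ≤ v.val) _ (projBasis k a x (0, v)) _ hv).trans ?_
      have hl : v.val - a.val < n - a.val := by omega
      refine (projCoord_apply (projBasis k a x) (0, v) ⟨hv⟩ ⟨v.val - a.val, hl⟩
        (by simp only; omega)).trans ((projCoord_basis _ _).trans ?_)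
      refine if_congr ?_ rfl rfl
      rw [Fin.ext_iff]
      simp only
      omega
    · refine Eq.trans ?_ (if_neg (by omega)).symm
      exact lineMap_apply_zero (a.val ≤ v.val) _ (projBasis k a x (0, v)) _ hv

variable (k) in
/-- The standard basis of an indecomposable projective representation. -/
noncomputable def projFrame (a : Fin n) : Frame (projCx k a) where
  N := n - a.val
  deg _ := 0
  vert l := ⟨a.val + l.val, by omega⟩
  basis := projBasis k a
  homog x q hq := by
    refine funext fun h => ?_
    have h1 := projCx_le h.down
    have h2 := Fin.le_def.1 h1.2
    refine (projCoord_apply _ q h ⟨q.2.val - a.val, by omega⟩ (by simp only; omega)).trans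
      ((projCoord_basis _ _).trans (if_neg fun e => hq ?_))
    refine Prod.ext h1.1 (Fin.ext ?_)
    have := congrArg Fin.val e
    simp only at this ⊢
    omega
  d_triangular x y _ := by
    have : tot (projCx k a).d = 0 := (totₗ (projCx k a) (projCx k a)).map_zero
    rw [this, map_zero]
    rfl
  suc_triangular x y h := by
    refine (mx_suc_projBasis x y).trans (if_neg fun e => h ?_)
    exact Fin.lt_def.2 (by omega)

variable {S : Type w} (s : ZMod (n + 1) ≃ S)

theorem isArc_projFrame (a : Fin n) :
    cyc.IsArc ((projFrame k a).tw s) ((a.val + 1 : ℕ) : ZMod (n + 1)) 0 (-1 : k) where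
  obj x := by
    refine ((projFrame k a).symm_fam_obj s x).trans ?_
    change ((a.val + x.val + 1 : ℕ) : ZMod (n + 1)) = _
    push_cast
    ring
  shift _ := rfl
  idM_δ := by
    refine ((projFrame k a).idM_δ s).trans ?_
    have : tot (projCx k a).d = 0 := (totₗ (projCx k a) (projCx k a)).map_zero
    rw [this, map_zero]
    rfl
  vM_δ x y := by
    refine (congrFun (congrFun ((projFrame k a).vM_δ s) x) y).trans ?_
    refine (congrArg Neg.neg (mx_suc_projBasis x y)).trans ?_
    split_ifs
    · rfl
    · exact neg_zero

/-- The generators of the spaces of `P_a`. -/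
def projGen (k : Type u) [Field k] (a l : Fin n) : (P k n a).obj l := (fun _ => 1 : Line k (a.val ≤ l.val))

/-- The morphism from `P_a` given by an element of the space at the vertex `a`. -/
def desc {M : QuiverRep k n} (a : Fin n) (x : M.obj a) : P k n a ⟶ M where
  app l := ModuleCat.ofHom (lineTo k (a.val ≤ l.val) fun h => (M.map (homOfLE h)).hom x)
  naturality l l' g := by
    refine ModuleCat.hom_ext ((lineTo_comp_lineMap k _ _ (fun h => h.trans (leOfHom g)) _).trans
      (Eq.trans ?_ (comp_lineTo k _ _ _).symm))
    congr 1
    funext h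
    exact ConcreteCategory.congr_hom (M.map_comp (homOfLE h : a ⟶ l) g) x

theorem desc_apply {M : QuiverRep k n} (x : M.obj a) :
    ((desc a x).app a).hom (projGen k a a) = x := by
  refine (dif_pos (le_refl a.val)).trans ((one_smul k _).trans ?_)
  exact ConcreteCategory.congr_hom (M.map_id a) x

theorem app_eq_map {M : QuiverRep k n} (f : P k n a ⟶ M) {l : Fin n} (h : a ≤ l) :
    (f.app l).hom (projGen k a l) =
      (M.map (homOfLE h)).hom ((f.app a).hom (projGen k a a)) := by
  refine Eq.trans ?_ (ConcreteCategory.congr_hom (f.naturality (homOfLE h)) _)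
  exact congrArg (f.app l).hom (funext fun h' =>
    (lineMap_apply (a.val ≤ a.val) (a.val ≤ l.val) (projGen k a a) h' le_rfl).symm)

theorem proj_hom_ext {M : QuiverRep k n} {f g : P k n a ⟶ M}
    (h : (f.app a).hom (projGen k a a) =
      (g.app a).hom (projGen k a a)) : f = g := by
  refine NatTrans.ext (funext fun l => ModuleCat.hom_ext ?_)
  refine (eq_lineTo k (a.val ≤ l.val) (f.app l).hom).trans (Eq.trans ?_
    (eq_lineTo k (a.val ≤ l.val) (g.app l).hom).symm)
  congr 1
  funext hl
  exact (app_eq_map f hl).trans ((congrArg _ h).trans (app_eq_map g hl).symm)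

theorem zero_hom_ext {M : QuiverRep k n} {f g : P k n n ⟶ M} : f = g := by
  refine NatTrans.ext (funext fun l => ModuleCat.hom_ext (LinearMap.ext fun x => ?_))
  have : x = 0 := funext fun h => absurd h.down l.2.not_ge
  rw [this, map_zero, map_zero]

end QuiverRep

namespace cyc

open PerComplex QuiverRep

variable {k : Type u} [Field k] {n : ℕ} {S : Type w} {s : ZMod (n + 1) ≃ S} (Y : (cyc k s).TwOb)

/-! ### The complex of representations attached to a twisted complex -/

/-- The morphisms from the arc `s_0 → ⋯ → s_{n-1}`. -/
abbrev Rows : Type u := Fam.Hom (seg k s n le_rfl).1.toFam Y.1.toFam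

instance : Module.Finite k (Rows Y) := by
  let f : Rows Y →ₗ[k] (Fin n → Fin Y.1.N → k × k) := LinearMap.pi fun x => LinearMap.pi fun y =>
    ((idc _ _).prod (vc _ _)) ∘ₗ LinearMap.proj y ∘ₗ LinearMap.proj x
  refine Module.Finite.of_injective f fun a b h => hom_ext ?_ ?_
  · exact funext fun x => funext fun y => congrArg Prod.fst (congrFun (congrFun h x) y)
  · exact funext fun x => funext fun y => congrArg Prod.snd (congrFun (congrFun h x) y)

/-- The homogeneous morphisms whose rows after the row `a` vanish. -/
def rowSub (p : ZMod 2) (a : Fin n) : Submodule k (Rows Y) where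
  carrier := {b | Fam.proj p b = b ∧ ∀ x : Fin n, a < x → b x = 0}
  add_mem' := fun ha hb => ⟨by rw [map_add, ha.1, hb.1], fun x hx =>
    (congrArg₂ (· + ·) (ha.2 x hx) (hb.2 x hx)).trans (add_zero _)⟩
  zero_mem' := ⟨map_zero _, fun _ _ => rfl⟩
  smul_mem' r b hb := ⟨by rw [map_smul, hb.1], fun x hx =>
    (congrArg (r • ·) (hb.2 x hx)).trans (smul_zero _)⟩

theorem rowSub_mono (p : ZMod 2) {a b : Fin n} (h : a ≤ b) : rowSub Y p a ≤ rowSub Y p b :=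
  fun _ hb => ⟨hb.1, fun x hx => hb.2 x (h.trans_lt hx)⟩

/-- The representation formed by the homogeneous morphisms. -/
def rowRep (p : ZMod 2) : QuiverRep k n where
  obj a := ModuleCat.of k (rowSub Y p a)
  map f := ModuleCat.ofHom (Submodule.inclusion (rowSub_mono Y p (leOfHom f)))
  map_id _ := rfl
  map_comp _ _ := rfl

variable {Y} in
theorem proj_row_eq_zero (p : ZMod 2) {b : Rows Y} {x : Fin n} (h : b x = 0) :
    (Fam.proj p b : Rows Y) x = 0 :=
  funext fun y => (congrArg ((cyc k s).proj _) (congrFun h y)).trans (map_zero _)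

/-- The differential. -/
def rowD (j : ZMod 2) : Rows Y →ₗ[k] Rows Y :=
  let X' : (cyc k s).tw.Ob := seg k s n le_rfl
  let Y' : (cyc k s).tw.Ob := Y
  Fam.proj j ∘ₗ (cyc.isAInf.tw.dₗ X' Y' : Rows Y →ₗ[k] Rows Y) ∘ₗ
    (Fam.proj 1 - Fam.proj 0 : Rows Y →ₗ[k] Rows Y)

variable {Y} in
theorem rowD_mem {i : ZMod 2} (j : ZMod 2) {a : Fin n} {b : Rows Y} (hb : b ∈ rowSub Y i a) :
    rowD Y j b ∈ rowSub Y j a := by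
  refine ⟨(Fam.proj_proj j j _).trans (if_pos rfl), fun x hx => proj_row_eq_zero j ?_⟩
  refine d_eq_zero_of_rows (m := a.val + 1) _ a.2 (fun z hz => ?_) x hx
  have h0 := hb.2 z hz
  exact (congrArg₂ (· - ·) (proj_row_eq_zero 1 h0) (proj_row_eq_zero 0 h0)).trans (sub_zero _)

theorem rowD_eq_zero {i j : ZMod 2} (h : j ≠ i + 1) {b : Rows Y} (hb : Fam.proj i b = b) :
    rowD Y j b = 0 := by
  let X' : (cyc k s).tw.Ob := seg k s n le_rfl
  let Y' : (cyc k s).tw.Ob := Y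
  let b' : (cyc k s).tw.Hom X' Y' := b
  have h1 : (cyc k s).tw.IsHomog i b' := hb
  have h2 : (cyc k s).tw.IsHomog i ((cyc k s).tw.redSgn b') := by
    rw [h1.redSgn_eq]
    split_ifs
    · exact h1
    · exact (map_neg _ _).trans (congrArg _ h1)
  have h3 := cyc.isAInf.tw.isHomog_d h2
  have h4 : (cyc k s).tw.proj j ((cyc k s).tw.d ((cyc k s).tw.redSgn b')) = 0 := by
    rw [← show _ = _ from h3, AInfData.proj_proj, if_neg h]
  exact h4

theorem sum_rowD (b : Rows Y) : rowD Y 0 b + rowD Y 1 b =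
    (cyc k s).tw.d (X := seg k s n le_rfl) (Y := Y)
      ((cyc k s).tw.redSgn (X := seg k s n le_rfl) (Y := Y) b) :=
  (cyc k s).tw.proj_add (X := seg k s n le_rfl) (Y := Y) _

theorem rowD_rowD (j : ZMod 2) (b : Rows Y) : rowD Y j (rowD Y 0 b) + rowD Y j (rowD Y 1 b) = 0 := by
  rw [← map_add, sum_rowD]
  let X' : (cyc k s).tw.Ob := seg k s n le_rfl
  let Y' : (cyc k s).tw.Ob := Y
  let b' : (cyc k s).tw.Hom X' Y' := b
  have hB := (cyc.isAInf (k := k) (s := s)).tw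
  have h : (cyc k s).tw.proj j ((cyc k s).tw.d ((cyc k s).tw.redSgn ((cyc k s).tw.d
      ((cyc k s).tw.redSgn b')))) = 0 := by
    rw [hB.redSgn_d, hB.d_neg, hB.dd, neg_zero, map_zero]
  exact h

/-- The complex formed by the homogeneous morphisms. -/
def rowCx : PerComplex (QuiverRep k n) where
  X := rowRep Y
  d i j :=
    { app a := ModuleCat.ofHom ((rowD Y j).restrict (p := rowSub Y i a) (q := rowSub Y j a)
        fun _ hb => rowD_mem j hb)
      naturality _ _ _ := rfl }
  d_deg i j h := NatTrans.ext (funext fun a => ModuleCat.hom_ext (LinearMap.ext fun b =>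
    Subtype.ext (rowD_eq_zero Y h b.2.1)))
  d_sq i j := by
    refine (Fin.sum_univ_two _).trans (NatTrans.ext (funext fun a => ModuleCat.hom_ext
      (LinearMap.ext fun b => Subtype.ext ?_)))
    exact rowD_rowD Y j b.1

/-- The spaces of all rows. -/
def rowV (x : Fin n) : ModuleCat.{u} k :=
  ModuleCat.of k (∀ y : Fin Y.1.N, (cyc k s).Hom (ob k s x.val) (Y.1.obj y))

/-- The inclusion of the homogeneous morphisms. -/
def rowIncl (p : ZMod 2) : rowRep Y p ⟶ free (rowV Y) where
  app a := ModuleCat.ofHom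
    { toFun := fun b x _ => b.1 x
      map_add' := fun _ _ => rfl
      map_smul' := fun _ _ => rfl }
  naturality a a' f := ModuleCat.hom_ext (LinearMap.ext fun b => funext fun x => funext fun h => by
    refine Eq.trans ?_ (free_map_apply f _ x h).symm
    by_cases hx : x ≤ a
    · refine Eq.symm (dif_pos (c := x ≤ a) hx)
    · exact (b.2.2 x (not_le.1 hx)).trans (Eq.symm (dif_neg (c := x ≤ a) hx)))

/-- The morphisms given by their rows up to the row `a`. -/
def ofRows (a : Fin n) : (free (rowV Y)).obj a →ₗ[k] Rows Y :=
  LinearMap.pi (φ := fun x : Fin n => rowV Y x) (freeCoord (rowV Y) a)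

variable {Y} in
theorem ofRows_of_le {a : Fin n} (u : (free (rowV Y)).obj a) {x : Fin n} (h : x ≤ a) :
    ofRows Y a u x = u x ⟨h⟩ := dif_pos (α := rowV Y x) h

variable {Y} in
theorem ofRows_of_lt {a : Fin n} (u : (free (rowV Y)).obj a) {x : Fin n} (h : a < x) :
    ofRows Y a u x = 0 := dif_neg (α := rowV Y x) h.not_ge

/-- The projection to the homogeneous morphisms. -/
def rowProj (p : ZMod 2) : free (rowV Y) ⟶ rowRep Y p where
  app a := ModuleCat.ofHom (LinearMap.codRestrict (rowSub Y p a) (Fam.proj p ∘ₗ ofRows Y a)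
    fun u => ⟨(Fam.proj_proj p p _).trans (if_pos rfl), fun x hx =>
      proj_row_eq_zero p (ofRows_of_lt u hx)⟩)
  naturality a a' f := ModuleCat.hom_ext (LinearMap.ext fun u => Subtype.ext
    (congrArg (Fam.proj p : Rows Y →ₗ[k] Rows Y) (funext fun (x : Fin n) => by
      obtain hx | hx := le_or_gt x a
      · refine (ofRows_of_le _ (hx.trans (leOfHom f))).trans (Eq.trans ?_ (ofRows_of_le u hx).symm)
        exact (free_map_apply f u x _).trans (dif_pos hx)
      · refine Eq.trans ?_ (ofRows_of_lt u hx).symm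
        obtain hx' | hx' := le_or_gt x a'
        · exact (ofRows_of_le _ hx').trans ((free_map_apply f u x _).trans (dif_neg hx.not_ge))
        · exact ofRows_of_lt _ hx')))

theorem rowIncl_rowProj (p : ZMod 2) : rowIncl Y p ≫ rowProj Y p = 𝟙 _ :=
  NatTrans.ext (funext fun a => ModuleCat.hom_ext (LinearMap.ext fun b => Subtype.ext (by
    refine Eq.trans (congrArg (Fam.proj p : Rows Y →ₗ[k] Rows Y) (funext fun x => ?_)) b.2.1
    obtain hx | hx := le_or_gt (x : Fin n) a
    · exact ofRows_of_le _ hx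
    · exact (ofRows_of_lt _ hx).trans (b.2.2 x hx).symm)))

/-- The complex of projective representations attached to a twisted complex. -/
def rowOb : (quiverDG k n).Ob :=
  ⟨rowCx Y, fun i => ⟨(⟨rowIncl Y i, rowProj Y i, rowIncl_rowProj Y i⟩ :
    Retract (rowRep Y i) (free (rowV Y))).projective, fun a =>
      inferInstanceAs (Module.Finite k (rowSub Y i a))⟩⟩

/-! ### Morphisms from the indecomposable projective representations -/

variable {Y} {a : Fin n}

/-- The element which determines a morphism. -/
def evHom (f : Hom (projCx k a) (rowCx Y)) : Rows Y :=
  ∑ j, (((f 0 j).app a).hom (projGen k a a) : rowSub Y j a).1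

theorem proj_evHom (f : Hom (projCx k a) (rowCx Y)) (j : ZMod 2) :
    Fam.proj j (evHom f) = (((f 0 j).app a).hom (projGen k a a) : rowSub Y j a).1 := by
  rw [evHom, map_sum, Finset.sum_eq_single j]
  · exact (((f 0 j).app a).hom (projGen k a a) : rowSub Y j a).2.1
  · intro l _ hl
    rw [← (((f 0 l).app a).hom (projGen k a a) : rowSub Y l a).2.1, Fam.proj_proj, if_neg hl.symm]
  · exact fun h => absurd (Finset.mem_univ _) h

theorem evHom_row (f : Hom (projCx k a) (rowCx Y)) (x : Fin n) (hx : a < x) : evHom f x = 0 := by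
  rw [← Fam.proj_add (evHom f), proj_evHom, proj_evHom]
  exact (congrArg₂ (· + ·) ((((f 0 0).app a).hom (projGen k a a) : rowSub Y 0 a).2.2 x hx)
    ((((f 0 1).app a).hom (projGen k a a) : rowSub Y 1 a).2.2 x hx)).trans (add_zero _)

theorem evHom_injective : Function.Injective (evHom : Hom (projCx k a) (rowCx Y) → Rows Y) := by
  intro f g h
  funext (i : Fin 2) j
  fin_cases i
  · refine proj_hom_ext (Subtype.ext ?_)
    exact (proj_evHom f j).symm.trans ((congrArg _ h).trans (proj_evHom g j))
  · exact zero_hom_ext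

theorem exists_evHom_eq (b : Rows Y) (hb : ∀ x, a < x → b x = 0) :
    ∃ f : Hom (projCx k a) (rowCx Y), evHom f = b := by
  refine ⟨fun
    | (0 : Fin 2), j => desc (M := rowRep Y j) a ⟨Fam.proj j b,
        (Fam.proj_proj j j _).trans (if_pos rfl), fun x hx => proj_row_eq_zero j (hb x hx)⟩
    | (1 : Fin 2), _ => 0, ?_⟩
  refine (Fin.sum_univ_two _).trans (Eq.trans ?_ (Fam.proj_add b))
  exact congrArg₂ (· + ·) (congrArg Subtype.val (desc_apply (M := rowRep Y 0) _))
    (congrArg Subtype.val (desc_apply (M := rowRep Y 1) _))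

variable (Y) in
/-- The differential of morphisms from the arc. -/
def dRows (b : Rows Y) : Rows Y := (cyc k s).tw.d (X := seg k s n le_rfl) (Y := Y) b

theorem evHom_d (f : Hom (projCx k a) (rowCx Y)) :
    evHom (comp (sgn f) (rowCx Y).d - comp (projCx k a).d f) =
      -dRows Y (evHom f) := by
  have h0 : comp (projCx k a).d f = 0 := funext fun _ => funext fun _ =>
    Finset.sum_eq_zero fun _ _ => Limits.zero_comp
  rw [h0, sub_zero]
  set x := Fam.proj 0 (evHom f) with hx
  set y := Fam.proj 1 (evHom f) with hy
  have h1 (j : ZMod 2) : (((comp (sgn f) (rowCx Y).d 0 j).app a).hom (projGen k a a) : rowSub Y j a).1 =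
      rowD Y j (x - y) := by
    have e : comp (sgn f) (rowCx Y).d 0 j = f 0 0 ≫ (rowCx Y).d 0 j + (-(f 0 1)) ≫ (rowCx Y).d 1 j :=
      Fin.sum_univ_two _
    rw [e, hx, hy, proj_evHom, proj_evHom, sub_eq_add_neg, map_add, map_neg]
    exact congrArg₂ (· + ·) rfl (map_neg (rowD Y j) _)
  refine (Fin.sum_univ_two _).trans ((congrArg₂ (· + ·) (h1 0) (h1 1)).trans ((sum_rowD Y _).trans ?_))
  let X' : (cyc k s).tw.Ob := seg k s n le_rfl
  let Y' : (cyc k s).tw.Ob := Y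
  let b' : (cyc k s).tw.Hom X' Y' := evHom f
  have e : (cyc k s).tw.redSgn ((cyc k s).tw.sgn b') = -b' := redSgn_sgn b'
  exact (congrArg (cyc k s).tw.d e).trans (cyc.isAInf.tw.d_neg b')

end cyc

namespace cyc

open PerComplex QuiverRep

variable {k : Type u} [Field k] {n : ℕ} {S : Type w} (s : ZMod (n + 1) ≃ S) {Y : (cyc k s).TwOb}

/-! ### Comparison of complementary arcs -/

/-- The morphism from the arc `s_{a+1} → ⋯ → s_n` to the arc `s_0 → ⋯ → s_a`. -/
noncomputable def projCorner (k : Type u) [Field k] (a : Fin n) :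
    Fam.Hom ((projFrame k a).tw s).1.toFam (seg k s (a.val + 1) a.2).1.toFam := corner _ _

variable {s}

/-- Composition with `projCorner`. -/
noncomputable def cornerMul (a : Fin n) (b : Fam.Hom (seg k s (a.val + 1) a.2).1.toFam Y.1.toFam) :
    Fam.Hom ((projFrame k a).tw s).1.toFam Y.1.toFam :=
  (cyc k s).tw.mul (X := (projFrame k a).tw s) (Y := seg k s (a.val + 1) a.2) (Z := Y)
    (projCorner s k a) b

variable (s) in
theorem projCorner_pos (a : Fin n) : (((a.val + 1 : ℕ) : ZMod (n + 1)) + ((n - a.val : ℕ) : ℕ)) = 0 := by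
  rw [← Nat.cast_add, show a.val + 1 + (n - a.val) = n + 1 by omega, ZMod.natCast_self]

theorem idM_cornerMul (a : Fin n) (b : Fam.Hom (seg k s (a.val + 1) a.2).1.toFam Y.1.toFam)
    (l : Fin (n - a.val)) (y : Fin Y.1.N) : idM (cornerMul a b) l y =
      (-1) ^ (n - a.val - 1 - l.val) * twSum (X := seg k s (a.val + 1) a.2) 0 (.single b)
        (⟨0, Nat.succ_pos _⟩ : Fin (a.val + 1)) y (vProdOf (a.val + l.val + 1)) := by
  have hX := isArc_projFrame (k := k) s a
  have hZ := isArc_seg k s (a.val + 1) a.2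
  have hN : n - a.val + (a.val + 1) = n + 1 := by omega
  have h0 := hX.idM_eq_zero hZ (projCorner_pos a) hN.le (projCorner s k a)
  refine (congrFun (congrFun (idM_mul (X := (projFrame k a).tw s) (Y := seg k s (a.val + 1) a.2)
    (projCorner s k a) b) l) y).trans ?_
  rw [h0, conj_zero, Matrix.zero_mul, zero_add]
  have h1 := hX.twSum_cons 0 (hX.vM_corner hZ (projCorner_pos a)) (Nat.succ_pos _) (.single b)
    (a.val + l.val + 1) (n - a.val - 1 - l.val) l y (show l.val + _ + 1 = n - a.val by omega)
  rw [show a.val + l.val + 1 + (n - a.val - 1 - l.val) + 1 = n + 1 by omega] at h1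
  exact h1

theorem vM_cornerMul (a : Fin n) (b : Fam.Hom (seg k s (a.val + 1) a.2).1.toFam Y.1.toFam)
    (l : Fin (n - a.val)) (y : Fin Y.1.N) : vM (cornerMul a b) l y =
      if l.val + 1 = n - a.val then idM b (⟨0, Nat.succ_pos _⟩ : Fin (a.val + 1)) y else 0 := by
  have hX := isArc_projFrame (k := k) s a
  have hZ := isArc_seg k s (a.val + 1) a.2
  have hN : n - a.val + (a.val + 1) = n + 1 := by omega
  have h0 := hX.idM_eq_zero hZ (projCorner_pos a) hN.le (projCorner s k a)
  refine (congrFun (congrFun (vM_mul (X := (projFrame k a).tw s) (Y := seg k s (a.val + 1) a.2)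
    (projCorner s k a) b) l) y).trans ?_
  rw [h0, Matrix.zero_mul, zero_sub, show vM (projCorner s k a) = _ from
    hX.vM_corner hZ (projCorner_pos a), conj_eq_smul (p := 1) fun x z _ => by
      rw [hX.shift, hZ.shift, sub_zero], sg_one, neg_one_smul, Matrix.neg_mul, neg_neg]
  refine Matrix.mul_apply.trans ((Finset.sum_eq_single (⟨0, Nat.succ_pos _⟩ : Fin (a.val + 1)) ?_ ?_).trans ?_)
  · intro z _ hz
    exact (congrArg (· * _) (if_neg fun e => hz (Fin.ext e.2))).trans (zero_mul _)
  · exact fun h => absurd (Finset.mem_univ _) h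
  · refine (congrArg (· * _) (if_congr (and_iff_left rfl) rfl rfl)).trans ?_
    change (if l.val + 1 = n - a.val then (1 : k) else 0) * _ = _
    split_ifs
    · exact one_mul _
    · exact zero_mul _

/-- The first row of the composition with `projCorner`. -/
noncomputable def lead (a : Fin n) (y : Fin Y.1.N) :
    Rows Y →ₗ[k] (cyc k s).Hom (((projFrame k a).tw s).1.obj (⟨0, by omega⟩ : Fin (n - a.val))) (Y.1.obj y) :=
  let X' : (cyc k s).tw.Ob := (projFrame k a).tw s
  let Z' : (cyc k s).tw.Ob := seg k s (a.val + 1) a.2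
  let Y' : (cyc k s).tw.Ob := Y
  LinearMap.proj y ∘ₗ LinearMap.proj (⟨0, by omega⟩ : Fin (n - a.val)) ∘ₗ
    (cyc.isAInf.tw.mulₗ X' Z' Y' (projCorner s k a) : Fam.Hom (seg k s (a.val + 1) a.2).1.toFam Y.1.toFam →ₗ[k]
      Fam.Hom ((projFrame k a).tw s).1.toFam Y.1.toFam) ∘ₗ cut (a.val + 1) a.2 Y

theorem idM_cornerMul_cut (a : Fin n) {b : Rows Y} (hb : ∀ x, a < x → b x = 0) (l : Fin (n - a.val))
    (y : Fin Y.1.N) : idM (cornerMul a (cut (a.val + 1) a.2 Y b)) l y =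
      idc _ _ (lead ⟨a.val + l.val, by omega⟩ y b) := by
  have hb' : ∀ x : Fin n, a.val + l.val + 1 ≤ x.val → b x = 0 := fun x hx =>
    hb x (Fin.lt_def.2 (by omega))
  refine (idM_cornerMul a _ l y).trans (Eq.trans ?_ (idM_cornerMul ⟨a.val + l.val, by omega⟩
    (cut (a.val + l.val + 1) (by omega) Y b) ⟨0, by simp only; omega⟩ y).symm)
  refine congrArg₂ (· * ·) (congrArg _ ?_) ((twSum_cut 0 b hb _ _ y).trans
    (twSum_cut (m := a.val + l.val + 1) (hm := by omega) 0 b hb' _ ⟨0, Nat.succ_pos _⟩ y).symm)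
  simp only
  omega

theorem vM_cornerMul_cut (a : Fin n) (b : Rows Y) (l : Fin (n - a.val)) (y : Fin Y.1.N) :
    vM (cornerMul a (cut (a.val + 1) a.2 Y b)) l y = vc _ _ (lead ⟨a.val + l.val, by omega⟩ y b) := by
  refine (vM_cornerMul a _ l y).trans (Eq.trans ?_ (vM_cornerMul ⟨a.val + l.val, by omega⟩
    (cut (a.val + l.val + 1) (by omega) Y b) ⟨0, by simp only; omega⟩ y).symm)
  refine if_congr ?_ rfl rfl
  simp only
  omega

/-! ### The comparison morphism -/

variable (F : Frame (rowCx Y))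

/-- The elements of a homogeneous basis. -/
noncomputable def rowBasis (z : Fin F.N) : rowSub Y (F.deg z) (F.vert z) := F.basis z (F.deg z, F.vert z)

/-- The morphism from the twisted complex of `rowCx Y` to `Y`. -/
noncomputable def counit : Fam.Hom (F.tw s).1.toFam Y.1.toFam :=
  fun (z : Fin F.N) y => (cyc k s).twist (F.deg z) (lead (F.vert z) y (rowBasis F z).1)

/-- The sum of the components in both degrees at the vertex `l`. -/
def totVal (l : Fin n) : Total (rowCx Y) →ₗ[k] Rows Y :=
  ∑ j, (rowSub Y j l).subtype ∘ₗ LinearMap.proj (φ := fun q : ZMod 2 × Fin n => ((rowCx Y).X q.1).obj q.2) (j, l)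

theorem totVal_apply (l : Fin n) (u : Total (rowCx Y)) :
    totVal l u = ∑ j, (u (j, l) : rowSub Y j l).1 := by
  rw [totVal, LinearMap.sum_apply]
  rfl

theorem totVal_basis (z : Fin F.N) : totVal (F.vert z) (F.basis z) = (rowBasis F z).1 := by
  rw [totVal_apply, Finset.sum_eq_single (F.deg z)]
  · rfl
  · intro j _ hj
    rw [F.homog z (j, F.vert z) fun e => hj (congrArg Prod.fst e)]
    rfl
  · exact fun h => absurd (Finset.mem_univ _) h

theorem totVal_tot {a : Fin n} (f : Hom (projCx k a) (rowCx Y)) (l : Fin (n - a.val)) :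
    totVal ⟨a.val + l.val, by omega⟩ (tot f (projBasis k a l)) = evHom f := by
  rw [totVal_apply]
  refine Finset.sum_congr rfl fun j _ => ?_
  have hl : a ≤ (⟨a.val + l.val, by omega⟩ : Fin n) := Fin.le_def.2 (Nat.le_add_right _ _)
  have e0 : projBasis k a l (0, ⟨a.val + l.val, by omega⟩) = projGen k a _ := funext fun h =>
    (projCoord_apply (projBasis k a l) (0, ⟨a.val + l.val, by omega⟩) h l rfl).trans
      ((projCoord_basis l l).trans (if_pos rfl))
  have e1 : projBasis k a l (1, ⟨a.val + l.val, by omega⟩) = 0 := funext fun h =>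
    absurd (projCx_le (a := a) (q := (1, ⟨a.val + l.val, by omega⟩)) h.down).1 one_ne_zero
  have e2 : tot f (projBasis k a l) (j, ⟨a.val + l.val, by omega⟩) =
      ((f 0 j).app ⟨a.val + l.val, by omega⟩).hom (projGen k a _) := by
    refine (tot_apply _ _ _).trans ((Fin.sum_univ_two _).trans ((congrArg₂ (· + ·) (congrArg _ e0)
      ((congrArg _ e1).trans (map_zero _))).trans (add_zero _)))
  rw [e2]
  exact congrArg Subtype.val (app_eq_map (f 0 j) hl)

theorem sum_mx {a : Fin n} (f : Hom (projCx k a) (rowCx Y)) (l : Fin (n - a.val))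
    (ψ : Fin n → Rows Y →ₗ[k] k) :
    ∑ z, mx (projBasis k a) F.basis (tot f) l z * ψ (F.vert z) (rowBasis F z).1 =
      ψ ⟨a.val + l.val, by omega⟩ (evHom f) := by
  rw [← totVal_tot f l]
  conv_rhs => rw [← F.basis.sum_repr (tot f (projBasis k a l)), map_sum, map_sum]
  refine Finset.sum_congr rfl fun z _ => ?_
  rw [map_smul, map_smul, smul_eq_mul]
  change mx (projBasis k a) F.basis (tot f) l z * _ = mx (projBasis k a) F.basis (tot f) l z * _
  by_cases h : mx (projBasis k a) F.basis (tot f) l z = 0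
  · rw [h, zero_mul, zero_mul]
  · have hv := (projFrame k a).raises_tot F f l z h
    have hv : F.vert z = ⟨a.val + l.val, by omega⟩ := Fin.ext (by
      have e : ((projFrame k a).vert l).val = a.val + l.val := rfl
      simp only
      omega)
    rw [← hv, totVal_basis]

theorem hom_mul_counit {a : Fin n} (f : Hom (projCx k a) (rowCx Y)) :
    (cyc k s).tw.mul (X := (projFrame k a).tw s) (Y := F.tw s) (Z := Y) ((projFrame k a).hom F s f)
      (counit F) = cornerMul a (cut (a.val + 1) a.2 Y (evHom f)) := by
  have h0 : vM (X := ((projFrame k a).tw s).1.toFam) (Y := (F.tw s).1.toFam)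
    ((projFrame k a).hom F s f) = 0 := (projFrame k a).vM_hom F s f
  have h1 : idM (X := ((projFrame k a).tw s).1.toFam) (Y := (F.tw s).1.toFam)
    ((projFrame k a).hom F s f) = mx (projBasis k a) F.basis (tot f) := (projFrame k a).idM_hom F s f
  refine hom_ext ?_ ?_
  · refine (idM_mul_of_left h0 (counit F)).trans (funext fun (l : Fin (n - a.val)) => funext fun y => ?_)
    refine Eq.trans ?_ (idM_cornerMul_cut a (evHom_row f) l y).symm
    rw [h1]
    refine Eq.trans ?_ (sum_mx F f l fun v => idc _ _ ∘ₗ lead v y)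
    refine Matrix.mul_apply.trans (Finset.sum_congr rfl fun (z : Fin F.N) _ => ?_)
    refine (congrArg₂ (· * ·) rfl (idc_twist _ _)).trans ?_
    change sg k (F.deg z - 0) * _ * (sg k (F.deg z) * _) = _
    rw [sub_zero, mul_comm (sg k _), _root_.mul_assoc, ← _root_.mul_assoc (sg k _), ← sg_add, CharTwo.add_self_eq_zero,
      sg_zero, one_mul]
    rfl
  · refine (vM_mul_of_left h0 (counit F)).trans (funext fun (l : Fin (n - a.val)) => funext fun y => ?_)
    refine Eq.trans ?_ (vM_cornerMul_cut a (evHom f) l y).symm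
    rw [h1]
    refine Eq.trans ?_ (sum_mx F f l fun v => vc _ _ ∘ₗ lead v y)
    exact Matrix.mul_apply.trans (Finset.sum_congr rfl fun (z : Fin F.N) _ =>
      congrArg₂ (· * ·) rfl (vc_twist _ _))

end cyc

namespace cyc

open PerComplex QuiverRep

variable {k : Type u} [Field k] {n : ℕ} {S : Type w} {s : ZMod (n + 1) ≃ S} {Y : (cyc k s).TwOb}

theorem isHomog_projCorner (a : Fin n) : (cyc k s).tw.IsHomog (X := (projFrame k a).tw s)
    (Y := seg k s (a.val + 1) a.2) 0 (projCorner s k a) :=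
  (isArc_projFrame s a).isHomog_corner (isArc_seg k s (a.val + 1) a.2) (projCorner_pos a)
    (show n - a.val + (a.val + 1) ≤ n + 1 by omega)

theorem d_projCorner (a : Fin n) : (cyc k s).tw.d (X := (projFrame k a).tw s)
    (Y := seg k s (a.val + 1) a.2) (projCorner s k a) =
      (0 : Fam.Hom ((projFrame k a).tw s).1.toFam (seg k s (a.val + 1) a.2).1.toFam) :=
  (isArc_projFrame s a).d_corner (isArc_seg k s (a.val + 1) a.2) (projCorner_pos a)
    (show n - a.val + (a.val + 1) ≤ n + 1 by omega)

theorem isHIso_projCorner (a : Fin n) : (cyc k s).tw.IsHIso (X := (projFrame k a).tw s)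
    (Y := seg k s (a.val + 1) a.2) (projCorner s k a) :=
  (isArc_projFrame s a).isHIso_corner (isArc_seg k s (a.val + 1) a.2) (projCorner_pos a)
    (show n - a.val + (a.val + 1) = n + 1 by omega) (show 0 < n - a.val by omega) (Nat.succ_pos _)
    (neg_ne_zero.2 one_ne_zero) one_ne_zero

theorem proj_cornerMul (a : Fin n) {p : ZMod 2}
    {b : Fam.Hom (seg k s (a.val + 1) a.2).1.toFam Y.1.toFam} (hb : Fam.proj p b = b) :
    Fam.proj p (cornerMul a b) = cornerMul a b := by
  let X' : (cyc k s).tw.Ob := (projFrame k a).tw s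
  let Z' : (cyc k s).tw.Ob := seg k s (a.val + 1) a.2
  let Y' : (cyc k s).tw.Ob := Y
  let c : (cyc k s).tw.Hom X' Z' := projCorner s k a
  let b' : (cyc k s).tw.Hom Z' Y' := b
  have h := cyc.isAInf.tw.isHomog_mul (show (cyc k s).tw.IsHomog 0 c from isHomog_projCorner a)
    (show (cyc k s).tw.IsHomog p b' from hb)
  rw [zero_add] at h
  exact h

theorem d_cornerMul (a : Fin n) (b : Fam.Hom (seg k s (a.val + 1) a.2).1.toFam Y.1.toFam) :
    (cyc k s).tw.d (X := (projFrame k a).tw s) (Y := Y) (cornerMul a b) =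
      cornerMul a ((cyc k s).tw.d (X := seg k s (a.val + 1) a.2) (Y := Y) b) := by
  let X' : (cyc k s).tw.Ob := (projFrame k a).tw s
  let Z' : (cyc k s).tw.Ob := seg k s (a.val + 1) a.2
  let Y' : (cyc k s).tw.Ob := Y
  let c : (cyc k s).tw.Hom X' Z' := projCorner s k a
  let b' : (cyc k s).tw.Hom Z' Y' := b
  have hB := (cyc.isAInf (k := k) (s := s)).tw
  have h1 : (cyc k s).tw.d c = 0 := d_projCorner a
  have h2 : (cyc k s).tw.IsHomog 0 c := isHomog_projCorner a
  have h3 := hB.d_mul c b'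
  rw [h1, h2.redSgn_of_zero, hB.zero_mul, hB.neg_mul, neg_zero, zero_sub, neg_neg] at h3
  exact h3

variable (F : Frame (rowCx Y))

theorem isHomog_counit : (cyc k s).tw.IsHomog (X := F.tw s) (Y := Y) 0 (counit F) := by
  have h (z : Fin F.N) := proj_cornerMul (F.vert z)
    (b := cut ((F.vert z).val + 1) (F.vert z).2 Y (rowBasis F z).1)
    (congrArg (cut ((F.vert z).val + 1) (F.vert z).2 Y) (rowBasis F z).2.1)
  refine isHomog_of _ (fun (z : Fin F.N) y hz => ?_) fun (z : Fin F.N) y hz => ?_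
  · by_contra hne
    refine hz ((idc_twist _ _).trans ((congrArg (sg k _ * ·) ?_).trans (mul_zero _)))
    refine (congrFun (congrFun (congrArg idM (h z)) _) y).symm.trans ((idM_proj _ _ _ _).trans
      (if_neg fun e => hne ?_))
    have e' : F.deg z = Y.1.shift y := (show F.deg z = Y.1.shift y - 0 from e).trans (sub_zero _)
    exact sub_eq_zero.2 e'.symm
  · by_contra hne
    refine hz ((vc_twist _ _).trans ?_)
    refine (congrFun (congrFun (congrArg vM (h z)) _) y).symm.trans ((vM_proj _ _ _ _).trans
      (if_neg fun e => hne ?_))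
    have e' : F.deg z = Y.1.shift y + 1 := (show F.deg z = Y.1.shift y - 0 + 1 from e).trans (by rw [sub_zero])
    change Y.1.shift y - F.deg z = 0 + 1
    rw [e', sub_add_cancel_left]
    rfl

theorem hom_mul_d_counit {a : Fin n} (f : Hom (projCx k a) (rowCx Y)) :
    (cyc k s).tw.mul (X := (projFrame k a).tw s) (Y := F.tw s) (Z := Y) ((projFrame k a).hom F s f)
      ((cyc k s).tw.d (X := F.tw s) (Y := Y) (counit F)) =
        (0 : Fam.Hom ((projFrame k a).tw s).1.toFam Y.1.toFam) := by
  let X' : (cyc k s).tw.Ob := (projFrame k a).tw s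
  let Z' : (cyc k s).tw.Ob := F.tw s
  let Y' : (cyc k s).tw.Ob := Y
  let H : (cyc k s).tw.Hom X' Z' := (projFrame k a).hom F s f
  let ε : (cyc k s).tw.Hom Z' Y' := counit F
  have hB := (cyc.isAInf (k := k) (s := s)).tw
  have e1 : (cyc k s).tw.d (H ⊚ ε) = -((cyc k s).tw.d H ⊚ ε) := by
    have l : (cyc k s).tw.d (H ⊚ ε) =
        cornerMul a (cut (a.val + 1) a.2 Y (dRows Y (evHom f))) := by
      refine (congrArg ((cyc k s).tw.d (X := X') (Y := Y')) (hom_mul_counit F f)).trans ((d_cornerMul a _).trans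
        (congrArg (cornerMul a) (cut_d _ fun x hx => evHom_row f x (Fin.lt_def.2 hx)).symm))
    have r : (cyc k s).tw.d H ⊚ ε =
        -cornerMul a (cut (a.val + 1) a.2 Y (dRows Y (evHom f))) := by
      refine (congrArg (fun b => (cyc k s).tw.mul (X := X') (Y := Z') (Z := Y') b ε)
        ((projFrame k a).hom_d F s f).symm).trans ((hom_mul_counit F _).trans ?_)
      rw [evHom_d, map_neg]
      exact hB.mul_neg (X := X') (Y := seg k s (a.val + 1) a.2) (Z := Y') (projCorner s k a)
        (cut (a.val + 1) a.2 Y (dRows Y (evHom f)))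
    rw [l, r]
    exact (neg_neg _).symm
  have e2 := hB.d_mul H ε
  rw [e1, eq_comm, sub_eq_self] at e2
  have e3 := congrArg (cyc k s).tw.redSgn e2
  have h1 := hB.isHomog_d (show (cyc k s).tw.IsHomog 0 ε from isHomog_counit F)
  rw [zero_add] at h1
  rw [hB.redSgn_mul, redSgn_redSgn, h1.redSgn_of_one, redSgn_zero, neg_eq_zero] at e3
  exact e3

theorem proj_totVal (l : Fin n) (u : Total (rowCx Y)) (j : ZMod 2) :
    Fam.proj j (totVal l u) = (u (j, l) : rowSub Y j l).1 := by
  rw [totVal_apply, map_sum, Finset.sum_eq_single j]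
  · exact (u (j, l) : rowSub Y j l).2.1
  · intro i _ hi
    rw [← (u (i, l) : rowSub Y i l).2.1, Fam.proj_proj, if_neg hi.symm]
  · exact fun h => absurd (Finset.mem_univ _) h

theorem tot_eq_basis {z : Fin F.N} {f : Hom (projCx k (F.vert z)) (rowCx Y)}
    (h : evHom f = (rowBasis F z).1) :
    tot f (projBasis k (F.vert z) ⟨0, by omega⟩) = F.basis z := by
  refine funext fun ⟨j, l⟩ => ?_
  by_cases hl : l = F.vert z
  · subst hl
    refine Subtype.ext ((proj_totVal _ _ j).symm.trans (Eq.trans ?_ (proj_totVal _ _ j)))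
    exact congrArg _ ((totVal_tot f ⟨0, by omega⟩).trans (h.trans (totVal_basis F z).symm))
  · refine Eq.trans ?_ (F.homog z (j, l) fun e => hl (congrArg Prod.snd e)).symm
    refine (tot_apply _ _ _).trans (Finset.sum_eq_zero fun i _ => ?_)
    refine (congrArg _ ((projFrame k (F.vert z)).homog (⟨0, by omega⟩ : Fin (n - (F.vert z).val))
      (i, l) fun e => hl ?_)).trans (map_zero _)
    exact congrArg Prod.snd e

theorem d_counit : (cyc k s).tw.d (X := F.tw s) (Y := Y) (counit F) =
    (0 : Fam.Hom (F.tw s).1.toFam Y.1.toFam) := by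
  set D : Fam.Hom (F.tw s).1.toFam Y.1.toFam := (cyc k s).tw.d (X := F.tw s) (Y := Y) (counit F) with hD
  have key (z : Fin F.N) : idM D z = 0 ∧ vM D z = 0 := by
    obtain ⟨f, hf⟩ := exists_evHom_eq (a := F.vert z) (rowBasis F z).1 (rowBasis F z).2.2
    let l : Fin (n - (F.vert z).val) := ⟨0, by omega⟩
    have h0 : vM (X := ((projFrame k (F.vert z)).tw s).1.toFam) (Y := (F.tw s).1.toFam)
      ((projFrame k (F.vert z)).hom F s f) = 0 := (projFrame k (F.vert z)).vM_hom F s f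
    have h1 : idM (X := ((projFrame k (F.vert z)).tw s).1.toFam) (Y := (F.tw s).1.toFam)
      ((projFrame k (F.vert z)).hom F s f) l = Pi.single z 1 := by
      refine (congrFun ((projFrame k (F.vert z)).idM_hom F s f) l).trans (funext fun w => ?_)
      refine (mx_apply _ _ _ _ _).trans ((congrArg (fun u => F.basis.repr u w) (tot_eq_basis F hf)).trans ?_)
      rw [Module.Basis.repr_self, Finsupp.single_eq_pi_single]
    have e := hom_mul_d_counit (s := s) F f
    have hi := (idM_mul_of_left h0 D).symm.trans ((congrArg idM e).trans (idM_zero _ _))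
    have hv := (vM_mul_of_left h0 D).symm.trans ((congrArg vM e).trans (vM_zero _ _))
    constructor
    · funext y
      have := (congrFun (congrFun hi l) y)
      refine (mul_eq_zero.1 (?_ : sg k (F.deg z) * idM D z y = 0)).resolve_left ?_
      · refine Eq.trans (Eq.symm ?_) this
        refine Matrix.mul_apply.trans ((Finset.sum_eq_single z ?_ ?_).trans ?_)
        · intro w _ hw
          refine (congrArg (· * _) ?_).trans (zero_mul _)
          exact (congrArg (_ * ·) ((congrFun h1 w).trans (Pi.single_eq_of_ne hw _))).trans (mul_zero _)
        · exact fun h => absurd (Finset.mem_univ _) h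
        · refine congrArg (· * _) ((congrArg (_ * ·) ((congrFun h1 z).trans (Pi.single_eq_same _ _))).trans
            ((mul_one _).trans ?_))
          change sg k (F.deg z - 0) = _
          rw [sub_zero]
      · rw [sg]
        split_ifs
        · exact one_ne_zero
        · exact neg_ne_zero.2 one_ne_zero
    · funext y
      refine Eq.trans (Eq.symm ?_) (congrFun (congrFun hv l) y)
      refine Matrix.mul_apply.trans ((Finset.sum_eq_single z ?_ ?_).trans ?_)
      · intro w _ hw
        exact (congrArg (· * _) ((congrFun h1 w).trans (Pi.single_eq_of_ne hw _))).trans (zero_mul _)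
      · exact fun h => absurd (Finset.mem_univ _) h
      · exact (congrArg (· * _) ((congrFun h1 z).trans (Pi.single_eq_same _ _))).trans (one_mul _)
  refine hom_ext ?_ ?_
  · exact funext fun z => (key z).1.trans (congrFun (idM_zero _ _) z).symm
  · exact funext fun z => (key z).2.trans (congrFun (vM_zero _ _) z).symm

theorem evHom_zero {a : Fin n} : evHom (0 : Hom (projCx k a) (rowCx Y)) = 0 :=
  Finset.sum_eq_zero fun _ _ => rfl

theorem projCx_map_injective (b : Fin n) (i) (l l' : Fin n) (f : l ⟶ l') :
    Function.Injective (((projCx k b).X i).map f).hom :=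
  injective_of_projective (P k n (if i = 0 then b.val else n)) f

theorem detectsIso_counit_projFrame (a : Fin n) : DetectsIso (A := (cyc k s).tw) (Z := F.tw s) (Y := Y)
    (counit F) ((projFrame k a).tw s) := by
  let X' : (cyc k s).tw.Ob := (projFrame k a).tw s
  let Z' : (cyc k s).tw.Ob := F.tw s
  let W' : (cyc k s).tw.Ob := seg k s (a.val + 1) a.2
  let Y' : (cyc k s).tw.Ob := Y
  let ε : (cyc k s).tw.Hom Z' Y' := counit F
  have hB := (cyc.isAInf (k := k) (s := s)).tw
  have hε : (cyc k s).tw.d ε = 0 := d_counit F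
  have hc : (cyc k s).tw.IsHIso (X := X') (Y := W') (projCorner s k a) := isHIso_projCorner a
  constructor
  · intro (φ : (cyc k s).tw.Hom X' Z') hφ (e : (cyc k s).tw.Exact (φ ⊚ ε))
    obtain ⟨f, c, hf, hfc⟩ := (projFrame k a).exists_sub_hom_eq_twD F (projCx_map_injective a) hφ
    let c' : (cyc k s).tw.Hom X' Z' := c
    let H : (cyc k s).tw.Hom X' Z' := (projFrame k a).hom F s f
    have hfc' : (cyc k s).tw.d c' = φ - H := hfc
    have hx : dRows Y (evHom f) = 0 := by
      have := evHom_d f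
      rw [hf, evHom_zero, zero_eq_neg] at this
      exact this
    have hrow : ∀ x : Fin n, a.val + 1 ≤ x.val → evHom f x = 0 := fun x hx =>
      evHom_row f x (Fin.lt_def.2 hx)
    let x' : (cyc k s).tw.Hom W' Y' := cut (a.val + 1) a.2 Y (evHom f)
    have dx : (cyc k s).tw.d x' = 0 :=
      (cut_d _ hrow).symm.trans ((congrArg (cut (a.val + 1) a.2 Y) hx).trans (map_zero _))
    have e1 : (cyc k s).tw.Exact (H ⊚ ε) := by
      have h1 := hB.exact_mul (exact_d c') hε
      rw [hfc', hB.sub_mul] at h1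
      have h2 := hB.exact_sub e h1
      rwa [sub_sub_cancel] at h2
    have e2 : (cyc k s).tw.Exact x' := by
      refine hc.exact_of_exact_mul hB dx ?_
      rw [show H ⊚ ε = _ from hom_mul_counit F f] at e1
      exact e1
    obtain ⟨t, ht⟩ := e2
    let t' : Fam.Hom (seg k s (a.val + 1) a.2).1.toFam Y.1.toFam := t
    have hp : dRows Y (pad t') = evHom f :=
      (d_pad t').trans ((congrArg pad ht).trans (pad_cut _ hrow))
    obtain ⟨g, hg⟩ := exists_evHom_eq (a := a) (-pad t') fun x hx =>
      (congrArg Neg.neg (pad_eq_zero t' x (Fin.lt_def.1 hx))).trans neg_zero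
    have hgf : comp (sgn g) (rowCx Y).d - comp (projCx k a).d g = f := by
      refine evHom_injective ((evHom_d g).trans ?_)
      rw [hg]
      let U : (cyc k s).tw.Ob := seg k s n le_rfl
      have hn : dRows Y (-pad t') = -dRows Y (pad t') := hB.d_neg (X := U) (Y := Y') (pad t')
      rw [hn, neg_neg, hp]
    have e3 : (cyc k s).tw.Exact H := by
      refine ⟨(projFrame k a).hom F s g, ((projFrame k a).hom_d F s g).symm.trans ?_⟩
      exact congrArg _ hgf
    have e4 := hB.exact_add (exact_d c') e3
    rwa [hfc', sub_add_cancel] at e4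
  · intro ψ hψ
    obtain ⟨b, hb, e⟩ := hc.exists_exact_sub_mul hB hψ
    let b' : Fam.Hom (seg k s (a.val + 1) a.2).1.toFam Y.1.toFam := b
    obtain ⟨f, hf⟩ := exists_evHom_eq (a := a) (pad b') fun x hx =>
      pad_eq_zero b' x (Fin.lt_def.1 hx)
    refine ⟨(projFrame k a).hom F s f, ?_, ?_⟩
    · refine ((projFrame k a).hom_d F s f).symm.trans ((congrArg _ ?_).trans (map_zero _))
      refine evHom_injective ((evHom_d f).trans (Eq.trans ?_ evHom_zero.symm))
      have h0 : dRows Y (pad b') = 0 := (d_pad b').trans ((congrArg pad hb).trans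
        (hB.mul_zero (X := seg k s n le_rfl) (Y := W') (Z := Y') (padHom k s (a.val + 1) a.2)))
      rw [hf, h0, neg_zero]
    · have h : cornerMul a (cut (a.val + 1) a.2 Y (evHom f)) = cornerMul a b' := by
        rw [hf, cut_pad]
      rw [hom_mul_counit F f, h]
      exact e

/-! ### Reduction to single objects -/

section Single

variable {Z : (cyc k s).TwOb} {f : Fam.Hom Z.1.toFam Y.1.toFam}

theorem detectsIso_single_succ
    (hf : (cyc k s).tw.d (X := Z) (Y := Y) f = (0 : Fam.Hom Z.1.toFam Y.1.toFam))
    (hP : ∀ a : Fin n, DetectsIso (A := (cyc k s).tw) (Z := Z) (Y := Y) f ((projFrame k a).tw s))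
    (a : Fin n) : DetectsIso (A := (cyc k s).tw) (Z := Z) (Y := Y) f
      (singleTw cyc.isAInf (ob k s (a.val + 1)) 0) := by
  induction a using WellFoundedGT.induction with | _ a ih => ?_
  have hlt (z : Fin (n - a.val)) : a.val + z.val < n := by omega
  refine detectsIso_first_row cyc.isAInf hf (hP a) (⟨0, by omega⟩ : Fin (n - a.val)) rfl
    fun (z : Fin (n - a.val)) hz => ih ⟨a.val + z.val, hlt z⟩ (Fin.lt_def.2 ?_)
  have : 0 < z.val := hz
  simp only
  omega

theorem detectsIso_single_shift
    (hf : (cyc k s).tw.d (X := Z) (Y := Y) f = (0 : Fam.Hom Z.1.toFam Y.1.toFam)) {X : (cyc k s).Ob}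
    (h : DetectsIso (A := (cyc k s).tw) (Z := Z) (Y := Y) f (singleTw cyc.isAInf X 0)) :
    DetectsIso (A := (cyc k s).tw) (Z := Z) (Y := Y) f (singleTw cyc.isAInf X 1) := by
  have hB := (cyc.isAInf (k := k) (s := s)).tw
  let o (σ : ZMod 2) : (cyc k s).TwOb := singleTw cyc.isAInf X σ
  let m (σ τ : ZMod 2) (r : k) : Fam.Hom (o σ).1.toFam (o τ).1.toFam :=
    mat _ _ (fun _ _ => r) 0
  have hi (σ τ r) : idM (m σ τ r) = fun _ _ => r := idM_mat fun _ _ h => absurd rfl h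
  have hv (σ τ r) : vM (m σ τ r) = 0 := vM_mat fun _ _ _ => rfl
  have δi (σ) : idM (o σ).1.δ = 0 := idM_zero _ _
  have δv (σ) : vM (o σ).1.δ = 0 := vM_zero _ _
  have hd (σ τ r) : (cyc k s).tw.d (X := o σ) (Y := o τ) (m σ τ r) =
      (0 : Fam.Hom (o σ).1.toFam (o τ).1.toFam) := by
    refine hom_ext ?_ ?_
    · rw [idM_d, δi, δi, Chain.single, cycM_cons_eq_zero (hv σ τ r), Matrix.mul_zero,
        Matrix.zero_mul, idM_zero, sub_zero, add_zero]
    · rw [vM_d, hv, δi, δi, δv, δv, Matrix.mul_zero, Matrix.mul_zero, Matrix.mul_zero,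
        Matrix.zero_mul, vM_zero, sub_zero, add_zero]
  have hp : (cyc k s).tw.IsHomog (X := o 1) (Y := o 0) 1 (m 1 0 1) :=
    isHomog_of _ (fun _ _ _ => rfl) fun x y h => absurd (congrFun (congrFun (hv 1 0 1) x) y) h
  refine h.of_retract hB hf (hd 1 0 1) (hd 0 1 (-1)) ?_
  rw [show (cyc k s).tw.redSgn (X := o 1) (Y := o 0) (m 1 0 1) = _ from hp.redSgn_of_one]
  have e : (cyc k s).tw.mul (X := o 1) (Y := o 0) (Z := o 1) (m 1 0 1) (m 0 1 (-1)) =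
      (cyc k s).tw.one (o 1) := by
    refine hom_ext ?_ ?_
    · refine (idM_mul_of_left (X := o 1) (Y := o 0) (Z := o 1) (hv 1 0 1) _).trans
        (Eq.trans ?_ (idM_one _).symm)
      rw [hi, hi]
      funext (x : Fin 1) (y : Fin 1)
      rw [Subsingleton.elim x 0, Subsingleton.elim y 0]
      refine Matrix.mul_apply.trans ((Fin.sum_univ_one _).trans ?_)
      change sg k (0 - 1) * 1 * -1 = 1
      rw [show (0 : ZMod 2) - 1 = 1 from rfl, sg_one, mul_one, neg_mul_neg, one_mul]
    · refine (vM_mul_of_left (X := o 1) (Y := o 0) (Z := o 1) (hv 1 0 1) _).trans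
        (Eq.trans ?_ (vM_one _).symm)
      rw [hv, Matrix.mul_zero]
  let o' : (cyc k s).tw.Ob := o 1
  let a : (cyc k s).tw.Hom o' o' :=
    (cyc k s).tw.mul (X := o 1) (Y := o 0) (Z := o 1) (m 1 0 1) (m 0 1 (-1))
  have e' : a - (cyc k s).tw.one o' = 0 := sub_eq_zero.2 e
  have e2 : (cyc k s).tw.Exact (a - (cyc k s).tw.one o') := e' ▸ hB.exact_zero
  exact e2

theorem detectsIso_of_projFrame
    (hf : (cyc k s).tw.d (X := Z) (Y := Y) f = (0 : Fam.Hom Z.1.toFam Y.1.toFam))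
    (hP : ∀ a : Fin n, DetectsIso (A := (cyc k s).tw) (Z := Z) (Y := Y) f ((projFrame k a).tw s))
    (W : (cyc k s).TwOb) : DetectsIso (A := (cyc k s).tw) (Z := Z) (Y := Y) f W := by
  have h1 := detectsIso_single_succ hf hP
  have h0 : DetectsIso (A := (cyc k s).tw) (Z := Z) (Y := Y) f
      (singleTw cyc.isAInf (ob k s 0) 0) := by
    refine DetectsIso.of_hIso cyc.isAInf.tw hf (W' := arcTw k s 1 n 1 le_rfl) ?_ (twOb_hIso k s)
    exact detectsIso_of_rows cyc.isAInf hf fun (x : Fin n) => detectsIso_single_shift hf (h1 x)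
  have h (X : (cyc k s).Ob) : DetectsIso (A := (cyc k s).tw) (Z := Z) (Y := Y) f
      (singleTw cyc.isAInf X 0) := by
    obtain ⟨j, rfl⟩ := s.surjective X
    have e : s j = ob k s j.val := congrArg s (ZMod.natCast_zmod_val j).symm
    have hj := ZMod.val_lt j
    rw [e]
    obtain h | h := Nat.eq_zero_or_pos j.val
    · rw [h]; exact h0
    · rw [← Nat.sub_add_cancel h]
      exact h1 ⟨j.val - 1, by omega⟩
  refine detectsIso_of_rows cyc.isAInf hf fun x => ?_
  rw [rowTw]
  obtain e | e := zmod_two_cases (W.1.shift x)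
  · rw [e]; exact h _
  · rw [e]; exact detectsIso_single_shift hf (h _)

end Single

theorem counit_hIso : (cyc k s).tw.HIso (F.tw s) Y :=
  IsAInf.hIso_of_detectsIso (h := cyc.isAInf.tw) (A := (cyc k s).tw) (Z := F.tw s) (Y := Y) (f := counit F) (isHomog_counit F)
    (d_counit F)
    (detectsIso_of_projFrame (d_counit F) (detectsIso_counit_projFrame F) _)
    (detectsIso_of_projFrame (d_counit F) (detectsIso_counit_projFrame F) _)

end cyc

theorem quiverFunctor_essSurj (k : Type u) [Field k] {n : ℕ} {S : Type w} (s : ZMod (n + 1) ≃ S)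
    (Y : (cyc k s).tw.Ob) :
    ∃ X : (quiverDG k n).Ob, (cyc k s).tw.HIso ((quiverFunctor k s).obj X) Y :=
  ⟨cyc.rowOb Y, cyc.isAInf.tw.hIso_trans ((quiverRetraction k s (cyc.rowOb Y)).hIso cyc.isAInf.tw)
    (cyc.counit_hIso (quiverFrame k (cyc.rowOb Y)))⟩

theorem proposition4p1 {k : Type u} [Field k] (n : ℕ) {S : Type w} (s : ZMod (n + 1) ≃ S) :
    (quiverDG k n).IsAInf ∧ (cyc k s).tw.IsAInf ∧
    (∃ F : AInfFunctor (quiverDG k n) (cyc k s).tw,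
      F.IsQuasiEquiv ∧
      ∃ h : ∀ i : Fin n, F.obj (QuiverRep.simpleOb k n i) = cyc.twOb k s (i.val + 1),
        ∀ (i : ℕ) (hi : i + 1 < n),
          AInfData.castHom (cyc k s).tw (h ⟨i, Nat.lt_of_succ_lt hi⟩) (h ⟨i + 1, hi⟩)
            (F.map (.single (QuiverRep.extHom k n i hi))) = cyc.twV k s (i + 1)) ∧
    (∃ X : (cyc k s).TwOb, X.1 = cyc.shiftedChain k s ∧
      (cyc k s).tw.HIso (cyc.twOb k s 0) X) :=
  ⟨perDG.isAInf, cyc.isAInf.tw,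
    ⟨quiverFunctor k s,
      ⟨fun a ha hm => (quiverRetractData k s).functor_injective cyc.isAInf.tw
          (cyc.strictOn_avoid 0) (fun a _ => quiver_exact_of_exact a) a ha hm,
        fun b hb => (quiverRetractData k s).functor_surjective cyc.isAInf.tw
          (cyc.strictOn_avoid 0) quiver_exists_exact b hb,
        quiverFunctor_essSurj k s⟩,
      quiverFunctor_simpleOb k s,
      fun _ hi => quiverFunctor_extHom k s hi _ _⟩,
    ⟨cyc.arcTw k s 1 n 1 le_rfl, rfl, cyc.twOb_hIso k s⟩⟩
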